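/- **Theories.** Work in the two-sorted first-order language with variables $x,y,\dots$ for sets and $X,Y,\dots$ for classes, atomic formulas $x\in y$, $x\in X$, $x=y$, $X=Y$, and quantifiers over sets and over classes. $\langle x,y\rangle$ denotes the Kuratowski pair. * $\mathsf{IKM}$ (intuitionistic Kelley–Morse set theory) is the theory in intuitionistic two-sorted predicate logic with equality whose axioms are: the axioms of $\mathsf{IZF}$ (Extensionality, Pairing, Union, Infinity, Powerset, and the schemes of $\in$-Induction, Separation and Collection for formulas of the language of sets); Class Extensionality $X=Y\leftrightarrow\forall x(x\in X\leftrightarrow x\in Y)$; Class Set Induction $\forall x(\forall y\in x\,(y\in A)\to x\in A)\to\forall x\,(x\in A)$; Class Separation $\forall A\,\forall a\,\exists b\,\forall x(x\in b\leftrightarrow x\in A\wedge x\in a)$; Class Collection $\forall R\,\forall a\,[\forall x\in a\,\exists y\,\langle x,y\rangle\in R\to\exists b\,\forall x\in a\,\exists y\in b\,\langle x,y\rangle\in R]$; and Full Comprehension: $\exists A\,\forall x(x\in A\leftrightarrow\varphi(x))$ for every formula $\varphi$ of the two-sorted language (class quantifiers and set and class parameters allowed, $A$ not free in $\varphi$).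 * $\mathsf{KM}$ (Kelley–Morse set theory, without choice) is the theory in classical logic whose axioms are: the axioms of $\mathsf{ZF}$ (Extensionality, Pairing, Union, Infinity, Powerset, Foundation, and the schemes of Separation and Replacement); Class Extensionality; Class Replacement (if $F$ is a functional class of pairs, then for every set $a$ the image $\{y\mid\exists x\in a\,\langle x,y\rangle\in F\}$ is a set); and Full Comprehension. **Proof-theoretic strength.** Sentences of first-order arithmetic are read in these theories through the standard interpretation over $\omega$. A $\Pi^0_2$ sentence is a sentence $\forall\vec n\,\exists\vec m\,\theta$ of the language $0,S,+,\cdot$ with $\theta$ containing only bounded quantifiers (the blocks may be empty, so $\bot$ is such a sentence). A theory $S$ is *proof-theoretically reducible* to a theory $T$ if there is a primitive recursive function $f$ such that, whenever $d$ is the Gödel number of a natural deduction proof in $S$ of a $\Pi^0_2$ sentence $\varphi$, then $f(d)$ is the Gödel number of a proof of the same sentence $\varphi$ in $T$. Two theories *have the same proof-theoretic strength* if each is proof-theoretically reducible to the other; in particular they are then equiconsistent and prove the same $\Pi^0_2$ sentences of arithmetic. **Corollary.** $\mathsf{IKM}$ and $\mathsf{KM}$ have the same proof-theoretic strength. -/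

import Mathlib

/-! # Intuitionistic and classical Kelley--Morse set theory as formal theories

Formulas are written with de Bruijn indices, one family of indices for set variables and one for
class variables.  In the definitions below an argument such as `x : ℕ` of a formula is the index of
a set variable, and `x + k` is the same variable seen from below `k` further set quantifiers. -/

namespace SetClass

/-- Formulas of the two-sorted language of sets and classes. -/
inductive Fml : Type
  /-- set `x` is an element of set `y` -/
  | mem (x y : ℕ) : Fml
  /-- set `x` is an element of class `X` -/
  | memC (x X : ℕ) : Fml
  /-- equality of sets -/
  | eq (x y : ℕ) : Fml
  /-- equality of classes -/
  | eqC (X Y : ℕ) : Fml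
  | fls : Fml
  | conj (φ ψ : Fml) : Fml
  | disj (φ ψ : Fml) : Fml
  | imp (φ ψ : Fml) : Fml
  /-- quantifiers over sets; they bind the set variable `0` -/
  | all (φ : Fml) : Fml
  | ex (φ : Fml) : Fml
  /-- quantifiers over classes; they bind the class variable `0` -/
  | allC (φ : Fml) : Fml
  | exC (φ : Fml) : Fml

/-- The renaming `ρ` seen from below one more quantifier. -/
def up (ρ : ℕ → ℕ) : ℕ → ℕ
  | 0 => 0
  | n + 1 => ρ n + 1

/-- The renaming that replaces variable `0` by `t` and lowers the others. -/
def instRen (t : ℕ) : ℕ → ℕ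
  | 0 => t
  | n + 1 => n

namespace Fml

def neg (φ : Fml) : Fml := imp φ fls
def iff (φ ψ : Fml) : Fml := conj (imp φ ψ) (imp ψ φ)

/-- Capture-avoiding renaming of the free set variables by `ρ` and of the free class variables by
`σ`.  The language has no function symbols, so this is substitution. -/
def rename : (ρ σ : ℕ → ℕ) → Fml → Fml
  | ρ, _, mem x y => mem (ρ x) (ρ y)
  | ρ, σ, memC x X => memC (ρ x) (σ X)
  | ρ, _, eq x y => eq (ρ x) (ρ y)
  | _, σ, eqC X Y => eqC (σ X) (σ Y)
  | _, _, fls => fls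
  | ρ, σ, conj φ ψ => conj (rename ρ σ φ) (rename ρ σ ψ)
  | ρ, σ, disj φ ψ => disj (rename ρ σ φ) (rename ρ σ ψ)
  | ρ, σ, imp φ ψ => imp (rename ρ σ φ) (rename ρ σ ψ)
  | ρ, σ, all φ => all (rename (up ρ) σ φ)
  | ρ, σ, ex φ => ex (rename (up ρ) σ φ)
  | ρ, σ, allC φ => allC (rename ρ (up σ) φ)
  | ρ, σ, exC φ => exC (rename ρ (up σ) φ)

/-- Weakening by a fresh set variable `0`. -/
def shift (φ : Fml) : Fml := rename Nat.succ id φ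
/-- Weakening by a fresh class variable `0`. -/
def shiftC (φ : Fml) : Fml := rename id Nat.succ φ
/-- Substitution of the set variable `t` for the set variable `0`. -/
def inst (φ : Fml) (t : ℕ) : Fml := rename (instRen t) id φ
/-- Substitution of the class variable `T` for the class variable `0`. -/
def instC (φ : Fml) (T : ℕ) : Fml := rename id (instRen T) φ

/-- No class quantifiers (class parameters are allowed). -/
def IsElementary : Fml → Prop
  | conj φ ψ => IsElementary φ ∧ IsElementary ψ
  | disj φ ψ => IsElementary φ ∧ IsElementary ψ
  | imp φ ψ => IsElementary φ ∧ IsElementary ψ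
  | all φ => IsElementary φ
  | ex φ => IsElementary φ
  | allC _ => False
  | exC _ => False
  | _ => True

/-- Formulas of the one-sorted language of sets: neither class quantifiers nor class variables. -/
def IsPure : Fml → Prop
  | memC _ _ => False
  | eqC _ _ => False
  | conj φ ψ => IsPure φ ∧ IsPure ψ
  | disj φ ψ => IsPure φ ∧ IsPure ψ
  | imp φ ψ => IsPure φ ∧ IsPure ψ
  | all φ => IsPure φ
  | ex φ => IsPure φ
  | allC _ => False
  | exC _ => False
  | _ => True

/-- Gödel number of a formula. -/
def code : Fml → ℕ
  | mem x y => Nat.pair 0 (Nat.pair x y)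
  | memC x X => Nat.pair 1 (Nat.pair x X)
  | eq x y => Nat.pair 2 (Nat.pair x y)
  | eqC X Y => Nat.pair 3 (Nat.pair X Y)
  | fls => Nat.pair 4 0
  | conj φ ψ => Nat.pair 5 (Nat.pair φ.code ψ.code)
  | disj φ ψ => Nat.pair 6 (Nat.pair φ.code ψ.code)
  | imp φ ψ => Nat.pair 7 (Nat.pair φ.code ψ.code)
  | all φ => Nat.pair 8 φ.code
  | ex φ => Nat.pair 9 φ.code
  | allC φ => Nat.pair 10 φ.code
  | exC φ => Nat.pair 11 φ.code

end Fml

open Fml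

/-- Gödel number of a finite list of formulas. -/
def codeList : List Fml → ℕ
  | [] => 0
  | φ :: Γ => Nat.pair φ.code (codeList Γ) + 1

/-! ## Theories and proofs -/

/-- A theory: a logic (classical or intuitionistic) and a set of axioms.  Free variables of axioms
are parameters, that is, they are understood to be universally quantified. -/
structure Theory where
  /-- whether the underlying logic is classical; otherwise it is intuitionistic -/
  classical : Prop
  /-- the non-logical axioms -/
  axioms : Set Fml

/-- Natural deduction derivations, from the axioms of `T`, of `φ` from the hypotheses `Γ`, in
two-sorted intuitionistic predicate logic with equality; if the logic of `T` is classical, excluded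
middle is available in addition. -/
inductive Deriv (T : Theory) : List Fml → Fml → Type
  | ax {Γ φ} (h : φ ∈ T.axioms) : Deriv T Γ φ
  | lem {Γ φ} (h : T.classical) : Deriv T Γ (disj φ (neg φ))
  | hyp {Γ φ} (h : φ ∈ Γ) : Deriv T Γ φ
  | efq {Γ φ} (d : Deriv T Γ fls) : Deriv T Γ φ
  | andI {Γ φ ψ} (d : Deriv T Γ φ) (e : Deriv T Γ ψ) : Deriv T Γ (conj φ ψ)
  | andL {Γ φ ψ} (d : Deriv T Γ (conj φ ψ)) : Deriv T Γ φ
  | andR {Γ φ ψ} (d : Deriv T Γ (conj φ ψ)) : Deriv T Γ ψ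
  | orL {Γ φ ψ} (d : Deriv T Γ φ) : Deriv T Γ (disj φ ψ)
  | orR {Γ φ ψ} (d : Deriv T Γ ψ) : Deriv T Γ (disj φ ψ)
  | orE {Γ φ ψ χ} (d : Deriv T Γ (disj φ ψ)) (e₁ : Deriv T (φ :: Γ) χ) (e₂ : Deriv T (ψ :: Γ) χ) :
      Deriv T Γ χ
  | impI {Γ φ ψ} (d : Deriv T (φ :: Γ) ψ) : Deriv T Γ (imp φ ψ)
  | impE {Γ φ ψ} (d : Deriv T Γ (imp φ ψ)) (e : Deriv T Γ φ) : Deriv T Γ ψ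
  | allI {Γ φ} (d : Deriv T (Γ.map shift) φ) : Deriv T Γ (all φ)
  | allE {Γ φ} (t : ℕ) (d : Deriv T Γ (all φ)) : Deriv T Γ (φ.inst t)
  | exI {Γ φ} (t : ℕ) (d : Deriv T Γ (φ.inst t)) : Deriv T Γ (ex φ)
  | exE {Γ φ χ} (d : Deriv T Γ (ex φ)) (e : Deriv T (φ :: Γ.map shift) χ.shift) : Deriv T Γ χ
  | allCI {Γ φ} (d : Deriv T (Γ.map shiftC) φ) : Deriv T Γ (allC φ)
  | allCE {Γ φ} (t : ℕ) (d : Deriv T Γ (allC φ)) : Deriv T Γ (φ.instC t)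
  | exCI {Γ φ} (t : ℕ) (d : Deriv T Γ (φ.instC t)) : Deriv T Γ (exC φ)
  | exCE {Γ φ χ} (d : Deriv T Γ (exC φ)) (e : Deriv T (φ :: Γ.map shiftC) χ.shiftC) : Deriv T Γ χ
  | eqRefl {Γ} (x : ℕ) : Deriv T Γ (eq x x)
  | eqSubst {Γ x y} (φ : Fml) (d : Deriv T Γ (eq x y)) (e : Deriv T Γ (φ.inst x)) :
      Deriv T Γ (φ.inst y)
  | eqCRefl {Γ} (X : ℕ) : Deriv T Γ (eqC X X)
  | eqCSubst {Γ X Y} (φ : Fml) (d : Deriv T Γ (eqC X Y)) (e : Deriv T Γ (φ.instC X)) :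
      Deriv T Γ (φ.instC Y)

/-- Gödel number of a derivation: every node records its sequent `Γ ⊢ φ`, the number of the rule
that was applied, the instantiation data of the rule and the numbers of the subderivations. -/
def Deriv.code {T : Theory} {Γ : List Fml} {φ : Fml} (d : Deriv T Γ φ) : ℕ :=
  Nat.pair (Nat.pair (codeList Γ) φ.code) <| match d with
  | .ax _ => Nat.pair 0 0
  | .lem _ => Nat.pair 1 0
  | .hyp _ => Nat.pair 2 0
  | .efq d => Nat.pair 3 d.code
  | .andI d e => Nat.pair 4 (Nat.pair d.code e.code)
  | .andL d => Nat.pair 5 d.code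
  | .andR d => Nat.pair 6 d.code
  | .orL d => Nat.pair 7 d.code
  | .orR d => Nat.pair 8 d.code
  | .orE d e₁ e₂ => Nat.pair 9 (Nat.pair d.code (Nat.pair e₁.code e₂.code))
  | .impI d => Nat.pair 10 d.code
  | .impE d e => Nat.pair 11 (Nat.pair d.code e.code)
  | .allI d => Nat.pair 12 d.code
  | .allE t d => Nat.pair 13 (Nat.pair t d.code)
  | .exI t d => Nat.pair 14 (Nat.pair t d.code)
  | .exE d e => Nat.pair 15 (Nat.pair d.code e.code)
  | .allCI d => Nat.pair 16 d.code
  | .allCE t d => Nat.pair 17 (Nat.pair t d.code)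
  | .exCI t d => Nat.pair 18 (Nat.pair t d.code)
  | .exCE d e => Nat.pair 19 (Nat.pair d.code e.code)
  | .eqRefl _ => Nat.pair 20 0
  | .eqSubst ψ d e => Nat.pair 21 (Nat.pair ψ.code (Nat.pair d.code e.code))
  | .eqCRefl _ => Nat.pair 22 0
  | .eqCSubst ψ d e => Nat.pair 23 (Nat.pair ψ.code (Nat.pair d.code e.code))

/-- Proofs of `φ` in `T`: derivations without open hypotheses. -/
abbrev Theory.Proof (T : Theory) (φ : Fml) : Type := Deriv T [] φ

/-! ## Set-theoretic vocabulary -/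

/-- `∀ z ∈ a, φ(z)`, where `z` is variable `0` of `φ`. -/
def ballIn (a : ℕ) (φ : Fml) : Fml := all (imp (mem 0 (a + 1)) φ)
/-- `∃ z ∈ a, φ(z)`, where `z` is variable `0` of `φ`. -/
def bexIn (a : ℕ) (φ : Fml) : Fml := ex (conj (mem 0 (a + 1)) φ)

/-- `x ⊆ y` -/
def isSubset (x y : ℕ) : Fml := ballIn x (mem 0 (y + 1))
/-- `x = ∅` -/
def isEmpty (x : ℕ) : Fml := all (neg (mem 0 (x + 1)))
/-- `y = x ∪ {x}` -/
def isSucc (x y : ℕ) : Fml :=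
  all (iff (mem 0 (y + 1)) (disj (mem 0 (x + 1)) (eq 0 (x + 1))))
/-- `p = {x, y}` -/
def isUPair (p x y : ℕ) : Fml :=
  all (iff (mem 0 (p + 1)) (disj (eq 0 (x + 1)) (eq 0 (y + 1))))
/-- `p = ⟨x, y⟩ = {{x}, {x, y}}` -/
def isOPair (p x y : ℕ) : Fml :=
  all (iff (mem 0 (p + 1)) (disj (isUPair 0 (x + 1) (x + 1)) (isUPair 0 (x + 1) (y + 1))))
/-- `⟨x, y⟩ ∈ f` for a set `f` -/
def pairMem (x y f : ℕ) : Fml := ex (conj (isOPair 0 (x + 1) (y + 1)) (mem 0 (f + 1)))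
/-- `⟨x, y⟩ ∈ R` for a class `R` -/
def pairMemC (x y R : ℕ) : Fml := ex (conj (isOPair 0 (x + 1) (y + 1)) (memC 0 R))
/-- `∅ ∈ a` and `x ∪ {x} ∈ a` for every `x ∈ a` -/
def isInductive (a : ℕ) : Fml :=
  conj (bexIn a (isEmpty 0)) (ballIn a (bexIn (a + 1) (isSucc 1 0)))

/-! ## First-order axioms -/

/-- `∀ x y, (∀ z, z ∈ x ↔ z ∈ y) → x = y` -/
def extensionality : Fml :=
  all (all (imp (all (iff (mem 0 2) (mem 0 1))) (eq 1 0)))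
/-- `∀ x y, ∃ p, p = {x, y}` -/
def pairing : Fml := all (all (ex (isUPair 0 2 1)))
/-- `∀ a, ∃ b, ∀ x, x ∈ b ↔ ∃ y ∈ a, x ∈ y` -/
def union : Fml := all (ex (all (iff (mem 0 1) (bexIn 2 (mem 1 0)))))
/-- `∀ a, ∃ b, ∀ x, x ∈ b ↔ x ⊆ a` -/
def powerset : Fml := all (ex (all (iff (mem 0 1) (isSubset 0 2))))
/-- `∃ a, ∅ ∈ a ∧ ∀ x ∈ a, x ∪ {x} ∈ a` -/
def infinity : Fml := ex (isInductive 0)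
/-- `∀ x, (∃ y, y ∈ x) → ∃ y ∈ x, ∀ z ∈ y, z ∉ x` -/
def foundation : Fml :=
  all (imp (ex (mem 0 1)) (bexIn 0 (ballIn 0 (neg (mem 0 2)))))

/-- `(∀ x, (∀ y ∈ x, φ(y)) → φ(x)) → ∀ x, φ(x)`; variable `0` of `φ` is the displayed one. -/
def setInduction (φ : Fml) : Fml :=
  imp (all (imp (ballIn 0 (φ.rename (up Nat.succ) id)) φ)) (all φ)

/-- `∀ a, ∃ b, ∀ x, x ∈ b ↔ x ∈ a ∧ φ(x)`; variable `0` of `φ` is `x`. -/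
def separation (φ : Fml) : Fml :=
  all (ex (all (iff (mem 0 1) (conj (mem 0 2) (φ.rename (up (· + 2)) id)))))

/-- `∀ a, (∀ x ∈ a, ∃ y, φ(x, y)) → ∃ b, ∀ x ∈ a, ∃ y ∈ b, φ(x, y)`;
variables `1` and `0` of `φ` are `x` and `y`. -/
def collection (φ : Fml) : Fml :=
  all (imp (ballIn 0 (ex (φ.rename (up (up (· + 1))) id)))
    (ex (ballIn 1 (bexIn 1 (φ.rename (up (up (· + 2))) id)))))

/-- `(∀ x y z, φ(x, y) ∧ φ(x, z) → y = z) → ∀ a, ∃ b, ∀ y, y ∈ b ↔ ∃ x ∈ a, φ(x, y)`;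
variables `1` and `0` of `φ` are `x` and `y`. -/
def replacement (φ : Fml) : Fml :=
  imp
    (all (all (all (imp
      (conj (φ.rename (fun | 0 => 1 | 1 => 2 | n + 2 => n + 3) id)
        (φ.rename (fun | 0 => 0 | 1 => 2 | n + 2 => n + 3) id))
      (eq 1 0)))))
    (all (ex (all (iff (mem 0 1)
      (bexIn 2 (φ.rename (fun | 0 => 1 | 1 => 0 | n + 2 => n + 4) id))))))

/-! ## Second-order axioms -/

/-- `∀ X Y, X = Y ↔ ∀ x, x ∈ X ↔ x ∈ Y` -/
def classExtensionality : Fml :=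
  allC (allC (iff (eqC 1 0) (all (iff (memC 0 1) (memC 0 0)))))

/-- `∃ A, ∀ x, x ∈ A ↔ φ(x)`; set variable `0` of `φ` is `x`, and the other free variables of `φ`,
set and class variables, are parameters. -/
def comprehension (φ : Fml) : Fml := exC (all (iff (memC 0 0) φ.shiftC))

/-- `∀ A, (∀ x, (∀ y ∈ x, y ∈ A) → x ∈ A) → ∀ x, x ∈ A` -/
def classSetInduction : Fml :=
  allC (imp (all (imp (ballIn 0 (memC 0 0)) (memC 0 0))) (all (memC 0 0)))

/-- `∀ A, ∀ a, ∃ b, ∀ x, x ∈ b ↔ x ∈ A ∧ x ∈ a` -/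
def classSeparation : Fml :=
  allC (all (ex (all (iff (mem 0 1) (conj (memC 0 0) (mem 0 2))))))

/-- `∀ R, ∀ a, (∀ x ∈ a, ∃ y, ⟨x, y⟩ ∈ R) → ∃ b, ∀ x ∈ a, ∃ y ∈ b, ⟨x, y⟩ ∈ R` -/
def classCollection : Fml :=
  allC (all (imp (ballIn 0 (ex (pairMemC 1 0 0)))
    (ex (ballIn 1 (bexIn 1 (pairMemC 1 0 0))))))

/-- `∀ F, (∀ x y z, ⟨x, y⟩ ∈ F ∧ ⟨x, z⟩ ∈ F → y = z) →
  ∀ a, ∃ b, ∀ y, y ∈ b ↔ ∃ x ∈ a, ⟨x, y⟩ ∈ F` -/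
def classReplacement : Fml :=
  allC (imp
    (all (all (all (imp (conj (pairMemC 2 1 0) (pairMemC 2 0 0)) (eq 1 0)))))
    (all (ex (all (iff (mem 0 1) (bexIn 2 (pairMemC 0 1 0)))))))

/-! ## The theories -/

/-- Axioms of `IZF`. -/
inductive IZFAxiom : Fml → Prop
  | extensionality : IZFAxiom extensionality
  | pairing : IZFAxiom pairing
  | union : IZFAxiom union
  | infinity : IZFAxiom infinity
  | powerset : IZFAxiom powerset
  | setInduction (φ : Fml) (h : φ.IsPure) : IZFAxiom (setInduction φ)
  | separation (φ : Fml) (h : φ.IsPure) : IZFAxiom (separation φ)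
  | collection (φ : Fml) (h : φ.IsPure) : IZFAxiom (collection φ)

/-- Axioms of `IGB`. -/
inductive IGBAxiom : Fml → Prop
  | izf {φ : Fml} (h : IZFAxiom φ) : IGBAxiom φ
  | classExtensionality : IGBAxiom classExtensionality
  | elementaryComprehension (φ : Fml) (h : φ.IsElementary) : IGBAxiom (comprehension φ)
  | classSetInduction : IGBAxiom classSetInduction
  | classSeparation : IGBAxiom classSeparation
  | classCollection : IGBAxiom classCollection

/-- Axioms of `IKM`: those of `IGB` and comprehension for all second-order formulas. -/
inductive IKMAxiom : Fml → Prop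
  | igb {φ : Fml} (h : IGBAxiom φ) : IKMAxiom φ
  | fullComprehension (φ : Fml) : IKMAxiom (comprehension φ)

/-- Axioms of `ZF`. -/
inductive ZFAxiom : Fml → Prop
  | extensionality : ZFAxiom extensionality
  | pairing : ZFAxiom pairing
  | union : ZFAxiom union
  | infinity : ZFAxiom infinity
  | powerset : ZFAxiom powerset
  | foundation : ZFAxiom foundation
  | separation (φ : Fml) (h : φ.IsPure) : ZFAxiom (separation φ)
  | replacement (φ : Fml) (h : φ.IsPure) : ZFAxiom (replacement φ)

/-- Axioms of Gödel--Bernays set theory `GB` (without choice). -/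
inductive GBAxiom : Fml → Prop
  | zf {φ : Fml} (h : ZFAxiom φ) : GBAxiom φ
  | classExtensionality : GBAxiom classExtensionality
  | elementaryComprehension (φ : Fml) (h : φ.IsElementary) : GBAxiom (comprehension φ)
  | classReplacement : GBAxiom classReplacement

/-- Axioms of `KM`: those of `GB` and comprehension for all second-order formulas. -/
inductive KMAxiom : Fml → Prop
  | gb {φ : Fml} (h : GBAxiom φ) : KMAxiom φ
  | fullComprehension (φ : Fml) : KMAxiom (comprehension φ)

/-- Intuitionistic Kelley--Morse set theory. -/
def IKM : Theory := ⟨False, {φ | IKMAxiom φ}⟩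

/-- Classical Kelley--Morse set theory. -/
def KM : Theory := ⟨True, {φ | KMAxiom φ}⟩

/-! ## Arithmetic and its standard interpretation in set theory -/

/-- `x` is a natural number, i.e. an element of `ω`, the least inductive set. -/
def isNat (x : ℕ) : Fml := all (imp (isInductive 0) (mem (x + 1) 0))

/-- `x + y = z`: the pair `⟨y, z⟩` lies in every set `f` that contains `⟨0, x⟩` and is closed
under `⟨u, v⟩ ↦ ⟨u + 1, v + 1⟩`. -/
def isAdd (x y z : ℕ) : Fml :=
  all (imp
    (conj
      (all (imp (isEmpty 0) (pairMem 0 (x + 2) 1)))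
      (all (all (all (all (imp
        (conj (pairMem 3 2 4) (conj (isSucc 3 1) (isSucc 2 0)))
        (pairMem 1 0 4)))))))
    (pairMem (y + 1) (z + 1) 0))

/-- `x * y = z`: the pair `⟨y, z⟩` lies in every set `f` that contains `⟨0, 0⟩` and is closed
under `⟨u, v⟩ ↦ ⟨u + 1, v + x⟩`. -/
def isMul (x y z : ℕ) : Fml :=
  all (imp
    (conj
      (all (imp (isEmpty 0) (pairMem 0 0 1)))
      (all (all (all (all (imp
        (conj (pairMem 3 2 4) (conj (isSucc 3 1) (isAdd 2 (x + 5) 0)))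
        (pairMem 1 0 4)))))))
    (pairMem (y + 1) (z + 1) 0))

/-- Terms of the language of arithmetic in the variables `0, …, n - 1`. -/
inductive ATerm (n : ℕ) : Type
  | var (i : Fin n) : ATerm n
  | zero : ATerm n
  | succ (t : ATerm n) : ATerm n
  | add (t s : ATerm n) : ATerm n
  | mul (t s : ATerm n) : ATerm n

/-- Formulas of the language of arithmetic in the free variables `0, …, n - 1`; quantifiers bind
the variable `0`.  `ball t φ` and `bex t φ` are the bounded quantifications `∀ x < t, φ(x)` and
`∃ x < t, φ(x)`. -/
inductive AFml : ℕ → Type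
  | eq {n : ℕ} (t s : ATerm n) : AFml n
  | fls {n : ℕ} : AFml n
  | conj {n : ℕ} (φ ψ : AFml n) : AFml n
  | disj {n : ℕ} (φ ψ : AFml n) : AFml n
  | imp {n : ℕ} (φ ψ : AFml n) : AFml n
  | ball {n : ℕ} (t : ATerm n) (φ : AFml (n + 1)) : AFml n
  | bex {n : ℕ} (t : ATerm n) (φ : AFml (n + 1)) : AFml n
  | all {n : ℕ} (φ : AFml (n + 1)) : AFml n
  | ex {n : ℕ} (φ : AFml (n + 1)) : AFml n

/-- All quantifiers are bounded. -/
def AFml.IsDelta0 : {n : ℕ} → AFml n → Prop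
  | _, .eq _ _ => True
  | _, .fls => True
  | _, .conj φ ψ => φ.IsDelta0 ∧ ψ.IsDelta0
  | _, .disj φ ψ => φ.IsDelta0 ∧ ψ.IsDelta0
  | _, .imp φ ψ => φ.IsDelta0 ∧ ψ.IsDelta0
  | _, .ball _ φ => φ.IsDelta0
  | _, .bex _ φ => φ.IsDelta0
  | _, .all _ => False
  | _, .ex _ => False

/-- `Σ⁰₁` formulas: existential quantifiers before a `Δ₀` formula. -/
inductive AFml.IsSigma1 : {n : ℕ} → AFml n → Prop
  | delta {n : ℕ} {φ : AFml n} (h : φ.IsDelta0) : IsSigma1 φ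
  | ex {n : ℕ} {φ : AFml (n + 1)} (h : IsSigma1 φ) : IsSigma1 (.ex φ)

/-- `Π⁰₂` formulas: universal quantifiers before a `Σ⁰₁` formula. -/
inductive AFml.IsPi2 : {n : ℕ} → AFml n → Prop
  | sigma {n : ℕ} {φ : AFml n} (h : φ.IsSigma1) : IsPi2 φ
  | all {n : ℕ} {φ : AFml (n + 1)} (h : IsPi2 φ) : IsPi2 (.all φ)

/-- The set-theoretic formula "`t` has the value `v`", where `v` is set variable `0` and variable
`i` of `t` is set variable `i + 1`. -/
def ATerm.graph {n : ℕ} : ATerm n → Fml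
  | var i => Fml.eq 0 (i.val + 1)
  | zero => isEmpty 0
  | succ t => Fml.ex (Fml.conj (t.graph.rename (up (· + 1)) id) (isSucc 0 1))
  | add t s => Fml.ex (Fml.ex (Fml.conj
      (t.graph.rename (fun | 0 => 1 | k + 1 => k + 3) id)
      (Fml.conj (s.graph.rename (fun | 0 => 0 | k + 1 => k + 3) id) (isAdd 1 0 2))))
  | mul t s => Fml.ex (Fml.ex (Fml.conj
      (t.graph.rename (fun | 0 => 1 | k + 1 => k + 3) id)
      (Fml.conj (s.graph.rename (fun | 0 => 0 | k + 1 => k + 3) id) (isMul 1 0 2))))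

/-- The standard interpretation of arithmetic in set theory: quantifiers range over `ω`, and
`x < t` becomes `x ∈ t`; variable `i` becomes set variable `i`. -/
def AFml.toSet : {n : ℕ} → AFml n → Fml
  | _, .eq t s => Fml.ex (Fml.conj t.graph s.graph)
  | _, .fls => Fml.fls
  | _, .conj φ ψ => Fml.conj φ.toSet ψ.toSet
  | _, .disj φ ψ => Fml.disj φ.toSet ψ.toSet
  | _, .imp φ ψ => Fml.imp φ.toSet ψ.toSet
  | _, .ball t φ => Fml.all (Fml.imp t.graph (ballIn 0 (φ.toSet.rename (up (· + 1)) id)))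
  | _, .bex t φ => Fml.ex (Fml.conj t.graph (bexIn 0 (φ.toSet.rename (up (· + 1)) id)))
  | _, .all φ => Fml.all (Fml.imp (isNat 0) φ.toSet)
  | _, .ex φ => Fml.ex (Fml.conj (isNat 0) φ.toSet)

/-! ## Proof-theoretic strength -/

/-- `S` is proof-theoretically reducible to `T`: a primitive recursive function transforms every
proof in `S` of a `Π⁰₂` sentence of arithmetic (in particular, every proof of a contradiction) into
a proof of the same sentence in `T`. -/
def Theory.Reducible (S T : Theory) : Prop :=
  ∃ f : ℕ → ℕ, Nat.Primrec f ∧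
    ∀ φ : AFml 0, φ.IsPi2 → ∀ d : S.Proof φ.toSet, ∃ e : T.Proof φ.toSet, e.code = f d.code

/-- Two theories have the same proof-theoretic strength if each is proof-theoretically reducible
to the other. -/
def Theory.SameStrength (S T : Theory) : Prop := S.Reducible T ∧ T.Reducible S

end SetClass

/-! ## Renaming -/

namespace SetClass

theorem up_comp (ρ ρ' : ℕ → ℕ) : up (ρ' ∘ ρ) = up ρ' ∘ up ρ := by
  funext n; cases n <;> rfl

@[simp] theorem up_id : up id = id := by
  funext n; cases n <;> rfl

@[simp] theorem up_zero (ρ : ℕ → ℕ) : up ρ 0 = 0 := rfl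
@[simp] theorem up_succ (ρ : ℕ → ℕ) (n : ℕ) : up ρ (n + 1) = ρ n + 1 := rfl
@[simp] theorem instRen_zero (t : ℕ) : instRen t 0 = t := rfl
@[simp] theorem instRen_succ (t n : ℕ) : instRen t (n + 1) = n := rfl

namespace Fml

@[simp] theorem rename_rename (ρ σ ρ' σ' : ℕ → ℕ) (φ : Fml) :
    (φ.rename ρ σ).rename ρ' σ' = φ.rename (ρ' ∘ ρ) (σ' ∘ σ) := by
  induction φ generalizing ρ σ ρ' σ' <;> simp_all [rename, up_comp]

@[simp] theorem rename_id (φ : Fml) : φ.rename id id = φ := by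
  induction φ <;> simp_all [rename]

theorem rename_congr {ρ σ ρ' σ' : ℕ → ℕ} (φ : Fml) (h : ∀ n, ρ n = ρ' n) (h' : ∀ n, σ n = σ' n) :
    φ.rename ρ σ = φ.rename ρ' σ' := by
  rw [funext h, funext h']

theorem rename_eq_self {ρ σ : ℕ → ℕ} (φ : Fml) (h : ∀ n, ρ n = n) (h' : ∀ n, σ n = n) :
    φ.rename ρ σ = φ := by
  rw [show ρ = id from funext h, show σ = id from funext h', rename_id]

@[simp] theorem shift_inst (φ : Fml) (t : ℕ) : φ.shift.inst t = φ := by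
  simp only [shift, inst, rename_rename]; exact rename_eq_self _ (fun _ => rfl) (fun _ => rfl)

@[simp] theorem shiftC_instC (φ : Fml) (t : ℕ) : φ.shiftC.instC t = φ := by
  simp only [shiftC, instC, rename_rename]; exact rename_eq_self _ (fun _ => rfl) (fun _ => rfl)

theorem inst_rename (φ : Fml) (t : ℕ) (ρ σ : ℕ → ℕ) :
    (φ.inst t).rename ρ σ = (φ.rename (up ρ) σ).inst (ρ t) := by
  simp only [inst, rename_rename]
  exact rename_congr _ (fun n => by cases n <;> rfl) (fun _ => rfl)

theorem instC_rename (φ : Fml) (t : ℕ) (ρ σ : ℕ → ℕ) :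
    (φ.instC t).rename ρ σ = (φ.rename ρ (up σ)).instC (σ t) := by
  simp only [instC, rename_rename]
  exact rename_congr _ (fun _ => rfl) (fun n => by cases n <;> rfl)

theorem shift_rename (φ : Fml) (ρ σ : ℕ → ℕ) :
    φ.shift.rename (up ρ) σ = (φ.rename ρ σ).shift := by
  simp only [shift, rename_rename]; rfl

theorem shiftC_rename (φ : Fml) (ρ σ : ℕ → ℕ) :
    φ.shiftC.rename ρ (up σ) = (φ.rename ρ σ).shiftC := by
  simp only [shiftC, rename_rename]; rfl

/-- Every variable that occurs free is smaller than `bound`. -/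
def bound : Fml → ℕ
  | mem x y => max x y + 1
  | memC x X => max x X + 1
  | eq x y => max x y + 1
  | eqC X Y => max X Y + 1
  | fls => 0
  | conj φ ψ => max φ.bound ψ.bound
  | disj φ ψ => max φ.bound ψ.bound
  | imp φ ψ => max φ.bound ψ.bound
  | all φ => φ.bound
  | ex φ => φ.bound
  | allC φ => φ.bound
  | exC φ => φ.bound

theorem up_agree {ρ ρ' : ℕ → ℕ} {b : ℕ} (h : ∀ n < b, ρ n = ρ' n) : ∀ n < b, up ρ n = up ρ' n := by
  intro n hn
  cases n with
  | zero => rfl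
  | succ n => simp [h n (by omega)]

theorem rename_agree (φ : Fml) {ρ σ ρ' σ' : ℕ → ℕ} (h : ∀ n < φ.bound, ρ n = ρ' n)
    (h' : ∀ n < φ.bound, σ n = σ' n) : φ.rename ρ σ = φ.rename ρ' σ' := by
  induction φ generalizing ρ σ ρ' σ' with
  | mem x y => simp only [bound] at h; simp [rename, h x (by omega), h y (by omega)]
  | memC x y => simp only [bound] at h h'; simp [rename, h x (by omega), h' y (by omega)]
  | eq x y => simp only [bound] at h; simp [rename, h x (by omega), h y (by omega)]
  | eqC x y => simp only [bound] at h'; simp [rename, h' x (by omega), h' y (by omega)]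
  | fls => rfl
  | conj φ ψ ih₁ ih₂ | disj φ ψ ih₁ ih₂ | imp φ ψ ih₁ ih₂ =>
    simp only [bound] at h h'
    simp only [rename]
    rw [ih₁ (fun n hn => h n (by omega)) (fun n hn => h' n (by omega)),
      ih₂ (fun n hn => h n (by omega)) (fun n hn => h' n (by omega))]
  | all φ ih | ex φ ih => simp only [rename]; rw [ih (up_agree h) h']
  | allC φ ih | exC φ ih => simp only [rename]; rw [ih h (up_agree h')]

theorem code_injective : Function.Injective code := by
  intro φ
  induction φ with
  | mem x y | memC x y | eq x y | eqC x y | fls =>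
    intro ψ h
    cases ψ <;> simp_all [code]
  | conj φ ψ ih₁ ih₂ | disj φ ψ ih₁ ih₂ | imp φ ψ ih₁ ih₂ =>
    intro χ h
    cases χ <;> simp [code] at h ⊢
    exact ⟨ih₁ h.1, ih₂ h.2⟩
  | all φ ih | ex φ ih | allC φ ih | exC φ ih =>
    intro χ h
    cases χ <;> simp [code] at h ⊢
    exact ih h

end Fml

open Fml

/-! ## Derivability -/

/-- The axioms are closed under renaming of free variables. -/
class Theory.Renamable (T : Theory) : Prop where
  rename_mem : ∀ φ ∈ T.axioms, ∀ ρ σ, φ.rename ρ σ ∈ T.axioms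

/-- `φ` is derivable from `Γ`. -/
def Prv (T : Theory) (Γ : List Fml) (φ : Fml) : Prop := Nonempty (Deriv T Γ φ)

theorem map_rename_subset_shift {Γ Δ : List Fml} {ρ σ : ℕ → ℕ}
    (h : ∀ ψ ∈ Γ, ψ.rename ρ σ ∈ Δ) : ∀ ψ ∈ Γ.map shift, ψ.rename (up ρ) σ ∈ Δ.map shift := by
  intro ψ hψ
  obtain ⟨χ, hχ, rfl⟩ := List.mem_map.1 hψ
  rw [shift_rename]
  exact List.mem_map_of_mem (h χ hχ)

theorem map_rename_subset_shiftC {Γ Δ : List Fml} {ρ σ : ℕ → ℕ}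
    (h : ∀ ψ ∈ Γ, ψ.rename ρ σ ∈ Δ) : ∀ ψ ∈ Γ.map shiftC, ψ.rename ρ (up σ) ∈ Δ.map shiftC := by
  intro ψ hψ
  obtain ⟨χ, hχ, rfl⟩ := List.mem_map.1 hψ
  rw [shiftC_rename]
  exact List.mem_map_of_mem (h χ hχ)

theorem cons_rename_subset {Γ Δ : List Fml} {ρ σ : ℕ → ℕ} (φ : Fml)
    (h : ∀ ψ ∈ Γ, ψ.rename ρ σ ∈ Δ) : ∀ ψ ∈ φ :: Γ, ψ.rename ρ σ ∈ φ.rename ρ σ :: Δ := by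
  intro ψ hψ
  rcases List.mem_cons.1 hψ with rfl | hψ
  · exact List.mem_cons_self
  · exact List.mem_cons_of_mem _ (h ψ hψ)

/-- Renaming and weakening of derivations. -/
theorem Deriv.rename {T : Theory} [hT : T.Renamable] {Γ : List Fml} {φ : Fml} (d : Deriv T Γ φ) :
    ∀ {Δ : List Fml} (ρ σ : ℕ → ℕ), (∀ ψ ∈ Γ, ψ.rename ρ σ ∈ Δ) → Prv T Δ (φ.rename ρ σ) := by
  induction d with
  | ax h => intro Δ ρ σ _; exact ⟨.ax (hT.rename_mem _ h _ _)⟩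
  | lem h => intro Δ ρ σ _; exact ⟨.lem h⟩
  | hyp h => intro Δ ρ σ H; exact ⟨.hyp (H _ h)⟩
  | efq d ih => intro Δ ρ σ H; obtain ⟨d'⟩ := ih ρ σ H; exact ⟨.efq d'⟩
  | andI d e ih₁ ih₂ =>
    intro Δ ρ σ H; obtain ⟨d'⟩ := ih₁ ρ σ H; obtain ⟨e'⟩ := ih₂ ρ σ H; exact ⟨.andI d' e'⟩
  | andL d ih => intro Δ ρ σ H; obtain ⟨d'⟩ := ih ρ σ H; exact ⟨.andL d'⟩
  | andR d ih => intro Δ ρ σ H; obtain ⟨d'⟩ := ih ρ σ H; exact ⟨.andR d'⟩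
  | orL d ih => intro Δ ρ σ H; obtain ⟨d'⟩ := ih ρ σ H; exact ⟨.orL d'⟩
  | orR d ih => intro Δ ρ σ H; obtain ⟨d'⟩ := ih ρ σ H; exact ⟨.orR d'⟩
  | orE d e₁ e₂ ih ih₁ ih₂ =>
    intro Δ ρ σ H
    obtain ⟨d'⟩ := ih ρ σ H
    obtain ⟨e₁'⟩ := ih₁ ρ σ (cons_rename_subset _ H)
    obtain ⟨e₂'⟩ := ih₂ ρ σ (cons_rename_subset _ H)
    exact ⟨.orE d' e₁' e₂'⟩
  | impI d ih =>
    intro Δ ρ σ H; obtain ⟨d'⟩ := ih ρ σ (cons_rename_subset _ H); exact ⟨.impI d'⟩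
  | impE d e ih₁ ih₂ =>
    intro Δ ρ σ H; obtain ⟨d'⟩ := ih₁ ρ σ H; obtain ⟨e'⟩ := ih₂ ρ σ H; exact ⟨.impE d' e'⟩
  | allI d ih =>
    intro Δ ρ σ H
    obtain ⟨d'⟩ := ih (up ρ) σ (map_rename_subset_shift H)
    exact ⟨.allI d'⟩
  | allE t d ih =>
    intro Δ ρ σ H; obtain ⟨d'⟩ := ih ρ σ H
    rw [inst_rename]; exact ⟨.allE _ d'⟩
  | exI t d ih =>
    intro Δ ρ σ H; obtain ⟨d'⟩ := ih ρ σ H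
    rw [inst_rename] at d'; exact ⟨.exI _ d'⟩
  | exE d e ih₁ ih₂ =>
    intro Δ ρ σ H
    obtain ⟨d'⟩ := ih₁ ρ σ H
    obtain ⟨e'⟩ := ih₂ (up ρ) σ (cons_rename_subset _ (map_rename_subset_shift H))
    rw [shift_rename] at e'
    exact ⟨.exE d' e'⟩
  | allCI d ih =>
    intro Δ ρ σ H
    obtain ⟨d'⟩ := ih ρ (up σ) (map_rename_subset_shiftC H)
    exact ⟨.allCI d'⟩
  | allCE t d ih =>
    intro Δ ρ σ H; obtain ⟨d'⟩ := ih ρ σ H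
    rw [instC_rename]; exact ⟨.allCE _ d'⟩
  | exCI t d ih =>
    intro Δ ρ σ H; obtain ⟨d'⟩ := ih ρ σ H
    rw [instC_rename] at d'; exact ⟨.exCI _ d'⟩
  | exCE d e ih₁ ih₂ =>
    intro Δ ρ σ H
    obtain ⟨d'⟩ := ih₁ ρ σ H
    obtain ⟨e'⟩ := ih₂ ρ (up σ) (cons_rename_subset _ (map_rename_subset_shiftC H))
    rw [shiftC_rename] at e'
    exact ⟨.exCE d' e'⟩
  | eqRefl x => intro Δ ρ σ H; exact ⟨.eqRefl _⟩
  | eqSubst φ d e ih₁ ih₂ =>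
    intro Δ ρ σ H; obtain ⟨d'⟩ := ih₁ ρ σ H; obtain ⟨e'⟩ := ih₂ ρ σ H
    rw [inst_rename] at e' ⊢; exact ⟨.eqSubst _ d' e'⟩
  | eqCRefl x => intro Δ ρ σ H; exact ⟨.eqCRefl _⟩
  | eqCSubst φ d e ih₁ ih₂ =>
    intro Δ ρ σ H; obtain ⟨d'⟩ := ih₁ ρ σ H; obtain ⟨k⟩ := ih₂ ρ σ H
    rw [instC_rename] at k ⊢; exact ⟨.eqCSubst _ d' k⟩

/-- `Γ` is part of `Δ`. -/
class Sub (Γ Δ : List Fml) : Prop where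
  subset : ∀ φ ∈ Γ, φ ∈ Δ

instance Sub.refl (Γ : List Fml) : Sub Γ Γ := ⟨fun _ h => h⟩
instance Sub.cons (φ : Fml) (Γ Δ : List Fml) [h : Sub Γ Δ] : Sub Γ (φ :: Δ) :=
  ⟨fun _ hψ => List.mem_cons_of_mem _ (h.subset _ hψ)⟩
instance (priority := high) Sub.nil (Δ : List Fml) : Sub [] Δ := ⟨fun _ h => by simp at h⟩

namespace Prv

variable {T : Theory} {Γ Δ : List Fml} {φ ψ χ : Fml}

theorem ax (h : φ ∈ T.axioms) : Prv T Γ φ := ⟨.ax h⟩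
theorem lem (h : T.classical) : Prv T Γ (disj φ (neg φ)) := ⟨.lem h⟩
theorem hyp (h : φ ∈ Γ) : Prv T Γ φ := ⟨.hyp h⟩
theorem efq (h : Prv T Γ fls) : Prv T Γ φ := h.elim fun d => ⟨.efq d⟩
theorem andI (h : Prv T Γ φ) (h' : Prv T Γ ψ) : Prv T Γ (conj φ ψ) :=
  h.elim fun d => h'.elim fun e => ⟨.andI d e⟩
theorem andL (h : Prv T Γ (conj φ ψ)) : Prv T Γ φ := h.elim fun d => ⟨.andL d⟩
theorem andR (h : Prv T Γ (conj φ ψ)) : Prv T Γ ψ := h.elim fun d => ⟨.andR d⟩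
theorem orL (h : Prv T Γ φ) : Prv T Γ (disj φ ψ) := h.elim fun d => ⟨.orL d⟩
theorem orR (h : Prv T Γ ψ) : Prv T Γ (disj φ ψ) := h.elim fun d => ⟨.orR d⟩
theorem hyp0 : Prv T (φ :: Γ) φ := .hyp List.mem_cons_self
theorem orE (h : Prv T Γ (disj φ ψ)) (h₁ : Prv T (φ :: Γ) φ → Prv T (φ :: Γ) χ)
    (h₂ : Prv T (ψ :: Γ) ψ → Prv T (ψ :: Γ) χ) : Prv T Γ χ :=
  h.elim fun d => (h₁ hyp0).elim fun e₁ => (h₂ hyp0).elim fun e₂ => ⟨.orE d e₁ e₂⟩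
theorem impI (h : Prv T (φ :: Γ) φ → Prv T (φ :: Γ) ψ) : Prv T Γ (imp φ ψ) :=
  (h hyp0).elim fun d => ⟨.impI d⟩
theorem impE (h : Prv T Γ (imp φ ψ)) (h' : Prv T Γ φ) : Prv T Γ ψ :=
  h.elim fun d => h'.elim fun e => ⟨.impE d e⟩
theorem allE (h : Prv T Γ (all φ)) (t : ℕ) : Prv T Γ (φ.inst t) := h.elim fun d => ⟨.allE t d⟩
theorem exI (t : ℕ) (h : Prv T Γ (φ.inst t)) : Prv T Γ (ex φ) := h.elim fun d => ⟨.exI t d⟩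
theorem allCE (h : Prv T Γ (allC φ)) (t : ℕ) : Prv T Γ (φ.instC t) := h.elim fun d => ⟨.allCE t d⟩
theorem exCI (t : ℕ) (h : Prv T Γ (φ.instC t)) : Prv T Γ (exC φ) := h.elim fun d => ⟨.exCI t d⟩
theorem refl (x : ℕ) : Prv T Γ (eq x x) := ⟨.eqRefl x⟩
theorem reflC (x : ℕ) : Prv T Γ (eqC x x) := ⟨.eqCRefl x⟩
theorem subst {x y : ℕ} (φ : Fml) (h : Prv T Γ (eq x y)) (h' : Prv T Γ (φ.inst x)) :
    Prv T Γ (φ.inst y) :=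
  h.elim fun d => h'.elim fun e => ⟨.eqSubst φ d e⟩
theorem substC {x y : ℕ} (φ : Fml) (h : Prv T Γ (eqC x y)) (h' : Prv T Γ (φ.instC x)) :
    Prv T Γ (φ.instC y) :=
  h.elim fun d => h'.elim fun e => ⟨.eqCSubst φ d e⟩

theorem iffI (h : Prv T (φ :: Γ) φ → Prv T (φ :: Γ) ψ) (h' : Prv T (ψ :: Γ) ψ → Prv T (ψ :: Γ) φ) :
    Prv T Γ (iff φ ψ) := andI (impI h) (impI h')
theorem mp (h : Prv T Γ (iff φ ψ)) (h' : Prv T Γ φ) : Prv T Γ ψ := impE (andL h) h'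
theorem mpr (h : Prv T Γ (iff φ ψ)) (h' : Prv T Γ ψ) : Prv T Γ φ := impE (andR h) h'
theorem symm {x y : ℕ} (h : Prv T Γ (eq x y)) : Prv T Γ (eq y x) :=
  subst (Γ := Γ) (eq 0 (x + 1)) h (refl x)
theorem trans {x y z : ℕ} (h : Prv T Γ (eq x y)) (h' : Prv T Γ (eq y z)) : Prv T Γ (eq x z) :=
  subst (Γ := Γ) (eq (x + 1) 0) h' h
theorem cut (h : Prv T Γ φ) (h' : Prv T (φ :: Γ) φ → Prv T (φ :: Γ) χ) : Prv T Γ χ :=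
  impE (impI h') h

section
variable [T.Renamable]

theorem rename (ρ σ : ℕ → ℕ) (h : Prv T Γ φ) (H : ∀ ψ ∈ Γ, ψ.rename ρ σ ∈ Δ) :
    Prv T Δ (φ.rename ρ σ) := h.elim fun d => d.rename ρ σ H

theorem mono (h : Prv T Γ φ) (H : ∀ ψ ∈ Γ, ψ ∈ Δ) : Prv T Δ φ := by
  simpa using h.rename id id (by simpa using H)

/-- Weakening. -/
theorem w [H : Sub Γ Δ] (h : Prv T Γ φ) : Prv T Δ φ := h.mono H.subset

end

/-- A number above all variables of a context. -/
theorem exists_bound (Γ : List Fml) : ∃ b, ∀ φ ∈ Γ, φ.bound ≤ b := by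
  induction Γ with
  | nil => exact ⟨0, by simp⟩
  | cons φ Γ ih =>
    obtain ⟨b, hb⟩ := ih
    refine ⟨max b φ.bound, ?_⟩
    intro ψ hψ
    rcases List.mem_cons.1 hψ with rfl | h
    · simp
    · exact le_max_of_le_left (hb _ h)

/-- The renaming that undoes the substitution of a fresh variable `t` for variable `0`. -/
def gen (t n : ℕ) : ℕ := if n = t then 0 else n + 1

theorem gen_shift {t : ℕ} (φ : Fml) (h : φ.bound ≤ t) : φ.rename (gen t) id = φ.shift :=
  rename_agree _ (fun n hn => by simp [gen]; omega) (fun _ _ => rfl)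

theorem gen_shiftC {t : ℕ} (φ : Fml) (h : φ.bound ≤ t) : φ.rename id (gen t) = φ.shiftC :=
  rename_agree _ (fun _ _ => rfl) (fun n hn => by simp [gen]; omega)

theorem gen_inst {t : ℕ} (φ : Fml) (h : φ.bound ≤ t) : (φ.inst t).rename (gen t) id = φ := by
  rw [inst, rename_rename]
  conv_rhs => rw [← rename_id φ]
  refine rename_agree _ (fun n hn => ?_) (fun _ _ => rfl)
  cases n with
  | zero => simp [gen]
  | succ n =>
    have : n ≠ t := by omega
    simp [gen, this]

theorem gen_instC {t : ℕ} (φ : Fml) (h : φ.bound ≤ t) : (φ.instC t).rename id (gen t) = φ := by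
  rw [instC, rename_rename]
  conv_rhs => rw [← rename_id φ]
  refine rename_agree _ (fun _ _ => rfl) (fun n hn => ?_)
  cases n with
  | zero => simp [gen]
  | succ n =>
    have : n ≠ t := by omega
    simp [gen, this]

variable [T.Renamable]

theorem allI (h : ∀ t, Prv T Γ (φ.inst t)) : Prv T Γ (all φ) := by
  obtain ⟨b, hb⟩ := exists_bound (φ :: Γ)
  have h' : Prv T (Γ.map shift) φ := by
    have := (h b).rename (Δ := Γ.map shift) (gen b) id (fun ψ hψ => by
      rw [gen_shift _ (hb _ (List.mem_cons_of_mem _ hψ))]; exact List.mem_map_of_mem hψ)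
    rwa [gen_inst _ (hb _ List.mem_cons_self)] at this
  exact h'.elim fun d => ⟨.allI d⟩

theorem allCI (h : ∀ t, Prv T Γ (φ.instC t)) : Prv T Γ (allC φ) := by
  obtain ⟨b, hb⟩ := exists_bound (φ :: Γ)
  have h' : Prv T (Γ.map shiftC) φ := by
    have := (h b).rename (Δ := Γ.map shiftC) id (gen b) (fun ψ hψ => by
      rw [gen_shiftC _ (hb _ (List.mem_cons_of_mem _ hψ))]; exact List.mem_map_of_mem hψ)
    rwa [gen_instC _ (hb _ List.mem_cons_self)] at this
  exact h'.elim fun d => ⟨.allCI d⟩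

theorem exE (h : Prv T Γ (ex φ))
    (h' : ∀ t, Prv T (φ.inst t :: Γ) (φ.inst t) → Prv T (φ.inst t :: Γ) χ) : Prv T Γ χ := by
  have h₁ : Prv T Γ (all (imp φ χ.shift)) := allI fun t => by
    have h₀ : (imp φ χ.shift).inst t = imp (φ.inst t) χ := congrArg (imp _) (shift_inst χ t)
    exact h₀ ▸ impI (h' t)
  have h₂ : Prv T (φ :: Γ.map shift) χ.shift := by
    have h₃ : Prv T (φ :: Γ.map shift) (all (imp φ χ.shift)).shift :=
      h₁.rename Nat.succ id (fun ψ hψ => List.mem_cons_of_mem _ (List.mem_map_of_mem hψ))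
    have h₄ := h₃.allE 0
    have h₅ : ∀ θ : Fml, (θ.rename (up Nat.succ) id).inst 0 = θ := fun θ => by
      rw [inst, rename_rename]
      exact rename_eq_self _ (fun n => by cases n <;> rfl) (fun _ => rfl)
    have h₆ : Prv T (φ :: Γ.map shift) (imp φ χ.shift) := by
      rw [← h₅ (imp φ χ.shift)]; exact h₄
    exact impE h₆ hyp0
  exact h.elim fun d => h₂.elim fun e => ⟨.exE d e⟩

theorem exCE (h : Prv T Γ (exC φ))
    (h' : ∀ t, Prv T (φ.instC t :: Γ) (φ.instC t) → Prv T (φ.instC t :: Γ) χ) : Prv T Γ χ := by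
  have h₁ : Prv T Γ (allC (imp φ χ.shiftC)) := allCI fun t => by
    have h₀ : (imp φ χ.shiftC).instC t = imp (φ.instC t) χ := congrArg (imp _) (shiftC_instC χ t)
    exact h₀ ▸ impI (h' t)
  have h₂ : Prv T (φ :: Γ.map shiftC) χ.shiftC := by
    have h₃ : Prv T (φ :: Γ.map shiftC) (allC (imp φ χ.shiftC)).shiftC :=
      h₁.rename id Nat.succ (fun ψ hψ => List.mem_cons_of_mem _ (List.mem_map_of_mem hψ))
    have h₄ := h₃.allCE 0
    have h₅ : ∀ θ : Fml, (θ.rename id (up Nat.succ)).instC 0 = θ := fun θ => by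
      rw [instC, rename_rename]
      exact rename_eq_self _ (fun _ => rfl) (fun n => by cases n <;> rfl)
    have h₆ : Prv T (φ :: Γ.map shiftC) (imp φ χ.shiftC) := by
      rw [← h₅ (imp φ χ.shiftC)]; exact h₄
    exact impE h₆ hyp0
  exact h.elim fun d => h₂.elim fun e => ⟨.exCE d e⟩

end Prv

end SetClass


/-! ## Primitive recursive evaluation of recursions with changing parameters -/

namespace SetClass

/-- The recursion `G (n + 1) x = step x [G n (q 0 x), …, G n (q (r - 1) x)]`. -/
def fuelRec (r : ℕ) (q : ℕ → ℕ → ℕ) (step : ℕ → List ℕ → ℕ) : ℕ → ℕ → ℕ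
  | 0, _ => 0
  | n + 1, x => step x ((List.range r).map fun i => fuelRec r q step n (q i x))

/-- The arguments at depth `d` of the call tree of `fuelRec`. -/
def callTree (r : ℕ) (q : ℕ → ℕ → ℕ) (x : ℕ) : ℕ → List ℕ
  | 0 => [x]
  | d + 1 => (callTree r q x d).flatMap fun y => (List.range r).map fun i => q i y

/-- The values of `fuelRec` at the arguments of depth `n - k`. -/
def callValues (r : ℕ) (q : ℕ → ℕ → ℕ) (step : ℕ → List ℕ → ℕ) (n x : ℕ) : ℕ → List ℕ
  | 0 => (callTree r q x n).map fun _ => 0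
  | k + 1 => (callTree r q x (n - (k + 1))).map fun y => step y ((List.range r).map fun i =>
      (callValues r q step n x k).getD ((callTree r q x (n - k)).idxOf (q i y)) 0)

theorem callValues_eq (r : ℕ) (q : ℕ → ℕ → ℕ) (step : ℕ → List ℕ → ℕ) (n x k : ℕ) (hk : k ≤ n) :
    callValues r q step n x k = (callTree r q x (n - k)).map (fuelRec r q step k) := by
  induction k with
  | zero => exact List.map_congr_left fun y _ => rfl
  | succ k ih =>
    rw [callValues, ih (by omega)]
    refine List.map_congr_left fun y hy => ?_
    rw [fuelRec]
    congr 1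
    refine List.map_congr_left fun i hi => ?_
    have hmem : q i y ∈ callTree r q x (n - k) := by
      rw [show n - k = (n - (k + 1)) + 1 by omega, callTree]
      exact List.mem_flatMap.2 ⟨y, hy, List.mem_map_of_mem hi⟩
    rw [List.getD_eq_getElem?_getD, List.getElem?_map]
    have := List.idxOf_lt_length_of_mem hmem
    simp [List.getElem?_eq_getElem this]

theorem fuelRec_primrec (r : ℕ) {q : ℕ → ℕ → ℕ} {step : ℕ → List ℕ → ℕ} (hq : Primrec₂ q)
    (hs : Primrec₂ step) : Primrec₂ (fuelRec r q step) := by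
  have htree : Primrec₂ (callTree r q) := by
    have : Primrec₂ fun (x d : ℕ) => (Nat.rec [x] (fun _ l => l.flatMap fun y =>
        (List.range r).map fun i => q i y) d : List ℕ) := by
      refine Primrec.nat_rec (f := fun x : ℕ => [x])
        (g := fun (_ : ℕ) (p : ℕ × List ℕ) => p.2.flatMap fun y =>
          (List.range r).map fun i => q i y) ?_ ?_
      · exact Primrec.list_cons.comp .id (.const [])
      · refine Primrec.list_flatMap (Primrec.snd.comp Primrec.snd) ?_
        refine Primrec.list_map (.const _) ?_
        exact hq.comp Primrec.snd (Primrec.snd.comp Primrec.fst)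
    refine this.of_eq fun x d => ?_
    induction d with
    | zero => rfl
    | succ d ih => rw [callTree, ← ih]
  have hval : Primrec₂ fun (p : ℕ × ℕ) k => callValues r q step p.1 p.2 k := by
    have : Primrec₂ fun (p : ℕ × ℕ) (k : ℕ) => (Nat.rec ((callTree r q p.2 p.1).map fun _ => 0)
        (fun k l => (callTree r q p.2 (p.1 - (k + 1))).map fun y => step y ((List.range r).map
          fun i => l.getD ((callTree r q p.2 (p.1 - k)).idxOf (q i y)) 0)) k : List ℕ) := by
      refine Primrec.nat_rec (f := fun p : ℕ × ℕ => (callTree r q p.2 p.1).map fun _ => 0)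
        (g := fun (p : ℕ × ℕ) (kl : ℕ × List ℕ) =>
          (callTree r q p.2 (p.1 - (kl.1 + 1))).map fun y => step y ((List.range r).map
          fun i => kl.2.getD ((callTree r q p.2 (p.1 - kl.1)).idxOf (q i y)) 0)) ?_ ?_
      · exact Primrec.list_map (htree.comp Primrec.snd Primrec.fst) (Primrec.const 0).to₂
      · refine Primrec.list_map (htree.comp (Primrec.snd.comp Primrec.fst)
          (Primrec.nat_sub.comp (Primrec.fst.comp Primrec.fst)
            (Primrec.succ.comp (Primrec.fst.comp Primrec.snd)))) ?_
        refine hs.comp Primrec.snd ?_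
        refine Primrec.list_map (.const _) ?_
        refine (Primrec.list_getD 0).comp
          (Primrec.snd.comp (Primrec.snd.comp (Primrec.fst.comp Primrec.fst))) ?_
        refine Primrec.list_idxOf.comp (hq.comp Primrec.snd (Primrec.snd.comp Primrec.fst)) ?_
        exact htree.comp (Primrec.snd.comp (Primrec.fst.comp (Primrec.fst.comp Primrec.fst)))
          (Primrec.nat_sub.comp (Primrec.fst.comp (Primrec.fst.comp (Primrec.fst.comp Primrec.fst)))
            (Primrec.fst.comp (Primrec.snd.comp (Primrec.fst.comp Primrec.fst))))
    refine this.of_eq fun x d => ?_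
    induction d with
    | zero => rfl
    | succ d ih => rw [callValues, ← ih]
  have : Primrec₂ fun n x => (callValues r q step n x n).getD 0 0 :=
    (Primrec.list_getD 0).comp (hval.comp (Primrec.pair Primrec.fst Primrec.snd) Primrec.fst)
      (.const 0)
  refine this.of_eq fun n x => ?_
  rw [callValues_eq _ _ _ _ _ _ le_rfl]
  simp [callTree]

/-! ## Primitive recursive families -/

section
variable {α : Type} {β γ δ : Type} [Primcodable β] [Primcodable γ] [Primcodable δ]

/-- `h a` is computed from the number `c a` by a primitive recursive function. -/
def PR (c : α → ℕ) (h : α → β) : Prop := ∃ g : ℕ → β, Primrec g ∧ ∀ a, h a = g (c a)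

variable {c : α → ℕ}

theorem PR.const (b : β) : PR c fun _ => b := ⟨_, .const b, fun _ => rfl⟩
theorem PR.self : PR c c := ⟨_, .id, fun _ => rfl⟩
theorem PR.comp {f : β → γ} (hf : Primrec f) {h : α → β} (hh : PR c h) : PR c fun a => f (h a) := by
  obtain ⟨g, hg, e⟩ := hh
  exact ⟨_, hf.comp hg, fun a => congrArg f (e a)⟩
theorem PR.comp₂ {f : β → γ → δ} (hf : Primrec₂ f) {h : α → β} {k : α → γ} (hh : PR c h)
    (hk : PR c k) : PR c fun a => f (h a) (k a) := by
  obtain ⟨g, hg, e⟩ := hh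
  obtain ⟨g', hg', e'⟩ := hk
  exact ⟨_, hf.comp hg hg', fun a => by simp only [e, e']⟩
theorem PR.mk {h : α → β} {k : α → γ} (hh : PR c h) (hk : PR c k) : PR c fun a => (h a, k a) :=
  .comp₂ Primrec₂.pair hh hk
theorem PR.natPair {h k : α → ℕ} (hh : PR c h) (hk : PR c k) : PR c fun a => Nat.pair (h a) (k a) :=
  .comp₂ Primrec₂.natPair hh hk
theorem PR.left {h : α → ℕ} (hh : PR c h) : PR c fun a => (h a).unpair.1 :=
  .comp (Primrec.fst.comp Primrec.unpair) hh
theorem PR.right {h : α → ℕ} (hh : PR c h) : PR c fun a => (h a).unpair.2 :=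
  .comp (Primrec.snd.comp Primrec.unpair) hh
theorem PR.fst {h : α → β × γ} (hh : PR c h) : PR c fun a => (h a).1 := .comp Primrec.fst hh
theorem PR.snd {h : α → β × γ} (hh : PR c h) : PR c fun a => (h a).2 := .comp Primrec.snd hh
theorem PR.succ {h : α → ℕ} (hh : PR c h) : PR c fun a => h a + 1 := .comp Primrec.succ hh
theorem PR.of_eq {h k : α → β} (hh : PR c h) (e : ∀ a, h a = k a) : PR c k := by
  rwa [← funext e]
theorem PR.comap {α' : Type} (f : α' → α) {h : α → β} (hh : PR c h) :
    PR (fun a => c (f a)) fun a => h (f a) := by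
  obtain ⟨g, hg, e⟩ := hh
  exact ⟨g, hg, fun a => e _⟩
theorem PR.ite {p : α → Bool} {h k : α → β} (hp : PR c p) (hh : PR c h) (hk : PR c k) :
    PR c fun a => cond (p a) (h a) (k a) := by
  obtain ⟨g, hg, e⟩ := hh
  obtain ⟨g', hg', e'⟩ := hk
  obtain ⟨p', hp', e''⟩ := hp
  exact ⟨_, .cond hp' hg hg', fun a => by simp only [e, e', e'']⟩
end

/-- A family of numbers. -/
structure PN {α : Type} (c : α → ℕ) where
  f : α → ℕ
  pr : PR c f

/-- A family of formulas. -/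
structure PF {α : Type} (c : α → ℕ) where
  f : α → Fml
  pr : PR c fun a => (f a).code

/-- A family of contexts. -/
structure PL {α : Type} (c : α → ℕ) where
  f : α → List Fml
  pr : PR c fun a => codeList (f a)

section
variable {α : Type} {c : α → ℕ}

@[ext] theorem PN.ext {x y : PN c} (h : ∀ a, x.f a = y.f a) : x = y := by
  cases x; cases y; congr; exact funext h
@[ext] theorem PF.ext {x y : PF c} (h : ∀ a, x.f a = y.f a) : x = y := by
  cases x; cases y; congr; exact funext h
@[ext] theorem PL.ext {x y : PL c} (h : ∀ a, x.f a = y.f a) : x = y := by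
  cases x; cases y; congr; exact funext h

namespace PN
def const (n : ℕ) : PN c := ⟨fun _ => n, .const n⟩
def succ (x : PN c) : PN c := ⟨fun a => x.f a + 1, x.pr.succ⟩
end PN

namespace PF
def const (φ : Fml) : PF c := ⟨fun _ => φ, .const _⟩
def mem (x y : PN c) : PF c := ⟨fun a => .mem (x.f a) (y.f a), .natPair (.const 0) (.natPair x.pr y.pr)⟩
def memC (x y : PN c) : PF c := ⟨fun a => .memC (x.f a) (y.f a), .natPair (.const 1) (.natPair x.pr y.pr)⟩
def eq (x y : PN c) : PF c := ⟨fun a => .eq (x.f a) (y.f a), .natPair (.const 2) (.natPair x.pr y.pr)⟩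
def eqC (x y : PN c) : PF c := ⟨fun a => .eqC (x.f a) (y.f a), .natPair (.const 3) (.natPair x.pr y.pr)⟩
def fls : PF c := ⟨fun _ => .fls, .const _⟩
def conj (φ ψ : PF c) : PF c := ⟨fun a => .conj (φ.f a) (ψ.f a), .natPair (.const 5) (.natPair φ.pr ψ.pr)⟩
def disj (φ ψ : PF c) : PF c := ⟨fun a => .disj (φ.f a) (ψ.f a), .natPair (.const 6) (.natPair φ.pr ψ.pr)⟩
def imp (φ ψ : PF c) : PF c := ⟨fun a => .imp (φ.f a) (ψ.f a), .natPair (.const 7) (.natPair φ.pr ψ.pr)⟩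
def all (φ : PF c) : PF c := ⟨fun a => .all (φ.f a), .natPair (.const 8) φ.pr⟩
def ex (φ : PF c) : PF c := ⟨fun a => .ex (φ.f a), .natPair (.const 9) φ.pr⟩
def allC (φ : PF c) : PF c := ⟨fun a => .allC (φ.f a), .natPair (.const 10) φ.pr⟩
def exC (φ : PF c) : PF c := ⟨fun a => .exC (φ.f a), .natPair (.const 11) φ.pr⟩
def iff (φ ψ : PF c) : PF c := conj (imp φ ψ) (imp ψ φ)
end PF

end

/-! ## Recursion on formulas -/

/-- Numbers `n a` related to the formulas `φ a` and the parameters `p a` can be computed. -/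
def QF {π : Type} [Primcodable π] (Q : π → Fml → ℕ → Prop) {α : Type} (c : α → ℕ) (p : α → π)
    (φ : PF c) : Prop := ∃ n : α → ℕ, PR c n ∧ ∀ a, Q (p a) (φ.f a) (n a)

/-- A relation `Q p φ n` that can be computed by recursion on `φ`.  Below a set quantifier the
parameter `p` becomes `q p`, below a class quantifier it becomes `qC p`. -/
structure FRules {π : Type} [Primcodable π] (q qC : π → π) (Q : π → Fml → ℕ → Prop) : Prop where
  mem : ∀ {α : Type} (c : α → ℕ) (p : α → π) (x y : PN c), PR c p → QF Q c p (.mem x y)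
  memC : ∀ {α : Type} (c : α → ℕ) (p : α → π) (x y : PN c), PR c p → QF Q c p (.memC x y)
  eq : ∀ {α : Type} (c : α → ℕ) (p : α → π) (x y : PN c), PR c p → QF Q c p (.eq x y)
  eqC : ∀ {α : Type} (c : α → ℕ) (p : α → π) (x y : PN c), PR c p → QF Q c p (.eqC x y)
  fls : ∀ {α : Type} (c : α → ℕ) (p : α → π), PR c p → QF Q c p .fls
  conj : ∀ {α : Type} (c : α → ℕ) (p : α → π) (φ ψ : PF c), PR c p → QF Q c p φ → QF Q c p ψ →
    QF Q c p (.conj φ ψ)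
  disj : ∀ {α : Type} (c : α → ℕ) (p : α → π) (φ ψ : PF c), PR c p → QF Q c p φ → QF Q c p ψ →
    QF Q c p (.disj φ ψ)
  imp : ∀ {α : Type} (c : α → ℕ) (p : α → π) (φ ψ : PF c), PR c p → QF Q c p φ → QF Q c p ψ →
    QF Q c p (.imp φ ψ)
  all : ∀ {α : Type} (c : α → ℕ) (p : α → π) (φ : PF c), PR c p → QF Q c (fun a => q (p a)) φ →
    QF Q c p (.all φ)
  ex : ∀ {α : Type} (c : α → ℕ) (p : α → π) (φ : PF c), PR c p → QF Q c (fun a => q (p a)) φ →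
    QF Q c p (.ex φ)
  allC : ∀ {α : Type} (c : α → ℕ) (p : α → π) (φ : PF c), PR c p → QF Q c (fun a => qC (p a)) φ →
    QF Q c p (.allC φ)
  exC : ∀ {α : Type} (c : α → ℕ) (p : α → π) (φ : PF c), PR c p → QF Q c (fun a => qC (p a)) φ →
    QF Q c p (.exC φ)

namespace FRules
variable {π : Type} [Primcodable π] {q qC : π → π} {Q : π → Fml → ℕ → Prop}

/-- The height of a formula. -/
def height : Fml → ℕ
  | .conj φ ψ => max (height φ) (height ψ) + 1
  | .disj φ ψ => max (height φ) (height ψ) + 1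
  | .imp φ ψ => max (height φ) (height ψ) + 1
  | .all φ => height φ + 1
  | .ex φ => height φ + 1
  | .allC φ => height φ + 1
  | .exC φ => height φ + 1
  | _ => 1

theorem lt_pair {k n m : ℕ} (hk : 0 < k) (h : m ≤ n) : m < Nat.pair k n := by
  refine lt_of_le_of_lt h ?_
  rcases Nat.eq_zero_or_pos n with rfl | hn
  · exact lt_of_lt_of_le hk (Nat.left_le_pair _ _)
  · unfold Nat.pair
    split
    · nlinarith
    · nlinarith

theorem height_le_code (φ : Fml) : height φ ≤ φ.code + 1 := by
  induction φ with
  | conj φ ψ ih₁ ih₂ | disj φ ψ ih₁ ih₂ | imp φ ψ ih₁ ih₂ =>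
    simp only [height, Fml.code]
    have h₁ := lt_pair (k := 1) (by omega) (Nat.left_le_pair φ.code ψ.code)
    have h₂ := lt_pair (k := 1) (by omega) (Nat.right_le_pair φ.code ψ.code)
    gcongr
    refine max_le (ih₁.trans ?_) (ih₂.trans ?_)
    · exact lt_pair (by omega) (Nat.left_le_pair φ.code ψ.code)
    · exact lt_pair (by omega) (Nat.right_le_pair φ.code ψ.code)
  | all φ ih | ex φ ih | allC φ ih | exC φ ih =>
    simp only [height, Fml.code]
    gcongr
    exact ih.trans (lt_pair (by omega) le_rfl)
  | _ => simp [height]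

theorem natural {β : Type} {mk : β → Fml} {C : β → ℕ} {P : π → β → ℕ → Prop}
    (h : ∀ {α : Type} (c : α → ℕ) (p : α → π) (b : α → β) (n : α → ℕ),
      (PR c fun a => Nat.pair (Nat.pair (Encodable.encode (p a)) (C (b a))) (n a)) →
      (∀ a, P (p a) (b a) (n a)) → ∃ n' : α → ℕ, PR c n' ∧ ∀ a, Q (p a) (mk (b a)) (n' a)) :
    ∃ g : ℕ → ℕ, Primrec g ∧ ∀ p b n, P p b n →
      Q p (mk b) (g (Nat.pair (Nat.pair (Encodable.encode p) (C b)) n)) := by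
  obtain ⟨n', ⟨g, hg, e⟩, H⟩ := h (α := {y : π × β × ℕ // P y.1 y.2.1 y.2.2})
    (fun y => Nat.pair (Nat.pair (Encodable.encode y.1.1) (C y.1.2.1)) y.1.2.2) (fun y => y.1.1)
    (fun y => y.1.2.1) (fun y => y.1.2.2) .self (fun y => y.2)
  exact ⟨g, hg, fun p b n hP => e ⟨(p, b, n), hP⟩ ▸ H ⟨(p, b, n), hP⟩⟩

theorem param {α : Type} {c : α → ℕ} {p : α → π} [Inhabited π] (h : PR c fun a => Encodable.encode (p a)) :
    PR c p := by
  have := PR.comp (f := fun n : ℕ => ((Encodable.decode n : Option π).getD default))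
    (Primrec.option_getD.comp Primrec.decode (.const _)) h
  simpa using this

theorem pick (h : ℕ → ℕ → List ℕ → ℕ) (hh : ∀ k, Primrec₂ (h k)) (t : ℕ → ℕ) (ht : Primrec t)
    (N : ℕ) : ∃ s : ℕ → List ℕ → ℕ, Primrec₂ s ∧ ∀ x l, t x < N → s x l = h (t x) x l := by
  induction N with
  | zero => exact ⟨fun _ _ => 0, .const 0, fun x l h => by omega⟩
  | succ N ih =>
    obtain ⟨s, hs, e⟩ := ih
    refine ⟨fun x l => if t x = N then h N x l else s x l, ?_, fun x l hx => ?_⟩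
    · exact Primrec.ite (PrimrecPred.comp (p := fun y : ℕ × List ℕ => t y.1 = N)
        (Primrec.eq.comp (ht.comp Primrec.fst) (.const N)) .id) (hh N) hs
    · by_cases h' : t x = N
      · simp [h']
      · simp only [h', if_false]; exact e x l (by omega)

theorem bin [Inhabited π] {mk : Fml → Fml → Fml} {k : ℕ}
    (hmk : ∀ φ ψ, (mk φ ψ).code = Nat.pair k (Nat.pair φ.code ψ.code))
    (h : ∀ {α : Type} (c : α → ℕ) (p : α → π) (φ ψ : PF c), PR c p → QF Q c p φ → QF Q c p ψ →
      ∃ n' : α → ℕ, PR c n' ∧ ∀ a, Q (p a) (mk (φ.f a) (ψ.f a)) (n' a)) :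
    ∃ g : ℕ → ℕ, Primrec g ∧ ∀ p φ ψ n m, Q p φ n → Q p ψ m →
      Q p (mk φ ψ) (g (Nat.pair (Nat.pair (Encodable.encode p) (mk φ ψ).code) (Nat.pair n m))) := by
  obtain ⟨g, hg, H⟩ := natural (Q := Q) (mk := fun b : Fml × Fml => mk b.1 b.2)
    (C := fun b => (mk b.1 b.2).code)
    (P := fun p b n => Q p b.1 n.unpair.1 ∧ Q p b.2 n.unpair.2) (fun c p b n hc hP => by
      have hcode := hc.left.right.of_eq (k := fun a => Nat.pair k (Nat.pair (b a).1.code (b a).2.code))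
        (fun a => by simp [hmk])
      exact h c p ⟨fun a => (b a).1, hcode.right.left.of_eq (by simp)⟩
        ⟨fun a => (b a).2, hcode.right.right.of_eq (by simp)⟩
        (param (hc.left.left.of_eq (by simp)))
        ⟨_, hc.right.left.of_eq (k := fun a => (n a).unpair.1) (by simp), fun a => (hP a).1⟩
        ⟨_, hc.right.right.of_eq (k := fun a => (n a).unpair.2) (by simp), fun a => (hP a).2⟩)
  exact ⟨g, hg, fun p φ ψ n m hn hm => H p (φ, ψ) (Nat.pair n m) (by simpa using ⟨hn, hm⟩)⟩

theorem un [Inhabited π] {q : π → π} {mk : Fml → Fml} {k : ℕ}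
    (hmk : ∀ φ, (mk φ).code = Nat.pair k φ.code)
    (h : ∀ {α : Type} (c : α → ℕ) (p : α → π) (φ : PF c), PR c p → QF Q c (fun a => q (p a)) φ →
      ∃ n' : α → ℕ, PR c n' ∧ ∀ a, Q (p a) (mk (φ.f a)) (n' a)) :
    ∃ g : ℕ → ℕ, Primrec g ∧ ∀ p φ n, Q (q p) φ n →
      Q p (mk φ) (g (Nat.pair (Nat.pair (Encodable.encode p) (mk φ).code) n)) := by
  obtain ⟨g, hg, H⟩ := natural (Q := Q) (mk := mk)
    (C := fun b => (mk b).code)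
    (P := fun p b n => Q (q p) b n) (fun c p b n hc hP => by
      have hcode := hc.left.right.of_eq (k := fun a => Nat.pair k (b a).code)
        (fun a => by simp [hmk])
      exact h c p ⟨b, hcode.right.of_eq (by simp)⟩
        (param (hc.left.left.of_eq (by simp)))
        ⟨n, hc.right.of_eq (by simp), hP⟩)
  exact ⟨g, hg, fun p φ n hn => H p φ n hn⟩

theorem atom [Inhabited π] {mk : ℕ → ℕ → Fml} {k : ℕ}
    (hmk : ∀ x y, (mk x y).code = Nat.pair k (Nat.pair x y))
    (h : ∀ {α : Type} (c : α → ℕ) (p : α → π) (x y : PN c), PR c p →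
      ∃ n' : α → ℕ, PR c n' ∧ ∀ a, Q (p a) (mk (x.f a) (y.f a)) (n' a)) :
    ∃ g : ℕ → ℕ, Primrec g ∧ ∀ p x y,
      Q p (mk x y) (g (Nat.pair (Nat.pair (Encodable.encode p) (mk x y).code) 0)) := by
  obtain ⟨g, hg, H⟩ := natural (Q := Q) (mk := fun b : ℕ × ℕ => mk b.1 b.2)
    (C := fun b => (mk b.1 b.2).code)
    (P := fun p b n => True) (fun c p b n hc hP => by
      have hcode := hc.left.right.of_eq (k := fun a => Nat.pair k (Nat.pair (b a).1 (b a).2))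
        (fun a => by simp [hmk])
      exact h c p ⟨fun a => (b a).1, hcode.right.left.of_eq (by simp)⟩
        ⟨fun a => (b a).2, hcode.right.right.of_eq (by simp)⟩
        (param (hc.left.left.of_eq (by simp))))
  exact ⟨g, hg, fun p x y => H p (x, y) 0 trivial⟩

theorem nullary [Inhabited π] {mk : Fml}
    (h : ∀ {α : Type} (c : α → ℕ) (p : α → π), PR c p →
      ∃ n' : α → ℕ, PR c n' ∧ ∀ a, Q (p a) mk (n' a)) :
    ∃ g : ℕ → ℕ, Primrec g ∧ ∀ p,
      Q p mk (g (Nat.pair (Nat.pair (Encodable.encode p) mk.code) 0)) := by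
  obtain ⟨g, hg, H⟩ := natural (Q := Q) (mk := fun _ : Unit => mk) (C := fun _ => mk.code)
    (P := fun p b n => True) (fun c p b n hc hP => h c p (param (hc.left.left.of_eq (by simp))))
  exact ⟨g, hg, fun p => H p () 0 trivial⟩

theorem pick' (h : ℕ → ℕ → ℕ) (hh : ∀ k, Primrec (h k)) (N : ℕ) :
    ∃ s : ℕ → ℕ → ℕ, Primrec₂ s ∧ ∀ k x, k < N → s k x = h k x := by
  obtain ⟨s, hs, e⟩ := pick (fun k y _ => h k y.unpair.2)
    (fun k => (hh k).comp (Primrec.snd.comp (Primrec.unpair.comp Primrec.fst)))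
    (fun y => y.unpair.1) (Primrec.fst.comp Primrec.unpair) N
  exact ⟨fun k x => s (Nat.pair k x) [], hs.comp Primrec₂.natPair (.const _),
    fun k x hk => by
      show s (Nat.pair k x) [] = _
      rw [e _ _ (by simpa using hk)]; simp⟩

/-- A relation that satisfies `FRules` is computed by a primitive recursive function. -/
theorem exists_primrec [Inhabited π] (R : FRules q qC Q) (hq : Primrec q) (hqC : Primrec qC) :
    ∃ G : ℕ → ℕ, Primrec G ∧ ∀ p φ, Q p φ (G (Nat.pair (Encodable.encode p) φ.code)) := by
  obtain ⟨g0, h0, e0⟩ := atom (Q := Q) (mk := .mem) (k := 0) (fun _ _ => rfl) R.mem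
  obtain ⟨g1, h1, e1⟩ := atom (Q := Q) (mk := .memC) (k := 1) (fun _ _ => rfl) R.memC
  obtain ⟨g2, h2, e2⟩ := atom (Q := Q) (mk := .eq) (k := 2) (fun _ _ => rfl) R.eq
  obtain ⟨g3, h3, e3⟩ := atom (Q := Q) (mk := .eqC) (k := 3) (fun _ _ => rfl) R.eqC
  obtain ⟨g4, h4, e4⟩ := nullary (Q := Q) (mk := .fls) R.fls
  obtain ⟨g5, h5, e5⟩ := bin (Q := Q) (mk := .conj) (k := 5) (fun _ _ => rfl) R.conj
  obtain ⟨g6, h6, e6⟩ := bin (Q := Q) (mk := .disj) (k := 6) (fun _ _ => rfl) R.disj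
  obtain ⟨g7, h7, e7⟩ := bin (Q := Q) (mk := .imp) (k := 7) (fun _ _ => rfl) R.imp
  obtain ⟨g8, h8, e8⟩ := un (Q := Q) (mk := .all) (k := 8) (fun _ => rfl) R.all
  obtain ⟨g9, h9, e9⟩ := un (Q := Q) (mk := .ex) (k := 9) (fun _ => rfl) R.ex
  obtain ⟨g10, h10, e10⟩ := un (Q := Q) (mk := .allC) (k := 10) (fun _ => rfl) R.allC
  obtain ⟨g11, h11, e11⟩ := un (Q := Q) (mk := .exC) (k := 11) (fun _ => rfl) R.exC
  have pleft : Primrec fun x : ℕ => x.unpair.1 := Primrec.fst.comp Primrec.unpair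
  have pright : Primrec fun x : ℕ => x.unpair.2 := Primrec.snd.comp Primrec.unpair
  have dec : ∀ {f : π → π}, Primrec f → Primrec fun n : ℕ =>
      Encodable.encode (f ((Encodable.decode n : Option π).getD default)) := fun hf =>
    Primrec.encode.comp (hf.comp (Primrec.option_getD.comp Primrec.decode (.const _)))
  have nth : ∀ i, Primrec₂ fun (_ : ℕ) (l : List ℕ) => l.getD i 0 := fun i =>
    (Primrec.list_getD 0).comp Primrec.snd (.const i)
  obtain ⟨q', hq', eq'⟩ := pick' (fun
    | 0, x => Nat.pair x.unpair.1 x.unpair.2.unpair.2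
    | 1, x => Nat.pair (Encodable.encode (q ((Encodable.decode x.unpair.1 : Option π).getD default)))
        x.unpair.2.unpair.2
    | 2, x => Nat.pair (Encodable.encode (qC ((Encodable.decode x.unpair.1 : Option π).getD default)))
        x.unpair.2.unpair.2
    | 3, x => Nat.pair x.unpair.1 x.unpair.2.unpair.2.unpair.1
    | _, x => Nat.pair x.unpair.1 x.unpair.2.unpair.2.unpair.2) (fun k => by
      rcases k with _ | _ | _ | _ | k
      · exact Primrec₂.natPair.comp pleft (pright.comp pright)
      · exact Primrec₂.natPair.comp ((dec hq).comp pleft) (pright.comp pright)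
      · exact Primrec₂.natPair.comp ((dec hqC).comp pleft) (pright.comp pright)
      · exact Primrec₂.natPair.comp pleft (pleft.comp (pright.comp pright))
      · exact Primrec₂.natPair.comp pleft (pright.comp (pright.comp pright))) 5
  have a : ∀ {g : ℕ → ℕ}, Primrec g → Primrec₂ fun (x : ℕ) (_ : List ℕ) => g (Nat.pair x 0) := fun h =>
    h.comp (Primrec₂.natPair.comp Primrec.fst (.const 0))
  have u : ∀ {g : ℕ → ℕ}, Primrec g → ∀ i, Primrec₂ fun (x : ℕ) (l : List ℕ) => g (Nat.pair x (l.getD i 0)) := fun h i =>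
    h.comp (Primrec₂.natPair.comp Primrec.fst (nth i))
  have b : ∀ {g : ℕ → ℕ}, Primrec g → Primrec₂ fun (x : ℕ) (l : List ℕ) => g (Nat.pair x (Nat.pair (l.getD 3 0) (l.getD 4 0))) :=
    fun h => h.comp (Primrec₂.natPair.comp Primrec.fst (Primrec₂.natPair.comp (nth 3) (nth 4)))
  obtain ⟨s, hs, es⟩ := pick (fun
    | 0, x, _ => g0 (Nat.pair x 0)
    | 1, x, _ => g1 (Nat.pair x 0)
    | 2, x, _ => g2 (Nat.pair x 0)
    | 3, x, _ => g3 (Nat.pair x 0)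
    | 4, x, _ => g4 (Nat.pair x 0)
    | 5, x, l => g5 (Nat.pair x (Nat.pair (l.getD 3 0) (l.getD 4 0)))
    | 6, x, l => g6 (Nat.pair x (Nat.pair (l.getD 3 0) (l.getD 4 0)))
    | 7, x, l => g7 (Nat.pair x (Nat.pair (l.getD 3 0) (l.getD 4 0)))
    | 8, x, l => g8 (Nat.pair x (l.getD 1 0))
    | 9, x, l => g9 (Nat.pair x (l.getD 1 0))
    | 10, x, l => g10 (Nat.pair x (l.getD 2 0))
    | _, x, l => g11 (Nat.pair x (l.getD 2 0))) (fun k => by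
      rcases k with _ | _ | _ | _ | _ | _ | _ | _ | _ | _ | _ | k
      exacts [a h0, a h1, a h2, a h3, a h4, b h5, b h6, b h7, u h8 1, u h9 1, u h10 2, u h11 2])
    (fun x => x.unpair.2.unpair.1) (pleft.comp pright) 12
  have hG := fuelRec_primrec 5 hq' hs
  have key : ∀ n p φ, height φ ≤ n →
      Q p φ (fuelRec 5 q' s n (Nat.pair (Encodable.encode p) φ.code)) := by
    intro n
    induction n with
    | zero => intro p φ h; cases φ <;> simp [height] at h
    | succ n ih =>
      intro p φ hφ
      have hr : List.range 5 = [0, 1, 2, 3, 4] := rfl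
      rw [fuelRec, hr]
      simp only [List.map]
      rw [eq' 0 _ (by omega), eq' 1 _ (by omega), eq' 2 _ (by omega), eq' 3 _ (by omega),
        eq' 4 _ (by omega)]
      cases φ with
      | mem x y => rw [es _ _ (by simp [Fml.code])]; simpa [Fml.code] using e0 p x y
      | memC x y => rw [es _ _ (by simp [Fml.code])]; simpa [Fml.code] using e1 p x y
      | eq x y => rw [es _ _ (by simp [Fml.code])]; simpa [Fml.code] using e2 p x y
      | eqC x y => rw [es _ _ (by simp [Fml.code])]; simpa [Fml.code] using e3 p x y
      | fls => rw [es _ _ (by simp [Fml.code])]; simpa [Fml.code] using e4 p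
      | conj φ ψ =>
        simp only [height] at hφ
        rw [es _ _ (by simp [Fml.code])]
        simpa [Fml.code] using e5 p φ ψ _ _ (ih p φ (by omega)) (ih p ψ (by omega))
      | disj φ ψ =>
        simp only [height] at hφ
        rw [es _ _ (by simp [Fml.code])]
        simpa [Fml.code] using e6 p φ ψ _ _ (ih p φ (by omega)) (ih p ψ (by omega))
      | imp φ ψ =>
        simp only [height] at hφ
        rw [es _ _ (by simp [Fml.code])]
        simpa [Fml.code] using e7 p φ ψ _ _ (ih p φ (by omega)) (ih p ψ (by omega))
      | all φ =>
        simp only [height] at hφ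
        rw [es _ _ (by simp [Fml.code])]
        simpa [Fml.code] using e8 p φ _ (ih (q p) φ (by omega))
      | ex φ =>
        simp only [height] at hφ
        rw [es _ _ (by simp [Fml.code])]
        simpa [Fml.code] using e9 p φ _ (ih (q p) φ (by omega))
      | allC φ =>
        simp only [height] at hφ
        rw [es _ _ (by simp [Fml.code])]
        simpa [Fml.code] using e10 p φ _ (ih (qC p) φ (by omega))
      | exC φ =>
        simp only [height] at hφ
        rw [es _ _ (by simp [Fml.code])]
        simpa [Fml.code] using e11 p φ _ (ih (qC p) φ (by omega))
  refine ⟨fun x => fuelRec 5 q' s (x.unpair.2 + 1) x, hG.comp (Primrec.succ.comp pright) .id,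
    fun p φ => ?_⟩
  simp only [Nat.unpair_pair]
  exact key _ p φ (height_le_code φ)

/-- The family form of `exists_primrec`. -/
theorem family [Inhabited π] (R : FRules q qC Q) (hq : Primrec q) (hqC : Primrec qC) {α : Type}
    (c : α → ℕ) (p : α → π) (φ : PF c) (hp : PR c p) : QF Q c p φ := by
  obtain ⟨G, hG, e⟩ := R.exists_primrec hq hqC
  exact ⟨_, .comp hG (.natPair (.comp Primrec.encode hp) φ.pr), fun a => e _ _⟩

end FRules

/-! ## Renaming families of formulas -/

/-- The renaming `ρ` seen from below `k` more quantifiers. -/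
def upTo (k : ℕ) (ρ : ℕ → ℕ) (n : ℕ) : ℕ := if n < k then n else ρ (n - k) + k

theorem up_upTo (k : ℕ) (ρ : ℕ → ℕ) : up (upTo k ρ) = upTo (k + 1) ρ := by
  funext n
  cases n with
  | zero => simp [upTo]
  | succ n =>
    by_cases h : n < k
    · simp [upTo, h]
    · simp [upTo, h]; omega

theorem upTo_zero (ρ : ℕ → ℕ) : upTo 0 ρ = ρ := by
  funext n; simp [upTo]

theorem rename_rules {π : Type} [Primcodable π] {ρ σ : π → ℕ → ℕ} (hρ : Primrec₂ ρ)
    (hσ : Primrec₂ σ) : FRules (π := π × ℕ × ℕ) (fun p => (p.1, p.2.1 + 1, p.2.2))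
      (fun p => (p.1, p.2.1, p.2.2 + 1))
      (fun p φ n => n = (φ.rename (upTo p.2.1 (ρ p.1)) (upTo p.2.2 (σ p.1))).code) := by
  have val : ∀ {τ : π → ℕ → ℕ}, Primrec₂ τ → ∀ {α : Type} {c : α → ℕ} {r : α → π} {k x : α → ℕ},
      PR c r → PR c k → PR c x → PR c fun a => upTo (k a) (τ (r a)) (x a) := by
    intro τ hτ α c r k x hr hk hx
    have : PR c fun a => cond (decide (x a < k a)) (x a) (τ (r a) (x a - k a) + k a) :=
      .ite (.comp₂ (f := fun m n => decide (m < n)) (Primrec.nat_lt.decide) hx hk) hx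
        (.comp₂ Primrec.nat_add (.comp₂ hτ hr (.comp₂ Primrec.nat_sub hx hk)) hk)
    exact this.of_eq fun a => by by_cases h : x a < k a <;> simp [upTo, h]
  constructor
  · exact fun c p x y hp => ⟨_, .natPair (.const 0) (.natPair (val hρ hp.fst hp.snd.fst x.pr)
      (val hρ hp.fst hp.snd.fst y.pr)), fun a => rfl⟩
  · exact fun c p x y hp => ⟨_, .natPair (.const 1) (.natPair (val hρ hp.fst hp.snd.fst x.pr)
      (val hσ hp.fst hp.snd.snd y.pr)), fun a => rfl⟩
  · exact fun c p x y hp => ⟨_, .natPair (.const 2) (.natPair (val hρ hp.fst hp.snd.fst x.pr)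
      (val hρ hp.fst hp.snd.fst y.pr)), fun a => rfl⟩
  · exact fun c p x y hp => ⟨_, .natPair (.const 3) (.natPair (val hσ hp.fst hp.snd.snd x.pr)
      (val hσ hp.fst hp.snd.snd y.pr)), fun a => rfl⟩
  · exact fun c p hp => ⟨_, .const _, fun a => rfl⟩
  · rintro α c p φ ψ hp ⟨n, hn, e⟩ ⟨m, hm, e'⟩
    exact ⟨_, .natPair (.const 5) (.natPair hn hm), fun a => by rw [e, e']; rfl⟩
  · rintro α c p φ ψ hp ⟨n, hn, e⟩ ⟨m, hm, e'⟩
    exact ⟨_, .natPair (.const 6) (.natPair hn hm), fun a => by rw [e, e']; rfl⟩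
  · rintro α c p φ ψ hp ⟨n, hn, e⟩ ⟨m, hm, e'⟩
    exact ⟨_, .natPair (.const 7) (.natPair hn hm), fun a => by rw [e, e']; rfl⟩
  · rintro α c p φ hp ⟨n, hn, e⟩
    exact ⟨_, .natPair (.const 8) hn, fun a => by rw [e, ← up_upTo]; rfl⟩
  · rintro α c p φ hp ⟨n, hn, e⟩
    exact ⟨_, .natPair (.const 9) hn, fun a => by rw [e, ← up_upTo]; rfl⟩
  · rintro α c p φ hp ⟨n, hn, e⟩
    exact ⟨_, .natPair (.const 10) hn, fun a => by rw [e, ← up_upTo]; rfl⟩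
  · rintro α c p φ hp ⟨n, hn, e⟩
    exact ⟨_, .natPair (.const 11) hn, fun a => by rw [e, ← up_upTo]; rfl⟩

namespace PF
variable {α : Type} {c : α → ℕ}

theorem rename_pr {π : Type} [Primcodable π] [Inhabited π] {ρ σ : π → ℕ → ℕ} (hρ : Primrec₂ ρ)
    (hσ : Primrec₂ σ) (φ : PF c) {r : α → π} (hr : PR c r) :
    PR c fun a => ((φ.f a).rename (ρ (r a)) (σ (r a))).code := by
  obtain ⟨n, hn, e⟩ := (rename_rules hρ hσ).family
    (Primrec.pair Primrec.fst (Primrec.pair (Primrec.succ.comp (Primrec.fst.comp Primrec.snd))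
      (Primrec.snd.comp Primrec.snd)))
    (Primrec.pair Primrec.fst (Primrec.pair (Primrec.fst.comp Primrec.snd)
      (Primrec.succ.comp (Primrec.snd.comp Primrec.snd)))) c (fun a => (r a, 0, 0)) φ
      (hr.mk (.const _))
  refine hn.of_eq fun a => ?_
  rw [e]
  simp only [upTo_zero]

/-- Renaming by fixed primitive recursive functions. -/
def ren (ρ σ : ℕ → ℕ) (hρ : Primrec ρ) (hσ : Primrec σ) (φ : PF c) : PF c :=
  ⟨fun a => (φ.f a).rename ρ σ, rename_pr (π := ℕ) (ρ := fun _ => ρ) (σ := fun _ => σ)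
    (hρ.comp Primrec.snd) (hσ.comp Primrec.snd) φ (.const 0)⟩

def shift (φ : PF c) : PF c :=
  ⟨fun a => (φ.f a).shift, (ren Nat.succ id Primrec.succ .id φ).pr⟩
def shiftC (φ : PF c) : PF c :=
  ⟨fun a => (φ.f a).shiftC, (ren id Nat.succ .id Primrec.succ φ).pr⟩

theorem instRen_primrec : Primrec₂ instRen := by
  have : Primrec₂ fun t n : ℕ => (Nat.casesOn n t fun m => m : ℕ) :=
    Primrec.nat_casesOn Primrec.snd Primrec.fst (Primrec.snd (α := ℕ × ℕ)).to₂
  exact this.of_eq fun t n => by cases n <;> rfl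

def inst (φ : PF c) (t : PN c) : PF c :=
  ⟨fun a => (φ.f a).inst (t.f a), rename_pr instRen_primrec Primrec.snd.to₂ φ t.pr⟩
def instC (φ : PF c) (t : PN c) : PF c :=
  ⟨fun a => (φ.f a).instC (t.f a), rename_pr Primrec.snd.to₂ instRen_primrec φ t.pr⟩
end PF

namespace PL
variable {α : Type} {c : α → ℕ}

def nil : PL c := ⟨fun _ => [], .const _⟩
def cons (φ : PF c) (Γ : PL c) : PL c :=
  ⟨fun a => φ.f a :: Γ.f a, (PR.natPair φ.pr Γ.pr).succ⟩

/-- Codes of lists can be mapped by a primitive recursive function of codes. -/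
theorem map_pr {π : Type} [Primcodable π] {F : π → Fml → Fml}
    (hF : PR (fun x : π × Fml => Nat.pair (Encodable.encode x.1) x.2.code)
      fun x => (F x.1 x.2).code) (Γ : PL c) {p : α → π}
    (hp : PR c p) : PR c fun a => codeList ((Γ.f a).map (F (p a))) := by
  obtain ⟨g₀, hg₀, h₀⟩ := hF
  let g : ℕ → ℕ → ℕ := fun m n => g₀ (Nat.pair m n)
  have hg : Primrec₂ g := hg₀.comp Primrec₂.natPair
  have h : ∀ p φ, (F p φ).code = g (Encodable.encode p) φ.code := fun p φ => h₀ (p, φ)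
  let step : ℕ → List ℕ → ℕ := fun x l => Nat.casesOn x.unpair.2 0 fun m =>
    Nat.pair (g x.unpair.1 m.unpair.1) (l.getD 0 0) + 1
  let q : ℕ → ℕ → ℕ := fun _ x => Nat.pair x.unpair.1 (x.unpair.2 - 1).unpair.2
  have pleft : Primrec fun x : ℕ => x.unpair.1 := Primrec.fst.comp Primrec.unpair
  have pright : Primrec fun x : ℕ => x.unpair.2 := Primrec.snd.comp Primrec.unpair
  have hq : Primrec₂ q := (Primrec₂.natPair.comp pleft (pright.comp
    (Primrec.nat_sub.comp pright (.const 1)))).comp Primrec.snd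
  have hs : Primrec₂ step := Primrec.nat_casesOn (pright.comp Primrec.fst) (.const 0)
    (Primrec.succ.comp (Primrec₂.natPair.comp
      (hg.comp (pleft.comp (Primrec.fst.comp Primrec.fst)) (pleft.comp Primrec.snd))
      ((Primrec.list_getD 0).comp (Primrec.snd.comp Primrec.fst) (.const 0)))).to₂
  have key : ∀ (p : π) (Δ : List Fml) (n : ℕ), Δ.length < n →
      fuelRec 1 q step n (Nat.pair (Encodable.encode p) (codeList Δ)) = codeList (Δ.map (F p)) := by
    intro p Δ
    induction Δ with
    | nil => intro n hn; cases n with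
      | zero => simp at hn
      | succ n => simp [fuelRec, step, codeList]
    | cons φ Δ ih => intro n hn; cases n with
      | zero => simp at hn
      | succ n =>
        have := ih n (by simpa using hn)
        simp [fuelRec, step, codeList, q, h]
        exact this
  have hlen : ∀ Δ : List Fml, Δ.length ≤ codeList Δ := by
    intro Δ
    induction Δ with
    | nil => simp
    | cons φ Δ ih =>
      simp only [codeList, List.length_cons]
      have := Nat.right_le_pair φ.code (codeList Δ)
      omega
  have hpe := PR.natPair (PR.comp Primrec.encode hp) Γ.pr
  refine (PR.comp₂ (fuelRec_primrec 1 hq hs) Γ.pr.succ hpe).of_eq fun a => key _ _ _ ?_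
  have := hlen (Γ.f a)
  omega

/-- The formula of a pair of a parameter and a formula. -/
def sndFml (π : Type) [Primcodable π] :
    PF (fun x : π × Fml => Nat.pair (Encodable.encode x.1) x.2.code) :=
  ⟨fun x => x.2, PR.self.right.of_eq (by simp)⟩

def shift (Γ : PL c) : PL c :=
  ⟨fun a => (Γ.f a).map Fml.shift, map_pr (π := ℕ) (F := fun _ => Fml.shift)
    (sndFml ℕ).shift.pr Γ (.const 0)⟩
def shiftC (Γ : PL c) : PL c :=
  ⟨fun a => (Γ.f a).map Fml.shiftC, map_pr (π := ℕ) (F := fun _ => Fml.shiftC)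
    (sndFml ℕ).shiftC.pr Γ (.const 0)⟩

end PL

end SetClass


set_option linter.unusedSimpArgs false

/-! ## Families of derivations -/

namespace SetClass

open Fml

/-- `n` is the Gödel number of a derivation of `φ` from `Γ`. -/
def IsProof (T : Theory) (Γ : List Fml) (φ : Fml) (n : ℕ) : Prop :=
  ∃ d : Deriv T Γ φ, d.code = n

/-- Numbers related to the sequents `Γ a ⊢ φ a` and the parameters `p a` can be computed. -/
def QD {π : Type} [Primcodable π] (Q : π → List Fml → Fml → ℕ → Prop) {α : Type} (c : α → ℕ)
    (p : α → π) (Γ : PL c) (φ : PF c) : Prop :=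
  ∃ n : α → ℕ, PR c n ∧ ∀ a, Q (p a) (Γ.f a) (φ.f a) (n a)

/-- A family of derivations. -/
def Pv (T : Theory) {α : Type} {c : α → ℕ} (Γ : PL c) (φ : PF c) : Prop :=
  ∃ n : α → ℕ, PR c n ∧ ∀ a, IsProof T (Γ.f a) (φ.f a) (n a)

theorem Deriv.code_fst {T : Theory} {Γ : List Fml} {φ : Fml} (d : Deriv T Γ φ) :
    d.code.unpair.1 = Nat.pair (codeList Γ) φ.code := by
  cases d <;> exact congrArg Prod.fst (Nat.unpair_pair _ _)

namespace Pv
variable {T : Theory} {α : Type} {c : α → ℕ} {Γ : PL c} {φ ψ χ : PF c}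

theorem hyp (h : ∀ a, φ.f a ∈ Γ.f a) : Pv T Γ φ :=
  ⟨_, .natPair (.natPair Γ.pr φ.pr) (.const (Nat.pair 2 0)), fun a => ⟨.hyp (h a), rfl⟩⟩
theorem lem (h : T.classical) : Pv T Γ (φ.disj (φ.imp .fls)) :=
  ⟨_, .natPair (.natPair Γ.pr (φ.disj (φ.imp .fls)).pr) (.const (Nat.pair 1 0)),
    fun _ => ⟨.lem h, rfl⟩⟩
theorem ax (h : ∀ a, φ.f a ∈ T.axioms) : Pv T Γ φ :=
  ⟨_, .natPair (.natPair Γ.pr φ.pr) (.const (Nat.pair 0 0)), fun a => ⟨.ax (h a), rfl⟩⟩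
theorem eqRefl (x : PN c) : Pv T Γ (.eq x x) :=
  ⟨_, .natPair (.natPair Γ.pr (PF.eq x x).pr) (.const (Nat.pair 20 0)), fun a => ⟨.eqRefl _, rfl⟩⟩
theorem eqCRefl (x : PN c) : Pv T Γ (.eqC x x) :=
  ⟨_, .natPair (.natPair Γ.pr (PF.eqC x x).pr) (.const (Nat.pair 22 0)),
    fun a => ⟨.eqCRefl _, rfl⟩⟩

theorem efq (h : Pv T Γ .fls) : Pv T Γ φ := by
  obtain ⟨n, hn, e⟩ := h
  exact ⟨_, .natPair (.natPair Γ.pr φ.pr) (.natPair (.const 3) hn),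
    fun a => (e a).elim fun d hd => ⟨.efq d, hd ▸ rfl⟩⟩

theorem andL (h : Pv T Γ (.conj φ ψ)) : Pv T Γ φ := by
  obtain ⟨n, hn, e⟩ := h
  exact ⟨_, .natPair (.natPair Γ.pr φ.pr) (.natPair (.const 5) hn),
    fun a => (e a).elim fun d hd => ⟨.andL d, hd ▸ rfl⟩⟩

theorem andR (h : Pv T Γ (.conj φ ψ)) : Pv T Γ ψ := by
  obtain ⟨n, hn, e⟩ := h
  exact ⟨_, .natPair (.natPair Γ.pr ψ.pr) (.natPair (.const 6) hn),
    fun a => (e a).elim fun d hd => ⟨.andR d, hd ▸ rfl⟩⟩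

theorem orL (h : Pv T Γ φ) : Pv T Γ (PF.disj φ ψ) := by
  obtain ⟨n, hn, e⟩ := h
  exact ⟨_, .natPair (.natPair Γ.pr (PF.disj φ ψ).pr) (.natPair (.const 7) hn),
    fun a => (e a).elim fun d hd => ⟨.orL d, hd ▸ rfl⟩⟩

theorem orR (h : Pv T Γ ψ) : Pv T Γ (PF.disj φ ψ) := by
  obtain ⟨n, hn, e⟩ := h
  exact ⟨_, .natPair (.natPair Γ.pr (PF.disj φ ψ).pr) (.natPair (.const 8) hn),
    fun a => (e a).elim fun d hd => ⟨.orR d, hd ▸ rfl⟩⟩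

theorem impI (h : Pv T (.cons φ Γ) ψ) : Pv T Γ (PF.imp φ ψ) := by
  obtain ⟨n, hn, e⟩ := h
  exact ⟨_, .natPair (.natPair Γ.pr (PF.imp φ ψ).pr) (.natPair (.const 10) hn),
    fun a => (e a).elim fun d hd => ⟨.impI d, hd ▸ rfl⟩⟩

theorem allI (h : Pv T Γ.shift φ) : Pv T Γ (PF.all φ) := by
  obtain ⟨n, hn, e⟩ := h
  exact ⟨_, .natPair (.natPair Γ.pr (PF.all φ).pr) (.natPair (.const 12) hn),
    fun a => (e a).elim fun d hd => ⟨.allI d, hd ▸ rfl⟩⟩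

theorem allCI (h : Pv T Γ.shiftC φ) : Pv T Γ (PF.allC φ) := by
  obtain ⟨n, hn, e⟩ := h
  exact ⟨_, .natPair (.natPair Γ.pr (PF.allC φ).pr) (.natPair (.const 16) hn),
    fun a => (e a).elim fun d hd => ⟨.allCI d, hd ▸ rfl⟩⟩

theorem allE (t : PN c) (h : Pv T Γ (.all φ)) : Pv T Γ (φ.inst t) := by
  obtain ⟨n, hn, e⟩ := h
  exact ⟨_, .natPair (.natPair Γ.pr (φ.inst t).pr) (.natPair (.const 13) (.natPair t.pr hn)),
    fun a => (e a).elim fun d hd => ⟨.allE _ d, hd ▸ rfl⟩⟩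

theorem exI (t : PN c) (h : Pv T Γ (φ.inst t)) : Pv T Γ φ.ex := by
  obtain ⟨n, hn, e⟩ := h
  exact ⟨_, .natPair (.natPair Γ.pr φ.ex.pr) (.natPair (.const 14) (.natPair t.pr hn)),
    fun a => (e a).elim fun d hd => ⟨.exI _ d, hd ▸ rfl⟩⟩

theorem allCE (t : PN c) (h : Pv T Γ (.allC φ)) : Pv T Γ (φ.instC t) := by
  obtain ⟨n, hn, e⟩ := h
  exact ⟨_, .natPair (.natPair Γ.pr (φ.instC t).pr) (.natPair (.const 17) (.natPair t.pr hn)),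
    fun a => (e a).elim fun d hd => ⟨.allCE _ d, hd ▸ rfl⟩⟩

theorem exCI (t : PN c) (h : Pv T Γ (φ.instC t)) : Pv T Γ φ.exC := by
  obtain ⟨n, hn, e⟩ := h
  exact ⟨_, .natPair (.natPair Γ.pr φ.exC.pr) (.natPair (.const 18) (.natPair t.pr hn)),
    fun a => (e a).elim fun d hd => ⟨.exCI _ d, hd ▸ rfl⟩⟩

theorem andI (h : Pv T Γ φ) (h' : Pv T Γ ψ) : Pv T Γ (PF.conj φ ψ) := by
  obtain ⟨n, hn, e⟩ := h
  obtain ⟨m, hm, e'⟩ := h'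
  exact ⟨_, .natPair (.natPair Γ.pr (PF.conj φ ψ).pr) (.natPair (.const 4) (.natPair hn hm)),
    fun a => (e a).elim fun d hd => (e' a).elim fun d' hd' => ⟨.andI d d', hd ▸ hd' ▸ rfl⟩⟩

theorem impE (h : Pv T Γ (.imp φ ψ)) (h' : Pv T Γ φ) : Pv T Γ ψ := by
  obtain ⟨n, hn, e⟩ := h
  obtain ⟨m, hm, e'⟩ := h'
  exact ⟨_, .natPair (.natPair Γ.pr ψ.pr) (.natPair (.const 11) (.natPair hn hm)),
    fun a => (e a).elim fun d hd => (e' a).elim fun d' hd' => ⟨.impE d d', hd ▸ hd' ▸ rfl⟩⟩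

theorem exE (h : Pv T Γ (.ex φ)) (h' : Pv T (.cons φ Γ.shift) χ.shift) : Pv T Γ χ := by
  obtain ⟨n, hn, e⟩ := h
  obtain ⟨m, hm, e'⟩ := h'
  exact ⟨_, .natPair (.natPair Γ.pr χ.pr) (.natPair (.const 15) (.natPair hn hm)),
    fun a => (e a).elim fun d hd => (e' a).elim fun d' hd' => ⟨.exE d d', hd ▸ hd' ▸ rfl⟩⟩

theorem exCE (h : Pv T Γ (.exC φ)) (h' : Pv T (.cons φ Γ.shiftC) χ.shiftC) : Pv T Γ χ := by
  obtain ⟨n, hn, e⟩ := h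
  obtain ⟨m, hm, e'⟩ := h'
  exact ⟨_, .natPair (.natPair Γ.pr χ.pr) (.natPair (.const 19) (.natPair hn hm)),
    fun a => (e a).elim fun d hd => (e' a).elim fun d' hd' => ⟨.exCE d d', hd ▸ hd' ▸ rfl⟩⟩

theorem eqSubst {x y : PN c} (h : Pv T Γ (.eq x y)) (h' : Pv T Γ (φ.inst x)) : Pv T Γ (φ.inst y) := by
  obtain ⟨n, hn, e⟩ := h
  obtain ⟨m, hm, e'⟩ := h'
  exact ⟨_, .natPair (.natPair Γ.pr (φ.inst y).pr) (.natPair (.const 21) (.natPair φ.pr (.natPair hn hm))),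
    fun a => (e a).elim fun d hd => (e' a).elim fun d' hd' => ⟨.eqSubst _ d d', hd ▸ hd' ▸ rfl⟩⟩

theorem eqCSubst {x y : PN c} (h : Pv T Γ (.eqC x y)) (h' : Pv T Γ (φ.instC x)) : Pv T Γ (φ.instC y) := by
  obtain ⟨n, hn, e⟩ := h
  obtain ⟨m, hm, e'⟩ := h'
  exact ⟨_, .natPair (.natPair Γ.pr (φ.instC y).pr) (.natPair (.const 23) (.natPair φ.pr (.natPair hn hm))),
    fun a => (e a).elim fun d hd => (e' a).elim fun d' hd' => ⟨.eqCSubst _ d d', hd ▸ hd' ▸ rfl⟩⟩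

theorem orE (h : Pv T Γ (.disj φ ψ)) (h' : Pv T (.cons φ Γ) χ) (h'' : Pv T (.cons ψ Γ) χ) :
    Pv T Γ χ := by
  obtain ⟨n, hn, e⟩ := h
  obtain ⟨m, hm, e'⟩ := h'
  obtain ⟨k, hk, e''⟩ := h''
  exact ⟨_, .natPair (.natPair Γ.pr χ.pr) (.natPair (.const 9) (.natPair hn (.natPair hm hk))),
    fun a => (e a).elim fun d hd => (e' a).elim fun d' hd' => (e'' a).elim fun d'' hd'' =>
      ⟨.orE d d' d'', hd ▸ hd' ▸ hd'' ▸ rfl⟩⟩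

theorem toPrv (h : Pv T Γ φ) (a : α) : Prv T (Γ.f a) (φ.f a) := by
  obtain ⟨n, _, e⟩ := h
  exact (e a).elim fun d _ => ⟨d⟩
end Pv

/-! ## Recursion on derivations -/

/-- A relation `Q p Γ φ n` that can be computed by recursion on derivations of `Γ ⊢ φ` in `S`.
Below a set variable condition the parameter `p` becomes `q p`. -/
structure DRules (S : Theory) {π : Type} [Primcodable π] (q : π → π)
    (Q : π → List Fml → Fml → ℕ → Prop) : Prop where
  ax : ∀ {α : Type} (c : α → ℕ) (p : α → π) (Γ : PL c) (φ : PF c), PR c p → (∀ a, φ.f a ∈ S.axioms) →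
    QD Q c p Γ φ
  lem : ∀ {α : Type} (c : α → ℕ) (p : α → π) (Γ : PL c) (φ : PF c), PR c p → S.classical →
    QD Q c p Γ (φ.disj (φ.imp .fls))
  hyp : ∀ {α : Type} (c : α → ℕ) (p : α → π) (Γ : PL c) (φ : PF c), PR c p → (∀ a, φ.f a ∈ Γ.f a) →
    QD Q c p Γ φ
  efq : ∀ {α : Type} (c : α → ℕ) (p : α → π) (Γ : PL c) (φ : PF c), PR c p →
    QD Q c p Γ .fls → QD Q c p Γ φ
  andI : ∀ {α : Type} (c : α → ℕ) (p : α → π) (Γ : PL c) (φ ψ : PF c), PR c p →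
    QD Q c p Γ φ → QD Q c p Γ ψ → QD Q c p Γ (φ.conj ψ)
  andL : ∀ {α : Type} (c : α → ℕ) (p : α → π) (Γ : PL c) (φ ψ : PF c), PR c p →
    QD Q c p Γ (φ.conj ψ) → QD Q c p Γ φ
  andR : ∀ {α : Type} (c : α → ℕ) (p : α → π) (Γ : PL c) (φ ψ : PF c), PR c p →
    QD Q c p Γ (φ.conj ψ) → QD Q c p Γ ψ
  orL : ∀ {α : Type} (c : α → ℕ) (p : α → π) (Γ : PL c) (φ ψ : PF c), PR c p →
    QD Q c p Γ φ → QD Q c p Γ (φ.disj ψ)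
  orR : ∀ {α : Type} (c : α → ℕ) (p : α → π) (Γ : PL c) (φ ψ : PF c), PR c p →
    QD Q c p Γ ψ → QD Q c p Γ (φ.disj ψ)
  orE : ∀ {α : Type} (c : α → ℕ) (p : α → π) (Γ : PL c) (φ ψ χ : PF c), PR c p →
    QD Q c p Γ (φ.disj ψ) → QD Q c p (.cons φ Γ) χ → QD Q c p (.cons ψ Γ) χ → QD Q c p Γ χ
  impI : ∀ {α : Type} (c : α → ℕ) (p : α → π) (Γ : PL c) (φ ψ : PF c), PR c p →
    QD Q c p (.cons φ Γ) ψ → QD Q c p Γ (φ.imp ψ)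
  impE : ∀ {α : Type} (c : α → ℕ) (p : α → π) (Γ : PL c) (φ ψ : PF c), PR c p →
    QD Q c p Γ (φ.imp ψ) → QD Q c p Γ φ → QD Q c p Γ ψ
  allI : ∀ {α : Type} (c : α → ℕ) (p : α → π) (Γ : PL c) (φ : PF c), PR c p →
    QD Q c (fun a => q (p a)) Γ.shift φ → QD Q c p Γ φ.all
  allE : ∀ {α : Type} (c : α → ℕ) (p : α → π) (Γ : PL c) (t : PN c) (φ : PF c), PR c p →
    QD Q c p Γ φ.all → QD Q c p Γ (φ.inst t)
  exI : ∀ {α : Type} (c : α → ℕ) (p : α → π) (Γ : PL c) (t : PN c) (φ : PF c), PR c p →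
    QD Q c p Γ (φ.inst t) → QD Q c p Γ φ.ex
  exE : ∀ {α : Type} (c : α → ℕ) (p : α → π) (Γ : PL c) (φ χ : PF c), PR c p →
    QD Q c p Γ φ.ex → QD Q c (fun a => q (p a)) (.cons φ Γ.shift) χ.shift → QD Q c p Γ χ
  allCI : ∀ {α : Type} (c : α → ℕ) (p : α → π) (Γ : PL c) (φ : PF c), PR c p →
    QD Q c p Γ.shiftC φ → QD Q c p Γ φ.allC
  allCE : ∀ {α : Type} (c : α → ℕ) (p : α → π) (Γ : PL c) (t : PN c) (φ : PF c), PR c p →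
    QD Q c p Γ φ.allC → QD Q c p Γ (φ.instC t)
  exCI : ∀ {α : Type} (c : α → ℕ) (p : α → π) (Γ : PL c) (t : PN c) (φ : PF c), PR c p →
    QD Q c p Γ (φ.instC t) → QD Q c p Γ φ.exC
  exCE : ∀ {α : Type} (c : α → ℕ) (p : α → π) (Γ : PL c) (φ χ : PF c), PR c p →
    QD Q c p Γ φ.exC → QD Q c p (.cons φ Γ.shiftC) χ.shiftC → QD Q c p Γ χ
  eqRefl : ∀ {α : Type} (c : α → ℕ) (p : α → π) (Γ : PL c) (x : PN c), PR c p →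
    QD Q c p Γ (.eq x x)
  eqSubst : ∀ {α : Type} (c : α → ℕ) (p : α → π) (Γ : PL c) (x y : PN c) (φ : PF c), PR c p →
    QD Q c p Γ (.eq x y) → QD Q c p Γ (φ.inst x) → QD Q c p Γ (φ.inst y)
  eqCRefl : ∀ {α : Type} (c : α → ℕ) (p : α → π) (Γ : PL c) (x : PN c), PR c p →
    QD Q c p Γ (.eqC x x)
  eqCSubst : ∀ {α : Type} (c : α → ℕ) (p : α → π) (Γ : PL c) (x y : PN c) (φ : PF c), PR c p →
    QD Q c p Γ (.eqC x y) → QD Q c p Γ (φ.instC x) → QD Q c p Γ (φ.instC y)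

namespace DRules
variable {S : Theory} {π : Type} [Primcodable π] {q : π → π} {Q : π → List Fml → Fml → ℕ → Prop}

theorem natural [Inhabited π] {β : Type} {C : β → ℕ} {P R : π → β → ℕ → Prop}
    (h : ∀ {α : Type} (c : α → ℕ) (p : α → π) (b : α → β) (n : α → ℕ),
      PR c p → (PR c fun a => C (b a)) → PR c n →
      (∀ a, P (p a) (b a) (n a)) → ∃ n' : α → ℕ, PR c n' ∧ ∀ a, R (p a) (b a) (n' a)) :
    ∃ g : ℕ → ℕ, Primrec g ∧ ∀ p b n, P p b n →
      R p b (g (Nat.pair (Nat.pair (Encodable.encode p) (C b)) n)) := by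
  obtain ⟨n', ⟨g, hg, e⟩, H⟩ := h (α := {y : π × β × ℕ // P y.1 y.2.1 y.2.2})
    (fun y => Nat.pair (Nat.pair (Encodable.encode y.1.1) (C y.1.2.1)) y.1.2.2) (fun y => y.1.1)
    (fun y => y.1.2.1) (fun y => y.1.2.2) (FRules.param (PR.self.left.left.of_eq (by simp)))
    (PR.self.left.right.of_eq (by simp)) (PR.self.right.of_eq (by simp)) (fun y => y.2)
  exact ⟨g, hg, fun p b n hP => e ⟨(p, b, n), hP⟩ ▸ H ⟨(p, b, n), hP⟩⟩

attribute [local simp] Deriv.code Deriv.code_fst codeList Fml.code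

set_option maxHeartbeats 2000000 in
/-- A relation that satisfies `DRules` is computed by a primitive recursive function. -/
theorem exists_primrec [Inhabited π] (R : DRules S q Q) (hq : Primrec q) :
    ∃ G : ℕ → ℕ, Primrec G ∧ ∀ p Γ φ (d : Deriv S Γ φ),
      Q p Γ φ (G (Nat.pair (Encodable.encode p) d.code)) := by
  obtain ⟨g0, h0, e0⟩ := natural (β := (x : List Fml × Fml) × (PLift (x.2 ∈ S.axioms)))
    (C := fun b => (Deriv.ax b.2.down : Deriv S b.1.1 b.1.2).code)
    (P := fun p b n => True)
    (R := fun p b n => Q p b.1.1 b.1.2 n) (fun c p b n hp hC hn hP => R.ax c p ⟨fun a => (b a).1.1, hC.left.left.of_eq (by simp)⟩ ⟨fun a => (b a).1.2, hC.left.right.of_eq (by simp)⟩ hp (fun a => (b a).2.down))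
  obtain ⟨g1, h1, e1⟩ := natural (β := (x : List Fml × Fml) × PLift S.classical)
    (C := fun b => (Deriv.lem b.2.down : Deriv S b.1.1 (disj b.1.2 (imp b.1.2 fls))).code)
    (P := fun p b n => True)
    (R := fun p b n => Q p b.1.1 (disj b.1.2 (imp b.1.2 fls)) n) (fun c p b n hp hC hn hP => by
      by_cases hcl : S.classical
      · exact R.lem c p ⟨fun a => (b a).1.1, hC.left.left.of_eq (by simp)⟩ ⟨fun a => (b a).1.2, hC.left.right.right.left.of_eq (by simp)⟩ hp hcl
      · exact ⟨fun _ => 0, .const 0, fun a => absurd (b a).2.down hcl⟩)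
  obtain ⟨g2, h2, e2⟩ := natural (β := (x : List Fml × Fml) × (PLift (x.2 ∈ x.1)))
    (C := fun b => (Deriv.hyp b.2.down : Deriv S b.1.1 b.1.2).code)
    (P := fun p b n => True)
    (R := fun p b n => Q p b.1.1 b.1.2 n) (fun c p b n hp hC hn hP => R.hyp c p ⟨fun a => (b a).1.1, hC.left.left.of_eq (by simp)⟩ ⟨fun a => (b a).1.2, hC.left.right.of_eq (by simp)⟩ hp (fun a => (b a).2.down))
  obtain ⟨g3, h3, e3⟩ := natural (β := (x : List Fml × Fml) × (Deriv S x.1 fls))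
    (C := fun b => (Deriv.efq b.2 : Deriv S b.1.1 b.1.2).code)
    (P := fun p b n => Q p b.1.1 fls n.unpair.1)
    (R := fun p b n => Q p b.1.1 b.1.2 n) (fun c p b n hp hC hn hP => R.efq c p ⟨fun a => (b a).1.1, hC.left.left.of_eq (by simp)⟩ ⟨fun a => (b a).1.2, hC.left.right.of_eq (by simp)⟩ hp
        ⟨_, hn.left, fun a => hP a⟩)
  obtain ⟨g4, h4, e4⟩ := natural (β := (x : List Fml × Fml × Fml) × (Deriv S x.1 x.2.1 × Deriv S x.1 x.2.2))
    (C := fun b => (Deriv.andI b.2.1 b.2.2 : Deriv S b.1.1 (conj b.1.2.1 b.1.2.2)).code)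
    (P := fun p b n => Q p b.1.1 b.1.2.1 n.unpair.1 ∧ Q p b.1.1 b.1.2.2 n.unpair.2.unpair.1)
    (R := fun p b n => Q p b.1.1 (conj b.1.2.1 b.1.2.2) n) (fun c p b n hp hC hn hP => R.andI c p ⟨fun a => (b a).1.1, hC.left.left.of_eq (by simp)⟩ ⟨fun a => (b a).1.2.1, hC.left.right.right.left.of_eq (by simp)⟩ ⟨fun a => (b a).1.2.2, hC.left.right.right.right.of_eq (by simp)⟩ hp
        ⟨_, hn.left, fun a => (hP a).1⟩
        ⟨_, hn.right.left, fun a => (hP a).2⟩)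
  obtain ⟨g5, h5, e5⟩ := natural (β := (x : List Fml × Fml × Fml) × (Deriv S x.1 (conj x.2.1 x.2.2)))
    (C := fun b => (Deriv.andL b.2 : Deriv S b.1.1 b.1.2.1).code)
    (P := fun p b n => Q p b.1.1 (conj b.1.2.1 b.1.2.2) n.unpair.1)
    (R := fun p b n => Q p b.1.1 b.1.2.1 n) (fun c p b n hp hC hn hP => R.andL c p ⟨fun a => (b a).1.1, hC.left.left.of_eq (by simp)⟩ ⟨fun a => (b a).1.2.1, hC.left.right.of_eq (by simp)⟩ ⟨fun a => (b a).1.2.2, hC.right.right.left.right.right.right.of_eq (by simp)⟩ hp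
        ⟨_, hn.left, fun a => hP a⟩)
  obtain ⟨g6, h6, e6⟩ := natural (β := (x : List Fml × Fml × Fml) × (Deriv S x.1 (conj x.2.1 x.2.2)))
    (C := fun b => (Deriv.andR b.2 : Deriv S b.1.1 b.1.2.2).code)
    (P := fun p b n => Q p b.1.1 (conj b.1.2.1 b.1.2.2) n.unpair.1)
    (R := fun p b n => Q p b.1.1 b.1.2.2 n) (fun c p b n hp hC hn hP => R.andR c p ⟨fun a => (b a).1.1, hC.left.left.of_eq (by simp)⟩ ⟨fun a => (b a).1.2.1, hC.right.right.left.right.right.left.of_eq (by simp)⟩ ⟨fun a => (b a).1.2.2, hC.left.right.of_eq (by simp)⟩ hp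
        ⟨_, hn.left, fun a => hP a⟩)
  obtain ⟨g7, h7, e7⟩ := natural (β := (x : List Fml × Fml × Fml) × (Deriv S x.1 x.2.1))
    (C := fun b => (Deriv.orL b.2 : Deriv S b.1.1 (disj b.1.2.1 b.1.2.2)).code)
    (P := fun p b n => Q p b.1.1 b.1.2.1 n.unpair.1)
    (R := fun p b n => Q p b.1.1 (disj b.1.2.1 b.1.2.2) n) (fun c p b n hp hC hn hP => R.orL c p ⟨fun a => (b a).1.1, hC.left.left.of_eq (by simp)⟩ ⟨fun a => (b a).1.2.1, hC.left.right.right.left.of_eq (by simp)⟩ ⟨fun a => (b a).1.2.2, hC.left.right.right.right.of_eq (by simp)⟩ hp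
        ⟨_, hn.left, fun a => hP a⟩)
  obtain ⟨g8, h8, e8⟩ := natural (β := (x : List Fml × Fml × Fml) × (Deriv S x.1 x.2.2))
    (C := fun b => (Deriv.orR b.2 : Deriv S b.1.1 (disj b.1.2.1 b.1.2.2)).code)
    (P := fun p b n => Q p b.1.1 b.1.2.2 n.unpair.1)
    (R := fun p b n => Q p b.1.1 (disj b.1.2.1 b.1.2.2) n) (fun c p b n hp hC hn hP => R.orR c p ⟨fun a => (b a).1.1, hC.left.left.of_eq (by simp)⟩ ⟨fun a => (b a).1.2.1, hC.left.right.right.left.of_eq (by simp)⟩ ⟨fun a => (b a).1.2.2, hC.left.right.right.right.of_eq (by simp)⟩ hp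
        ⟨_, hn.left, fun a => hP a⟩)
  obtain ⟨g9, h9, e9⟩ := natural (β := (x : List Fml × Fml × Fml × Fml) × (Deriv S x.1 (disj x.2.1 x.2.2.1) × Deriv S (x.2.1 :: x.1) x.2.2.2 × Deriv S (x.2.2.1 :: x.1) x.2.2.2))
    (C := fun b => (Deriv.orE b.2.1 b.2.2.1 b.2.2.2 : Deriv S b.1.1 b.1.2.2.2).code)
    (P := fun p b n => Q p b.1.1 (disj b.1.2.1 b.1.2.2.1) n.unpair.1 ∧ Q p (b.1.2.1 :: b.1.1) b.1.2.2.2 n.unpair.2.unpair.1 ∧ Q p (b.1.2.2.1 :: b.1.1) b.1.2.2.2 n.unpair.2.unpair.2)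
    (R := fun p b n => Q p b.1.1 b.1.2.2.2 n) (fun c p b n hp hC hn hP => R.orE c p ⟨fun a => (b a).1.1, hC.left.left.of_eq (by simp)⟩ ⟨fun a => (b a).1.2.1, hC.right.right.left.left.right.right.left.of_eq (by simp)⟩ ⟨fun a => (b a).1.2.2.1, hC.right.right.left.left.right.right.right.of_eq (by simp)⟩ ⟨fun a => (b a).1.2.2.2, hC.left.right.of_eq (by simp)⟩ hp
        ⟨_, hn.left, fun a => (hP a).1⟩
        ⟨_, hn.right.left, fun a => (hP a).2.1⟩
        ⟨_, hn.right.right, fun a => (hP a).2.2⟩)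
  obtain ⟨g10, h10, e10⟩ := natural (β := (x : List Fml × Fml × Fml) × (Deriv S (x.2.1 :: x.1) x.2.2))
    (C := fun b => (Deriv.impI b.2 : Deriv S b.1.1 (imp b.1.2.1 b.1.2.2)).code)
    (P := fun p b n => Q p (b.1.2.1 :: b.1.1) b.1.2.2 n.unpair.1)
    (R := fun p b n => Q p b.1.1 (imp b.1.2.1 b.1.2.2) n) (fun c p b n hp hC hn hP => R.impI c p ⟨fun a => (b a).1.1, hC.left.left.of_eq (by simp)⟩ ⟨fun a => (b a).1.2.1, hC.left.right.right.left.of_eq (by simp)⟩ ⟨fun a => (b a).1.2.2, hC.left.right.right.right.of_eq (by simp)⟩ hp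
        ⟨_, hn.left, fun a => hP a⟩)
  obtain ⟨g11, h11, e11⟩ := natural (β := (x : List Fml × Fml × Fml) × (Deriv S x.1 (imp x.2.1 x.2.2) × Deriv S x.1 x.2.1))
    (C := fun b => (Deriv.impE b.2.1 b.2.2 : Deriv S b.1.1 b.1.2.2).code)
    (P := fun p b n => Q p b.1.1 (imp b.1.2.1 b.1.2.2) n.unpair.1 ∧ Q p b.1.1 b.1.2.1 n.unpair.2.unpair.1)
    (R := fun p b n => Q p b.1.1 b.1.2.2 n) (fun c p b n hp hC hn hP => R.impE c p ⟨fun a => (b a).1.1, hC.left.left.of_eq (by simp)⟩ ⟨fun a => (b a).1.2.1, hC.right.right.right.left.right.of_eq (by simp)⟩ ⟨fun a => (b a).1.2.2, hC.left.right.of_eq (by simp)⟩ hp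
        ⟨_, hn.left, fun a => (hP a).1⟩
        ⟨_, hn.right.left, fun a => (hP a).2⟩)
  obtain ⟨g12, h12, e12⟩ := natural (β := (x : List Fml × Fml) × (Deriv S (x.1.map shift) x.2))
    (C := fun b => (Deriv.allI b.2 : Deriv S b.1.1 (all b.1.2)).code)
    (P := fun p b n => Q (q p) (b.1.1.map shift) b.1.2 n.unpair.1)
    (R := fun p b n => Q p b.1.1 (all b.1.2) n) (fun c p b n hp hC hn hP => R.allI c p ⟨fun a => (b a).1.1, hC.left.left.of_eq (by simp)⟩ ⟨fun a => (b a).1.2, hC.left.right.right.of_eq (by simp)⟩ hp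
        ⟨_, hn.left, fun a => hP a⟩)
  obtain ⟨g13, h13, e13⟩ := natural (β := (x : List Fml × ℕ × Fml) × (Deriv S x.1 (all x.2.2)))
    (C := fun b => (Deriv.allE (φ := b.1.2.2) b.1.2.1 b.2 : Deriv S b.1.1 (inst b.1.2.2 b.1.2.1)).code)
    (P := fun p b n => Q p b.1.1 (all b.1.2.2) n.unpair.1)
    (R := fun p b n => Q p b.1.1 (inst b.1.2.2 b.1.2.1) n) (fun c p b n hp hC hn hP => R.allE c p ⟨fun a => (b a).1.1, hC.left.left.of_eq (by simp)⟩ ⟨fun a => (b a).1.2.1, hC.right.right.left.of_eq (by simp)⟩ ⟨fun a => (b a).1.2.2, hC.right.right.right.left.right.right.of_eq (by simp)⟩ hp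
        ⟨_, hn.left, fun a => hP a⟩)
  obtain ⟨g14, h14, e14⟩ := natural (β := (x : List Fml × ℕ × Fml) × (Deriv S x.1 (inst x.2.2 x.2.1)))
    (C := fun b => (Deriv.exI (φ := b.1.2.2) b.1.2.1 b.2 : Deriv S b.1.1 (ex b.1.2.2)).code)
    (P := fun p b n => Q p b.1.1 (inst b.1.2.2 b.1.2.1) n.unpair.1)
    (R := fun p b n => Q p b.1.1 (ex b.1.2.2) n) (fun c p b n hp hC hn hP => R.exI c p ⟨fun a => (b a).1.1, hC.left.left.of_eq (by simp)⟩ ⟨fun a => (b a).1.2.1, hC.right.right.left.of_eq (by simp)⟩ ⟨fun a => (b a).1.2.2, hC.left.right.right.of_eq (by simp)⟩ hp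
        ⟨_, hn.left, fun a => hP a⟩)
  obtain ⟨g15, h15, e15⟩ := natural (β := (x : List Fml × Fml × Fml) × (Deriv S x.1 (ex x.2.1) × Deriv S (x.2.1 :: x.1.map shift) (shift x.2.2)))
    (C := fun b => (Deriv.exE (χ := b.1.2.2) b.2.1 b.2.2 : Deriv S b.1.1 b.1.2.2).code)
    (P := fun p b n => Q p b.1.1 (ex b.1.2.1) n.unpair.1 ∧ Q (q p) (b.1.2.1 :: b.1.1.map shift) (shift b.1.2.2) n.unpair.2.unpair.1)
    (R := fun p b n => Q p b.1.1 b.1.2.2 n) (fun c p b n hp hC hn hP => R.exE c p ⟨fun a => (b a).1.1, hC.left.left.of_eq (by simp)⟩ ⟨fun a => (b a).1.2.1, hC.right.right.left.left.right.right.of_eq (by simp)⟩ ⟨fun a => (b a).1.2.2, hC.left.right.of_eq (by simp)⟩ hp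
        ⟨_, hn.left, fun a => (hP a).1⟩
        ⟨_, hn.right.left, fun a => (hP a).2⟩)
  obtain ⟨g16, h16, e16⟩ := natural (β := (x : List Fml × Fml) × (Deriv S (x.1.map shiftC) x.2))
    (C := fun b => (Deriv.allCI b.2 : Deriv S b.1.1 (allC b.1.2)).code)
    (P := fun p b n => Q p (b.1.1.map shiftC) b.1.2 n.unpair.1)
    (R := fun p b n => Q p b.1.1 (allC b.1.2) n) (fun c p b n hp hC hn hP => R.allCI c p ⟨fun a => (b a).1.1, hC.left.left.of_eq (by simp)⟩ ⟨fun a => (b a).1.2, hC.left.right.right.of_eq (by simp)⟩ hp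
        ⟨_, hn.left, fun a => hP a⟩)
  obtain ⟨g17, h17, e17⟩ := natural (β := (x : List Fml × ℕ × Fml) × (Deriv S x.1 (allC x.2.2)))
    (C := fun b => (Deriv.allCE (φ := b.1.2.2) b.1.2.1 b.2 : Deriv S b.1.1 (instC b.1.2.2 b.1.2.1)).code)
    (P := fun p b n => Q p b.1.1 (allC b.1.2.2) n.unpair.1)
    (R := fun p b n => Q p b.1.1 (instC b.1.2.2 b.1.2.1) n) (fun c p b n hp hC hn hP => R.allCE c p ⟨fun a => (b a).1.1, hC.left.left.of_eq (by simp)⟩ ⟨fun a => (b a).1.2.1, hC.right.right.left.of_eq (by simp)⟩ ⟨fun a => (b a).1.2.2, hC.right.right.right.left.right.right.of_eq (by simp)⟩ hp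
        ⟨_, hn.left, fun a => hP a⟩)
  obtain ⟨g18, h18, e18⟩ := natural (β := (x : List Fml × ℕ × Fml) × (Deriv S x.1 (instC x.2.2 x.2.1)))
    (C := fun b => (Deriv.exCI (φ := b.1.2.2) b.1.2.1 b.2 : Deriv S b.1.1 (exC b.1.2.2)).code)
    (P := fun p b n => Q p b.1.1 (instC b.1.2.2 b.1.2.1) n.unpair.1)
    (R := fun p b n => Q p b.1.1 (exC b.1.2.2) n) (fun c p b n hp hC hn hP => R.exCI c p ⟨fun a => (b a).1.1, hC.left.left.of_eq (by simp)⟩ ⟨fun a => (b a).1.2.1, hC.right.right.left.of_eq (by simp)⟩ ⟨fun a => (b a).1.2.2, hC.left.right.right.of_eq (by simp)⟩ hp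
        ⟨_, hn.left, fun a => hP a⟩)
  obtain ⟨g19, h19, e19⟩ := natural (β := (x : List Fml × Fml × Fml) × (Deriv S x.1 (exC x.2.1) × Deriv S (x.2.1 :: x.1.map shiftC) (shiftC x.2.2)))
    (C := fun b => (Deriv.exCE (χ := b.1.2.2) b.2.1 b.2.2 : Deriv S b.1.1 b.1.2.2).code)
    (P := fun p b n => Q p b.1.1 (exC b.1.2.1) n.unpair.1 ∧ Q p (b.1.2.1 :: b.1.1.map shiftC) (shiftC b.1.2.2) n.unpair.2.unpair.1)
    (R := fun p b n => Q p b.1.1 b.1.2.2 n) (fun c p b n hp hC hn hP => R.exCE c p ⟨fun a => (b a).1.1, hC.left.left.of_eq (by simp)⟩ ⟨fun a => (b a).1.2.1, hC.right.right.left.left.right.right.of_eq (by simp)⟩ ⟨fun a => (b a).1.2.2, hC.left.right.of_eq (by simp)⟩ hp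
        ⟨_, hn.left, fun a => (hP a).1⟩
        ⟨_, hn.right.left, fun a => (hP a).2⟩)
  obtain ⟨g20, h20, e20⟩ := natural (β := (x : List Fml × ℕ) × (Unit))
    (C := fun b => (Deriv.eqRefl b.1.2 : Deriv S b.1.1 (eq b.1.2 b.1.2)).code)
    (P := fun p b n => True)
    (R := fun p b n => Q p b.1.1 (eq b.1.2 b.1.2) n) (fun c p b n hp hC hn hP => R.eqRefl c p ⟨fun a => (b a).1.1, hC.left.left.of_eq (by simp)⟩ ⟨fun a => (b a).1.2, hC.left.right.right.left.of_eq (by simp)⟩ hp)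
  obtain ⟨g21, h21, e21⟩ := natural (β := (x : List Fml × ℕ × ℕ × Fml) × (Deriv S x.1 (eq x.2.1 x.2.2.1) × Deriv S x.1 (inst x.2.2.2 x.2.1)))
    (C := fun b => (Deriv.eqSubst b.1.2.2.2 b.2.1 b.2.2 : Deriv S b.1.1 (inst b.1.2.2.2 b.1.2.2.1)).code)
    (P := fun p b n => Q p b.1.1 (eq b.1.2.1 b.1.2.2.1) n.unpair.1 ∧ Q p b.1.1 (inst b.1.2.2.2 b.1.2.1) n.unpair.2.unpair.1)
    (R := fun p b n => Q p b.1.1 (inst b.1.2.2.2 b.1.2.2.1) n) (fun c p b n hp hC hn hP => R.eqSubst c p ⟨fun a => (b a).1.1, hC.left.left.of_eq (by simp)⟩ ⟨fun a => (b a).1.2.1, hC.right.right.right.left.left.right.right.left.of_eq (by simp)⟩ ⟨fun a => (b a).1.2.2.1, hC.right.right.right.left.left.right.right.right.of_eq (by simp)⟩ ⟨fun a => (b a).1.2.2.2, hC.right.right.left.of_eq (by simp)⟩ hp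
        ⟨_, hn.left, fun a => (hP a).1⟩
        ⟨_, hn.right.left, fun a => (hP a).2⟩)
  obtain ⟨g22, h22, e22⟩ := natural (β := (x : List Fml × ℕ) × (Unit))
    (C := fun b => (Deriv.eqCRefl b.1.2 : Deriv S b.1.1 (eqC b.1.2 b.1.2)).code)
    (P := fun p b n => True)
    (R := fun p b n => Q p b.1.1 (eqC b.1.2 b.1.2) n) (fun c p b n hp hC hn hP => R.eqCRefl c p ⟨fun a => (b a).1.1, hC.left.left.of_eq (by simp)⟩ ⟨fun a => (b a).1.2, hC.left.right.right.left.of_eq (by simp)⟩ hp)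
  obtain ⟨g23, h23, e23⟩ := natural (β := (x : List Fml × ℕ × ℕ × Fml) × (Deriv S x.1 (eqC x.2.1 x.2.2.1) × Deriv S x.1 (instC x.2.2.2 x.2.1)))
    (C := fun b => (Deriv.eqCSubst b.1.2.2.2 b.2.1 b.2.2 : Deriv S b.1.1 (instC b.1.2.2.2 b.1.2.2.1)).code)
    (P := fun p b n => Q p b.1.1 (eqC b.1.2.1 b.1.2.2.1) n.unpair.1 ∧ Q p b.1.1 (instC b.1.2.2.2 b.1.2.1) n.unpair.2.unpair.1)
    (R := fun p b n => Q p b.1.1 (instC b.1.2.2.2 b.1.2.2.1) n) (fun c p b n hp hC hn hP => R.eqCSubst c p ⟨fun a => (b a).1.1, hC.left.left.of_eq (by simp)⟩ ⟨fun a => (b a).1.2.1, hC.right.right.right.left.left.right.right.left.of_eq (by simp)⟩ ⟨fun a => (b a).1.2.2.1, hC.right.right.right.left.left.right.right.right.of_eq (by simp)⟩ ⟨fun a => (b a).1.2.2.2, hC.right.right.left.of_eq (by simp)⟩ hp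
        ⟨_, hn.left, fun a => (hP a).1⟩
        ⟨_, hn.right.left, fun a => (hP a).2⟩)
  have pleft : Primrec fun x : ℕ => x.unpair.1 := Primrec.fst.comp Primrec.unpair
  have pright : Primrec fun x : ℕ => x.unpair.2 := Primrec.snd.comp Primrec.unpair
  have dec : Primrec fun n : ℕ =>
      Encodable.encode (q ((Encodable.decode n : Option π).getD default)) :=
    Primrec.encode.comp (hq.comp (Primrec.option_getD.comp Primrec.decode (.const _)))
  have nth : ∀ i, Primrec₂ fun (_ : ℕ) (l : List ℕ) => l.getD i 0 := fun i =>
    (Primrec.list_getD 0).comp Primrec.snd (.const i)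
  obtain ⟨q', hq', eq'⟩ := FRules.pick' (fun
    | 0, x => Nat.pair x.unpair.1 x.unpair.2.unpair.2.unpair.2
    | 1, x => Nat.pair (Encodable.encode (q ((Encodable.decode x.unpair.1 : Option π).getD default)))
        x.unpair.2.unpair.2.unpair.2
    | 2, x => Nat.pair x.unpair.1 x.unpair.2.unpair.2.unpair.2.unpair.1
    | 3, x => Nat.pair x.unpair.1 x.unpair.2.unpair.2.unpair.2.unpair.2
    | 4, x => Nat.pair (Encodable.encode (q ((Encodable.decode x.unpair.1 : Option π).getD default)))
        x.unpair.2.unpair.2.unpair.2.unpair.2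
    | 5, x => Nat.pair x.unpair.1 x.unpair.2.unpair.2.unpair.2.unpair.2.unpair.1
    | _, x => Nat.pair x.unpair.1 x.unpair.2.unpair.2.unpair.2.unpair.2.unpair.2) (fun k => by
      have pl := pright.comp (pright.comp pright)
      rcases k with _ | _ | _ | _ | _ | _ | k
      · exact Primrec₂.natPair.comp pleft pl
      · exact Primrec₂.natPair.comp (dec.comp pleft) pl
      · exact Primrec₂.natPair.comp pleft (pleft.comp pl)
      · exact Primrec₂.natPair.comp pleft (pright.comp pl)
      · exact Primrec₂.natPair.comp (dec.comp pleft) (pright.comp pl)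
      · exact Primrec₂.natPair.comp pleft (pleft.comp (pright.comp pl))
      · exact Primrec₂.natPair.comp pleft (pright.comp (pright.comp pl))) 7
  let rules : List ((ℕ → ℕ) × ℕ × ℕ × ℕ) :=
    [(g0, 0, 0, 0), (g1, 0, 0, 0), (g2, 0, 0, 0), (g3, 0, 0, 0), (g4, 2, 3, 0), (g5, 0, 0, 0),
      (g6, 0, 0, 0), (g7, 0, 0, 0), (g8, 0, 0, 0), (g9, 2, 5, 6), (g10, 0, 0, 0), (g11, 2, 3, 0),
      (g12, 1, 0, 0), (g13, 3, 0, 0), (g14, 3, 0, 0), (g15, 2, 4, 0), (g16, 0, 0, 0),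
      (g17, 3, 0, 0), (g18, 3, 0, 0), (g19, 2, 3, 0), (g20, 0, 0, 0), (g21, 5, 6, 0),
      (g22, 0, 0, 0), (g23, 5, 6, 0)]
  let rule : ℕ → (ℕ → ℕ) × ℕ × ℕ × ℕ := fun k => rules.getD k (g0, 0, 0, 0)
  let h : ℕ → ℕ → List ℕ → ℕ := fun k x l => (rule k).1 (Nat.pair x (Nat.pair (l.getD (rule k).2.1 0)
    (Nat.pair (l.getD (rule k).2.2.1 0) (l.getD (rule k).2.2.2 0))))
  have hg : ∀ k, Primrec (rule k).1 := fun k => by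
    have H : ∀ r ∈ rules, Primrec r.1 := by simp only [rules, List.forall_mem_cons, h0, h1, h2, h3, h4, h5, h6, h7, h8, h9, h10, h11, h12, h13, h14, h15, h16, h17, h18, h19, h20, h21, h22, h23, true_and]; simp
    simp only [rule]
    rcases lt_or_ge k rules.length with hk | hk
    · rw [List.getD_eq_getElem _ _ hk]; exact H _ (List.getElem_mem hk)
    · rw [List.getD_eq_default _ _ hk]; exact h0
  obtain ⟨s, hs, es⟩ := FRules.pick h (fun k => (hg k).comp (Primrec₂.natPair.comp Primrec.fst (Primrec₂.natPair.comp (nth _)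
      (Primrec₂.natPair.comp (nth _) (nth _))))) (fun x => x.unpair.2.unpair.2.unpair.1) (pleft.comp (pright.comp pright)) 24
  have hs' : ∀ {X m : ℕ} {l} (k : ℕ), m.unpair.2.unpair.1 = k → k < 24 → s (Nat.pair X m) l = h k (Nat.pair X m) l := fun k e hk => by
    rw [es _ _ (by simpa [e] using hk)]; simp [e]
  have lt : ∀ {i P m}, i < 7 → 0 < m.unpair.2.unpair.1 → (q' i (Nat.pair P m)).unpair.2 < m := fun {i P m} hi hm => by
    have h₁ : m.unpair.2.unpair.2 < m.unpair.2 := by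
      conv_rhs => rw [← Nat.pair_unpair m.unpair.2]
      exact FRules.lt_pair hm le_rfl
    have h₂ := Nat.unpair_right_le m
    have h₃ := Nat.unpair_left_le m.unpair.2.unpair.2
    have h₄ := Nat.unpair_right_le m.unpair.2.unpair.2
    have h₅ := Nat.unpair_left_le m.unpair.2.unpair.2.unpair.2
    have h₆ := Nat.unpair_right_le m.unpair.2.unpair.2.unpair.2
    rw [eq' _ _ hi]
    interval_cases i <;> simp only [Nat.unpair_pair] <;> omega
  have key : ∀ n p Γ φ (d : Deriv S Γ φ), d.code < n →
      Q p Γ φ (fuelRec 7 q' s n (Nat.pair (Encodable.encode p) d.code)) := by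
    intro n
    induction n with
    | zero => intro p Γ φ d h; omega
    | succ n ih =>
      intro p Γ φ d hd
      have r : ∀ {p' Γ' φ' m N} (i : ℕ) (d' : Deriv S Γ' φ'), m < n + 1 → i < 7 ∧ 0 < m.unpair.2.unpair.1 ∧
          q' i (Nat.pair (Encodable.encode p) m) = Nat.pair (Encodable.encode p') d'.code ∧
          N = fuelRec 7 q' s n (q' i (Nat.pair (Encodable.encode p) m)) → Q p' Γ' φ' N := fun {p' Γ' φ' m N} i d' hm ⟨hi, ht, e, eN⟩ => by
        have := lt (P := Encodable.encode p) hi ht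
        rw [e, Nat.unpair_pair] at this
        rw [eN, e]
        exact ih _ _ _ d' (by omega)
      have hr : List.range 7 = [0, 1, 2, 3, 4, 5, 6] := rfl
      rw [fuelRec, hr]
      simp only [List.map]
      cases d with
      | ax h =>
        rw [hs' 0 (by simp) (by decide)]
        exact e0 p ⟨(Γ, _), ⟨h⟩⟩ _ trivial
      | lem h =>
        rw [hs' 1 (by simp) (by decide)]
        exact e1 p ⟨(Γ, _), ⟨h⟩⟩ _ trivial
      | hyp h =>
        rw [hs' 2 (by simp) (by decide)]
        exact e2 p ⟨(Γ, _), ⟨h⟩⟩ _ trivial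
      | efq d =>
        rw [hs' 3 (by simp) (by decide)]
        exact e3 p ⟨(Γ, _), d⟩ _ (r 0 d hd (by simp [eq', rule, rules]))
      | andI d e =>
        rw [hs' 4 (by simp) (by decide)]
        exact e4 p ⟨(Γ, _, _), d, e⟩ _ ⟨r 2 d hd (by simp [eq', rule, rules]), r 3 e hd (by simp [eq', rule, rules])⟩
      | andL d =>
        rw [hs' 5 (by simp) (by decide)]
        exact e5 p ⟨(Γ, _, _), d⟩ _ (r 0 d hd (by simp [eq', rule, rules]))
      | andR d =>
        rw [hs' 6 (by simp) (by decide)]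
        exact e6 p ⟨(Γ, _, _), d⟩ _ (r 0 d hd (by simp [eq', rule, rules]))
      | orL d =>
        rw [hs' 7 (by simp) (by decide)]
        exact e7 p ⟨(Γ, _, _), d⟩ _ (r 0 d hd (by simp [eq', rule, rules]))
      | orR d =>
        rw [hs' 8 (by simp) (by decide)]
        exact e8 p ⟨(Γ, _, _), d⟩ _ (r 0 d hd (by simp [eq', rule, rules]))
      | orE d e f =>
        rw [hs' 9 (by simp) (by decide)]
        exact e9 p ⟨(Γ, _, _, _), d, e, f⟩ _ ⟨r 2 d hd (by simp [eq', rule, rules]), r 5 e hd (by simp [eq', rule, rules]), r 6 f hd (by simp [eq', rule, rules])⟩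
      | impI d =>
        rw [hs' 10 (by simp) (by decide)]
        exact e10 p ⟨(Γ, _, _), d⟩ _ (r 0 d hd (by simp [eq', rule, rules]))
      | impE d e =>
        rw [hs' 11 (by simp) (by decide)]
        exact e11 p ⟨(Γ, _, _), d, e⟩ _ ⟨r 2 d hd (by simp [eq', rule, rules]), r 3 e hd (by simp [eq', rule, rules])⟩
      | allI d =>
        rw [hs' 12 (by simp) (by decide)]
        exact e12 p ⟨(Γ, _), d⟩ _ (r 1 d hd (by simp [eq', rule, rules]))
      | allE t d =>
        rw [hs' 13 (by simp) (by decide)]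
        exact e13 p ⟨(Γ, t, _), d⟩ _ (r 3 d hd (by simp [eq', rule, rules]))
      | exI t d =>
        rw [hs' 14 (by simp) (by decide)]
        exact e14 p ⟨(Γ, t, _), d⟩ _ (r 3 d hd (by simp [eq', rule, rules]))
      | exE d e =>
        rw [hs' 15 (by simp) (by decide)]
        exact e15 p ⟨(Γ, _, _), d, e⟩ _ ⟨r 2 d hd (by simp [eq', rule, rules]), r 4 e hd (by simp [eq', rule, rules])⟩
      | allCI d =>
        rw [hs' 16 (by simp) (by decide)]
        exact e16 p ⟨(Γ, _), d⟩ _ (r 0 d hd (by simp [eq', rule, rules]))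
      | allCE t d =>
        rw [hs' 17 (by simp) (by decide)]
        exact e17 p ⟨(Γ, t, _), d⟩ _ (r 3 d hd (by simp [eq', rule, rules]))
      | exCI t d =>
        rw [hs' 18 (by simp) (by decide)]
        exact e18 p ⟨(Γ, t, _), d⟩ _ (r 3 d hd (by simp [eq', rule, rules]))
      | exCE d e =>
        rw [hs' 19 (by simp) (by decide)]
        exact e19 p ⟨(Γ, _, _), d, e⟩ _ ⟨r 2 d hd (by simp [eq', rule, rules]), r 3 e hd (by simp [eq', rule, rules])⟩
      | eqRefl x =>
        rw [hs' 20 (by simp) (by decide)]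
        exact e20 p ⟨(Γ, x), ()⟩ _ trivial
      | eqSubst ψ d e =>
        rw [hs' 21 (by simp) (by decide)]
        exact e21 p ⟨(Γ, _, _, ψ), d, e⟩ _ ⟨r 5 d hd (by simp [eq', rule, rules]), r 6 e hd (by simp [eq', rule, rules])⟩
      | eqCRefl x =>
        rw [hs' 22 (by simp) (by decide)]
        exact e22 p ⟨(Γ, x), ()⟩ _ trivial
      | eqCSubst ψ d e =>
        rw [hs' 23 (by simp) (by decide)]
        exact e23 p ⟨(Γ, _, _, ψ), d, e⟩ _ ⟨r 5 d hd (by simp [eq', rule, rules]), r 6 e hd (by simp [eq', rule, rules])⟩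
  refine ⟨fun x => fuelRec 7 q' s (x.unpair.2 + 1) x,
    (fuelRec_primrec 7 hq' hs).comp (Primrec.succ.comp pright) .id, fun p Γ φ d => ?_⟩
  simp only [Nat.unpair_pair]
  exact key _ p Γ φ d (Nat.lt_succ_self _)

end DRules
end SetClass


/-! ## Derived rules for families of derivations -/

namespace SetClass

open Fml

/-- Comprehension for all formulas. -/
class Theory.Comprehension (T : Theory) : Prop where
  comprehension_mem : ∀ φ, comprehension φ ∈ T.axioms

/-- If `T` has uniform derivations of the axioms of `S`, derivations in `S` can be turned into
derivations in `T`. -/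
theorem exists_primrec_of_axioms {S T : Theory} (hc : S.classical → T.classical)
    (hax : ∀ {α : Type} (c : α → ℕ) (Γ : PL c) (φ : PF c), (∀ a, φ.f a ∈ S.axioms) → Pv T Γ φ) :
    ∃ G : ℕ → ℕ, Primrec G ∧ ∀ Γ φ (d : Deriv S Γ φ), IsProof T Γ φ (G d.code) := by
  have R : DRules S (π := Unit) id (fun _ Γ φ n => IsProof T Γ φ n) :=
    { ax := fun c _ Γ φ _ h => hax c Γ φ h
      lem := fun _ _ _ _ _ h => Pv.lem (hc h)
      hyp := fun _ _ _ _ _ h => Pv.hyp h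
      efq := fun _ _ _ _ _ h => Pv.efq h
      andI := fun _ _ _ _ _ _ h h' => Pv.andI h h'
      andL := fun _ _ _ _ _ _ h => Pv.andL h
      andR := fun _ _ _ _ _ _ h => Pv.andR h
      orL := fun _ _ _ _ _ _ h => Pv.orL h
      orR := fun _ _ _ _ _ _ h => Pv.orR h
      orE := fun _ _ _ _ _ _ _ h h' h'' => Pv.orE h h' h''
      impI := fun _ _ _ _ _ _ h => Pv.impI h
      impE := fun _ _ _ _ _ _ h h' => Pv.impE h h'
      allI := fun _ _ _ _ _ h => Pv.allI h
      allE := fun _ _ _ t _ _ h => Pv.allE t h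
      exI := fun _ _ _ t _ _ h => Pv.exI t h
      exE := fun _ _ _ _ _ _ h h' => Pv.exE h h'
      allCI := fun _ _ _ _ _ h => Pv.allCI h
      allCE := fun _ _ _ t _ _ h => Pv.allCE t h
      exCI := fun _ _ _ t _ _ h => Pv.exCI t h
      exCE := fun _ _ _ _ _ _ h h' => Pv.exCE h h'
      eqRefl := fun _ _ _ x _ => Pv.eqRefl x
      eqSubst := fun _ _ _ _ _ _ _ h h' => Pv.eqSubst h h'
      eqCRefl := fun _ _ _ x _ => Pv.eqCRefl x
      eqCSubst := fun _ _ _ _ _ _ _ h h' => Pv.eqCSubst h h' }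
  obtain ⟨G, hG, e⟩ := R.exists_primrec .id
  exact ⟨fun n => G (Nat.pair 0 n), hG.comp (Primrec₂.natPair.comp (.const 0) .id),
    fun Γ φ d => e () Γ φ d⟩

theorem up_primrec {ρ : ℕ → ℕ} (h : Primrec ρ) : Primrec (up ρ) := by
  have : Primrec fun n : ℕ => (Nat.casesOn n 0 fun m => ρ m + 1 : ℕ) :=
    Primrec.nat_casesOn .id (.const 0) (Primrec.succ.comp (h.comp Primrec.snd)).to₂
  exact this.of_eq fun n => by cases n <;> rfl

section
variable {α : Type} {c : α → ℕ}

/-- The variables `ρ` seen from below one more quantifier. -/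
def upP (ρ : ℕ → PN c) : ℕ → PN c
  | 0 => .const 0
  | n + 1 => (ρ n).succ

theorem upP_f (ρ : ℕ → PN c) (a : α) : (fun i => (upP ρ i).f a) = up fun i => (ρ i).f a := by
  funext i; cases i <;> rfl

namespace PF

/-- The formula seen from below a fresh set variable `1`. -/
def under (φ : PF c) : PF c := φ.ren (up Nat.succ) id (up_primrec .succ) .id

@[simp] theorem under_inst (φ : PF c) : φ.under.inst (.const 0) = φ := by
  ext a
  simp only [under, inst, ren, PN.const, Fml.inst, rename_rename]
  exact rename_eq_self _ (fun n => by cases n <;> rfl) (fun _ => rfl)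

/-- The formula seen from below a fresh class variable `1`. -/
def underC (φ : PF c) : PF c := φ.ren id (up Nat.succ) .id (up_primrec .succ)

@[simp] theorem underC_instC (φ : PF c) : φ.underC.instC (.const 0) = φ := by
  ext a
  simp only [underC, instC, ren, PN.const, Fml.instC, rename_rename]
  exact rename_eq_self _ (fun _ => rfl) (fun n => by cases n <;> rfl)

@[simp] theorem shift_inst (φ : PF c) (t : PN c) : φ.shift.inst t = φ := by
  ext a; exact Fml.shift_inst _ _

end PF

/-- A fixed formula with families of variables in place of its free variables. -/
def Fml.fam : Fml → (ρ σ : ℕ → PN c) → PF c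
  | .mem x y, ρ, _ => .mem (ρ x) (ρ y)
  | .memC x X, ρ, σ => .memC (ρ x) (σ X)
  | .eq x y, ρ, _ => .eq (ρ x) (ρ y)
  | .eqC X Y, _, σ => .eqC (σ X) (σ Y)
  | .fls, _, _ => .fls
  | .conj φ ψ, ρ, σ => .conj (fam φ ρ σ) (fam ψ ρ σ)
  | .disj φ ψ, ρ, σ => .disj (fam φ ρ σ) (fam ψ ρ σ)
  | .imp φ ψ, ρ, σ => .imp (fam φ ρ σ) (fam ψ ρ σ)
  | .all φ, ρ, σ => .all (fam φ (upP ρ) σ)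
  | .ex φ, ρ, σ => .ex (fam φ (upP ρ) σ)
  | .allC φ, ρ, σ => .allC (fam φ ρ (upP σ))
  | .exC φ, ρ, σ => .exC (fam φ ρ (upP σ))

theorem Fml.fam_f (φ : Fml) (ρ σ : ℕ → PN c) (a : α) :
    (φ.fam ρ σ).f a = φ.rename (fun i => (ρ i).f a) (fun i => (σ i).f a) := by
  induction φ generalizing ρ σ with
  | mem | memC | eq | eqC | fls => rfl
  | conj φ ψ h₁ h₂ => exact congrArg₂ Fml.conj (h₁ ρ σ) (h₂ ρ σ)
  | disj φ ψ h₁ h₂ => exact congrArg₂ Fml.disj (h₁ ρ σ) (h₂ ρ σ)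
  | imp φ ψ h₁ h₂ => exact congrArg₂ Fml.imp (h₁ ρ σ) (h₂ ρ σ)
  | all φ h => exact congrArg Fml.all ((h _ _).trans (by rw [upP_f]))
  | ex φ h => exact congrArg Fml.ex ((h _ _).trans (by rw [upP_f]))
  | allC φ h => exact congrArg Fml.allC ((h _ _).trans (by rw [upP_f]))
  | exC φ h => exact congrArg Fml.exC ((h _ _).trans (by rw [upP_f]))

theorem Fml.fam_inst (φ : Fml) (t : ℕ) (ρ σ : ℕ → PN c) :
    (φ.inst t).fam ρ σ = (φ.fam (upP ρ) σ).inst (ρ t) := by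
  ext a
  simp only [fam_f, PF.inst, inst_rename, upP_f]

theorem Fml.fam_instC (φ : Fml) (t : ℕ) (ρ σ : ℕ → PN c) :
    (φ.instC t).fam ρ σ = (φ.fam ρ (upP σ)).instC (σ t) := by
  ext a
  simp only [fam_f, PF.instC, instC_rename, upP_f]

theorem Fml.fam_shift (φ : Fml) (ρ σ : ℕ → PN c) :
    φ.shift.fam (upP ρ) σ = (φ.fam ρ σ).shift := by
  ext a
  simp only [fam_f, PF.shift, shift_rename, upP_f]

theorem Fml.fam_shiftC (φ : Fml) (ρ σ : ℕ → PN c) :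
    φ.shiftC.fam ρ (upP σ) = (φ.fam ρ σ).shiftC := by
  ext a
  simp only [fam_f, PF.shiftC, shiftC_rename, upP_f]

end

/-- A fixed derivation with families of variables in place of its free variables. -/
theorem Deriv.fam {T : Theory} [hT : T.Renamable] {Δ : List Fml} {φ : Fml} (d : Deriv T Δ φ) :
    ∀ {α : Type} {c : α → ℕ} (Γ : PL c) (ρ σ : ℕ → PN c),
      (∀ a, ∀ ψ ∈ Δ, ψ.rename (fun i => (ρ i).f a) (fun i => (σ i).f a) ∈ Γ.f a) →
      Pv T Γ (φ.fam ρ σ) := by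
  have cons : ∀ {α : Type} {c : α → ℕ} {Γ : PL c} {ρ σ : ℕ → PN c} {Δ : List Fml} (χ : Fml),
      (∀ a, ∀ ψ ∈ Δ, ψ.rename (fun i => (ρ i).f a) (fun i => (σ i).f a) ∈ Γ.f a) →
      (∀ a, ∀ ψ ∈ χ :: Δ, ψ.rename (fun i => (ρ i).f a) (fun i => (σ i).f a) ∈
        (PL.cons (χ.fam ρ σ) Γ).f a) := by
    intro α c Γ ρ σ Δ χ H a
    simp only [PL.cons, Fml.fam_f]
    exact cons_rename_subset χ (H a)
  have shift : ∀ {α : Type} {c : α → ℕ} {Γ : PL c} {ρ σ : ℕ → PN c} {Δ : List Fml},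
      (∀ a, ∀ ψ ∈ Δ, ψ.rename (fun i => (ρ i).f a) (fun i => (σ i).f a) ∈ Γ.f a) →
      (∀ a, ∀ ψ ∈ Δ.map Fml.shift, ψ.rename (fun i => (upP ρ i).f a) (fun i => (σ i).f a) ∈
        Γ.shift.f a) := by
    intro α c Γ ρ σ Δ H a
    rw [upP_f]
    exact map_rename_subset_shift (H a)
  have shiftC : ∀ {α : Type} {c : α → ℕ} {Γ : PL c} {ρ σ : ℕ → PN c} {Δ : List Fml},
      (∀ a, ∀ ψ ∈ Δ, ψ.rename (fun i => (ρ i).f a) (fun i => (σ i).f a) ∈ Γ.f a) →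
      (∀ a, ∀ ψ ∈ Δ.map Fml.shiftC, ψ.rename (fun i => (ρ i).f a) (fun i => (upP σ i).f a) ∈
        Γ.shiftC.f a) := by
    intro α c Γ ρ σ Δ H a
    rw [upP_f]
    exact map_rename_subset_shiftC (H a)
  induction d with
  | ax h => intro α c Γ ρ σ _; exact .ax fun a => by rw [fam_f]; exact hT.rename_mem _ h _ _
  | lem h => intro α c Γ ρ σ _; exact .lem h
  | hyp h => intro α c Γ ρ σ H; exact .hyp fun a => by rw [fam_f]; exact H a _ h
  | efq d ih => intro α c Γ ρ σ H; exact .efq (ih Γ ρ σ H)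
  | andI d e ih₁ ih₂ => intro α c Γ ρ σ H; exact .andI (ih₁ Γ ρ σ H) (ih₂ Γ ρ σ H)
  | andL d ih => intro α c Γ ρ σ H; exact .andL (ih Γ ρ σ H)
  | andR d ih => intro α c Γ ρ σ H; exact .andR (ih Γ ρ σ H)
  | orL d ih => intro α c Γ ρ σ H; exact .orL (ih Γ ρ σ H)
  | orR d ih => intro α c Γ ρ σ H; exact .orR (ih Γ ρ σ H)
  | orE d e₁ e₂ ih ih₁ ih₂ =>
    intro α c Γ ρ σ H
    exact .orE (ih Γ ρ σ H) (ih₁ _ ρ σ (cons _ H)) (ih₂ _ ρ σ (cons _ H))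
  | impI d ih => intro α c Γ ρ σ H; exact .impI (ih _ ρ σ (cons _ H))
  | impE d e ih₁ ih₂ => intro α c Γ ρ σ H; exact .impE (ih₁ Γ ρ σ H) (ih₂ Γ ρ σ H)
  | allI d ih => intro α c Γ ρ σ H; exact .allI (ih _ _ σ (shift H))
  | allE t d ih => intro α c Γ ρ σ H; rw [fam_inst]; exact .allE _ (ih Γ ρ σ H)
  | exI t d ih => intro α c Γ ρ σ H; exact .exI (ρ t) (fam_inst _ _ ρ σ ▸ ih Γ ρ σ H)
  | exE d e ih₁ ih₂ =>
    intro α c Γ ρ σ H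
    exact .exE (ih₁ Γ ρ σ H) (fam_shift _ ρ σ ▸ ih₂ _ _ σ (cons _ (shift H)))
  | allCI d ih => intro α c Γ ρ σ H; exact .allCI (ih _ ρ _ (shiftC H))
  | allCE t d ih => intro α c Γ ρ σ H; rw [fam_instC]; exact .allCE _ (ih Γ ρ σ H)
  | exCI t d ih => intro α c Γ ρ σ H; exact .exCI (σ t) (fam_instC _ _ ρ σ ▸ ih Γ ρ σ H)
  | exCE d e ih₁ ih₂ =>
    intro α c Γ ρ σ H
    exact .exCE (ih₁ Γ ρ σ H) (fam_shiftC _ ρ σ ▸ ih₂ _ ρ _ (cons _ (shiftC H)))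
  | eqRefl x => intro α c Γ ρ σ H; exact .eqRefl _
  | eqSubst φ d e ih₁ ih₂ =>
    intro α c Γ ρ σ H
    rw [fam_inst]
    exact .eqSubst (ih₁ Γ ρ σ H) (fam_inst _ _ ρ σ ▸ ih₂ Γ ρ σ H)
  | eqCRefl x => intro α c Γ ρ σ H; exact .eqCRefl _
  | eqCSubst φ d e ih₁ ih₂ =>
    intro α c Γ ρ σ H
    rw [fam_instC]
    exact .eqCSubst (ih₁ Γ ρ σ H) (fam_instC _ _ ρ σ ▸ ih₂ Γ ρ σ H)

theorem Prv.fam {T : Theory} [T.Renamable] {φ : Fml} (h : Prv T [] φ) {α : Type} {c : α → ℕ}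
    (Γ : PL c) (ρ σ : ℕ → PN c) : Pv T Γ (φ.fam ρ σ) :=
  h.elim fun d => d.fam Γ ρ σ (by simp)

/-- Derivable formulas are uniformly derivable in all contexts. -/
theorem Prv.const {T : Theory} [T.Renamable] {φ : Fml} (h : Prv T [] φ) {α : Type} {c : α → ℕ}
    (Γ : PL c) : Pv T Γ (.const φ) := by
  have : φ.fam (fun i => PN.const (c := c) i) (fun i => .const i) = .const φ := by
    ext a
    rw [fam_f]
    exact rename_eq_self _ (fun _ => rfl) (fun _ => rfl)
  exact this ▸ h.fam Γ _ _

namespace Pv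
variable {T : Theory} {α : Type} {c : α → ℕ} {Γ : PL c} {φ ψ χ θ φ' ψ' : PF c}

theorem hyp0 : Pv T (.cons φ Γ) φ := hyp fun _ => by simp [PL.cons]
theorem hyp1 : Pv T (.cons ψ (.cons φ Γ)) φ := hyp fun _ => by simp [PL.cons]
theorem hyp2 : Pv T (.cons χ (.cons ψ (.cons φ Γ))) φ := hyp fun _ => by simp [PL.cons]
theorem hyp3 : Pv T (.cons θ (.cons χ (.cons ψ (.cons φ Γ)))) φ := hyp fun _ => by simp [PL.cons]

theorem allE0 (h : Pv T Γ φ.under.all) : Pv T Γ φ := by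
  simpa using allE (.const 0) h
theorem exI0 (h : Pv T Γ φ) : Pv T Γ φ.under.ex :=
  exI (.const 0) (by simpa using h)
theorem allCE0 (h : Pv T Γ φ.underC.allC) : Pv T Γ φ := by
  simpa using allCE (.const 0) h
theorem exCI0 (h : Pv T Γ φ) : Pv T Γ φ.underC.exC :=
  exCI (.const 0) (by simpa using h)

theorem iffRefl : Pv T Γ (φ.iff φ) := andI (impI hyp0) (impI hyp0)

theorem iffConj (h : Pv T Γ (φ.iff φ')) (h' : Pv T Γ (ψ.iff ψ')) :
    Pv T Γ ((φ.conj ψ).iff (φ'.conj ψ')) := by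
  have : Pv T Γ ((φ.iff φ').imp ((ψ.iff ψ').imp ((φ.conj ψ).iff (φ'.conj ψ')))) :=
    impI (impI (andI
      (impI (andI (impE (andL hyp2) (andL hyp0)) (impE (andL hyp1) (andR hyp0))))
      (impI (andI (impE (andR hyp2) (andL hyp0)) (impE (andR hyp1) (andR hyp0))))))
  exact impE (impE this h) h'

theorem iffDisj (h : Pv T Γ (φ.iff φ')) (h' : Pv T Γ (ψ.iff ψ')) :
    Pv T Γ ((φ.disj ψ).iff (φ'.disj ψ')) := by
  have : Pv T Γ ((φ.iff φ').imp ((ψ.iff ψ').imp ((φ.disj ψ).iff (φ'.disj ψ')))) :=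
    impI (impI (andI
      (impI (orE hyp0 (orL (impE (andL hyp3) hyp0)) (orR (impE (andL hyp2) hyp0))))
      (impI (orE hyp0 (orL (impE (andR hyp3) hyp0)) (orR (impE (andR hyp2) hyp0))))))
  exact impE (impE this h) h'

theorem iffImp (h : Pv T Γ (φ.iff φ')) (h' : Pv T Γ (ψ.iff ψ')) :
    Pv T Γ ((φ.imp ψ).iff (φ'.imp ψ')) := by
  have : Pv T Γ ((φ.iff φ').imp ((ψ.iff ψ').imp ((φ.imp ψ).iff (φ'.imp ψ')))) :=
    impI (impI (andI
      (impI (impI (impE (andL hyp2) (impE hyp1 (impE (andR hyp3) hyp0)))))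
      (impI (impI (impE (andR hyp2) (impE hyp1 (impE (andL hyp3) hyp0)))))))
  exact impE (impE this h) h'

theorem iffAll (h : Pv T Γ.shift (φ.iff φ')) : Pv T Γ (φ.all.iff φ'.all) := by
  have : Pv T Γ ((φ.iff φ').all.imp (φ.all.iff φ'.all)) :=
    impI (andI
      (impI (allI (impE (andL (allE0 (φ := φ.iff φ') (hyp fun _ => by simp [PL.cons, PL.shift]; right; left; rfl)))
        (allE0 (hyp fun _ => by simp [PL.cons, PL.shift]; left; rfl)))))
      (impI (allI (impE (andR (allE0 (φ := φ.iff φ') (hyp fun _ => by simp [PL.cons, PL.shift]; right; left; rfl)))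
        (allE0 (hyp fun _ => by simp [PL.cons, PL.shift]; left; rfl))))))
  exact impE this (allI h)

theorem iffAllC (h : Pv T Γ.shiftC (φ.iff φ')) : Pv T Γ (φ.allC.iff φ'.allC) := by
  have : Pv T Γ ((φ.iff φ').allC.imp (φ.allC.iff φ'.allC)) :=
    impI (andI
      (impI (allCI (impE (andL (allCE0 (φ := φ.iff φ') (hyp fun _ => by simp [PL.cons, PL.shiftC]; right; left; rfl)))
        (allCE0 (hyp fun _ => by simp [PL.cons, PL.shiftC]; left; rfl)))))
      (impI (allCI (impE (andR (allCE0 (φ := φ.iff φ') (hyp fun _ => by simp [PL.cons, PL.shiftC]; right; left; rfl)))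
        (allCE0 (hyp fun _ => by simp [PL.cons, PL.shiftC]; left; rfl))))))
  exact impE this (allCI h)

theorem iffEx (h : Pv T Γ.shift (φ.iff φ')) : Pv T Γ (φ.ex.iff φ'.ex) := by
  have : Pv T Γ ((φ.iff φ').all.imp (φ.ex.iff φ'.ex)) :=
    impI (andI
      (impI (exE hyp0 (exI0 (φ := φ') (impE (andL (allE0 (φ := φ.iff φ')
        (hyp fun _ => by simp [PL.cons, PL.shift]; right; right; left; rfl))) hyp0))))
      (impI (exE hyp0 (exI0 (φ := φ) (impE (andR (allE0 (φ := φ.iff φ')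
        (hyp fun _ => by simp [PL.cons, PL.shift]; right; right; left; rfl))) hyp0)))))
  exact impE this (allI h)

theorem iffExC (h : Pv T Γ.shiftC (φ.iff φ')) : Pv T Γ (φ.exC.iff φ'.exC) := by
  have : Pv T Γ ((φ.iff φ').allC.imp (φ.exC.iff φ'.exC)) :=
    impI (andI
      (impI (exCE hyp0 (exCI0 (φ := φ') (impE (andL (allCE0 (φ := φ.iff φ')
        (hyp fun _ => by simp [PL.cons, PL.shiftC]; right; right; left; rfl))) hyp0))))
      (impI (exCE hyp0 (exCI0 (φ := φ) (impE (andR (allCE0 (φ := φ.iff φ')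
        (hyp fun _ => by simp [PL.cons, PL.shiftC]; right; right; left; rfl))) hyp0)))))
  exact impE this (allCI h)

end Pv

/-! ## Substitution of formulas for class variables -/

/-- No equations between classes. -/
def Fml.NoEqC : Fml → Prop
  | .eqC _ _ => False
  | .conj φ ψ => NoEqC φ ∧ NoEqC ψ
  | .disj φ ψ => NoEqC φ ∧ NoEqC ψ
  | .imp φ ψ => NoEqC φ ∧ NoEqC ψ
  | .all φ => NoEqC φ
  | .ex φ => NoEqC φ
  | .allC φ => NoEqC φ
  | .exC φ => NoEqC φ
  | _ => True

section
variable {T : Theory} {α : Type} {c : α → ℕ}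

/-- The class terms `S` seen from below one more class quantifier. -/
def upS (S : ℕ → PF c) : ℕ → PF c
  | 0 => .memC (.const 0) (.const 0)
  | n + 1 => (S n).shiftC

/-- The formula `φ` with set variables `ρ` and with `x ∈ X` replaced by `S X`, where `x` is
substituted for variable `0` of `S X`. -/
def Fml.fill : Fml → (ρ : ℕ → PN c) → (S : ℕ → PF c) → PF c
  | .mem x y, ρ, _ => .mem (ρ x) (ρ y)
  | .memC x X, ρ, S => (S X).inst (ρ x)
  | .eq x y, ρ, _ => .eq (ρ x) (ρ y)
  | .eqC _ _, _, _ => .fls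
  | .fls, _, _ => .fls
  | .conj φ ψ, ρ, S => .conj (fill φ ρ S) (fill ψ ρ S)
  | .disj φ ψ, ρ, S => .disj (fill φ ρ S) (fill ψ ρ S)
  | .imp φ ψ, ρ, S => .imp (fill φ ρ S) (fill ψ ρ S)
  | .all φ, ρ, S => .all (fill φ (upP ρ) fun i => (S i).under)
  | .ex φ, ρ, S => .ex (fill φ (upP ρ) fun i => (S i).under)
  | .allC φ, ρ, S => .allC (fill φ ρ (upS S))
  | .exC φ, ρ, S => .exC (fill φ ρ (upS S))

/-- `∀ x, x ∈ X ↔ φ(x)` -/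
def PF.isClass (X : PN c) (φ : PF c) : PF c := ((PF.memC (.const 0) X).iff φ).all

theorem PF.isClass_shiftC (X : PN c) (φ : PF c) (a : α) :
    ((PF.isClass X φ).f a).shiftC = (PF.isClass X.succ φ.shiftC).f a := by
  simp only [isClass, all, iff, conj, imp, Fml.shiftC, rename, up_id, memC, PF.shiftC]
  rfl

theorem Fml.fill_iff (Φ : Fml) (h : Φ.NoEqC) (Γ : PL c) (ρ σ : ℕ → PN c) (S : ℕ → PF c)
    (H : ∀ i, S i = .memC (.const 0) (σ i) ∨ ∀ a, (PF.isClass (σ i) (S i)).f a ∈ Γ.f a) :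
    Pv T Γ ((Φ.fam ρ σ).iff (Φ.fill ρ S)) := by
  induction Φ generalizing Γ ρ σ S with
  | mem | eq | fls => exact .iffRefl
  | eqC => exact h.elim
  | memC x X =>
    rcases H X with e | e
    · simp only [fill, e]; exact .iffRefl
    · exact Pv.allE (ρ x) (Pv.hyp e)
  | conj φ ψ h₁ h₂ => exact .iffConj (h₁ h.1 Γ ρ σ S H) (h₂ h.2 Γ ρ σ S H)
  | disj φ ψ h₁ h₂ => exact .iffDisj (h₁ h.1 Γ ρ σ S H) (h₂ h.2 Γ ρ σ S H)
  | imp φ ψ h₁ h₂ => exact .iffImp (h₁ h.1 Γ ρ σ S H) (h₂ h.2 Γ ρ σ S H)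
  | all φ ih | ex φ ih =>
    have := ih h Γ.shift (upP ρ) σ (fun i => (S i).under) fun i => (H i).imp
      (fun e => by rw [e]; rfl)
      fun e a => List.mem_map.2 ⟨_, e a, rfl⟩
    first | exact .iffAll this | exact .iffEx this
  | allC φ ih | exC φ ih =>
    have := ih h Γ.shiftC ρ (upP σ) (upS S) fun i => by
      cases i with
      | zero => exact .inl rfl
      | succ i =>
        exact (H i).imp (fun e => by rw [upS, e]; rfl) fun e a =>
          List.mem_map.2 ⟨_, e a, PF.isClass_shiftC _ _ _⟩
    first | exact .iffAllC this | exact .iffExC this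

theorem Fml.fill_rename (Φ : Fml) (ρ : ℕ → PN c) (τ : ℕ → ℕ) (S S' : ℕ → PF c)
    (h : ∀ i a, (S' i).f a = ((S i).f a).rename id τ) (a : α) :
    (Φ.fill ρ S').f a = ((Φ.fill ρ S).f a).rename id τ := by
  induction Φ generalizing ρ τ S S' with
  | mem | eq | fls | eqC => rfl
  | memC x X =>
    simp only [fill, PF.inst, h, inst_rename, up_id]; rfl
  | conj φ ψ h₁ h₂ => exact congrArg₂ Fml.conj (h₁ ρ τ S S' h) (h₂ ρ τ S S' h)
  | disj φ ψ h₁ h₂ => exact congrArg₂ Fml.disj (h₁ ρ τ S S' h) (h₂ ρ τ S S' h)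
  | imp φ ψ h₁ h₂ => exact congrArg₂ Fml.imp (h₁ ρ τ S S' h) (h₂ ρ τ S S' h)
  | all φ ih | ex φ ih =>
    have := ih (upP ρ) τ (fun i => (S i).under) (fun i => (S' i).under) fun i a => by
      simp only [PF.under, PF.ren, h, rename_rename]; rfl
    rw [← up_id] at this
    first | exact congrArg Fml.all this | exact congrArg Fml.ex this
  | allC φ ih | exC φ ih =>
    have := ih ρ (up τ) (upS S) (upS S') fun i a => by
      cases i with
      | zero => rfl
      | succ i => simp only [upS, PF.shiftC, Fml.shiftC, h, rename_rename]; rfl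
    first | exact congrArg Fml.allC this | exact congrArg Fml.exC this

/-- Class terms: those of the list `L`, followed by the class variables. -/
def holes : List (PF c) → ℕ → PF c
  | [], i => .memC (.const 0) (.const i)
  | φ :: _, 0 => φ
  | _ :: L, i + 1 => holes L i

/-- Weakening by `n` fresh class variables. -/
def PF.shiftCs (n : ℕ) (φ : PF c) : PF c := PF.shiftC^[n] φ

/-- The context that says of the first class variables that they are given by the formulas `L`. -/
def classCtx (Γ : PL c) : List (PF c) → PL c
  | [] => Γ
  | φ :: L => .cons (.isClass (.const 0) (φ.shiftCs (L.length + 1))) (classCtx Γ L).shiftC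

theorem Pv.exists_class [hT : T.Comprehension] {Γ : PL c} {φ χ : PF c}
    (h : Pv T (.cons (.isClass (.const 0) φ.shiftC) Γ.shiftC) χ.shiftC) : Pv T Γ χ :=
  .exCE (φ := .isClass (.const 0) φ.shiftC) (.ax fun _ => hT.comprehension_mem _) h

theorem Pv.of_classCtx [hT : T.Comprehension] {Γ : PL c} {χ : PF c} (L : List (PF c))
    (h : Pv T (classCtx Γ L) (χ.shiftCs L.length)) : Pv T Γ χ := by
  induction L with
  | nil => exact h
  | cons φ L ih =>
    refine ih (.exists_class (φ := φ.shiftCs L.length) ?_)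
    simpa only [classCtx, List.length_cons, PF.shiftCs, Function.iterate_succ_apply'] using h

theorem mem_classCtx (Γ : PL c) (L : List (PF c)) (i : ℕ) :
    (holes L i).shiftCs L.length = .memC (.const 0) (.const i) ∨
    ∀ a, (PF.isClass (.const i) ((holes L i).shiftCs L.length)).f a ∈ (classCtx Γ L).f a := by
  induction L generalizing i with
  | nil => exact .inl rfl
  | cons φ L ih =>
    cases i with
    | zero => exact .inr fun a => List.mem_cons_self
    | succ i =>
      refine (ih i).imp (fun e => ?_) (fun e a => ?_)
      · simp only [PF.shiftCs, List.length_cons, Function.iterate_succ_apply', holes] at e ⊢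
        rw [e]; rfl
      · refine List.mem_cons_of_mem _ (List.mem_map.2 ⟨_, e a, ?_⟩)
        rw [PF.isClass_shiftC]
        simp only [PF.shiftCs, List.length_cons, Function.iterate_succ_apply', holes]
        rfl

theorem Fml.fill_shiftCs (Φ : Fml) (ρ : ℕ → PN c) (S : ℕ → PF c) (n : ℕ) :
    (Φ.fill ρ S).shiftCs n = Φ.fill ρ fun i => (S i).shiftCs n := by
  induction n with
  | zero => rfl
  | succ n ih =>
    simp only [PF.shiftCs, Function.iterate_succ_apply'] at ih ⊢
    rw [ih]
    ext a
    exact (fill_rename Φ ρ Nat.succ _ _ (fun i a => rfl) a).symm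

/-- Substitution of formulas for the free class variables of a derivable formula. -/
theorem Prv.fill [T.Renamable] [T.Comprehension] {Φ : Fml} (h : Prv T [] Φ) (hΦ : Φ.NoEqC)
    (Γ : PL c) (ρ : ℕ → PN c) (L : List (PF c)) : Pv T Γ (Φ.fill ρ (holes L)) := by
  refine .of_classCtx L ?_
  rw [fill_shiftCs]
  exact .impE (.andL (Φ.fill_iff hΦ _ ρ (fun i => .const i) _ (mem_classCtx Γ L)))
    (h.fam _ ρ _)

end

end SetClass


/-! ## Models and the completeness of classical theories -/

namespace SetClass

open Fml

/-- A structure for the two-sorted language, with true equality. -/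
structure Model where
  S : Type
  C : Type
  E : S → S → Prop
  EC : S → C → Prop

/-- The environment `e` with the value `x` for a new variable `0`. -/
def cons {β : Type} (x : β) (e : ℕ → β) : ℕ → β
  | 0 => x
  | n + 1 => e n

/-- Truth in a model. -/
def Model.Sat (m : Model) : Fml → (ℕ → m.S) → (ℕ → m.C) → Prop
  | .mem x y, e, _ => m.E (e x) (e y)
  | .memC x X, e, f => m.EC (e x) (f X)
  | .eq x y, e, _ => e x = e y
  | .eqC X Y, _, f => f X = f Y
  | .fls, _, _ => False
  | .conj φ ψ, e, f => m.Sat φ e f ∧ m.Sat ψ e f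
  | .disj φ ψ, e, f => m.Sat φ e f ∨ m.Sat ψ e f
  | .imp φ ψ, e, f => m.Sat φ e f → m.Sat ψ e f
  | .all φ, e, f => ∀ x, m.Sat φ (cons x e) f
  | .ex φ, e, f => ∃ x, m.Sat φ (cons x e) f
  | .allC φ, e, f => ∀ X, m.Sat φ e (cons X f)
  | .exC φ, e, f => ∃ X, m.Sat φ e (cons X f)

/-- All axioms of the theory hold in the model. -/
def Model.Models (m : Model) (T : Theory) : Prop := ∀ φ ∈ T.axioms, ∀ e f, m.Sat φ e f

theorem Model.sat_rename (m : Model) (φ : Fml) (ρ σ : ℕ → ℕ) (e : ℕ → m.S) (f : ℕ → m.C) :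
    m.Sat (φ.rename ρ σ) e f ↔ m.Sat φ (fun n => e (ρ n)) fun n => f (σ n) := by
  have hc : ∀ {β : Type} (x : β) (ρ : ℕ → ℕ) (e : ℕ → β),
      (fun n => cons x e (up ρ n)) = cons x fun n => e (ρ n) := by
    intro β x ρ e; funext n; cases n <;> rfl
  induction φ generalizing ρ σ e f with
  | mem | memC | eq | eqC | fls => rfl
  | conj φ ψ h₁ h₂ => exact and_congr (h₁ ..) (h₂ ..)
  | disj φ ψ h₁ h₂ => exact or_congr (h₁ ..) (h₂ ..)
  | imp φ ψ h₁ h₂ => exact imp_congr (h₁ ..) (h₂ ..)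
  | all φ h => exact forall_congr' fun x => (h ..).trans (by rw [hc])
  | ex φ h => exact exists_congr fun x => (h ..).trans (by rw [hc])
  | allC φ h => exact forall_congr' fun x => (h ..).trans (by rw [hc])
  | exC φ h => exact exists_congr fun x => (h ..).trans (by rw [hc])

section
variable {T : Theory} [T.Renamable]

namespace Prv
variable {Γ : List Fml} {φ ψ χ : Fml}

theorem by_contra (hT : T.classical) (h : Prv T (neg φ :: Γ) fls) : Prv T Γ φ :=
  .orE (.lem hT) id fun _ => .efq h

theorem neg_all (hT : T.classical) (h : Prv T Γ (neg (all φ))) : Prv T Γ (ex (neg φ)) :=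
  .by_contra hT <| .impE h.w <| .allI fun t => .by_contra hT <|
    .impE (φ := ex (neg φ)) (.hyp (.tail _ (.head _))) (.exI t .hyp0)

theorem neg_allC (hT : T.classical) (h : Prv T Γ (neg (allC φ))) : Prv T Γ (exC (neg φ)) :=
  .by_contra hT <| .impE h.w <| .allCI fun t => .by_contra hT <|
    .impE (φ := exC (neg φ)) (.hyp (.tail _ (.head _))) (.exCI t .hyp0)

end Prv

theorem exists_extension (Γ : List Fml) (hΓ : ¬ Prv T Γ fls) (ψ : Fml) :
    ∃ Δ, (∀ χ ∈ Γ, χ ∈ Δ) ∧ ¬ Prv T Δ fls ∧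
      (Prv T Δ (neg ψ) ∨ ψ ∈ Δ ∧ (∀ χ, ψ = ex χ → ∃ t, χ.inst t ∈ Δ) ∧
        ∀ χ, ψ = exC χ → ∃ t, χ.instC t ∈ Δ) := by
  by_cases h : Prv T (ψ :: Γ) fls
  · exact ⟨Γ, fun _ => id, hΓ, .inl (.impI fun _ => h)⟩
  by_cases h₁ : ∃ χ, ψ = ex χ
  · obtain ⟨χ, rfl⟩ := h₁
    have : ∃ t, ¬ Prv T (χ.inst t :: ex χ :: Γ) fls := by
      by_contra! H
      exact h (.exE .hyp0 fun t _ => H t)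
    obtain ⟨t, ht⟩ := this
    refine ⟨_, fun _ h => .tail _ (.tail _ h), ht, .inr ⟨by simp, ?_, ?_⟩⟩
    · rintro _ ⟨⟩; exact ⟨t, by simp⟩
    · rintro _ ⟨⟩
  by_cases h₂ : ∃ χ, ψ = exC χ
  · obtain ⟨χ, rfl⟩ := h₂
    have : ∃ t, ¬ Prv T (χ.instC t :: exC χ :: Γ) fls := by
      by_contra! H
      exact h (.exCE .hyp0 fun t _ => H t)
    obtain ⟨t, ht⟩ := this
    refine ⟨_, fun _ h => .tail _ (.tail _ h), ht, .inr ⟨by simp, ?_, ?_⟩⟩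
    · rintro _ ⟨⟩
    · rintro _ ⟨⟩; exact ⟨t, by simp⟩
  exact ⟨ψ :: Γ, fun _ h => .tail _ h, h, .inr ⟨by simp, fun χ e => (h₁ ⟨χ, e⟩).elim,
    fun χ e => (h₂ ⟨χ, e⟩).elim⟩⟩

/-- A complete Henkin theory extending `T`. -/
structure Henkin (T : Theory) (W : Fml → Prop) : Prop where
  closed : ∀ Γ φ, (∀ ψ ∈ Γ, W ψ) → Prv T Γ φ → W φ
  cons : ¬ W fls
  complete : ∀ φ, W φ ∨ W (neg φ)
  ex : ∀ φ, W (.ex φ) → ∃ t, W (φ.inst t)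
  exC : ∀ φ, W (.exC φ) → ∃ t, W (φ.instC t)

theorem exists_henkin (Γ : List Fml) (hΓ : ¬ Prv T Γ fls) :
    ∃ W, Henkin T W ∧ ∀ φ ∈ Γ, W φ := by
  classical
  have : Nonempty Fml := ⟨.fls⟩
  have hdec : ∃ dec : ℕ → Fml, Function.Surjective dec :=
    ⟨Function.invFun Fml.code, Function.invFun_surjective code_injective⟩
  obtain ⟨dec, hdec⟩ := hdec
  choose next h₁ h₂ h₃ using exists_extension (T := T)
  let G : ℕ → {Γ : List Fml // ¬ Prv T Γ fls} := fun n =>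
    Nat.rec ⟨Γ, hΓ⟩ (fun n Δ => ⟨next Δ.1 Δ.2 (dec n), h₂ Δ.1 Δ.2 (dec n)⟩) n
  have hG : ∀ n, (G (n + 1)).1 = next (G n).1 (G n).2 (dec n) := fun n => rfl
  have mono : ∀ n m, n ≤ m → ∀ φ ∈ (G n).1, φ ∈ (G m).1 := by
    intro n m h
    induction m, h using Nat.le_induction with
    | base => exact fun _ => id
    | succ m _ ih => exact fun φ hφ => by rw [hG]; exact h₁ _ _ _ _ (ih φ hφ)
  have closed : ∀ Γ φ, (∀ ψ ∈ Γ, ∃ n, Prv T (G n).1 ψ) → Prv T Γ φ → ∃ n, Prv T (G n).1 φ := by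
    intro Γ
    induction Γ with
    | nil => exact fun φ _ h => ⟨0, h.mono (by simp)⟩
    | cons χ Γ ih =>
      intro φ H h
      obtain ⟨n, hn⟩ := ih (imp χ φ) (fun ψ hψ => H ψ (.tail _ hψ)) (.impI fun _ => h)
      obtain ⟨m, hm⟩ := H χ (by simp)
      exact ⟨max n m, .impE (hn.mono (mono _ _ (le_max_left _ _)))
        (hm.mono (mono _ _ (le_max_right _ _)))⟩
  have key : ∀ ψ, (∃ n, Prv T (G n).1 (neg ψ)) ∨ ∃ n, ψ ∈ (G n).1 ∧
      (∀ χ, ψ = ex χ → ∃ t, χ.inst t ∈ (G n).1) ∧ ∀ χ, ψ = exC χ → ∃ t, χ.instC t ∈ (G n).1 := by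
    intro ψ
    obtain ⟨n, rfl⟩ := hdec ψ
    exact (h₃ _ (G n).2 (dec n)).imp (fun h => ⟨n + 1, h⟩) fun h => ⟨n + 1, h⟩
  have incons : ∀ ψ, (∃ n, Prv T (G n).1 (neg ψ)) → (∃ n, Prv T (G n).1 ψ) → False := by
    intro ψ h h'
    obtain ⟨n, hn⟩ := closed [neg ψ, ψ] fls (by simp [h, h'])
      (.impE (φ := ψ) (.hyp (.head _)) (.hyp (by simp)))
    exact (G n).2 hn
  refine ⟨fun φ => ∃ n, Prv T (G n).1 φ, ⟨closed, fun ⟨n, h⟩ => (G n).2 h, ?_, ?_, ?_⟩,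
    fun φ hφ => ⟨0, .hyp hφ⟩⟩
  · exact fun φ => (key φ).symm.imp_left fun ⟨n, h, _⟩ => ⟨n, .hyp h⟩
  · intro φ h
    rcases key (.ex φ) with h' | ⟨n, h', H, _⟩
    · exact (incons _ h' h).elim
    · obtain ⟨t, ht⟩ := H φ rfl; exact ⟨t, n, .hyp ht⟩
  · intro φ h
    rcases key (.exC φ) with h' | ⟨n, h', _, H⟩
    · exact (incons _ h' h).elim
    · obtain ⟨t, ht⟩ := H φ rfl; exact ⟨t, n, .hyp ht⟩

namespace Henkin
variable {W : Fml → Prop}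

theorem of (H : Henkin T W) {φ : Fml} (h : Prv T [] φ) : W φ := H.closed [] φ (by simp) h
theorem of₁ (H : Henkin T W) {φ ψ : Fml} (h : W φ) (h' : Prv T [φ] ψ) : W ψ :=
  H.closed [φ] ψ (by simpa) h'
theorem of₂ (H : Henkin T W) {φ ψ χ : Fml} (h : W φ) (h₁ : W ψ) (h' : Prv T [φ, ψ] χ) : W χ :=
  H.closed [φ, ψ] χ (by simp [h, h₁]) h'
theorem absurd (H : Henkin T W) {φ : Fml} (h : W φ) (h' : W (neg φ)) : False :=
  H.cons (H.of₂ h' h (.impE (.hyp (.head _)) (.hyp (.tail _ (.head _)))))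

theorem eq_symm (H : Henkin T W) {x y : ℕ} (h : W (eq x y)) : W (eq y x) :=
  H.of₁ h (.symm (.hyp (.head _)))
theorem eqC_symm (H : Henkin T W) {x y : ℕ} (h : W (eqC x y)) : W (eqC y x) :=
  H.of₁ h (.substC (eqC 0 (x + 1)) (.hyp (.head _)) (.reflC x))
theorem subst (H : Henkin T W) (φ : Fml) {x y : ℕ} (h : W (eq x y)) (h' : W (φ.inst x)) :
    W (φ.inst y) := H.of₂ h h' (.subst φ (.hyp (.head _)) (.hyp (.tail _ (.head _))))
theorem substC (H : Henkin T W) (φ : Fml) {x y : ℕ} (h : W (eqC x y)) (h' : W (φ.instC x)) :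
    W (φ.instC y) := H.of₂ h h' (.substC φ (.hyp (.head _)) (.hyp (.tail _ (.head _))))

def setoid (H : Henkin T W) : Setoid ℕ where
  r x y := W (eq x y)
  iseqv := ⟨fun x => H.of (.refl x), H.eq_symm, fun {x y z} h h' => H.subst (eq (x + 1) 0) h' h⟩

def setoidC (H : Henkin T W) : Setoid ℕ where
  r x y := W (eqC x y)
  iseqv := ⟨fun x => H.of (.reflC x), H.eqC_symm,
    fun {x y z} h k => H.substC (eqC (x + 1) 0) k h⟩

/-- The term model. -/
def model (H : Henkin T W) : Model where
  S := Quotient H.setoid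
  C := Quotient H.setoidC
  E := Quotient.lift₂ (fun x y => W (.mem x y)) fun x y x' y' h h' => propext
    ⟨fun k => H.subst (mem (x' + 1) 0) h' (H.subst (mem 0 (y + 1)) h k),
      fun k => H.subst (mem (x + 1) 0) (H.eq_symm h') (H.subst (mem 0 (y' + 1)) (H.eq_symm h) k)⟩
  EC := Quotient.lift₂ (fun x y => W (.memC x y)) fun x y x' y' h h' => propext
    ⟨fun k => H.substC (memC x' 0) h' (H.subst (memC 0 y) h k),
      fun k => H.substC (memC x 0) (H.eqC_symm h') (H.subst (memC 0 y') (H.eq_symm h) k)⟩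

theorem cons_mk {s : Setoid ℕ} (t : ℕ) (e : ℕ → ℕ) :
    SetClass.cons (Quotient.mk s t) (fun n => .mk s (e n)) = fun n => .mk s (SetClass.cons t e n) := by
  funext n; cases n <;> rfl

theorem rename_cons (φ : Fml) (t : ℕ) (e f : ℕ → ℕ) :
    φ.rename (SetClass.cons t e) f = (φ.rename (up e) f).inst t := by
  rw [inst, rename_rename]
  exact rename_congr _ (fun n => by cases n <;> rfl) fun n => rfl

theorem renameC_cons (φ : Fml) (t : ℕ) (e f : ℕ → ℕ) :
    φ.rename e (SetClass.cons t f) = (φ.rename e (up f)).instC t := by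
  rw [instC, rename_rename]
  exact rename_congr _ (fun n => rfl) fun n => by cases n <;> rfl

theorem truth (H : Henkin T W) (hT : T.classical) (φ : Fml) (e f : ℕ → ℕ) :
    H.model.Sat φ (fun n => .mk _ (e n)) (fun n => .mk _ (f n)) ↔ W (φ.rename e f) := by
  induction φ generalizing e f with
  | mem | memC => rfl
  | eq x y => exact ⟨fun h => Quotient.exact h, fun h => Quotient.sound h⟩
  | eqC x y => exact ⟨fun h => Quotient.exact h, fun h => Quotient.sound h⟩
  | fls => exact ⟨False.elim, H.cons⟩
  | conj φ ψ h₁ h₂ =>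
    refine (and_congr (h₁ e f) (h₂ e f)).trans ⟨fun h => ?_, fun h => ⟨?_, ?_⟩⟩
    · exact H.of₂ h.1 h.2 (.andI (.hyp (.head _)) (.hyp (.tail _ (.head _))))
    · exact H.of₁ h (.andL .hyp0)
    · exact H.of₁ h (.andR .hyp0)
  | disj φ ψ h₁ h₂ =>
    refine (or_congr (h₁ e f) (h₂ e f)).trans ⟨fun h => ?_, fun h => ?_⟩
    · exact h.elim (fun h => H.of₁ h (.orL .hyp0)) fun h => H.of₁ h (.orR .hyp0)
    · refine (H.complete _).imp_right fun k => (H.complete _).resolve_right fun k' => ?_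
      exact H.cons (H.closed [_, _, _] _
        (by simpa using ⟨h, k, k'⟩)
        (.orE .hyp0 (fun h => .impE (.hyp (.tail _ (.tail _ (.head _)))) h)
          fun h => .impE (.hyp (.tail _ (.tail _ (.tail _ (.head _))))) h))
  | imp φ ψ h₁ h₂ =>
    refine (imp_congr (h₁ e f) (h₂ e f)).trans ⟨fun h => ?_, fun h h' => ?_⟩
    · rcases H.complete (φ.rename e f) with k | k
      · exact H.of₁ (h k) (.impI fun _ => .hyp (.tail _ (.head _)))
      · exact H.of₁ k (.impI fun h => .efq (.impE (.hyp (.tail _ (.head _))) h))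
    · exact H.of₂ h h' (.impE .hyp0 (.hyp (.tail _ (.head _))))
  | all φ ih =>
    have key : ∀ t, H.model.Sat φ (SetClass.cons (.mk _ t) fun n => .mk _ (e n))
        (fun n => .mk _ (f n)) ↔ W ((φ.rename (up e) f).inst t) := fun t =>
      (Iff.of_eq (congrArg (fun g => H.model.Sat φ g _) (cons_mk t e))).trans
        ((ih _ _).trans (by rw [rename_cons]))
    refine ⟨fun h => (H.complete _).resolve_right fun k => ?_, fun h q => ?_⟩
    · obtain ⟨t, ht⟩ := H.ex _ (H.of₁ k (.neg_all hT .hyp0))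
      exact H.absurd ((key t).1 (h _)) ht
    · induction q using Quotient.ind with | _ t
      exact (key t).2 (H.of₁ h (.allE .hyp0 t))
  | ex φ ih =>
    have key : ∀ t, H.model.Sat φ (SetClass.cons (.mk _ t) fun n => .mk _ (e n))
        (fun n => .mk _ (f n)) ↔ W ((φ.rename (up e) f).inst t) := fun t =>
      (Iff.of_eq (congrArg (fun g => H.model.Sat φ g _) (cons_mk t e))).trans
        ((ih _ _).trans (by rw [rename_cons]))
    refine ⟨fun ⟨q, h⟩ => ?_, fun h => ?_⟩
    · induction q using Quotient.ind with | _ t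
      exact H.of₁ ((key t).1 h) (.exI t .hyp0)
    · obtain ⟨t, ht⟩ := H.ex _ h
      exact ⟨_, (key t).2 ht⟩
  | allC φ ih =>
    have key : ∀ t, H.model.Sat φ (fun n => .mk _ (e n)) (SetClass.cons (.mk _ t)
        fun n => .mk _ (f n)) ↔ W ((φ.rename e (up f)).instC t) := fun t =>
      (Iff.of_eq (congrArg (fun g => H.model.Sat φ _ g) (cons_mk t f))).trans
        ((ih _ _).trans (by rw [renameC_cons]))
    refine ⟨fun h => (H.complete _).resolve_right fun k => ?_, fun h q => ?_⟩
    · obtain ⟨t, ht⟩ := H.exC _ (H.of₁ k (.neg_allC hT .hyp0))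
      exact H.absurd ((key t).1 (h _)) ht
    · induction q using Quotient.ind with | _ t
      exact (key t).2 (H.of₁ h (.allCE .hyp0 t))
  | exC φ ih =>
    have key : ∀ t, H.model.Sat φ (fun n => .mk _ (e n)) (SetClass.cons (.mk _ t)
        fun n => .mk _ (f n)) ↔ W ((φ.rename e (up f)).instC t) := fun t =>
      (Iff.of_eq (congrArg (fun g => H.model.Sat φ _ g) (cons_mk t f))).trans
        ((ih _ _).trans (by rw [renameC_cons]))
    refine ⟨fun ⟨q, h⟩ => ?_, fun h => ?_⟩
    · induction q using Quotient.ind with | _ t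
      exact H.of₁ ((key t).1 h) (.exCI t .hyp0)
    · obtain ⟨t, ht⟩ := H.exC _ h
      exact ⟨_, (key t).2 ht⟩

end Henkin

/-- Completeness of classical logic. -/
theorem Prv.of_models (hT : T.classical) {φ : Fml}
    (h : ∀ m : Model, m.Models T → ∀ e f, m.Sat φ e f) : Prv T [] φ := by
  refine .by_contra hT (Classical.by_contradiction fun hn => ?_)
  obtain ⟨W, H, hW⟩ := exists_henkin _ hn
  have hφ := h H.model (fun ψ hψ e f => by
    have : ∀ {s : Setoid ℕ} (e : ℕ → Quotient s), ∃ e' : ℕ → ℕ, e = fun n => .mk s (e' n) :=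
      fun e => ⟨fun n => (e n).out, funext fun n => (Quotient.out_eq _).symm⟩
    obtain ⟨e, rfl⟩ := this e
    obtain ⟨f, rfl⟩ := this f
    exact (H.truth hT ψ e f).2 (H.of (.rename _ _ (.ax hψ) (by simp) (Γ := []))))
    (fun n => .mk _ n) fun n => .mk _ n
  rw [H.truth hT, rename_eq_self φ (fun _ => rfl) (fun _ => rfl)] at hφ
  exact H.absurd hφ (hW _ (by simp))

end
end SetClass


/-! ## Kelley--Morse set theory in its models -/

namespace SetClass

open Fml

namespace Model
variable {m : Model}

@[simp] theorem sat_iff (φ ψ : Fml) (e : ℕ → m.S) (f : ℕ → m.C) :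
    m.Sat (iff φ ψ) e f ↔ (m.Sat φ e f ↔ m.Sat ψ e f) :=
  ⟨fun h => ⟨h.1, h.2⟩, fun h => ⟨h.1, h.2⟩⟩

/-- `p = {x, y}` -/
def UPair (m : Model) (p x y : m.S) : Prop := ∀ z, m.E z p ↔ z = x ∨ z = y
/-- `p = ⟨x, y⟩` -/
def OPair (m : Model) (p x y : m.S) : Prop := ∀ z, m.E z p ↔ m.UPair z x x ∨ m.UPair z x y
/-- `⟨x, y⟩ ∈ R` -/
def PairC (m : Model) (x y : m.S) (R : m.C) : Prop := ∃ p, m.OPair p x y ∧ m.EC p R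
/-- `x ⊆ y` -/
def Sub (m : Model) (x y : m.S) : Prop := ∀ z, m.E z x → m.E z y
/-- `y = x ∪ {x}` -/
def Succ (m : Model) (x y : m.S) : Prop := ∀ z, m.E z y ↔ m.E z x ∨ z = x

@[simp] theorem sat_isUPair (p x y : ℕ) (e : ℕ → m.S) (f : ℕ → m.C) :
    m.Sat (isUPair p x y) e f ↔ m.UPair (e p) (e x) (e y) :=
  forall_congr' fun _ => sat_iff _ _ _ _
@[simp] theorem sat_isOPair (p x y : ℕ) (e : ℕ → m.S) (f : ℕ → m.C) :
    m.Sat (isOPair p x y) e f ↔ m.OPair (e p) (e x) (e y) :=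
  forall_congr' fun _ => (sat_iff _ _ _ _).trans
    (iff_congr Iff.rfl (or_congr (sat_isUPair _ _ _ _ _) (sat_isUPair _ _ _ _ _)))
@[simp] theorem sat_pairMemC (x y R : ℕ) (e : ℕ → m.S) (f : ℕ → m.C) :
    m.Sat (pairMemC x y R) e f ↔ m.PairC (e x) (e y) (f R) :=
  exists_congr fun _ => and_congr (sat_isOPair _ _ _ _ _) Iff.rfl
@[simp] theorem sat_isSubset (x y : ℕ) (e : ℕ → m.S) (f : ℕ → m.C) :
    m.Sat (isSubset x y) e f ↔ m.Sub (e x) (e y) := Iff.rfl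
@[simp] theorem sat_isSucc (x y : ℕ) (e : ℕ → m.S) (f : ℕ → m.C) :
    m.Sat (isSucc x y) e f ↔ m.Succ (e x) (e y) :=
  forall_congr' fun _ => sat_iff _ _ _ _

@[simp] theorem sat_shiftC (φ : Fml) (X : m.C) (e : ℕ → m.S) (f : ℕ → m.C) :
    m.Sat φ.shiftC e (cons X f) ↔ m.Sat φ e f := sat_rename ..

theorem sat_comprehension (φ : Fml) (e : ℕ → m.S) (f : ℕ → m.C) :
    m.Sat (comprehension φ) e f ↔ ∃ A, ∀ x, m.EC x A ↔ m.Sat φ (cons x e) f :=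
  exists_congr fun _ => forall_congr' fun _ => (sat_iff _ _ _ _).trans
    (iff_congr Iff.rfl (sat_shiftC _ _ _ _))

/-- Models of extensionality, pairing and comprehension. -/
structure Paired (m : Model) : Prop where
  ext : ∀ x y, (∀ z, m.E z x ↔ m.E z y) → x = y
  comp : ∀ φ e f, ∃ A, ∀ x, m.EC x A ↔ m.Sat φ (cons x e) f
  pair : ∀ x y, ∃ p, m.UPair p x y

/-- What is common to the models of the theories considered here. -/
structure Basic (m : Model) : Prop extends Paired m where
  extC : ∀ X Y, X = Y ↔ ∀ z, m.EC z X ↔ m.EC z Y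
  sep : ∀ A a, ∃ b, ∀ x, m.E x b ↔ m.EC x A ∧ m.E x a
  union : ∀ a, ∃ b, ∀ x, m.E x b ↔ ∃ y, m.E y a ∧ m.E x y
  power : ∀ a, ∃ b, ∀ x, m.E x b ↔ m.Sub x a
  inf : ∃ a, (∃ z, m.E z a ∧ ∀ w, ¬ m.E w z) ∧ ∀ x, m.E x a → ∃ y, m.E y a ∧ m.Succ x y

/-- Models of set theory with class induction and collection. -/
structure Full (m : Model) : Prop extends Basic m where
  ind : ∀ A, (∀ x, (∀ y, m.E y x → m.EC y A) → m.EC x A) → ∀ x, m.EC x A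
  coll : ∀ R a, (∀ x, m.E x a → ∃ y, m.PairC x y R) →
    ∃ b, ∀ x, m.E x a → ∃ y, m.E y b ∧ m.PairC x y R

theorem UPair.eq {p x y x' y' : m.S} (h : m.UPair p x y) (h' : m.UPair p x' y') :
    x = x' ∧ y = y' ∨ x = y' ∧ y = x' := by
  have h1 := (h' x).1 ((h x).2 (.inl rfl))
  have h2 := (h' y).1 ((h y).2 (.inr rfl))
  have h3 := (h x').1 ((h' x').2 (.inl rfl))
  have h4 := (h y').1 ((h' y').2 (.inr rfl))
  grind

namespace Paired

theorem uniq {P : m.S → Prop} {x y : m.S} (h : m.Paired) (hx : ∀ z, m.E z x ↔ P z)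
    (hy : ∀ z, m.E z y ↔ P z) : x = y := h.ext x y fun z => (hx z).trans (hy z).symm

theorem exists_opair (h : m.Paired) (x y : m.S) : ∃ p, m.OPair p x y := by
  obtain ⟨a, ha⟩ := h.pair x x
  obtain ⟨b, hb⟩ := h.pair x y
  obtain ⟨p, hp⟩ := h.pair a b
  refine ⟨p, fun z => (hp z).trans (or_congr ⟨?_, fun k => h.uniq k ha⟩ ⟨?_, fun k => h.uniq k hb⟩)⟩
  · rintro rfl; exact ha
  · rintro rfl; exact hb

theorem opair_eq (h : m.Paired) {p x y x' y' : m.S} (hp : m.OPair p x y) (hq : m.OPair p x' y') :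
    x = x' ∧ y = y' := by
  obtain ⟨a, ha⟩ := h.pair x x
  obtain ⟨b, hb⟩ := h.pair x y
  obtain ⟨b', hb'⟩ := h.pair x' y'
  have h1 := (hq a).1 ((hp a).2 (.inl ha))
  have h2 := (hq b).1 ((hp b).2 (.inr hb))
  have h3 := (hp b').1 ((hq b').2 (.inr hb'))
  have e1 : x = x' := by
    rcases h1 with h1 | h1 <;> have := ha.eq h1 <;> grind
  subst e1
  have e2 := h2.imp hb.eq hb.eq
  have e3 := h3.imp hb'.eq hb'.eq
  grind

/-- Comprehension for binary relations; variables `1` and `0` of the formula are the arguments. -/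
theorem comp₂ (h : m.Paired) (φ : Fml) (e : ℕ → m.S) (f : ℕ → m.C) :
    ∃ R, ∀ x y, m.PairC x y R ↔ m.Sat φ (cons y (cons x e)) f := by
  obtain ⟨R, hR⟩ := h.comp
    (.ex (.ex (.conj (isOPair 2 1 0) (φ.rename (up (up Nat.succ)) id)))) e f
  have key : ∀ p x y : m.S, m.Sat (φ.rename (up (up Nat.succ)) id) (cons y (cons x (cons p e))) f ↔
      m.Sat φ (cons y (cons x e)) f := fun p x y => by
    rw [sat_rename]
    refine iff_of_eq (congrArg₂ (m.Sat φ) (funext fun n => ?_) rfl)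
    rcases n with _ | _ | n <;> rfl
  refine ⟨R, fun x y => ⟨?_, fun k => ?_⟩⟩
  · rintro ⟨p, hp, hpR⟩
    obtain ⟨x', y', hp', k⟩ := (hR p).1 hpR
    obtain ⟨rfl, rfl⟩ := h.opair_eq hp ((sat_isOPair ..).1 hp')
    exact (key _ _ _).1 k
  · obtain ⟨p, hp⟩ := h.exists_opair x y
    exact ⟨p, hp, (hR p).2 ⟨x, y, (sat_isOPair ..).2 hp, (key _ _ _).2 k⟩⟩

end Paired
end Model

/-- An auxiliary classical theory with weak existence axioms, class induction and collection. -/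
inductive KMCAxiom : Fml → Prop
  | extensionality : KMCAxiom extensionality
  | pairing : KMCAxiom (all (all (ex (conj (mem 2 0) (mem 1 0)))))
  | union : KMCAxiom (all (ex (all (all (imp (mem 0 3) (imp (mem 1 0) (mem 1 2)))))))
  | powerset : KMCAxiom (all (ex (all (imp (isSubset 0 2) (mem 0 1)))))
  | infinity : KMCAxiom infinity
  | classExtensionality : KMCAxiom classExtensionality
  | classSeparation : KMCAxiom classSeparation
  | classSetInduction : KMCAxiom classSetInduction
  | classCollection : KMCAxiom classCollection
  | comprehension (φ : Fml) : KMCAxiom (comprehension φ)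

/-- The theory with the axioms `KMCAxiom` -/
def KMC : Theory := ⟨True, {φ | KMCAxiom φ}⟩

theorem Fml.IsPure.rename {φ : Fml} (h : φ.IsPure) (ρ σ : ℕ → ℕ) : (φ.rename ρ σ).IsPure := by
  induction φ generalizing ρ σ <;> simp_all [IsPure, Fml.rename]

theorem Fml.IsElementary.rename {φ : Fml} (h : φ.IsElementary) (ρ σ : ℕ → ℕ) :
    (φ.rename ρ σ).IsElementary := by
  induction φ generalizing ρ σ <;> simp_all [IsElementary, Fml.rename]

theorem comprehension_rename (φ : Fml) (ρ σ : ℕ → ℕ) :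
    (comprehension φ).rename ρ σ = comprehension (φ.rename (up ρ) σ) := by
  simp only [comprehension, iff, rename, ← shiftC_rename]; rfl

theorem separation_rename (φ : Fml) (ρ σ : ℕ → ℕ) :
    (separation φ).rename ρ σ = separation (φ.rename (up ρ) σ) := by
  have e : up (up (up ρ)) ∘ up (· + 2) = up (· + 2) ∘ up ρ := by funext n; cases n <;> rfl
  simp only [separation, iff, rename, rename_rename, e]; rfl

theorem setInduction_rename (φ : Fml) (ρ σ : ℕ → ℕ) :
    (setInduction φ).rename ρ σ = setInduction (φ.rename (up ρ) σ) := by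
  have e : up (up ρ) ∘ up Nat.succ = up Nat.succ ∘ up ρ := by funext n; cases n <;> rfl
  simp only [setInduction, ballIn, rename, rename_rename, e]; rfl

theorem collection_rename (φ : Fml) (ρ σ : ℕ → ℕ) :
    (collection φ).rename ρ σ = collection (φ.rename (up (up ρ)) σ) := by
  have e : up (up (up ρ)) ∘ up (up (· + 1)) = up (up (· + 1)) ∘ up (up ρ) := by
    funext n; rcases n with _ | _ | n <;> rfl
  have e' : up (up (up (up ρ))) ∘ up (up (· + 2)) = up (up (· + 2)) ∘ up (up ρ) := by
    funext n; rcases n with _ | _ | n <;> rfl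
  simp only [collection, ballIn, bexIn, rename, rename_rename, e, e']; rfl

/-- `replacement` with the occurrences of the formula as parameters. -/
def replacementForm (φ ψ χ : Fml) : Fml :=
  imp (all (all (all (imp (conj φ ψ) (eq 1 0)))))
    (all (ex (all (iff (mem 0 1) (bexIn 2 χ)))))

theorem replacement_rename (φ : Fml) (ρ σ : ℕ → ℕ) :
    (replacement φ).rename ρ σ = replacement (φ.rename (up (up ρ)) σ) := by
  refine (congr (congrArg₂ replacementForm ?_ ?_) ?_ :
    replacementForm _ _ _ = replacementForm _ _ _) <;>
  · rw [rename_rename, rename_rename]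
    exact rename_congr _ (fun n => by rcases n with _ | _ | n <;> rfl) fun _ => rfl

instance : IKM.Renamable where
  rename_mem := by
    intro φ h ρ σ
    cases h with
    | fullComprehension φ => exact comprehension_rename φ ρ σ ▸ .fullComprehension _
    | igb h =>
      refine .igb ?_
      cases h with
      | izf h =>
        refine .izf ?_
        cases h with
        | extensionality => exact .extensionality
        | pairing => exact .pairing
        | union => exact .union
        | infinity => exact .infinity
        | powerset => exact .powerset
        | setInduction φ h => exact setInduction_rename φ ρ σ ▸ .setInduction _ (h.rename _ _)
        | separation φ h => exact separation_rename φ ρ σ ▸ .separation _ (h.rename _ _)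
        | collection φ h => exact collection_rename φ ρ σ ▸ .collection _ (h.rename _ _)
      | classExtensionality => exact .classExtensionality
      | elementaryComprehension φ h =>
        exact comprehension_rename φ ρ σ ▸ .elementaryComprehension _ (h.rename _ _)
      | classSetInduction => exact .classSetInduction
      | classSeparation => exact .classSeparation
      | classCollection => exact .classCollection

instance : KM.Renamable where
  rename_mem := by
    intro φ h ρ σ
    cases h with
    | fullComprehension φ => exact comprehension_rename φ ρ σ ▸ .fullComprehension _
    | gb h =>
      refine .gb ?_
      cases h with
      | zf h =>
        refine .zf ?_
        cases h with
        | extensionality => exact .extensionality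
        | pairing => exact .pairing
        | union => exact .union
        | infinity => exact .infinity
        | powerset => exact .powerset
        | foundation => exact .foundation
        | separation φ h => exact separation_rename φ ρ σ ▸ .separation _ (h.rename _ _)
        | replacement φ h => exact replacement_rename φ ρ σ ▸ .replacement _ (h.rename _ _)
      | classExtensionality => exact .classExtensionality
      | elementaryComprehension φ h =>
        exact comprehension_rename φ ρ σ ▸ .elementaryComprehension _ (h.rename _ _)
      | classReplacement => exact .classReplacement

instance : KMC.Renamable where
  rename_mem := by
    rintro _ (_ | _) ρ σ
    case comprehension φ => exact comprehension_rename φ ρ σ ▸ .comprehension _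
    · exact .extensionality
    · exact .pairing
    · exact .union
    · exact .powerset
    · exact .infinity
    · exact .classExtensionality
    · exact .classSeparation
    · exact .classSetInduction
    · exact .classCollection

instance : IKM.Comprehension := ⟨fun φ => .fullComprehension φ⟩
instance : KM.Comprehension := ⟨fun φ => .fullComprehension φ⟩
instance : KMC.Comprehension := ⟨fun φ => .comprehension φ⟩

end SetClass


/-! ## Class induction and collection in models of `KM` -/

namespace SetClass

open Fml

namespace Model
variable {m : Model}

/-- `z` is the union of the powersets of the elements of `s` -/
def Par (m : Model) (z s : m.S) : Prop := ∀ v, m.E v z ↔ ∃ w, m.E w s ∧ m.Sub v w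

/-- `∀ v, v ∈ z ↔ ∃ w ∈ s, v ⊆ w` -/
def isPar (z s : ℕ) : Fml := all (iff (mem 0 (z + 1)) (bexIn (s + 1) (isSubset 1 0)))

@[simp] theorem sat_isPar (z s : ℕ) (e : ℕ → m.S) (f : ℕ → m.C) :
    m.Sat (isPar z s) e f ↔ m.Par (e z) (e s) := forall_congr' fun _ => sat_iff _ _ _ _

theorem Basic.exists_omega (h : m.Basic) (f : ℕ → m.C) : ∃ o, (∀ z, (∀ w, ¬ m.E w z) → m.E z o) ∧
    (∀ x y, m.E x o → m.Succ x y → m.E y o) ∧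
    ∀ X, (∀ z, (∀ w, ¬ m.E w z) → m.EC z X) →
      (∀ x y, m.E x o → m.EC x X → m.Succ x y → m.EC y X) → ∀ x, m.E x o → m.EC x X := by
  obtain ⟨a, ⟨z, hz, hz'⟩, ha⟩ := h.inf
  obtain ⟨N, hN⟩ := h.comp (allC (imp (conj (all (imp (isEmpty 0) (memC 0 0)))
    (all (all (imp (memC 1 0) (imp (isSucc 1 0) (memC 0 0)))))) (memC 0 0))) (fun _ => z) f
  have hN' : ∀ x, m.EC x N ↔ ∀ X, (∀ z, (∀ w, ¬ m.E w z) → m.EC z X) ∧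
      (∀ x y, m.EC x X → m.Succ x y → m.EC y X) → m.EC x X := by
    intro x; rw [hN]; simp [Sat, cons, isEmpty, neg]
  obtain ⟨o, ho⟩ := h.sep N a
  have h1 : ∀ z, (∀ w, ¬ m.E w z) → m.E z o := by
    intro y hy
    have : y = z := h.ext _ _ fun w => iff_of_false (hy w) (hz' w)
    subst this
    exact (ho _).2 ⟨(hN' _).2 fun X hX => hX.1 _ hy, hz⟩
  have h2 : ∀ x y, m.E x o → m.Succ x y → m.E y o := by
    intro x y hx hy
    obtain ⟨y', hy', hs⟩ := ha x ((ho _).1 hx).2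
    rw [h.uniq hy hs]
    exact (ho _).2 ⟨(hN' _).2 fun X hX => hX.2 _ _ ((hN' _).1 ((ho _).1 hx).1 X hX) hs, hy'⟩
  refine ⟨o, h1, h2, fun X hX hX' x hx => ?_⟩
  obtain ⟨Y, hY⟩ := h.comp (conj (mem 0 1) (memC 0 0)) (fun _ => o) (fun _ => X)
  exact ((hY _).1 ((hN' x).1 ((ho _).1 hx).1 Y ⟨fun z hz => (hY _).2 ⟨h1 z hz, hX z hz⟩,
    fun x y hx hy => (hY _).2 ⟨h2 _ _ ((hY _).1 hx).1 hy,
      hX' _ _ ((hY _).1 hx).1 ((hY _).1 hx).2 hy⟩⟩)).2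

/-- Models of set theory with class replacement and foundation. -/
structure Repl (m : Model) : Prop extends Basic m where
  found : ∀ x, (∃ y, m.E y x) → ∃ y, m.E y x ∧ ∀ z, m.E z y → ¬ m.E z x
  repl : ∀ F, (∀ x y z, m.PairC x y F → m.PairC x z F → y = z) →
    ∀ a, ∃ b, ∀ y, m.E y b ↔ ∃ x, m.E x a ∧ m.PairC x y F

namespace Repl

theorem succ_inj (h : m.Repl) {a b c : m.S} (h1 : m.Succ a b) (h2 : m.Succ c b) : a = c := by
  obtain ⟨p, hp⟩ := h.pair a c
  have k1 := (h2 a).1 ((h1 a).2 (.inr rfl))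
  have k2 := (h1 c).1 ((h2 c).2 (.inr rfl))
  rcases k1 with k1 | k1
  · rcases k2 with k2 | k2
    · obtain ⟨y, hy, hy'⟩ := h.found p ⟨a, (hp a).2 (.inl rfl)⟩
      rcases (hp y).1 hy with rfl | rfl
      · exact (hy' _ k2 ((hp _).2 (.inr rfl))).elim
      · exact (hy' _ k1 ((hp _).2 (.inl rfl))).elim
    · exact k2.symm
  · exact k1

theorem exists_transitive (h : m.Repl) (f : ℕ → m.C) (x₀ : m.S) :
    ∃ T, (∀ z, m.E z x₀ → m.E z T) ∧ ∀ y, m.E y T → ∀ z, m.E z y → m.E z T := by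
  obtain ⟨o, ho, hs, hi⟩ := h.exists_omega f
  obtain ⟨D, hD⟩ := h.comp₂ (allC (imp (conj
    (all (imp (mem 0 3) (all (imp (isEmpty 0) (pairMemC 0 1 0)))))
    (all (all (all (all (imp (pairMemC 3 1 0) (imp (mem 0 1) (imp (isSucc 3 2) (pairMemC 2 0 0)))))))))
    (pairMemC 1 0 0))) (fun _ => x₀) f
  have hD : ∀ n y, m.PairC n y D ↔ ∀ X, (∀ z, m.E z x₀ → ∀ o, (∀ w, ¬ m.E w o) → m.PairC o z X) ∧
      (∀ n n' y z, m.PairC n y X → m.E z y → m.Succ n n' → m.PairC n' z X) → m.PairC n y X := by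
    intro x y; rw [hD]; simp [Sat, cons, isEmpty, neg]
  have base : ∀ z, m.E z x₀ → ∀ o, (∀ w, ¬ m.E w o) → m.PairC o z D :=
    fun z hz o ho => (hD _ _).2 fun X hX => hX.1 z hz o ho
  have step : ∀ n n' y z, m.PairC n y D → m.E z y → m.Succ n n' → m.PairC n' z D :=
    fun n n' y z k hz hn => (hD _ _).2 fun X hX => hX.2 n n' y z ((hD _ _).1 k X hX) hz hn
  have inv₀ : ∀ n y, m.PairC n y D → (∀ w, ¬ m.E w n) → m.E y x₀ := by
    intro n y k
    obtain ⟨X, hX⟩ := h.comp₂ (imp (isEmpty 1) (mem 0 2)) (fun _ => x₀) f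
    refine (hX _ _).1 ((hD n y).1 k X ⟨fun z hz o ho => (hX _ _).2 fun _ => hz,
      fun n n' y z _ _ hn => (hX _ _).2 fun hn' => (hn' n ((hn n).2 (.inr rfl))).elim⟩)
  have inv₁ : ∀ n n' z, m.Succ n n' → m.PairC n' z D → ∃ y, m.PairC n y D ∧ m.E z y := by
    intro n n' z hn k
    obtain ⟨X, hX⟩ := h.comp₂ (conj (pairMemC 1 0 0) (imp (eq 1 2) (ex (conj (pairMemC 4 0 0) (mem 1 0)))))
      (cons n' (fun _ => n)) (fun _ => D)
    have hX : ∀ n₁ z, m.PairC n₁ z X ↔ m.PairC n₁ z D ∧ (n₁ = n' → ∃ y, m.PairC n y D ∧ m.E z y) := by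
      intro n₁ z; rw [hX]; simp [Sat, cons]
    refine ((hX _ _).1 ((hD _ _).1 k X ⟨fun z hz o ho => (hX _ _).2 ⟨base z hz o ho, ?_⟩,
      fun k k' y z k₁ hz hk => (hX _ _).2 ⟨step _ _ _ _ ((hX _ _).1 k₁).1 hz hk, ?_⟩⟩)).2 rfl
    · rintro rfl; exact (ho _ ((hn n).2 (.inr rfl))).elim
    · rintro rfl; exact ⟨y, h.succ_inj hk hn ▸ ((hX _ _).1 k₁).1, hz⟩
  obtain ⟨F, hF⟩ := h.comp₂ (all (iff (mem 0 1) (pairMemC 2 0 0))) (fun _ => x₀) (fun _ => D)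
  have hF : ∀ n t, m.PairC n t F ↔ ∀ y, m.E y t ↔ m.PairC n y D := by
    intro n t; rw [hF]; simp [Sat, cons]
  obtain ⟨X, hX⟩ := h.comp (ex (pairMemC 1 0 0)) (fun _ => x₀) (fun _ => F)
  have hX : ∀ n, m.EC n X ↔ ∃ t, m.PairC n t F := by intro n; rw [hX]; simp [Sat, cons]
  have tot : ∀ n, m.E n o → m.EC n X := by
    refine hi X (fun z hz => (hX _).2 ?_) fun n n' _ k hn => (hX _).2 ?_
    · refine ⟨x₀, (hF _ _).2 fun y => ⟨fun k => base _ k _ hz, fun k => inv₀ _ _ k hz⟩⟩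
    · obtain ⟨t, ht⟩ := (hX _).1 k
      obtain ⟨u, hu⟩ := h.union t
      refine ⟨u, (hF _ _).2 fun z => (hu z).trans ⟨?_, fun k => ?_⟩⟩
      · rintro ⟨y, hy, hz⟩; exact step _ _ _ _ (((hF _ _).1 ht y).1 hy) hz hn
      · obtain ⟨y, hy, hz⟩ := inv₁ _ _ _ hn k
        exact ⟨y, ((hF _ _).1 ht y).2 hy, hz⟩
  obtain ⟨b, hb⟩ := h.repl F (fun x y z hy hz => h.uniq ((hF _ _).1 hy) ((hF _ _).1 hz)) o
  obtain ⟨T, hT⟩ := h.union b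
  have hT : ∀ z, m.E z T ↔ ∃ n, m.E n o ∧ m.PairC n z D := by
    intro z
    refine (hT z).trans ⟨?_, ?_⟩
    · rintro ⟨t, ht, hz⟩
      obtain ⟨n, hn, k⟩ := (hb t).1 ht
      exact ⟨n, hn, ((hF _ _).1 k z).1 hz⟩
    · rintro ⟨n, hn, k⟩
      obtain ⟨t, ht⟩ := (hX _).1 (tot n hn)
      exact ⟨t, (hb t).2 ⟨n, hn, ht⟩, ((hF _ _).1 ht z).2 k⟩
  refine ⟨T, fun z hz => ?_, fun y hy z hz => ?_⟩
  · obtain ⟨a, ⟨e, _, he⟩, _⟩ := h.inf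
    exact (hT _).2 ⟨e, ho e he, base _ hz _ he⟩
  · obtain ⟨n, hn, k⟩ := (hT _).1 hy
    obtain ⟨s, hs₁⟩ := h.pair n n
    obtain ⟨p, hp⟩ := h.pair n s
    obtain ⟨n', hn'⟩ := h.union p
    have : m.Succ n n' := fun z => (hn' z).trans ⟨?_, ?_⟩
    · exact (hT _).2 ⟨n', hs _ _ hn this, step _ _ _ _ k hz this⟩
    · rintro ⟨y, hy, hz⟩
      rcases (hp y).1 hy with rfl | rfl
      · exact .inl hz
      · exact .inr (((hs₁ z).1 hz).elim id id)
    · rintro (k | rfl)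
      · exact ⟨n, (hp n).2 (.inl rfl), k⟩
      · exact ⟨s, (hp s).2 (.inr rfl), (hs₁ _).2 (.inl rfl)⟩

theorem ind (h : m.Repl) (A : m.C) (hA : ∀ x, (∀ y, m.E y x → m.EC y A) → m.EC x A) (x : m.S) :
    m.EC x A := by
  by_contra hx
  obtain ⟨T, hT, hT'⟩ := h.exists_transitive (fun _ => A) x
  obtain ⟨N, hN⟩ := h.comp (neg (memC 0 0)) (fun _ => x) (fun _ => A)
  obtain ⟨b, hb⟩ := h.sep N T
  have : ∃ y, m.E y b := by
    by_contra! H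
    refine hx (hA x fun y hy => by_contra fun k => H y ((hb _).2 ⟨(hN _).2 k, hT _ hy⟩))
  obtain ⟨y, hy, hy'⟩ := h.found b this
  exact (hN _).1 ((hb _).1 hy).1 (hA y fun z hz => by_contra fun k => hy' z hz
    ((hb _).2 ⟨(hN _).2 k, hT' _ ((hb _).1 hy).2 _ hz⟩))

theorem exists_par (h : m.Repl) (f : ℕ → m.C) (s : m.S) : ∃ z, m.Par z s := by
  obtain ⟨u, hu⟩ := h.union s
  obtain ⟨p, hp⟩ := h.power u
  obtain ⟨A, hA⟩ := h.comp (bexIn 1 (isSubset 1 0)) (fun _ => s) f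
  obtain ⟨z, hz⟩ := h.sep A p
  refine ⟨z, fun v => (hz v).trans ⟨fun k => (hA _).1 k.1, ?_⟩⟩
  rintro ⟨w, hw, hv⟩
  exact ⟨(hA _).2 ⟨w, hw, hv⟩, (hp _).2 fun y hy => (hu _).2 ⟨w, hw, hv y hy⟩⟩

/-- A hierarchy of levels that exhausts the universe. -/
theorem exists_levels (h : m.Repl) (f : ℕ → m.C) : ∃ L,
    (∀ s z, (∀ w, m.E w s → m.EC w L) → m.Par z s → m.EC z L) ∧
    ∀ z z', m.EC z L → m.EC z' L → m.Sub z z' ∨ ∀ v, m.Sub v z' → m.E v z := by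
  obtain ⟨_, ⟨x₀, _⟩, _⟩ := h.inf
  obtain ⟨L, hL⟩ := h.comp (allC (imp (all (all (imp (ballIn 1 (memC 0 0))
    (imp (isPar 0 1) (memC 0 0))))) (memC 0 0))) (fun _ => x₀) f
  have hL : ∀ z, m.EC z L ↔ ∀ X, (∀ s z, (∀ w, m.E w s → m.EC w X) → m.Par z s → m.EC z X) →
      m.EC z X := by
    intro z; rw [hL]; simp [Sat, cons, ballIn]
  have intro : ∀ s z, (∀ w, m.E w s → m.EC w L) → m.Par z s → m.EC z L :=
    fun s z hs hz => (hL z).2 fun X hX => hX s z (fun w hw => (hL w).1 (hs w hw) X hX) hz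
  have inv : ∀ z, m.EC z L → ∃ s, (∀ w, m.E w s → m.EC w L) ∧ m.Par z s := by
    intro z hz
    obtain ⟨X, hX⟩ := h.comp (conj (memC 0 0) (ex (conj (ballIn 0 (memC 0 0)) (isPar 1 0))))
      (fun _ => x₀) (fun _ => L)
    have hX : ∀ z, m.EC z X ↔ m.EC z L ∧ ∃ s, (∀ w, m.E w s → m.EC w L) ∧ m.Par z s := by
      intro z; rw [hX]; simp [Sat, cons, ballIn]
    exact ((hX z).1 ((hL z).1 hz X fun s z hs hz =>
      have := fun w hw => ((hX w).1 (hs w hw)).1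
      (hX _).2 ⟨intro s z this hz, s, this, hz⟩)).2
  refine ⟨L, intro, fun z z' hz => ?_⟩
  obtain ⟨X, hX⟩ := h.comp (all (imp (memC 0 0) (disj (isSubset 1 0)
    (all (imp (isSubset 0 1) (mem 0 2)))))) (fun _ => x₀) (fun _ => L)
  have hX : ∀ z, m.EC z X ↔ ∀ z', m.EC z' L → m.Sub z z' ∨ ∀ v, m.Sub v z' → m.E v z := by
    intro z; rw [hX]; simp [Sat, cons]
  refine (hX z).1 ((hL z).1 hz X fun s z hs hz => (hX z).2 fun z' hz' => ?_) z'
  obtain ⟨s', hs', hz'⟩ := inv z' hz'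
  by_cases H : ∀ u, m.E u s → ∃ w, m.E w s' ∧ m.Sub u w
  · refine .inl fun v hv => ?_
    obtain ⟨u, hu, hvu⟩ := (hz v).1 hv
    obtain ⟨w, hw, huw⟩ := H u hu
    exact (hz' v).2 ⟨w, hw, fun y hy => huw y (hvu y hy)⟩
  · push Not at H
    obtain ⟨u, hu, H⟩ := H
    refine .inr fun v hv => (hz v).2 ⟨u, hu, fun y hy => ?_⟩
    obtain ⟨w, hw, hyw⟩ := (hz' y).1 (hv y hy)
    exact ((hX u).1 (hs u hu) w (hs' w hw)).resolve_left (H w hw) y hyw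

/-- The least levels with some property. -/
theorem exists_least (h : m.Repl) {L : m.C}
    (hL : ∀ z z', m.EC z L → m.EC z' L → m.Sub z z' ∨ ∀ v, m.Sub v z' → m.E v z) (Q : m.C)
    (hQ : ∃ w, m.EC w L ∧ m.EC w Q) :
    ∃ w, m.EC w L ∧ m.EC w Q ∧ ∀ w', m.EC w' L → m.EC w' Q → m.Sub w w' := by
  by_contra! H
  obtain ⟨w, hw, hwQ⟩ := hQ
  obtain ⟨N, hN⟩ := h.comp (imp (memC 0 0) (neg (memC 0 1))) (fun _ => w) (cons L fun _ => Q)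
  refine (hN w).1 (h.ind N (fun x hx => (hN x).2 fun hxL hxQ => ?_) w) hw hwQ
  obtain ⟨w', h1, h2, h3⟩ := H x hxL hxQ
  refine (hN w').1 (hx w' ?_) h1 h2
  exact (hL x w' hxL h1).resolve_left h3 w' fun _ => id

theorem coll (h : m.Repl) (R : m.C) (a : m.S) (hR : ∀ x, m.E x a → ∃ y, m.PairC x y R) :
    ∃ b, ∀ x, m.E x a → ∃ y, m.E y b ∧ m.PairC x y R := by
  obtain ⟨L, intro, lin⟩ := h.exists_levels fun _ => R
  have bound : ∀ (a : m.S) (R : m.C), ∃ z, m.EC z L ∧ ∀ x, m.E x a →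
      (∃ w y, m.EC w L ∧ m.PairC x y R ∧ m.Sub y w) → ∃ y, m.E y z ∧ m.PairC x y R := by
    intro a R
    have hF := h.comp₂ (conj (conj (memC 0 0) (ex (conj (pairMemC 2 0 1) (isSubset 0 1))))
      (all (imp (memC 0 0) (imp (ex (conj (pairMemC 3 0 1) (isSubset 0 1))) (isSubset 1 0)))))
      (fun _ => a) (cons L fun _ => R)
    obtain ⟨F, hF⟩ := hF
    have hF : ∀ x w, m.PairC x w F ↔ (m.EC w L ∧ ∃ y, m.PairC x y R ∧ m.Sub y w) ∧
        ∀ w', m.EC w' L → (∃ y, m.PairC x y R ∧ m.Sub y w') → m.Sub w w' := by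
      intro x w; rw [hF]; simp only [Sat, cons, sat_pairMemC, sat_isSubset]
    obtain ⟨s, hs⟩ := h.repl F (fun x y z hy hz => by
      have hy := (hF _ _).1 hy
      have hz := (hF _ _).1 hz
      exact h.ext _ _ fun v => ⟨hy.2 z hz.1.1 hz.1.2 v, hz.2 y hy.1.1 hy.1.2 v⟩) a
    obtain ⟨z, hz⟩ := h.exists_par (fun _ => R) s
    refine ⟨z, intro s z (fun w hw => ?_) hz, ?_⟩
    · obtain ⟨x, _, k⟩ := (hs w).1 hw
      exact ((hF _ _).1 k).1.1
    · rintro x hx ⟨w, y, hw, hy, hyw⟩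
      obtain ⟨Q, hQ⟩ := h.comp (ex (conj (pairMemC 2 0 0) (isSubset 0 1))) (fun _ => x) (fun _ => R)
      have hQ : ∀ w, m.EC w Q ↔ ∃ y, m.PairC x y R ∧ m.Sub y w := by
        intro w; rw [hQ]; simp only [Sat, cons, sat_pairMemC, sat_isSubset]
      obtain ⟨w, hw, hwQ, hmin⟩ := h.exists_least lin Q ⟨w, hw, (hQ w).2 ⟨y, hy, hyw⟩⟩
      obtain ⟨y, hy, hyw⟩ := (hQ w).1 hwQ
      exact ⟨y, (hz y).2 ⟨w, (hs w).2 ⟨x, hx, (hF _ _).2 ⟨⟨hw, y, hy, hyw⟩,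
        fun w' hw' k => hmin w' hw' ((hQ _).2 k)⟩⟩, hyw⟩, hy⟩
  obtain ⟨A, hA⟩ := h.comp (ex (conj (memC 0 0) (isSubset 1 0))) (fun _ => a) (fun _ => L)
  have hA : ∀ x, m.EC x A ↔ ∃ w, m.EC w L ∧ m.Sub x w := by
    intro x; rw [hA]; simp [Sat, cons]
  have all : ∀ x, m.EC x A := h.ind A fun x hx => (hA x).2 <| by
    obtain ⟨I, hI⟩ := h.comp₂ (eq 1 0) (fun _ => a) (fun _ => L)
    obtain ⟨z, hz, hz'⟩ := bound x I
    refine ⟨z, hz, fun y hy => ?_⟩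
    obtain ⟨w, hw, hyw⟩ := (hA y).1 (hx y hy)
    obtain ⟨y', hy', k⟩ := hz' y hy ⟨w, y, hw, (hI _ _).2 rfl, hyw⟩
    obtain rfl : y = y' := (hI _ _).1 k
    exact hy'
  obtain ⟨z, -, hz⟩ := bound a R
  refine ⟨z, fun x hx => hz x hx ?_⟩
  obtain ⟨y, hy⟩ := hR x hx
  obtain ⟨w, hw, hyw⟩ := (hA y).1 (all y)
  exact ⟨w, y, hw, hy, hyw⟩

theorem full (h : m.Repl) : m.Full := { h.toBasic with ind := h.ind, coll := h.coll }

end Repl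

/-- Models of `KM`. -/
theorem Models.repl (h : m.Models KM) (e : ℕ → m.S) (f : ℕ → m.C) : m.Repl := by
  have zf : ∀ φ, ZFAxiom φ → m.Sat φ e f := fun φ k => h φ (.gb (.zf k)) e f
  have ext : ∀ x y, (∀ z, m.E z x ↔ m.E z y) → x = y := by
    simpa [extensionality, Sat, cons] using zf _ .extensionality
  have pair : ∀ x y, ∃ p, m.UPair p x y := by
    simpa [pairing, Sat, cons] using zf _ .pairing
  have comp : ∀ φ e f, ∃ A, ∀ x, m.EC x A ↔ m.Sat φ (cons x e) f := fun φ e f =>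
    (sat_comprehension φ e f).1 (h _ (.fullComprehension φ) e f)
  have repl : ∀ F, (∀ x y z, m.PairC x y F → m.PairC x z F → y = z) →
      ∀ a, ∃ b, ∀ y, m.E y b ↔ ∃ x, m.E x a ∧ m.PairC x y F := by
    have := h _ (.gb .classReplacement) e f
    simpa only [classReplacement, Sat, cons, sat_iff, sat_pairMemC, bexIn, and_imp] using this
  have hp : m.Paired := ⟨ext, comp, pair⟩
  refine { ext, comp, pair, repl, extC := ?_, sep := ?_, union := ?_, power := ?_, inf := ?_,
           found := ?_ }
  · simpa [classExtensionality, Sat, cons] using h _ (.gb .classExtensionality) e f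
  · intro A a
    obtain ⟨F, hF⟩ := hp.comp₂ (conj (eq 0 1) (memC 0 0)) e (fun _ => A)
    have hF : ∀ x y, m.PairC x y F ↔ y = x ∧ m.EC y A := by intro x y; rw [hF]; simp [Sat, cons]
    obtain ⟨b, hb⟩ := repl F (fun x y z hy hz => ((hF _ _).1 hy).1.trans ((hF _ _).1 hz).1.symm) a
    refine ⟨b, fun x => (hb x).trans ⟨?_, fun k => ⟨x, k.2, (hF _ _).2 ⟨rfl, k.1⟩⟩⟩⟩
    rintro ⟨y, hy, k⟩
    obtain ⟨rfl, hx⟩ := (hF _ _).1 k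
    exact ⟨hx, hy⟩
  · simpa [SetClass.union, Sat, cons, bexIn] using zf _ .union
  · simpa [powerset, Sat, cons] using zf _ .powerset
  · simpa [infinity, isInductive, isEmpty, neg, ballIn, Sat, cons, bexIn] using zf _ .infinity
  · simpa [foundation, neg, ballIn, Sat, cons, bexIn] using zf _ .foundation

/-- Models of `KMC`. -/
theorem Models.full (h : m.Models KMC) (e : ℕ → m.S) (f : ℕ → m.C) : m.Full := by
  have ax : ∀ φ, KMCAxiom φ → m.Sat φ e f := fun φ k => h φ k e f
  have comp : ∀ φ e f, ∃ A, ∀ x, m.EC x A ↔ m.Sat φ (cons x e) f := fun φ e f =>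
    (sat_comprehension φ e f).1 (h _ (.comprehension φ) e f)
  have sep : ∀ A a, ∃ b, ∀ x, m.E x b ↔ m.EC x A ∧ m.E x a := by
    simpa [classSeparation, Sat, cons] using ax _ .classSeparation
  have comp' : ∀ (φ : Fml) e f a, (∀ x, m.Sat φ (cons x e) f → m.E x a) →
      ∃ b, ∀ x, m.E x b ↔ m.Sat φ (cons x e) f := fun φ e f a H => by
    obtain ⟨A, hA⟩ := comp φ e f
    obtain ⟨b, hb⟩ := sep A a
    exact ⟨b, fun x => (hb x).trans ⟨fun k => (hA x).1 k.1, fun k => ⟨(hA x).2 k, H x k⟩⟩⟩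
  refine { comp, sep, ext := ?_, pair := ?_, extC := ?_, union := ?_, power := ?_, inf := ?_,
           ind := ?_, coll := ?_ }
  · simpa [extensionality, Sat, cons] using ax _ .extensionality
  · intro x y
    have : ∀ x y, ∃ p, m.E x p ∧ m.E y p := ax _ .pairing
    obtain ⟨p, hp⟩ := this x y
    refine comp' (disj (eq 0 1) (eq 0 2)) (cons x (cons y e)) f p ?_
    intro z hz
    rcases (show z = x ∨ z = y from hz) with rfl | rfl
    exacts [hp.1, hp.2]
  · simpa [classExtensionality, Sat, cons] using ax _ .classExtensionality
  · intro a
    have : ∀ a, ∃ b, ∀ x y, m.E y a → m.E x y → m.E x b := ax _ .union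
    obtain ⟨p, hp⟩ := this a
    refine comp' (ex (conj (mem 0 2) (mem 1 0))) (cons a e) f p ?_
    rintro z ⟨y, hy, hz⟩
    exact hp z y hy hz
  · intro a
    have : ∀ a, ∃ b, ∀ x, m.Sub x a → m.E x b := ax _ .powerset
    obtain ⟨p, hp⟩ := this a
    exact comp' (isSubset 0 1) (cons a e) f p hp
  · simpa [infinity, isInductive, isEmpty, neg, ballIn, Sat, cons, bexIn] using ax _ .infinity
  · simpa [classSetInduction, ballIn, Sat, cons] using ax _ .classSetInduction
  · simpa [classCollection, ballIn, bexIn, Sat, cons] using ax _ .classCollection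

namespace Full

theorem found (h : m.Full) (x : m.S) (hx : ∃ y, m.E y x) (f : ℕ → m.C) :
    ∃ y, m.E y x ∧ ∀ z, m.E z y → ¬ m.E z x := by
  by_contra! H
  obtain ⟨y, hy⟩ := hx
  obtain ⟨N, hN⟩ := h.comp (neg (mem 0 1)) (fun _ => x) f
  exact (hN y).1 (h.ind N (fun z hz => (hN z).2 fun k => by
    obtain ⟨w, hw, hw'⟩ := H z k
    exact (hN w).1 (hz w hw) hw') y) hy

theorem repl (h : m.Full) (F : m.C) (hF : ∀ x y z, m.PairC x y F → m.PairC x z F → y = z)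
    (a : m.S) : ∃ b, ∀ y, m.E y b ↔ ∃ x, m.E x a ∧ m.PairC x y F := by
  obtain ⟨D, hD⟩ := h.comp (ex (pairMemC 1 0 0)) (fun _ => a) (fun _ => F)
  have hD : ∀ x, m.EC x D ↔ ∃ y, m.PairC x y F := by intro x; rw [hD]; simp [Sat, cons]
  obtain ⟨a', ha'⟩ := h.sep D a
  obtain ⟨b, hb⟩ := h.coll F a' fun x hx => (hD x).1 ((ha' x).1 hx).1
  obtain ⟨I, hI⟩ := h.comp (ex (conj (mem 0 2) (pairMemC 0 1 0))) (fun _ => a) (fun _ => F)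
  have hI : ∀ y, m.EC y I ↔ ∃ x, m.E x a ∧ m.PairC x y F := by intro x; rw [hI]; simp [Sat, cons]
  obtain ⟨c, hc⟩ := h.sep I b
  refine ⟨c, fun y => (hc y).trans ⟨fun k => (hI y).1 k.1, fun k => ⟨(hI y).2 k, ?_⟩⟩⟩
  obtain ⟨x, hx, hy⟩ := k
  obtain ⟨z, hz, k⟩ := hb x ((ha' x).2 ⟨(hD x).2 ⟨y, hy⟩, hx⟩)
  exact hF x y z hy k ▸ hz

end Full

/-- The axioms without formula parameters. -/
def closedAxioms : List Fml :=
  [extensionality, pairing, SetClass.union, infinity, powerset, foundation, classExtensionality,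
    classSetInduction, classSeparation, classCollection, classReplacement]

theorem Full.closedAxioms (h : m.Full) {φ : Fml} (hφ : φ ∈ closedAxioms) (e : ℕ → m.S)
    (f : ℕ → m.C) : m.Sat φ e f := by
  simp only [Model.closedAxioms, List.mem_cons, List.not_mem_nil, or_false] at hφ
  rcases hφ with rfl | rfl | rfl | rfl | rfl | rfl | rfl | rfl | rfl | rfl | rfl
  · simpa [extensionality, Sat, cons] using h.ext
  · simpa [pairing, Sat, cons] using h.pair
  · simpa [SetClass.union, Sat, cons, bexIn] using h.union
  · simpa [infinity, isInductive, isEmpty, neg, ballIn, Sat, cons, bexIn] using h.inf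
  · simpa [powerset, Sat, cons] using h.power
  · simpa [foundation, neg, ballIn, Sat, cons, bexIn] using fun x y hy => h.found x ⟨y, hy⟩ f
  · simpa [classExtensionality, Sat, cons] using h.extC
  · simpa [classSetInduction, ballIn, Sat, cons] using h.ind
  · simpa [classSeparation, Sat, cons] using h.sep
  · simpa [classCollection, ballIn, bexIn, Sat, cons] using h.coll
  · simpa only [classReplacement, Sat, cons, sat_iff, sat_pairMemC, bexIn, and_imp] using h.repl

end Model

/-- The two classical theories. -/
class Theory.IsKM (T : Theory) : Prop extends T.Renamable, T.Comprehension where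
  classical : T.classical
  full : ∀ m : Model, m.Models T → (ℕ → m.S) → (ℕ → m.C) → m.Full

instance : KM.IsKM where
  classical := trivial
  full _ h e f := (h.repl e f).full

instance : KMC.IsKM where
  classical := trivial
  full _ h e f := h.full e f

/-- What holds in all full models is derivable. -/
theorem Prv.of_full {T : Theory} [hT : T.IsKM] {φ : Fml}
    (h : ∀ m : Model, m.Full → ∀ e f, m.Sat φ e f) : Prv T [] φ :=
  .of_models hT.classical fun m hm e f => h m (hT.full m hm e f) e f

end SetClass


/-! ## Uniform derivations of the axiom schemes -/

namespace SetClass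

open Fml

section
variable {α : Type} {c : α → ℕ}

namespace PF

@[simp] theorem ren_ren {ρ σ ρ' σ' : ℕ → ℕ} (hρ hσ hρ' hσ') (φ : PF c) :
    (φ.ren ρ σ hρ hσ).ren ρ' σ' hρ' hσ' =
      φ.ren (ρ' ∘ ρ) (σ' ∘ σ) (hρ'.comp hρ) (hσ'.comp hσ) := by
  ext a; exact rename_rename _ _ _ _ _

theorem ren_congr {ρ σ ρ' σ' : ℕ → ℕ} {hρ hσ hρ' hσ'} (φ : PF c) (h : ∀ n, ρ n = ρ' n)
    (h' : ∀ n, σ n = σ' n) : φ.ren ρ σ hρ hσ = φ.ren ρ' σ' hρ' hσ' := by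
  ext a; exact rename_congr _ h h'

theorem inst_const (φ : PF c) (t : ℕ) : φ.inst (.const t) =
    φ.ren (instRen t) id (instRen_primrec.comp (.const t) .id) .id := rfl
theorem under_eq (φ : PF c) : φ.under = φ.ren (up Nat.succ) id (up_primrec .succ) .id := rfl

end PF

theorem primrec_of_cases {ρ : ℕ → ℕ} {σ : ℕ → ℕ} (h : Primrec σ) (a b : ℕ) (h0 : ρ 0 = a) (h1 : ρ 1 = b)
    (h2 : ∀ n, ρ (n + 2) = σ n) : Primrec ρ := by
  have : Primrec fun n : ℕ => (Nat.casesOn n a fun m => Nat.casesOn m b fun k => σ k : ℕ) :=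
    Primrec.nat_casesOn .id (.const a) ((Primrec.nat_casesOn Primrec.snd (.const b)
      (h.comp Primrec.snd).to₂).to₂)
  exact this.of_eq fun n => by rcases n with _ | _ | n <;> simp [h0, h1, h2]

/-- The renaming that sends the variables `0` and `1` to `a` and `b` and raises the others. -/
def ren₂ (a b k : ℕ) : ℕ → ℕ
  | 0 => a
  | 1 => b
  | n + 2 => n + k

theorem ren₂_primrec (a b k : ℕ) : Primrec (ren₂ a b k) :=
  primrec_of_cases (Primrec.nat_add.comp .id (.const k)) a b rfl rfl fun _ => rfl

/-- `φ(x, y)`, where the variables `1` and `0` of `φ` are the arguments, below `k` quantifiers. -/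
def PF.at₂ (φ : PF c) (x y k : ℕ) : PF c := φ.ren (ren₂ y x k) id (ren₂_primrec y x k) .id

theorem PF.at₂_ren (φ : PF c) (x y k k' : ℕ) (ρ : ℕ → ℕ) (hρ : Primrec ρ) (h : ∀ n, ρ (n + k) = n + k') :
    (φ.at₂ x y k).ren ρ id hρ .id = φ.at₂ (ρ x) (ρ y) k' := by
  simp only [PF.at₂, PF.ren_ren]
  exact PF.ren_congr _ (fun n => by rcases n with _ | _ | n <;> simp [ren₂, h]) fun _ => rfl

theorem PF.at₂_shift (φ : PF c) (x y k : ℕ) : (φ.at₂ x y k).shift = φ.at₂ (x + 1) (y + 1) (k + 1) :=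
  φ.at₂_ren x y k (k + 1) Nat.succ .succ fun _ => rfl

/-- Restriction of a family. -/
def PF.comap {β : Type} (i : β → α) (φ : PF c) : PF (fun b => c (i b)) := ⟨fun b => φ.f (i b), φ.pr.comap i⟩

/-- Restriction of a family. -/
def PL.comap {β : Type} (i : β → α) (Γ : PL c) : PL (fun b => c (i b)) :=
  ⟨fun b => Γ.f (i b), Γ.pr.comap i⟩

namespace Pv
variable {T : Theory} {Γ : PL c} {φ ψ χ : PF c}

/-- Derivations can be found by distinction of cases. -/
theorem ite {p : α → Bool} (hp : PR c p)
    (h₁ : Pv T (Γ.comap (Subtype.val : {a // p a = true} → α)) (φ.comap Subtype.val))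
    (h₂ : Pv T (Γ.comap (Subtype.val : {a // p a = false} → α)) (φ.comap Subtype.val)) :
    Pv T Γ φ := by
  obtain ⟨n₁, ⟨g₁, hg₁, e₁⟩, k₁⟩ := h₁
  obtain ⟨n₂, ⟨g₂, hg₂, e₂⟩, k₂⟩ := h₂
  refine ⟨_, .ite hp ⟨g₁, hg₁, fun _ => rfl⟩ ⟨g₂, hg₂, fun _ => rfl⟩, fun a => ?_⟩
  cases h : p a with
  | true => simpa [e₁, PL.comap, PF.comap] using k₁ ⟨a, h⟩
  | false => simpa [e₂, PL.comap, PF.comap] using k₂ ⟨a, h⟩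

theorem subst₂ {x y x' y' k : ℕ} (φ : PF c) (h : Pv T Γ (.eq (.const x) (.const x')))
    (h' : Pv T Γ (.eq (.const y) (.const y'))) (hφ : Pv T Γ (φ.at₂ x y k)) :
    Pv T Γ (φ.at₂ x' y' k) := by
  have e₁ : ∀ z, φ.at₂ z y k = (φ.at₂ 0 (y + 1) (k + 1)).inst (.const z) := fun z => by
    simp only [PF.inst_const, PF.at₂, PF.ren_ren]
    exact PF.ren_congr _ (fun n => by rcases n with _ | _ | n <;> rfl) fun _ => rfl
  have e₂ : ∀ z, φ.at₂ x' z k = (φ.at₂ (x' + 1) 0 (k + 1)).inst (.const z) := fun z => by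
    simp only [PF.inst_const, PF.at₂, PF.ren_ren]
    exact PF.ren_congr _ (fun n => by rcases n with _ | _ | n <;> rfl) fun _ => rfl
  rw [e₂]
  refine eqSubst h' ?_
  rw [← e₂, e₁]
  exact eqSubst h (e₁ x ▸ hφ)

end Pv

theorem Prv.opair_inj {T : Theory} [T.IsKM] : Prv T [] (imp (isOPair 0 1 2) (imp (isOPair 0 3 4)
    (conj (eq 3 1) (eq 4 2)))) :=
  .of_full fun m hm e f h h' => hm.opair_eq ((m.sat_isOPair _ _ _ _ _).1 h')
    ((m.sat_isOPair _ _ _ _ _).1 h)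

theorem Prv.opair_total {T : Theory} [T.IsKM] : Prv T [] (ex (isOPair 0 1 2)) :=
  .of_full fun m hm e f => by simpa [Model.Sat, cons] using hm.exists_opair (e 0) (e 1)

/-- `∃ x y, p = ⟨x, y⟩ ∧ φ(x, y)` -/
def PF.pairs (φ : PF c) (p k : ℕ) : PF c :=
  (PF.conj (.const (isOPair (p + 2) 1 0)) (φ.at₂ 1 0 (k + 2))).ex.ex

/-- `∃ p, p = ⟨x, y⟩ ∧ ∃ x' y', p = ⟨x', y'⟩ ∧ φ(x', y')` -/
def PF.pairMem (φ : PF c) (x y k : ℕ) : PF c :=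
  (PF.conj (.const (isOPair 0 (x + 1) (y + 1))) (φ.pairs 0 (k + 1))).ex

theorem PF.pairs_ren (φ : PF c) (p k k' : ℕ) (ρ : ℕ → ℕ) (hρ : Primrec ρ) (h : ∀ n, ρ (n + k) = n + k') :
    (φ.pairs p k).ren ρ id hρ .id = φ.pairs (ρ p) k' :=
  congrArg (fun X => (PF.conj (.const (isOPair (ρ p + 2) 1 0)) X).ex.ex)
    (φ.at₂_ren 1 0 (k + 2) (k' + 2) (up (up ρ)) (up_primrec (up_primrec hρ)) fun n => by
      simp only [← Nat.add_assoc, up_succ, h])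

theorem PF.pairMem_ren (φ : PF c) (x y k k' : ℕ) (ρ : ℕ → ℕ) (hρ : Primrec ρ) (h : ∀ n, ρ (n + k) = n + k') :
    (φ.pairMem x y k).ren ρ id hρ .id = φ.pairMem (ρ x) (ρ y) k' :=
  congrArg (fun X => (PF.conj (.const (isOPair 0 (ρ x + 1) (ρ y + 1))) X).ex)
    (φ.pairs_ren 0 (k + 1) (k' + 1) (up ρ) (up_primrec hρ) fun n => by
      simp only [← Nat.add_assoc, up_succ, h])

namespace Pv
variable {T : Theory} {Γ : PL c} {φ ψ χ : PF c}

theorem exI' (t : PN c) (e : φ.inst t = ψ) (h : Pv T Γ ψ) : Pv T Γ φ.ex := exI t (e ▸ h)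

theorem pairMem_iff [T.IsKM] (φ : PF c) (x y k : ℕ) : Pv T Γ ((φ.pairMem x y k).iff (φ.at₂ x y k)) := by
  have e : ∀ k x y, (φ.at₂ x y k).shift = φ.at₂ (x + 1) (y + 1) (k + 1) := fun k x y => φ.at₂_shift x y k
  refine .andI (.impI (.exE hyp0 (.exE (.andR hyp0) (.exE hyp0 ?_)))) (.impI ?_)
  · rw [e, e, e]
    have h₁ := Prv.opair_inj.fam (T := T) (c := c)
      (PL.cons (.conj (.const (isOPair 2 1 0)) (φ.at₂ 1 0 (k + 3)))
        (PL.cons (PF.conj (.const (isOPair 2 1 0)) (φ.at₂ 1 0 (k + 3))).ex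
        (PL.cons (.conj (.const (isOPair 0 (x + 1) (y + 1))) (φ.pairs 0 (k + 1)))
          (PL.cons (φ.pairMem x y k) Γ).shift).shift).shift)
      (fun | 0 => .const 2 | 1 => .const (x + 3) | 2 => .const (y + 3) | 3 => .const 1 | _ => .const 0)
      fun _ => .const 0
    have h₂ := impE (impE h₁ (andL (φ := PF.const (isOPair 2 (x + 3) (y + 3)))
      (ψ := (φ.pairs 0 (k + 1)).shift.shift) (hyp fun _ => .tail _ (.tail _ (.head _))))) (andL hyp0)
    exact subst₂ φ (andL h₂) (andR h₂) (andR hyp0)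
  · have h₁ := Prv.opair_total.fam (T := T) (c := c) (PL.cons (φ.at₂ x y k) Γ)
      (fun | 0 => .const x | _ => .const y) fun _ => .const 0
    refine .exE h₁ ?_
    rw [show (φ.pairMem x y k).shift = _ from
      φ.pairMem_ren x y k (k + 1) Nat.succ .succ fun _ => rfl]
    refine .exI' (.const 0) (congrArg (PF.conj (.const (isOPair 0 (x + 1) (y + 1))))
      (φ.pairs_ren 0 (k + 2) (k + 1) (instRen 0) (PF.instRen_primrec.comp (.const 0) .id) fun n => rfl))
      (.andI (hyp fun a => .head _) (.exI' (.const (x + 1))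
        (congrArg (fun X => (PF.conj (.const (isOPair 1 (x + 2) 0)) X).ex)
          (φ.at₂_ren 1 0 (k + 3) (k + 2) (up (instRen (x + 1))) (up_primrec (PF.instRen_primrec.comp (.const _) .id))
            fun n => rfl)) (.exI' (.const (y + 1))
            (congrArg (PF.conj (.const (isOPair 0 (x + 1) (y + 1))))
              (φ.at₂_ren (x + 2) 0 (k + 2) (k + 1) (instRen (y + 1)) (PF.instRen_primrec.comp (.const _) .id)
            fun n => rfl)) (.andI (hyp fun a => .head _) ?_))))
    exact e k x y ▸ hyp fun a => .tail _ (.head _)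

end Pv

namespace PF

def setInduction (φ : PF c) : PF c :=
  .imp (.all (.imp (.all (.imp (.mem (.const 0) (.const 1)) φ.under)) φ)) φ.all

def separation (φ : PF c) : PF c :=
  .all (.ex (.all (.iff (.mem (.const 0) (.const 1)) (.conj (.mem (.const 0) (.const 2))
    (φ.ren (up (· + 2)) id (up_primrec (Primrec.nat_add.comp .id (.const 2))) .id)))))

/-- `collection` with the occurrences of the formula as parameters. -/
def collectionForm (φ ψ : PF c) : PF c :=
  .all (.imp (.all (.imp (.mem (.const 0) (.const 1)) φ.ex))
    (.ex (.all (.imp (.mem (.const 0) (.const 2)) (.ex (.conj (.mem (.const 0) (.const 2)) ψ))))))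

def collection (φ : PF c) : PF c := collectionForm (φ.at₂ 1 0 3) (φ.at₂ 1 0 4)

/-- `replacement` with the occurrences of the formula as parameters. -/
def replacementForm (φ ψ χ : PF c) : PF c :=
  .imp (.all (.all (.all (.imp (.conj φ ψ) (.eq (.const 1) (.const 0))))))
    (.all (.ex (.all (.iff (.mem (.const 0) (.const 1))
      (.ex (.conj (.mem (.const 0) (.const 3)) χ))))))

def replacement (φ : PF c) : PF c :=
  replacementForm (φ.at₂ 2 1 3) (φ.at₂ 2 0 3) (φ.at₂ 0 1 4)

theorem setInduction_f (φ : PF c) (a : α) : φ.setInduction.f a = SetClass.setInduction (φ.f a) := rfl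
theorem separation_f (φ : PF c) (a : α) : φ.separation.f a = SetClass.separation (φ.f a) := rfl
theorem collection_f (φ : PF c) (a : α) : φ.collection.f a = SetClass.collection (φ.f a) := by
  have e : ren₂ 0 1 3 = up (up (· + 1)) := by funext n; rcases n with _ | _ | n <;> rfl
  have e' : ren₂ 0 1 4 = up (up (· + 2)) := by funext n; rcases n with _ | _ | n <;> rfl
  simp only [SetClass.collection, ← e, ← e']; rfl
theorem replacement_f (φ : PF c) (a : α) : φ.replacement.f a = SetClass.replacement (φ.f a) := by
  refine (congr (congrArg₂ SetClass.replacementForm ?_ ?_) ?_ :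
    SetClass.replacementForm _ _ _ = SetClass.replacementForm _ _ _) <;>
  exact rename_congr _ (fun n => by rcases n with _ | _ | n <;> rfl) fun _ => rfl

/-- The formulas with given codes. -/
noncomputable def ofCode {n : α → ℕ} (hn : PR c n) (h : ∀ a, ∃ φ : Fml, φ.code = n a) : PF c :=
  ⟨fun a => (h a).choose, hn.of_eq fun a => (h a).choose_spec.symm⟩

theorem ofCode_f {n : α → ℕ} (hn : PR c n) (h : ∀ a, ∃ φ : Fml, φ.code = n a) (a : α) {φ : Fml}
    (e : φ.code = n a) : (ofCode hn h).f a = φ :=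
  code_injective ((h a).choose_spec.trans e.symm)

end PF

namespace Pv
variable {T : Theory} {Γ : PL c}

theorem setInduction [T.IsKM] (φ : PF c) : Pv T Γ φ.setInduction := by
  have h : Prv T [] (imp (all (imp (ballIn 0 (memC 0 0)) (memC 0 0))) (all (memC 0 0))) :=
    .of_full fun m hm e f => by simpa [ballIn, Model.Sat, cons] using hm.ind (f 0)
  have := h.fill ⟨⟨⟨trivial, trivial⟩, trivial⟩, trivial⟩ Γ (fun _ => .const 0) [φ]
  simp only [Fml.fill, holes, ballIn, upP, PF.under_inst] at this
  exact this

theorem separation [T.IsKM] (φ : PF c) : Pv T Γ φ.separation := by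
  have h : Prv T [] (all (ex (all (iff (mem 0 1) (conj (mem 0 2) (memC 0 0)))))) :=
    .of_full fun m hm e f => by simpa [Model.Sat, cons, and_comm] using hm.sep (f 0)
  have := h.fill ⟨⟨trivial, trivial, trivial⟩, ⟨trivial, trivial⟩, trivial⟩ Γ (fun _ => .const 0) [φ]
  simp only [Fml.fill, iff, holes, upP, PF.under_inst] at this
  have e : φ.under.under = φ.ren (up (· + 2)) id (up_primrec (Primrec.nat_add.comp .id (.const 2))) .id := by
    simp only [PF.under_eq, PF.ren_ren]
    exact PF.ren_congr _ (fun n => by cases n <;> rfl) fun _ => rfl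
  rw [e] at this
  exact this

theorem collection [T.IsKM] (φ : PF c) : Pv T Γ φ.collection := by
  have h : Prv T [] (all (imp (ballIn 0 (ex (pairMemC 1 0 0)))
      (ex (ballIn 1 (bexIn 1 (pairMemC 1 0 0)))))) :=
    .of_full fun m hm e f => by simpa [ballIn, bexIn, Model.Sat, cons] using hm.coll (f 0)
  have := h.fill (by simp [NoEqC, pairMemC, ballIn, bexIn, isOPair, isUPair, iff]) Γ
    (fun _ => .const 0) [φ.pairs 0 1]
  have e : ∀ k, (φ.pairs 0 (k + 1)).under = φ.pairs 0 (k + 2) := fun k =>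
    φ.pairs_ren 0 (k + 1) (k + 2) _ _ fun n => rfl
  have e' : ∀ k, (φ.pairs 0 (k + 2)).inst (.const 0) = φ.pairs 0 (k + 1) := fun k =>
    φ.pairs_ren 0 (k + 2) (k + 1) (instRen 0) (PF.instRen_primrec.comp (.const 0) .id) fun n => rfl
  simp only [Fml.fill, holes, ballIn, bexIn, pairMemC, upP, PF.under_inst, e, e'] at this
  exact .impE (.andL (.iffAll (.iffImp (.iffAll (.iffImp .iffRefl (.iffEx (pairMem_iff φ 1 0 3))))
    (.iffEx (.iffAll (.iffImp .iffRefl (.iffEx (.iffConj .iffRefl (pairMem_iff φ 1 0 4))))))))) this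

theorem replacement [T.IsKM] (φ : PF c) : Pv T Γ φ.replacement := by
  have h : Prv T [] (imp
    (all (all (all (imp (conj (pairMemC 2 1 0) (pairMemC 2 0 0)) (eq 1 0)))))
    (all (ex (all (iff (mem 0 1) (bexIn 2 (pairMemC 0 1 0))))))) :=
    .of_full fun m hm e f => by
      simpa only [Model.Sat, cons, Model.sat_iff, Model.sat_pairMemC, bexIn, and_imp] using hm.repl (f 0)
  have := h.fill (by simp [NoEqC, pairMemC, bexIn, isOPair, isUPair, iff]) Γ
    (fun _ => .const 0) [φ.pairs 0 1]
  have e : ∀ k, (φ.pairs 0 (k + 1)).under = φ.pairs 0 (k + 2) := fun k =>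
    φ.pairs_ren 0 (k + 1) (k + 2) _ _ fun n => rfl
  have e' : ∀ k, (φ.pairs 0 (k + 2)).inst (.const 0) = φ.pairs 0 (k + 1) := fun k =>
    φ.pairs_ren 0 (k + 2) (k + 1) (instRen 0) (PF.instRen_primrec.comp (.const 0) .id) fun n => rfl
  simp only [Fml.fill, iff, holes, bexIn, pairMemC, upP, PF.under_inst, e, e'] at this
  have k : ∀ {Γ : PL c}, Pv T Γ (PF.iff (PF.ex (.conj (.mem (.const 0) (.const 3)) (φ.pairMem 0 1 4)))
    (PF.ex (.conj (.mem (.const 0) (.const 3)) (φ.at₂ 0 1 4)))) :=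
    .iffEx (.iffConj .iffRefl (pairMem_iff φ 0 1 4))
  exact .impE (.andL (.iffImp (.iffAll (.iffAll (.iffAll (.iffImp (.iffConj (pairMem_iff φ 2 1 3)
    (pairMem_iff φ 2 0 3)) .iffRefl)))) (.iffAll (.iffEx (.iffAll
      (.iffConj (.iffImp .iffRefl k) (.iffImp k .iffRefl))))))) this

end Pv
end

/-- Formulas from a finite list of derivable formulas are uniformly derivable. -/
theorem Pv.of_mem {T : Theory} [T.Renamable] (L : List Fml) (hL : ∀ χ ∈ L, Prv T [] χ) :
    ∀ {α : Type} {c : α → ℕ} (Γ : PL c) (φ : PF c), (∀ a, φ.f a ∈ L) → Pv T Γ φ := by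
  induction L with
  | nil => exact fun Γ φ h => ⟨fun _ => 0, .const 0, fun a => by simpa using h a⟩
  | cons χ L ih =>
    intro α c Γ φ h
    refine .ite (p := fun a => decide ((φ.f a).code = χ.code))
      (PR.comp (Primrec.eq.decide.comp .id (.const χ.code)) φ.pr) ?_ ?_
    · have := (hL χ (by simp)).const (Γ.comap (Subtype.val : {a // decide ((φ.f a).code = χ.code) = true} → α))
      rwa [show PF.const χ = φ.comap Subtype.val from
        PF.ext fun a => (code_injective (of_decide_eq_true a.2)).symm] at this
    · exact ih (fun χ hχ => hL χ (by simp [hχ])) (Γ.comap Subtype.val) (φ.comap Subtype.val) fun a =>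
        (List.mem_cons.1 (h a.1)).resolve_left fun e => of_decide_eq_false a.2 (congrArg code e)

/-- The axioms of the theories considered here, except comprehension. -/
inductive SetAxiom : Fml → Prop
  | closed {φ : Fml} (h : φ ∈ Model.closedAxioms) : SetAxiom φ
  | comprehension (φ : Fml) : SetAxiom (comprehension φ)
  | setInduction (φ : Fml) : SetAxiom (setInduction φ)
  | separation (φ : Fml) : SetAxiom (separation φ)
  | collection (φ : Fml) : SetAxiom (collection φ)
  | replacement (φ : Fml) : SetAxiom (replacement φ)


theorem PR.any {α : Type} {c : α → ℕ} {n : α → ℕ} (hn : PR c n) (L : List Fml) :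
    PR c fun a => L.any fun χ => decide (n a = χ.code) := by
  induction L with
  | nil => exact .const false
  | cons χ L ih => exact .comp₂ Primrec.or (PR.comp (Primrec.eq.decide.comp .id (.const χ.code)) hn) ih

theorem replacement_eq (χ : Fml) : replacement χ = replacementForm (χ.rename (ren₂ 1 2 3) id)
    (χ.rename (ren₂ 0 2 3) id) (χ.rename (ren₂ 1 0 4) id) := by
  refine (congr (congrArg₂ SetClass.replacementForm ?_ ?_) ?_ :
    SetClass.replacementForm _ _ _ = SetClass.replacementForm _ _ _) <;>
  exact rename_congr _ (fun n => by rcases n with _ | _ | n <;> rfl) fun _ => rfl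

section
variable {T : Theory} [T.IsKM] {α : Type} {c : α → ℕ} {Γ : PL c} {φ : PF c}

theorem Pv.of_setInduction (h : ∀ a, ∃ χ, φ.f a = SetClass.setInduction χ) : Pv T Γ φ := by
  obtain ⟨n, hn, h'⟩ : ∃ n : α → ℕ, PR c n ∧ ∀ a, ∃ χ : Fml, χ.code = n a ∧
      φ.f a = SetClass.setInduction χ :=
    ⟨_, φ.pr.right.right.right, fun a => (h a).imp fun χ hχ =>
      ⟨by rw [hχ]; simp [SetClass.setInduction, code], hχ⟩⟩
  have := Pv.setInduction (T := T) (Γ := Γ) (.ofCode hn fun a => (h' a).imp fun _ k => k.1)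
  rwa [show PF.setInduction _ = φ from PF.ext fun a => ?_] at this
  obtain ⟨χ, hχ, e⟩ := h' a
  rw [PF.setInduction_f, PF.ofCode_f _ _ a hχ, e]

theorem Pv.of_separation (h : ∀ a, ∃ χ, φ.f a = SetClass.separation χ) : Pv T Γ φ := by
  obtain ⟨n, hn, h'⟩ : ∃ n : α → ℕ, PR c n ∧ ∀ a, ∃ χ : Fml, (χ.rename (up (· + 2)) id).code = n a ∧
      φ.f a = SetClass.separation χ :=
    ⟨_, φ.pr.right.right.right.right.left.right.right.right.right, fun a => (h a).imp fun χ hχ => ⟨by rw [hχ]; simp [SetClass.separation, iff, code], hχ⟩⟩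
  have := Pv.separation (T := T) (Γ := Γ) ((PF.ofCode hn fun a => (h' a).elim fun _ k => ⟨_, k.1⟩).ren
    (up (· - 2)) id (up_primrec (Primrec.nat_sub.comp .id (.const 2))) .id)
  rwa [show PF.separation _ = φ from PF.ext fun a => ?_] at this
  obtain ⟨χ, hχ, e⟩ := h' a
  simp only [PF.separation_f, PF.ren, PF.ofCode_f _ _ a hχ, e, rename_rename]
  exact congrArg _ (rename_eq_self _ (fun n => by cases n <;> rfl) fun _ => rfl)

theorem Pv.of_collection (h : ∀ a, ∃ χ, φ.f a = SetClass.collection χ) : Pv T Γ φ := by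
  obtain ⟨n, hn, h'⟩ : ∃ n : α → ℕ, PR c n ∧ ∀ a, ∃ χ : Fml, (χ.rename (up (up (· + 1))) id).code = n a ∧
      φ.f a = SetClass.collection χ :=
    ⟨_, φ.pr.right.right.left.right.right.right.right, fun a => (h a).imp fun χ hχ => ⟨by rw [hχ]; simp [SetClass.collection, ballIn, code], hχ⟩⟩
  have := Pv.collection (T := T) (Γ := Γ) ((PF.ofCode hn fun a => (h' a).elim fun _ k => ⟨_, k.1⟩).ren
    (up (up (· - 1))) id (up_primrec (up_primrec (Primrec.nat_sub.comp .id (.const 1)))) .id)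
  rwa [show PF.collection _ = φ from PF.ext fun a => ?_] at this
  obtain ⟨χ, hχ, e⟩ := h' a
  simp only [PF.collection_f, PF.ren, PF.ofCode_f _ _ a hχ, e, rename_rename]
  exact congrArg _ (rename_eq_self _ (fun n => by rcases n with _ | _ | n <;> rfl) fun _ => rfl)

theorem Pv.of_replacement (h : ∀ a, ∃ χ, φ.f a = SetClass.replacement χ) : Pv T Γ φ := by
  obtain ⟨n, hn, h'⟩ : ∃ n : α → ℕ, PR c n ∧ ∀ a, ∃ χ : Fml, (χ.rename (ren₂ 1 2 3) id).code = n a ∧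
      φ.f a = SetClass.replacement χ :=
    ⟨_, φ.pr.right.left.right.right.right.right.left.right.left, fun a => (h a).imp fun χ hχ => ⟨by rw [hχ]; simp [replacement_eq, SetClass.replacementForm, code], hχ⟩⟩
  have := Pv.replacement (T := T) (Γ := Γ) ((PF.ofCode hn fun a => (h' a).elim fun _ k => ⟨_, k.1⟩).ren
    (· - 1) id (Primrec.nat_sub.comp .id (.const 1)) .id)
  rwa [show PF.replacement _ = φ from PF.ext fun a => ?_] at this
  obtain ⟨χ, hχ, e⟩ := h' a
  simp only [PF.replacement_f, PF.ren, PF.ofCode_f _ _ a hχ, e, rename_rename]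
  exact congrArg _ (rename_eq_self _ (fun n => by rcases n with _ | _ | n <;> rfl) fun _ => rfl)

/-- The axioms are uniformly derivable. -/
theorem Pv.setAxiom (h : ∀ a, SetAxiom (φ.f a)) : Pv T Γ φ := by
  have test : ∀ {β : Type} (i : β → α) (k : ℕ) {n : α → ℕ}, PR c n →
      PR (fun b => c (i b)) fun b => decide (n (i b) = k) := fun i k n hn =>
    (PR.comp (Primrec.eq.decide.comp .id (.const k)) hn).comap i
  refine .ite (.any φ.pr Model.closedAxioms)
    (Pv.of_mem Model.closedAxioms (fun χ hχ => .of_full fun m hm e f => hm.closedAxioms hχ e f)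
      _ _ fun ⟨a, ha⟩ => ?_) ?_
  · obtain ⟨χ, hχ, e⟩ := List.any_eq_true.1 ha
    rwa [show (φ.comap Subtype.val).f ⟨a, ha⟩ = χ from code_injective (of_decide_eq_true e)]
  have h₁ : ∀ a, (Model.closedAxioms.any fun χ => decide ((φ.f a).code = χ.code)) = false →
      (∃ χ, φ.f a = SetClass.comprehension χ) ∨ (∃ χ, φ.f a = SetClass.setInduction χ) ∨
      (∃ χ, φ.f a = SetClass.separation χ) ∨ (∃ χ, φ.f a = SetClass.collection χ) ∨
      ∃ χ, φ.f a = SetClass.replacement χ := by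
    intro a ha
    have k := h a
    generalize φ.f a = ψ at *
    cases k with
    | closed k => simp [List.any_eq_false] at ha; exact (ha _ k rfl).elim
    | comprehension χ => exact .inl ⟨χ, rfl⟩
    | setInduction χ => exact .inr (.inl ⟨χ, rfl⟩)
    | separation χ => exact .inr (.inr (.inl ⟨χ, rfl⟩))
    | collection χ => exact .inr (.inr (.inr (.inl ⟨χ, rfl⟩)))
    | replacement χ => exact .inr (.inr (.inr (.inr ⟨χ, rfl⟩)))
  refine .ite (test _ 11 φ.pr.left) (.ax fun ⟨⟨a, ha⟩, hb⟩ => ?_) ?_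
  · have hb : (φ.f a).code.unpair.1 = 11 := of_decide_eq_true hb
    show φ.f a ∈ T.axioms
    rcases h₁ a ha with ⟨χ, e⟩ | ⟨χ, e⟩ | ⟨χ, e⟩ | ⟨χ, e⟩ | ⟨χ, e⟩
    · exact e ▸ Theory.Comprehension.comprehension_mem χ
    all_goals rw [e] at hb; simp [code, SetClass.setInduction, SetClass.separation,
      SetClass.collection, SetClass.replacement] at hb
  refine .ite (test _ 8 φ.pr.left) (.ite (test _ 9 φ.pr.right.left)
    (.of_separation fun ⟨⟨⟨⟨a, ha⟩, hb⟩, hd⟩, he⟩ => ?_)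
    (.of_collection fun ⟨⟨⟨⟨a, ha⟩, hb⟩, hd⟩, he⟩ => ?_))
    (.ite (test _ 8 φ.pr.right.left.right.left)
    (.of_replacement fun ⟨⟨⟨⟨a, ha⟩, hb⟩, hd⟩, he⟩ => ?_)
    (.of_setInduction fun ⟨⟨⟨⟨a, ha⟩, hb⟩, hd⟩, he⟩ => ?_))
  all_goals
    simp only [decide_eq_true_eq, decide_eq_false_iff_not] at hb hd he
    rcases h₁ a ha with ⟨χ, e⟩ | ⟨χ, e⟩ | ⟨χ, e⟩ | ⟨χ, e⟩ | ⟨χ, e⟩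
  all_goals first
    | exact ⟨χ, e⟩
    | (exfalso; rw [e] at hb hd he; simp [code, SetClass.setInduction, SetClass.separation,
        SetClass.collection, SetClass.replacement, SetClass.comprehension] at hb hd he)
end

theorem IKMAxiom.setAxiom {φ : Fml} (h : IKMAxiom φ) : SetAxiom φ := by
  cases h with
  | fullComprehension φ => exact .comprehension φ
  | igb h =>
    cases h with
    | izf h =>
      cases h with
      | setInduction φ h => exact .setInduction φ
      | separation φ h => exact .separation φ
      | collection φ h => exact .collection φ
      | _ => exact .closed (by simp [Model.closedAxioms])
    | elementaryComprehension φ h => exact .comprehension φ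
    | _ => exact .closed (by simp [Model.closedAxioms])

theorem KMAxiom.setAxiom {φ : Fml} (h : KMAxiom φ) : SetAxiom φ := by
  cases h with
  | fullComprehension φ => exact .comprehension φ
  | gb h =>
    cases h with
    | zf h =>
      cases h with
      | separation φ h => exact .separation φ
      | replacement φ h => exact .replacement φ
      | _ => exact .closed (by simp [Model.closedAxioms])
    | elementaryComprehension φ h => exact .comprehension φ
    | _ => exact .closed (by simp [Model.closedAxioms])

/-- Derivations in `IKM` can be turned into derivations in classical theories. -/
theorem exists_primrec_IKM (T : Theory) [T.IsKM] : ∃ G : ℕ → ℕ, Primrec G ∧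
    ∀ Γ φ (d : Deriv IKM Γ φ), IsProof T Γ φ (G d.code) :=
  exists_primrec_of_axioms (fun h => h.elim) fun _ _ _ h => .setAxiom fun a => (h a).setAxiom

/-- Derivations in `KM` can be turned into derivations in `KMC`. -/
theorem exists_primrec_KM : ∃ G : ℕ → ℕ, Primrec G ∧
    ∀ Γ φ (d : Deriv KM Γ φ), IsProof KMC Γ φ (G d.code) :=
  exists_primrec_of_axioms (fun h => h) fun _ _ _ h => .setAxiom fun a => (h a).setAxiom

end SetClass


/-! ## Reasoning in `IKM` -/

namespace SetClass

open Fml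

/-- The double negation with respect to `a ∈ b`. -/
def Fml.J (a b : ℕ) (φ : Fml) : Fml := imp (imp φ (mem a b)) (mem a b)

/-- `φ(x, y)`, where the variables `1` and `0` of `φ` are the arguments. -/
def Fml.at₂ (φ : Fml) (x y : ℕ) : Fml := φ.rename (ren₂ y x 0) id

namespace Prv

section
variable {T : Theory} [T.Renamable] {Γ : List Fml} {φ ψ χ : Fml} {a b : ℕ}

theorem iff_symm (h : Prv T Γ (iff φ ψ)) : Prv T Γ (iff ψ φ) := .andI (.andR h) (.andL h)
theorem iff_trans (h : Prv T Γ (iff φ ψ)) (h' : Prv T Γ (iff ψ χ)) : Prv T Γ (iff φ χ) :=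
  .iffI (fun k => h'.w.mp (h.w.mp k)) fun k => h.w.mpr (h'.w.mpr k)

theorem jI (h : Prv T Γ φ) : Prv T Γ (J a b φ) := .impI fun k => .impE k h.w
theorem jBind (h : Prv T Γ (J a b φ)) (h' : Prv T (φ :: Γ) φ → Prv T (φ :: Γ) (J a b ψ)) :
    Prv T Γ (J a b ψ) :=
  .impI fun k => .impE h.w <| .impI fun x => .impE
    ((h' .hyp0).mono fun _ hψ => List.mem_cons.2 ((List.mem_cons.1 hψ).imp_right (.tail _))) k.w
theorem jMap (h : Prv T Γ (J a b φ)) (h' : Prv T (φ :: Γ) φ → Prv T (φ :: Γ) ψ) :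
    Prv T Γ (J a b ψ) := h.jBind fun k => .jI (h' k)

end

variable {Γ : List Fml} {φ ψ χ : Fml} {a b x y z p q x' y' : ℕ}

theorem izf (h : IZFAxiom φ) : Prv IKM Γ φ := .ax (.igb (.izf h))

theorem ext (h : ∀ z, Prv IKM Γ (iff (mem z x) (mem z y))) : Prv IKM Γ (eq x y) :=
  .impE (((izf .extensionality).allE x).allE y) (.allI h)

theorem exists_upair (x y : ℕ) : Prv IKM Γ (ex (isUPair 0 (x + 1) (y + 1))) :=
  ((izf .pairing).allE x).allE y

theorem upair_iff (h : Prv IKM Γ (isUPair p x y)) (z : ℕ) :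
    Prv IKM Γ (iff (mem z p) (disj (eq z x) (eq z y))) := h.allE z

theorem upair_uniq (h : Prv IKM Γ (isUPair p x y)) (h' : Prv IKM Γ (isUPair q x y)) :
    Prv IKM Γ (eq p q) := .ext fun z => (upair_iff h z).iff_trans (upair_iff h' z).iff_symm

theorem upair_left (h : Prv IKM Γ (isUPair p x y)) : Prv IKM Γ (mem x p) :=
  (upair_iff h x).mpr (.orL (.refl _))
theorem upair_right (h : Prv IKM Γ (isUPair p x y)) : Prv IKM Γ (mem y p) :=
  (upair_iff h y).mpr (.orR (.refl _))
theorem upair_self (h : Prv IKM Γ (isUPair p x x)) (hz : Prv IKM Γ (mem z p)) :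
    Prv IKM Γ (eq z x) := .orE ((upair_iff h z).mp hz) id id

theorem opair_iff (h : Prv IKM Γ (isOPair p x y)) (z : ℕ) :
    Prv IKM Γ (iff (mem z p) (disj (isUPair z x x) (isUPair z x y))) := h.allE z

theorem upair_congr (h : Prv IKM Γ (eq p q)) (k : Prv IKM Γ (isUPair p x y)) :
    Prv IKM Γ (isUPair q x y) := .subst (isUPair 0 (x + 1) (y + 1)) h k

theorem exists_opair (x y : ℕ) : Prv IKM Γ (ex (isOPair 0 (x + 1) (y + 1))) :=
  .exE (exists_upair x x) fun u hu => .exE (exists_upair x y) fun v hv =>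
    .exE (exists_upair u v) fun p hp => .exI p <| .allI fun z => .iffI
      (fun h => .orE ((upair_iff hp.w z).mp h)
        (fun e => .orL (upair_congr e.symm hu.w))
        fun e => .orR (upair_congr e.symm hv.w))
      fun h => (upair_iff hp.w z).mpr <| .orE h (fun k => .orL (upair_uniq k hu.w))
        fun k => .orR (upair_uniq k hv.w)

theorem opair_fst (h : Prv IKM Γ (isOPair p x y)) (h' : Prv IKM Γ (isOPair p x' y')) :
    Prv IKM Γ (eq x x') :=
  .exE (exists_upair x x) fun u hu =>
    .orE ((opair_iff h'.w u).mp ((opair_iff h.w u).mpr (.orL hu)))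
      (fun k => (upair_self hu.w (upair_left k)).symm)
      fun k => (upair_self hu.w (upair_left k)).symm

theorem opair_snd (h : Prv IKM Γ (isOPair p x y)) (h' : Prv IKM Γ (isOPair p x' y')) :
    Prv IKM Γ (eq y y') := by
  have e := opair_fst h h'
  refine .exE (exists_upair x y) fun v hv => .exE (exists_upair x' y') fun w hw =>
    .cut (φ := imp (eq y x') (eq y y')) (.impI fun k =>
      .orE ((opair_iff h.w w).mp ((opair_iff h'.w w).mpr (.orR hw.w)))
        (fun k' => (k.w.trans e.w.symm).trans (upair_self k' (upair_right hw.w)).symm)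
        fun k' => .orE ((upair_iff k' y').mp (upair_right hw.w))
          (fun k'' => (k.w.trans e.w.symm).trans k''.symm) fun k'' => k''.symm) fun key => ?_
  exact .orE ((opair_iff h'.w v).mp ((opair_iff h.w v).mpr (.orR hv.w)))
    (fun k => .impE key.w (upair_self k (upair_right hv.w)))
    fun k => .orE ((upair_iff k y).mp (upair_right hv.w)) (fun k' => .impE key.w k') id

theorem comprehension (φ : Fml) (h : ∀ A, Prv IKM (all (iff (memC 0 A) φ) :: Γ) (all (iff (memC 0 A) φ)) →
    Prv IKM (all (iff (memC 0 A) φ) :: Γ) χ) : Prv IKM Γ χ := by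
  refine .exCE (.ax (.fullComprehension φ)) fun A => ?_
  have : (all (iff (memC 0 0) φ.shiftC)).instC A = all (iff (memC 0 A) φ) := by
    have : (φ.shiftC).instC A = φ := shiftC_instC φ A
    simp only [instC, iff, Fml.rename, up_id] at this ⊢
    rw [this]; rfl
  rw [this]; exact h A

theorem subst₂ (φ : Fml) (h : Prv IKM Γ (eq x x')) (h' : Prv IKM Γ (eq y y')) (hφ : Prv IKM Γ (φ.at₂ x y)) :
    Prv IKM Γ (φ.at₂ x' y') := by
  have e₁ : ∀ z, φ.at₂ z y = (φ.rename (ren₂ (y + 1) 0 1) id).inst z := fun z => by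
    simp only [Fml.at₂, inst, rename_rename]
    exact rename_congr _ (fun n => by rcases n with _ | _ | n <;> rfl) fun _ => rfl
  have e₂ : ∀ z, φ.at₂ x' z = (φ.rename (ren₂ 0 (x' + 1) 1) id).inst z := fun z => by
    simp only [Fml.at₂, inst, rename_rename]
    exact rename_congr _ (fun n => by rcases n with _ | _ | n <;> rfl) fun _ => rfl
  rw [e₂]
  refine .subst _ h' ?_
  rw [← e₂, e₁]
  exact .subst _ h (e₁ x ▸ hφ)

end Prv

/-- `∀ x y, ⟨x, y⟩ ∈ R ↔ φ(x, y)` -/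
def isRel (R : ℕ) (φ : Fml) : Fml := all (all (iff (pairMemC 1 0 R) φ))

namespace Prv
variable {Γ : List Fml} {φ ψ χ : Fml} {a b x y z p q x' y' : ℕ}

theorem rel_iff {R : ℕ} (h : Prv IKM Γ (isRel R φ)) (x y : ℕ) :
    Prv IKM Γ (iff (pairMemC x y R) (φ.at₂ x y)) := by
  have := (h.allE x).allE y
  have e : ((iff (pairMemC 1 0 R) φ).rename (up (instRen x)) id).inst y =
      iff (pairMemC x y R) (φ.at₂ x y) := by
    have : (φ.rename (up (instRen x)) id).inst y = φ.at₂ x y := by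
      simp only [Fml.at₂, inst, rename_rename]
      exact rename_congr _ (fun n => by rcases n with _ | _ | n <;> rfl) fun _ => rfl
    rw [← this]; rfl
  rw [← e]; exact this

theorem isRel_intro {R : ℕ} (h : ∀ x y, Prv IKM Γ (iff (pairMemC x y R) (φ.at₂ x y))) :
    Prv IKM Γ (isRel R φ) := by
  refine .allI fun x => .allI fun y => ?_
  have e : ((iff (pairMemC 1 0 R) φ).rename (up (instRen x)) id).inst y =
      iff (pairMemC x y R) (φ.at₂ x y) := by
    have : (φ.rename (up (instRen x)) id).inst y = φ.at₂ x y := by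
      simp only [Fml.at₂, inst, rename_rename]
      exact rename_congr _ (fun n => by rcases n with _ | _ | n <;> rfl) fun _ => rfl
    rw [← this]; rfl
  have := h x y
  rw [← e] at this; exact this

/-- Comprehension for binary relations. -/
theorem comprehension₂ (φ : Fml) (h : ∀ R, Prv IKM (isRel R φ :: Γ) (isRel R φ) →
    Prv IKM (isRel R φ :: Γ) χ) : Prv IKM Γ χ := by
  let ψ := φ.rename (ren₂ 0 1 3) id
  have e : ∀ p x y, (((ψ.rename (up (up (instRen p))) id).rename (up (instRen x)) id).inst y) = φ.at₂ x y :=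
    fun p x y => by
      simp only [ψ, Fml.at₂, inst, rename_rename]
      exact rename_congr _ (fun n => by rcases n with _ | _ | n <;> rfl) fun _ => rfl
  refine .comprehension (ex (ex (conj (isOPair 2 1 0) ψ))) fun R hR => ?_
  have key : Prv IKM (all (iff (memC 0 R) (ex (ex (conj (isOPair 2 1 0) ψ)))) :: Γ) (isRel R φ) := by
    refine isRel_intro fun x y => .iffI (fun h => .exE h fun p hp => ?_) fun h => ?_
    · refine .exE ((hR.w.allE p).mp (.andR hp)) fun x' hx' => .exE hx' fun y' hy' => ?_
      have h₁ := opair_fst hy'.andL hp.andL.w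
      have h₂ := opair_snd hy'.andL hp.andL.w
      have h₃ := hy'.andR
      exact subst₂ φ h₁ h₂ (e p x' y' ▸ h₃)
    · refine .exE (exists_opair x y) fun p hp => .exI p (.andI hp ((hR.w.allE p).mpr ?_))
      refine .exI x (.exI y (.andI hp ?_))
      refine Eq.mpr (congrArg (Prv IKM _) (e p x y)) ?_
      exact h.w
  exact .cut key fun k => (h R .hyp0).mono fun χ hχ => by
    rcases List.mem_cons.1 hχ with rfl | hχ
    · simp
    · simp [hχ]

end Prv

end SetClass


/-! ## Bisimilarity of sets up to double negation -/

namespace SetClass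

open Fml

/-- Every element of `x` is related by `φ` to one of `y`, up to double negation, and every element
of `y` is related by `ψ` to one of `x`. -/
def forthBack (a b x y : ℕ) (φ ψ : Fml) : Fml :=
  conj (ballIn x (J (a + 1) (b + 1) (bexIn (y + 1) φ))) (ballIn y (J (a + 1) (b + 1) (bexIn (x + 1) ψ)))

/-- The class `R` is a bisimulation. -/
def isBisim (a b R : ℕ) : Fml := all (all (imp (pairMemC 1 0 R)
  (forthBack (a + 2) (b + 2) 1 0 (pairMemC 1 0 R) (pairMemC 0 1 R))))

/-- The sets `x` and `y` are bisimilar. -/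
def sim (a b x y : ℕ) : Fml := exC (conj (isBisim a b 0) (pairMemC x y 0))

/-- The elements of `x` and `y` are bisimilar. -/
def simExt (a b x y : ℕ) : Fml :=
  forthBack a b x y (sim (a + 2) (b + 2) 1 0) (sim (a + 2) (b + 2) 0 1)

namespace Prv
variable {Γ : List Fml} {φ ψ χ : Fml} {a b x y z u R : ℕ}

theorem sim_intro (R : ℕ) (h : Prv IKM Γ (isBisim a b R)) (h' : Prv IKM Γ (pairMemC x y R)) :
    Prv IKM Γ (sim a b x y) := .exCI R (.andI h h')

theorem bisim_forth (h : Prv IKM Γ (isBisim a b R)) (h' : Prv IKM Γ (pairMemC x y R))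
    (hu : Prv IKM Γ (mem u x)) : Prv IKM Γ (J a b (ex (conj (mem 0 (y + 1)) (pairMemC (u + 1) 0 R)))) :=
  .impE ((Prv.andL (.impE ((h.allE x).allE y) h')).allE u) hu

theorem bisim_back (h : Prv IKM Γ (isBisim a b R)) (h' : Prv IKM Γ (pairMemC x y R))
    (hu : Prv IKM Γ (mem u y)) : Prv IKM Γ (J a b (ex (conj (mem 0 (x + 1)) (pairMemC 0 (u + 1) R)))) :=
  .impE ((Prv.andR (.impE ((h.allE x).allE y) h')).allE u) hu

theorem sim_forth (h : Prv IKM Γ (sim a b x y)) (hu : Prv IKM Γ (mem u x)) :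
    Prv IKM Γ (J a b (ex (conj (mem 0 (y + 1)) (sim (a + 1) (b + 1) (u + 1) 0)))) :=
  .exCE h fun R hR => .jMap (bisim_forth hR.andL hR.andR hu.w) fun k => .exE k fun w hw =>
    .exI w (.andI hw.andL (sim_intro R hR.andL.w hw.andR))

theorem sim_back (h : Prv IKM Γ (sim a b x y)) (hu : Prv IKM Γ (mem u y)) :
    Prv IKM Γ (J a b (ex (conj (mem 0 (x + 1)) (sim (a + 1) (b + 1) 0 (u + 1))))) :=
  .exCE h fun R hR => .jMap (bisim_back hR.andL hR.andR hu.w) fun k => .exE k fun w hw =>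
    .exI w (.andI hw.andL (sim_intro R hR.andL.w hw.andR))

theorem sim_unfold (h : Prv IKM Γ (sim a b x y)) : Prv IKM Γ (simExt a b x y) :=
  .andI (.allI fun _ => .impI fun hu => sim_forth h.w hu) (.allI fun _ => .impI fun hu => sim_back h.w hu)

theorem sim_refl (x : ℕ) : Prv IKM Γ (sim a b x x) := by
  refine .comprehension₂ (eq 1 0) fun R hR => .sim_intro R (.allI fun x => .allI fun y => .impI fun h =>
    .andI (.allI fun u => .impI fun hu => .jI (.exI u (.andI ?_ ((rel_iff hR.w u u).mpr (.refl u)))))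
      (.allI fun u => .impI fun hu => .jI (.exI u (.andI ?_ ((rel_iff hR.w u u).mpr (.refl u))))))
    ((rel_iff hR x x).mpr (.refl x))
  · exact .subst (mem (u + 1) 0) ((rel_iff hR.w x y).mp h.w) hu
  · exact .subst (mem (u + 1) 0) (Prv.symm ((rel_iff hR.w x y).mp h.w)) hu

theorem sim_symm (h : Prv IKM Γ (sim a b x y)) : Prv IKM Γ (sim a b y x) := by
  refine .comprehension₂ (sim (a + 2) (b + 2) 0 1) fun R hR => ?_
  have e : ∀ x y, Prv IKM _ (iff (pairMemC x y R) (sim a b y x)) := fun x y => rel_iff hR x y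
  refine .sim_intro R (.allI fun x => .allI fun y => .impI fun h => ?_) ((e y x).mpr h.w)
  have h' := (e x y).w.mp h
  exact .andI (.allI fun u => .impI fun hu => .jMap (sim_back h'.w hu) fun k => .exE k fun w hw =>
      .exI w (.andI hw.andL ((e u w).w.mpr hw.andR)))
    (.allI fun u => .impI fun hu => .jMap (sim_forth h'.w hu) fun k => .exE k fun w hw =>
      .exI w (.andI hw.andL ((e w u).w.mpr hw.andR)))

theorem sim_trans (h : Prv IKM Γ (sim a b x y)) (h' : Prv IKM Γ (sim a b y z)) :
    Prv IKM Γ (sim a b x z) := by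
  refine .comprehension₂ (ex (conj (sim (a + 3) (b + 3) 2 0) (sim (a + 3) (b + 3) 0 1))) fun R hR => ?_
  have e : ∀ x z, Prv IKM _ (iff (pairMemC x z R) (ex (conj (sim (a + 1) (b + 1) (x + 1) 0)
    (sim (a + 1) (b + 1) 0 (z + 1))))) := fun x z => rel_iff hR x z
  refine .sim_intro R (.allI fun x => .allI fun z => .impI fun h =>
      .exE ((e x z).w.mp h) fun y hy => ?_)
      ((e x z).mpr (.exI y (.andI h.w h'.w)))
  have h₁ : Prv IKM _ (sim a b x y) := hy.andL
  have h₂ : Prv IKM _ (sim a b y z) := hy.andR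
  refine .andI ?_ ?_
  · refine .allI fun u => .impI fun hu => .jBind (sim_forth h₁.w hu) fun k => .exE k fun v hv => ?_
    have h₃ : Prv IKM _ (sim a b u v) := hv.andR
    refine .jMap (sim_forth h₂.w hv.andL) fun k => .exE k fun w hw => ?_
    have h₄ : Prv IKM _ (sim a b v w) := hw.andR
    exact .exI w (.andI hw.andL ((e u w).w.mpr (.exI v (.andI h₃.w h₄))))
  · refine .allI fun u => .impI fun hu => .jBind (sim_back h₂.w hu) fun k => .exE k fun v hv => ?_
    have h₃ : Prv IKM _ (sim a b v u) := hv.andR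
    refine .jMap (sim_back h₁.w hv.andL) fun k => .exE k fun w hw => ?_
    have h₄ : Prv IKM _ (sim a b w v) := hw.andR
    exact .exI w (.andI hw.andL ((e w u).w.mpr (.exI v (.andI h₄ h₃.w))))

theorem sim_fold (h : Prv IKM Γ (simExt a b x y)) : Prv IKM Γ (sim a b x y) := by
  refine .comprehension₂ (simExt (a + 2) (b + 2) 1 0) fun R hR => ?_
  have e : ∀ x y, Prv IKM _ (iff (pairMemC x y R) (simExt a b x y)) := fun x y => rel_iff hR x y
  refine .sim_intro R
    (.allI fun x => .allI fun y => .impI fun h => ?_) ((e x y).mpr h.w)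
  have h' := (e x y).w.mp h
  exact .andI (.allI fun u => .impI fun hu => .jMap (.impE (h'.andL.w.allE u) hu) fun k => .exE k fun w hw =>
      .exI w (.andI hw.andL ((e u w).w.mpr (sim_unfold hw.andR))))
    (.allI fun u => .impI fun hu => .jMap (.impE (h'.andR.w.allE u) hu) fun k => .exE k fun w hw =>
      .exI w (.andI hw.andL ((e w u).w.mpr (sim_unfold hw.andR))))

theorem sim_stable (h : Prv IKM Γ (J a b (sim a b x y))) : Prv IKM Γ (sim a b x y) :=
  .sim_fold (.andI (.allI fun _ => .impI fun hu => .jBind h.w fun k => sim_forth k hu.w)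
    (.allI fun _ => .impI fun hu => .jBind h.w fun k => sim_back k hu.w))

theorem sim_of_eq (h : Prv IKM Γ (eq x y)) : Prv IKM Γ (sim a b x y) :=
  .subst (sim (a + 1) (b + 1) (x + 1) 0) h (sim_refl x)

end Prv

end SetClass


/-! ## The translation of classical into intuitionistic formulas -/

namespace SetClass

open Fml

/-- `x ∈ X` up to bisimilarity and double negation -/
def simMemC (a b x X : ℕ) : Fml := J a b (ex (conj (memC 0 X) (sim (a + 1) (b + 1) 0 (x + 1))))

/-- `X` and `Y` have the same elements, up to bisimilarity and double negation. -/
def simC (a b X Y : ℕ) : Fml := all (iff (simMemC (a + 1) (b + 1) 0 X) (simMemC (a + 1) (b + 1) 0 Y))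

/-- The double negation translation with respect to `a ∈ b`, with bisimilarity for equality. -/
def Fml.tr : ℕ → ℕ → Fml → Fml
  | a, b, .mem x y => J a b (ex (conj (mem 0 (y + 1)) (sim (a + 1) (b + 1) 0 (x + 1))))
  | a, b, .memC x X => simMemC a b x X
  | a, b, .eq x y => J a b (sim a b x y)
  | a, b, .eqC X Y => J a b (simC a b X Y)
  | a, b, .fls => J a b fls
  | a, b, .conj φ ψ => J a b (conj (tr a b φ) (tr a b ψ))
  | a, b, .disj φ ψ => J a b (disj (tr a b φ) (tr a b ψ))
  | a, b, .imp φ ψ => J a b (imp (tr a b φ) (tr a b ψ))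
  | a, b, .all φ => J a b (all (tr (a + 1) (b + 1) φ))
  | a, b, .ex φ => J a b (ex (tr (a + 1) (b + 1) φ))
  | a, b, .allC φ => J a b (allC (tr a b φ))
  | a, b, .exC φ => J a b (exC (tr a b φ))

theorem Fml.tr_rename (a b : ℕ) (φ : Fml) (ρ σ : ℕ → ℕ) :
    (tr a b φ).rename ρ σ = tr (ρ a) (ρ b) (φ.rename ρ σ) := by
  induction φ generalizing a b ρ σ with
  | mem | memC | eq | eqC | fls => rfl
  | conj φ ψ h₁ h₂ => exact congrArg (J (ρ a) (ρ b)) (congrArg₂ Fml.conj (h₁ ..) (h₂ ..))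
  | disj φ ψ h₁ h₂ => exact congrArg (J (ρ a) (ρ b)) (congrArg₂ Fml.disj (h₁ ..) (h₂ ..))
  | imp φ ψ h₁ h₂ => exact congrArg (J (ρ a) (ρ b)) (congrArg₂ Fml.imp (h₁ ..) (h₂ ..))
  | all φ h => exact congrArg (J (ρ a) (ρ b)) (congrArg Fml.all (h ..))
  | ex φ h => exact congrArg (J (ρ a) (ρ b)) (congrArg Fml.ex (h ..))
  | allC φ h => exact congrArg (J (ρ a) (ρ b)) (congrArg Fml.allC (h ..))
  | exC φ h => exact congrArg (J (ρ a) (ρ b)) (congrArg Fml.exC (h ..))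

/-- The formula whose double negation is the translation. -/
def Fml.core (a b : ℕ) (φ : Fml) : Fml := match tr a b φ with
  | .imp (.imp χ _) _ => χ
  | χ => χ

theorem Fml.tr_eq (a b : ℕ) (φ : Fml) : tr a b φ = J a b (core a b φ) := by cases φ <;> rfl

section
variable {α : Type} {c : α → ℕ}

namespace PF

/-- `Fml.J` for families -/
def J (a b : PN c) (φ : PF c) : PF c := .imp (.imp φ (.mem a b)) (.mem a b)

def sim (a b x y : PN c) : PF c := ⟨fun i => SetClass.sim (a.f i) (b.f i) (x.f i) (y.f i),
  ((SetClass.sim 0 1 2 3).fam (fun | 0 => a | 1 => b | 2 => x | _ => y) fun _ => a).pr.of_eq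
    fun i => by rw [Fml.fam_f]; rfl⟩

def simMemC (a b x X : PN c) : PF c := ⟨fun i => SetClass.simMemC (a.f i) (b.f i) (x.f i) (X.f i),
  ((SetClass.simMemC 0 1 2 0).fam (fun | 0 => a | 1 => b | _ => x) fun _ => X).pr.of_eq
    fun i => by rw [Fml.fam_f]; rfl⟩

def simC (a b X Y : PN c) : PF c := ⟨fun i => SetClass.simC (a.f i) (b.f i) (X.f i) (Y.f i),
  ((SetClass.simC 0 1 0 1).fam (fun | 0 => a | _ => b) fun | 0 => X | _ => Y).pr.of_eq
    fun i => by rw [Fml.fam_f]; rfl⟩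

end PF

theorem tr_rules : FRules (π := ℕ × ℕ) (fun p => (p.1 + 1, p.2 + 1)) id
    (fun p φ n => n = (tr p.1 p.2 φ).code) := by
  have J : ∀ {α : Type} {c : α → ℕ} {p : α → ℕ × ℕ} {n : α → ℕ}, PR c p → PR c n →
      PR c fun a => Nat.pair 7 (Nat.pair (Nat.pair 7 (Nat.pair (n a) (mem (p a).1 (p a).2).code))
        (mem (p a).1 (p a).2).code) := fun hp hn =>
    .natPair (.const 7) (.natPair (.natPair (.const 7) (.natPair hn (PF.mem ⟨_, hp.fst⟩ ⟨_, hp.snd⟩).pr))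
      (PF.mem ⟨_, hp.fst⟩ ⟨_, hp.snd⟩).pr)
  constructor
  · exact fun c p x y hp => ⟨_, J hp (PF.ex (.conj (.mem (.const 0) y.succ)
      (.sim ⟨_, hp.fst.succ⟩ ⟨_, hp.snd.succ⟩ (.const 0) x.succ))).pr, fun a => rfl⟩
  · exact fun c p x y hp => ⟨_, (PF.simMemC ⟨_, hp.fst⟩ ⟨_, hp.snd⟩ x y).pr, fun a => rfl⟩
  · exact fun c p x y hp => ⟨_, J hp (PF.sim ⟨_, hp.fst⟩ ⟨_, hp.snd⟩ x y).pr, fun a => rfl⟩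
  · exact fun c p x y hp => ⟨_, J hp (PF.simC ⟨_, hp.fst⟩ ⟨_, hp.snd⟩ x y).pr, fun a => rfl⟩
  · exact fun c p hp => ⟨_, J hp PF.fls.pr, fun a => rfl⟩
  · rintro α c p φ ψ hp ⟨n, hn, e⟩ ⟨m, hm, e'⟩
    exact ⟨_, J hp (.natPair (.const 5) (.natPair hn hm)), fun a => by rw [e, e']; rfl⟩
  · rintro α c p φ ψ hp ⟨n, hn, e⟩ ⟨m, hm, e'⟩
    exact ⟨_, J hp (.natPair (.const 6) (.natPair hn hm)), fun a => by rw [e, e']; rfl⟩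
  · rintro α c p φ ψ hp ⟨n, hn, e⟩ ⟨m, hm, e'⟩
    exact ⟨_, J hp (.natPair (.const 7) (.natPair hn hm)), fun a => by rw [e, e']; rfl⟩
  · rintro α c p φ hp ⟨n, hn, e⟩
    exact ⟨_, J hp (.natPair (.const 8) hn), fun a => by rw [e]; rfl⟩
  · rintro α c p φ hp ⟨n, hn, e⟩
    exact ⟨_, J hp (.natPair (.const 9) hn), fun a => by rw [e]; rfl⟩
  · rintro α c p φ hp ⟨n, hn, e⟩
    exact ⟨_, J hp (.natPair (.const 10) hn), fun a => by rw [e]; rfl⟩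
  · rintro α c p φ hp ⟨n, hn, e⟩
    exact ⟨_, J hp (.natPair (.const 11) hn), fun a => by rw [e]; rfl⟩

namespace PF

theorem tr_pr (a b : PN c) (φ : PF c) : PR c fun i => (Fml.tr (a.f i) (b.f i) (φ.f i)).code := by
  obtain ⟨n, hn, e⟩ := tr_rules.family (Primrec.pair (Primrec.succ.comp Primrec.fst)
    (Primrec.succ.comp Primrec.snd)) .id c (fun i => (a.f i, b.f i)) φ (a.pr.mk b.pr)
  exact hn.of_eq e

/-- `Fml.tr` for families -/
def tr (a b : PN c) (φ : PF c) : PF c := ⟨fun i => Fml.tr (a.f i) (b.f i) (φ.f i), tr_pr a b φ⟩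

/-- `Fml.core` for families -/
def core (a b : PN c) (φ : PF c) : PF c := ⟨fun i => Fml.core (a.f i) (b.f i) (φ.f i),
  (tr_pr a b φ).right.left.right.left.of_eq fun i => by simp [Fml.tr_eq, Fml.J, code]⟩

theorem tr_eq (a b : PN c) (φ : PF c) : φ.tr a b = J a b (φ.core a b) := by
  ext i; exact Fml.tr_eq _ _ _

theorem tr_inst (a b t : PN c) (φ : PF c) : (φ.inst t).tr a b = (φ.tr a.succ b.succ).inst t := by
  ext i; exact (tr_rename (a.f i + 1) (b.f i + 1) (φ.f i) (instRen (t.f i)) id).symm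
theorem tr_instC (a b t : PN c) (φ : PF c) : (φ.instC t).tr a b = (φ.tr a b).instC t := by
  ext i; exact (tr_rename (a.f i) (b.f i) (φ.f i) id (instRen (t.f i))).symm
theorem tr_shift (a b : PN c) (φ : PF c) : φ.shift.tr a.succ b.succ = (φ.tr a b).shift := by
  ext i; exact (tr_rename _ _ _ _ _).symm
theorem tr_shiftC (a b : PN c) (φ : PF c) : φ.shiftC.tr a b = (φ.tr a b).shiftC := by
  ext i; exact (tr_rename (a.f i) (b.f i) (φ.f i) id Nat.succ).symm
theorem tr_under (a b : PN c) (φ : PF c) :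
    φ.under.tr a.succ.succ b.succ.succ = (φ.tr a.succ b.succ).under := by
  ext i; exact (tr_rename (a.f i + 1) (b.f i + 1) (φ.f i) (up Nat.succ) id).symm

end PF

def PL.tr (a b : PN c) (Γ : PL c) : PL c := ⟨fun i => (Γ.f i).map (Fml.tr (a.f i) (b.f i)),
  map_pr (π := ℕ × ℕ) (F := fun p => Fml.tr p.1 p.2)
    (PF.tr_pr ⟨fun x => x.1.1, ((FRules.param (π := ℕ × ℕ) (PR.self.left.of_eq fun _ => by simp)).fst)⟩
      ⟨fun x => x.1.2, ((FRules.param (π := ℕ × ℕ) (PR.self.left.of_eq fun _ => by simp)).snd)⟩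
      (sndFml (ℕ × ℕ))) Γ (a.pr.mk b.pr)⟩

theorem PL.tr_shift (a b : PN c) (Γ : PL c) : Γ.shift.tr a.succ b.succ = (Γ.tr a b).shift := by
  ext i : 1
  simp only [PL.tr, PL.shift, List.map_map]
  exact List.map_congr_left fun φ _ => (Fml.tr_rename _ _ _ _ _).symm
theorem PL.tr_shiftC (a b : PN c) (Γ : PL c) : Γ.shiftC.tr a b = (Γ.tr a b).shiftC := by
  ext i : 1
  simp only [PL.tr, PL.shiftC, List.map_map]
  exact List.map_congr_left fun φ _ => (Fml.tr_rename (a.f i) (b.f i) φ id Nat.succ).symm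

namespace Pv
variable {T : Theory} {Γ : PL c} {φ ψ χ φ' ψ' : PF c} {a b : PN c}

theorem jI (h : Pv T Γ φ) : Pv T Γ (.J a b φ) := by
  have : Pv T Γ (φ.imp (.J a b φ)) := impI (impI (impE hyp0 hyp1))
  exact impE this h

theorem jBind (h : Pv T Γ (.J a b φ)) (k : Pv T (.cons φ Γ) (.J a b ψ)) : Pv T Γ (.J a b ψ) := by
  have : Pv T Γ ((PF.J a b φ).imp ((φ.imp (.J a b ψ)).imp (.J a b ψ))) :=
    impI (impI (impI (impE hyp2 (impI (impE (impE hyp2 hyp0) hyp1)))))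
  exact impE (impE this h) (impI k)

/-- Translated formulas are equivalent to their double negations. -/
theorem trBind (h : Pv T Γ (.J a b φ)) (h' : Pv T (.cons φ Γ) (ψ.tr a b)) : Pv T Γ (ψ.tr a b) := by
  rw [PF.tr_eq] at h' ⊢
  exact jBind h h'

theorem iffJ (h : Pv T Γ (φ.iff φ')) : Pv T Γ ((PF.J a b φ).iff (.J a b φ')) :=
  iffImp (iffImp h iffRefl) iffRefl

end Pv
end

end SetClass


/-! ## Translated formulas respect bisimilarity -/

namespace SetClass

open Fml

namespace Prv
variable {Γ : List Fml} {a b x y z u v X Y Z : ℕ}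

theorem simMem_congr (h : Prv IKM Γ (sim a b x y)) (h' : Prv IKM Γ (sim a b u v))
    (k : Prv IKM Γ (tr a b (mem x u))) : Prv IKM Γ (tr a b (mem y v)) :=
  .jBind k fun k => .exE k fun z hz => .jMap (.sim_forth h'.w hz.andL) fun k => .exE k fun w hw => by
    have h₁ : Prv IKM _ (sim a b z x) := hz.andR
    have h₂ : Prv IKM _ (sim a b z w) := hw.andR
    exact .exI w (.andI hw.andL ((h₂.sim_symm.sim_trans h₁.w).sim_trans h.w))

theorem simMemC_congr (h : Prv IKM Γ (sim a b x y)) (k : Prv IKM Γ (simMemC a b x X)) :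
    Prv IKM Γ (simMemC a b y X) :=
  .jMap k fun k => .exE k fun z hz => by
    have h₁ : Prv IKM _ (sim a b z x) := hz.andR
    exact .exI z (.andI hz.andL (h₁.sim_trans h.w))

theorem simC_iff (h : Prv IKM Γ (simC a b X Y)) (x : ℕ) :
    Prv IKM Γ (iff (simMemC a b x X) (simMemC a b x Y)) := h.allE x

theorem simC_refl (X : ℕ) : Prv IKM Γ (simC a b X X) := .allI fun _ => .iffI id id

theorem simC_symm (h : Prv IKM Γ (simC a b X Y)) : Prv IKM Γ (simC a b Y X) :=
  .allI fun x => (simC_iff h x).iff_symm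

theorem simC_trans (h : Prv IKM Γ (simC a b X Y)) (h' : Prv IKM Γ (simC a b Y Z)) :
    Prv IKM Γ (simC a b X Z) := .allI fun x => (simC_iff h x).iff_trans (simC_iff h' x)

end Prv

/-- The renaming that substitutes `x` for `k` and lowers the variables above `k`. -/
def substRen (k x n : ℕ) : ℕ := if n < k then n else if n = k then x else n - 1

theorem up_substRen (k x : ℕ) : up (substRen k x) = substRen (k + 1) (x + 1) := by
  funext n
  rcases n with _ | n
  · simp [substRen]
  · simp only [up_succ, substRen, Nat.add_lt_add_iff_right, Nat.add_right_cancel_iff]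
    split_ifs <;> omega

theorem substRen_zero (x : ℕ) : substRen 0 x = instRen x := by
  funext n; cases n <;> rfl

section
variable {α : Type} {c : α → ℕ}

theorem PR.substRen {k x n : α → ℕ} (hk : PR c k) (hx : PR c x) (hn : PR c n) :
    PR c fun a => substRen (k a) (x a) (n a) := by
  have : PR c fun a => cond (decide (n a < k a)) (n a) (cond (decide (n a = k a)) (x a) (n a - 1)) :=
    .ite (.comp₂ Primrec.nat_lt.decide hn hk) hn (.ite (.comp₂ Primrec.eq.decide hn hk) hx
      (.comp₂ Primrec.nat_sub hn (.const 1)))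
  exact this.of_eq fun a => by simp only [SetClass.substRen, Bool.cond_decide]

theorem substRen_primrec : Primrec₂ fun r : ℕ × ℕ => substRen r.1 r.2 := by
  obtain ⟨g, hg, e⟩ := PR.substRen (c := fun x : (ℕ × ℕ) × ℕ => Encodable.encode x)
    (k := fun x => x.1.1) (x := fun x => x.1.2) (n := fun x => x.2)
    (FRules.param (π := (ℕ × ℕ) × ℕ) .self).fst.fst (FRules.param (π := (ℕ × ℕ) × ℕ) .self).fst.snd
    (FRules.param (π := (ℕ × ℕ) × ℕ) .self).snd
  exact (hg.comp Primrec.encode).of_eq fun x => (e x).symm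

/-- The family `φ` with `x` and `X` substituted for the variables `k` and `l`. -/
def PF.subst (k x l X : PN c) (φ : PF c) : PF c :=
  ⟨fun i => (φ.f i).rename (substRen (k.f i) (x.f i)) (substRen (l.f i) (X.f i)), rename_pr
    (π := (ℕ × ℕ) × ℕ × ℕ) (ρ := fun r => substRen r.1.1 r.1.2) (σ := fun r => substRen r.2.1 r.2.2)
    (substRen_primrec.comp (Primrec.fst.comp Primrec.fst) Primrec.snd)
    (substRen_primrec.comp (Primrec.snd.comp Primrec.fst) Primrec.snd) φ
    ((k.pr.mk x.pr).mk (l.pr.mk X.pr))⟩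

/-- Substitution for a variable of a family. -/
def PN.subst (k x n : PN c) : PN c := ⟨fun i => substRen (k.f i) (x.f i) (n.f i), .substRen k.pr x.pr n.pr⟩

/-- Restriction of a family. -/
def PN.comap {β : Type} (i : β → α) (x : PN c) : PN (fun b => c (i b)) := ⟨fun b => x.f (i b), x.pr.comap i⟩

theorem PF.all_subst (k x l X : PN c) (φ : PF c) :
    φ.all.subst k x l X = (φ.subst k.succ x.succ l X).all := by
  ext i; exact congrArg Fml.all (by rw [up_substRen]; rfl)
theorem PF.ex_subst (k x l X : PN c) (φ : PF c) :
    φ.ex.subst k x l X = (φ.subst k.succ x.succ l X).ex := by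
  ext i; exact congrArg Fml.ex (by rw [up_substRen]; rfl)
theorem PF.allC_subst (k x l X : PN c) (φ : PF c) :
    φ.allC.subst k x l X = (φ.subst k x l.succ X.succ).allC := by
  ext i; exact congrArg Fml.allC (by rw [up_substRen]; rfl)
theorem PF.exC_subst (k x l X : PN c) (φ : PF c) :
    φ.exC.subst k x l X = (φ.subst k x l.succ X.succ).exC := by
  ext i; exact congrArg Fml.exC (by rw [up_substRen]; rfl)

/-- The statement that bisimilar values of two variables give equivalent translated formulas. -/
def TrCongr (a b k x y l X Y : PN c) (Γ : PL c) (φ : PF c) : Prop :=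
  Pv IKM (.cons (.sim a b x y) (.cons (.simC a b X Y) Γ))
    (((φ.subst k x l X).tr a b).iff ((φ.subst k y l Y).tr a b))

theorem Prv.pv {T : Theory} [T.Renamable] {Φ : Fml} (h : Prv T [] Φ) {Γ : PL c} {φ : PF c}
    (ρ σ : ℕ → PN c) (e : ∀ i, Φ.rename (fun n => (ρ n).f i) (fun n => (σ n).f i) = φ.f i) :
    Pv T Γ φ := by
  rw [← show Φ.fam ρ σ = φ from PF.ext fun i => (Fml.fam_f ..).trans (e i)]
  exact h.fam Γ ρ σ

theorem Pv.sim_refl {Γ : PL c} (a b x : PN c) : Pv IKM Γ (.sim a b x x) :=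
  (Prv.sim_refl (Γ := []) (a := 0) (b := 1) 2).pv (fun | 0 => a | 1 => b | _ => x) (fun _ => a) fun _ => rfl
theorem Pv.simC_refl {Γ : PL c} (a b X : PN c) : Pv IKM Γ (.simC a b X X) :=
  (Prv.simC_refl (Γ := []) (a := 0) (b := 1) 0).pv (fun | 0 => a | _ => b) (fun _ => X) fun _ => rfl

namespace TrCongr
variable {a b k x y l X Y : PN c} {Γ : PL c} {φ ψ : PF c}

theorem sim_subst (n : PN c) : Pv IKM (.cons (.sim a b x y) (.cons (.simC a b X Y) Γ))
    (.sim a b (.subst k x n) (.subst k y n)) := by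
  refine .ite (p := fun i => decide (n.f i = k.f i)) (.comp₂ Primrec.eq.decide n.pr k.pr)
    (.hyp fun ⟨i, hi⟩ => ?_) ?_
  · have hi : n.f i = k.f i := of_decide_eq_true hi
    simp [PF.comap, PL.comap, PL.cons, PF.sim, PN.subst, substRen, hi]
  · let ι : {i // decide (n.f i = k.f i) = false} → α := Subtype.val
    have e : PF.sim (a.comap ι) (b.comap ι) (PN.comap ι (.subst k x n)) (PN.comap ι (.subst k x n)) =
        (PF.sim a b (.subst k x n) (.subst k y n)).comap ι := PF.ext fun ⟨i, hi⟩ => by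
      have hi : ¬ n.f i = k.f i := of_decide_eq_false hi
      simp [ι, PF.comap, PF.sim, PN.comap, PN.subst, substRen, hi]
    exact e ▸ Pv.sim_refl _ _ _

theorem simC_subst (n : PN c) : Pv IKM (.cons (.sim a b x y) (.cons (.simC a b X Y) Γ))
    (.simC a b (.subst l X n) (.subst l Y n)) := by
  refine .ite (p := fun i => decide (n.f i = l.f i)) (.comp₂ Primrec.eq.decide n.pr l.pr)
    (.hyp fun ⟨i, hi⟩ => ?_) ?_
  · have hi : n.f i = l.f i := of_decide_eq_true hi
    simp [PF.comap, PL.comap, PL.cons, PF.simC, PN.subst, substRen, hi]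
  · let ι : {i // decide (n.f i = l.f i) = false} → α := Subtype.val
    have e : PF.simC (a.comap ι) (b.comap ι) (PN.comap ι (.subst l X n)) (PN.comap ι (.subst l X n)) =
        (PF.simC a b (.subst l X n) (.subst l Y n)).comap ι := PF.ext fun ⟨i, hi⟩ => by
      have hi : ¬ n.f i = l.f i := of_decide_eq_false hi
      simp [ι, PF.comap, PF.simC, PN.comap, PN.subst, substRen, hi]
    exact e ▸ Pv.simC_refl _ _ _

theorem mem (m n : PN c) : TrCongr a b k x y l X Y Γ (.mem m n) := by
  have h : Prv IKM [] (imp (SetClass.sim 0 1 2 3) (imp (SetClass.sim 0 1 4 5)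
      (iff (tr 0 1 (.mem 2 4)) (tr 0 1 (.mem 3 5))))) := .impI fun h => .impI fun h' =>
    .iffI (Prv.simMem_congr h.w h'.w) (Prv.simMem_congr h.w.sim_symm h'.w.sim_symm)
  exact .impE (.impE (h.pv (φ := .imp _ (.imp _ (.iff _ _)))
    (fun | 0 => a | 1 => b | 2 => .subst k x m | 3 => .subst k y m | 4 => .subst k x n | _ => .subst k y n)
    (fun _ => a) fun i => rfl) (sim_subst m)) (sim_subst n)

theorem memC (m n : PN c) : TrCongr a b k x y l X Y Γ (.memC m n) := by
  have h : Prv IKM [] (imp (SetClass.sim 0 1 2 3) (imp (SetClass.simC 0 1 0 1)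
      (iff (tr 0 1 (.memC 2 0)) (tr 0 1 (.memC 3 1))))) := .impI fun h => .impI fun h' =>
    .iffI (fun k => (Prv.simC_iff h'.w 3).mp (Prv.simMemC_congr h.w k))
      (fun k => (Prv.simC_iff h'.w 2).mpr (Prv.simMemC_congr h.w.sim_symm k))
  exact .impE (.impE (h.pv (φ := .imp _ (.imp _ (.iff _ _)))
    (fun | 0 => a | 1 => b | 2 => .subst k x m | _ => .subst k y m)
    (fun | 0 => .subst l X n | _ => .subst l Y n) fun i => rfl) (sim_subst m)) (simC_subst n)

theorem eq (m n : PN c) : TrCongr a b k x y l X Y Γ (.eq m n) := by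
  have h : Prv IKM [] (imp (SetClass.sim 0 1 2 3) (imp (SetClass.sim 0 1 4 5)
      (iff (tr 0 1 (.eq 2 4)) (tr 0 1 (.eq 3 5))))) := .impI fun h => .impI fun h' =>
    .iffI (fun k => .jMap k fun k => (h.w.sim_symm.sim_trans k).sim_trans h'.w)
      (fun k => .jMap k fun k => (h.w.sim_trans k).sim_trans h'.w.sim_symm)
  exact .impE (.impE (h.pv (φ := .imp _ (.imp _ (.iff _ _)))
    (fun | 0 => a | 1 => b | 2 => .subst k x m | 3 => .subst k y m | 4 => .subst k x n | _ => .subst k y n)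
    (fun _ => a) fun i => rfl) (sim_subst m)) (sim_subst n)

theorem eqC (m n : PN c) : TrCongr a b k x y l X Y Γ (.eqC m n) := by
  have h : Prv IKM [] (imp (SetClass.simC 0 1 0 1) (imp (SetClass.simC 0 1 2 3)
      (iff (tr 0 1 (.eqC 0 2)) (tr 0 1 (.eqC 1 3))))) := .impI fun h => .impI fun h' =>
    .iffI (fun k => .jMap k fun k => (h.w.simC_symm.simC_trans k).simC_trans h'.w)
      (fun k => .jMap k fun k => (h.w.simC_trans k).simC_trans h'.w.simC_symm)
  exact .impE (.impE (h.pv (φ := .imp _ (.imp _ (.iff _ _)))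
    (fun | 0 => a | _ => b)
    (fun | 0 => .subst l X m | 1 => .subst l Y m | 2 => .subst l X n | _ => .subst l Y n)
    fun i => rfl) (simC_subst m)) (simC_subst n)

end TrCongr
end

end SetClass


namespace SetClass

open Fml

theorem exists_shiftCode : ∃ g : ℕ → ℕ, Primrec g ∧ ∀ Γ : List Fml,
    codeList (Γ.map shift) = g (codeList Γ) := (PL.mk (c := codeList) id .self).shift.pr
theorem exists_shiftCCode : ∃ g : ℕ → ℕ, Primrec g ∧ ∀ Γ : List Fml,
    codeList (Γ.map shiftC) = g (codeList Γ) := (PL.mk (c := codeList) id .self).shiftC.pr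

namespace TrCongr
variable {α : Type} {c : α → ℕ} {a b k x y l X Y : PN c} {Γ : PL c} {φ : PF c}
theorem all (h : TrCongr a.succ b.succ k.succ x.succ y.succ l X Y Γ.shift φ) :
    TrCongr a b k x y l X Y Γ φ.all := by
  unfold TrCongr
  rw [PF.all_subst, PF.all_subst]
  exact .iffJ (Pv.iffAll (Γ := .cons (.sim a b x y) (.cons (.simC a b X Y) Γ)) h)
theorem ex (h : TrCongr a.succ b.succ k.succ x.succ y.succ l X Y Γ.shift φ) :
    TrCongr a b k x y l X Y Γ φ.ex := by
  unfold TrCongr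
  rw [PF.ex_subst, PF.ex_subst]
  exact .iffJ (Pv.iffEx (Γ := .cons (.sim a b x y) (.cons (.simC a b X Y) Γ)) h)
theorem allC (h : TrCongr a b k x y l.succ X.succ Y.succ Γ.shiftC φ) :
    TrCongr a b k x y l X Y Γ φ.allC := by
  unfold TrCongr
  rw [PF.allC_subst, PF.allC_subst]
  exact .iffJ (Pv.iffAllC (Γ := .cons (.sim a b x y) (.cons (.simC a b X Y) Γ)) h)
theorem exC (h : TrCongr a b k x y l.succ X.succ Y.succ Γ.shiftC φ) :
    TrCongr a b k x y l X Y Γ φ.exC := by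
  unfold TrCongr
  rw [PF.exC_subst, PF.exC_subst]
  exact .iffJ (Pv.iffExC (Γ := .cons (.sim a b x y) (.cons (.simC a b X Y) Γ)) h)
end TrCongr

theorem PR.primrec {π β : Type} [Primcodable π] [Primcodable β] {f : π → β}
    (h : PR (fun x : π => Encodable.encode x) f) : Primrec f := by
  obtain ⟨g, hg, e⟩ := h
  exact (hg.comp Primrec.encode).of_eq fun x => (e x).symm

/-- The data of the recursion for `TrCongr`: variables `(a, b)`, `(k, x, y)`, `(l, X, Y)` and the
code of a context. -/
abbrev TrCongr.Param : Type := (ℕ × ℕ) × (ℕ × ℕ × ℕ) × (ℕ × ℕ × ℕ) × ℕ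

/-- The relation computed by the recursion for `TrCongr`. -/
def TrCongr.Rel (p : TrCongr.Param) (φ : Fml) (n : ℕ) : Prop := ∀ Γ : List Fml, codeList Γ = p.2.2.2 →
  IsProof IKM (sim p.1.1 p.1.2 p.2.1.2.1 p.2.1.2.2 :: simC p.1.1 p.1.2 p.2.2.1.2.1 p.2.2.1.2.2 :: Γ)
    (iff (tr p.1.1 p.1.2 (φ.rename (substRen p.2.1.1 p.2.1.2.1) (substRen p.2.2.1.1 p.2.2.1.2.1)))
      (tr p.1.1 p.1.2 (φ.rename (substRen p.2.1.1 p.2.1.2.2) (substRen p.2.2.1.1 p.2.2.1.2.2)))) n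

section
variable {α : Type} {c : α → ℕ} {p : α → TrCongr.Param}

/-- `TrCongr` for a family of parameters. -/
def TrCongr.At (hp : PR c p) (Γ : PL c) (φ : PF c) : Prop :=
  TrCongr ⟨_, hp.fst.fst⟩ ⟨_, hp.fst.snd⟩ ⟨_, hp.snd.fst.fst⟩ ⟨_, hp.snd.fst.snd.fst⟩
    ⟨_, hp.snd.fst.snd.snd⟩ ⟨_, hp.snd.snd.fst.fst⟩ ⟨_, hp.snd.snd.fst.snd.fst⟩
    ⟨_, hp.snd.snd.fst.snd.snd⟩ Γ φ

theorem TrCongr.qf_iff (hp : PR c p) (φ : PF c) : QF TrCongr.Rel c p φ ↔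
    ∀ {β : Type} (i : β → α) (Γ : PL fun j => c (i j)), (∀ j, codeList (Γ.f j) = (p (i j)).2.2.2) →
      TrCongr.At (hp.comap i) Γ (φ.comap i) := by
  constructor
  · rintro ⟨n, hn, e⟩ β i Γ hΓ
    exact ⟨_, hn.comap i, fun j => e (i j) (Γ.f j) (hΓ j)⟩
  · intro h
    obtain ⟨n, ⟨g, hg, e⟩, k⟩ := h (β := {x : α × List Fml // codeList x.2 = (p x.1).2.2.2}) (fun x => x.1.1)
      ⟨fun x => x.1.2, (hp.snd.snd.snd.comap _).of_eq fun x => x.2.symm⟩ fun x => x.2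
    exact ⟨fun a => g (c a), .comp hg .self, fun a Γ hΓ => by
      have := k ⟨(a, Γ), hΓ⟩
      rw [e] at this; exact this⟩

end

theorem TrCongr.q_pr {g : ℕ → ℕ} (hg : Primrec g) {α : Type} {c : α → ℕ} {p : α → TrCongr.Param}
    (hp : PR c p) : PR c fun a =>
      (((p a).1.1 + 1, (p a).1.2 + 1), ((p a).2.1.1 + 1, (p a).2.1.2.1 + 1, (p a).2.1.2.2 + 1),
        (p a).2.2.1, g (p a).2.2.2) := 
  .mk (.mk hp.fst.fst.succ hp.fst.snd.succ) (.mk (.mk hp.snd.fst.fst.succ (.mk hp.snd.fst.snd.fst.succ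
      hp.snd.fst.snd.snd.succ)) (.mk hp.snd.snd.fst (.comp hg hp.snd.snd.snd)))

theorem TrCongr.qC_pr {g : ℕ → ℕ} (hg : Primrec g) {α : Type} {c : α → ℕ} {p : α → TrCongr.Param}
    (hp : PR c p) : PR c fun a =>
      ((p a).1, (p a).2.1, ((p a).2.2.1.1 + 1, (p a).2.2.1.2.1 + 1, (p a).2.2.1.2.2 + 1),
        g (p a).2.2.2) := 
  .mk hp.fst (.mk hp.snd.fst (.mk (.mk hp.snd.snd.fst.fst.succ (.mk hp.snd.snd.fst.snd.fst.succ
      hp.snd.snd.fst.snd.snd.succ)) (.comp hg hp.snd.snd.snd)))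

theorem TrCongr.rules {g gC : ℕ → ℕ} (hg : Primrec g) (hgC : Primrec gC)
    (e : ∀ Γ : List Fml, codeList (Γ.map shift) = g (codeList Γ))
    (eC : ∀ Γ : List Fml, codeList (Γ.map shiftC) = gC (codeList Γ)) :
    FRules (π := TrCongr.Param)
      (fun p => ((p.1.1 + 1, p.1.2 + 1), (p.2.1.1 + 1, p.2.1.2.1 + 1, p.2.1.2.2 + 1), p.2.2.1, g p.2.2.2))
      (fun p => (p.1, p.2.1, (p.2.2.1.1 + 1, p.2.2.1.2.1 + 1, p.2.2.1.2.2 + 1), gC p.2.2.2))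
      TrCongr.Rel := by
  constructor
  · exact fun c p x y hp => (qf_iff hp _).2 fun i Γ _ => TrCongr.mem (x.comap i) (y.comap i)
  · exact fun c p x y hp => (qf_iff hp _).2 fun i Γ _ => TrCongr.memC (x.comap i) (y.comap i)
  · exact fun c p x y hp => (qf_iff hp _).2 fun i Γ _ => TrCongr.eq (x.comap i) (y.comap i)
  · exact fun c p x y hp => (qf_iff hp _).2 fun i Γ _ => TrCongr.eqC (x.comap i) (y.comap i)
  · exact fun c p hp => (qf_iff hp _).2 fun i Γ _ => .iffRefl
  · exact fun c p φ ψ hp h h' => (qf_iff hp _).2 fun i Γ hΓ =>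
      .iffJ (.iffConj ((qf_iff hp _).1 h i Γ hΓ) ((qf_iff hp _).1 h' i Γ hΓ))
  · exact fun c p φ ψ hp h h' => (qf_iff hp _).2 fun i Γ hΓ =>
      .iffJ (.iffDisj ((qf_iff hp _).1 h i Γ hΓ) ((qf_iff hp _).1 h' i Γ hΓ))
  · exact fun c p φ ψ hp h h' => (qf_iff hp _).2 fun i Γ hΓ =>
      .iffJ (.iffImp ((qf_iff hp _).1 h i Γ hΓ) ((qf_iff hp _).1 h' i Γ hΓ))
  · refine fun c p φ hp h => (qf_iff hp _).2 fun i Γ hΓ => ?_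
    have := (qf_iff (TrCongr.q_pr hg hp) _).1 h i Γ.shift fun j => by rw [← hΓ, ← e]; rfl
    refine TrCongr.all (φ := φ.comap i) ?_
    exact this
  · refine fun c p φ hp h => (qf_iff hp _).2 fun i Γ hΓ => ?_
    have := (qf_iff (TrCongr.q_pr hg hp) _).1 h i Γ.shift fun j => by rw [← hΓ, ← e]; rfl
    refine TrCongr.ex (φ := φ.comap i) ?_
    exact this
  · refine fun c p φ hp h => (qf_iff hp _).2 fun i Γ hΓ => ?_
    have := (qf_iff (TrCongr.qC_pr hgC hp) _).1 h i Γ.shiftC fun j => by rw [← hΓ, ← eC]; rfl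
    refine TrCongr.allC (φ := φ.comap i) ?_
    exact this
  · refine fun c p φ hp h => (qf_iff hp _).2 fun i Γ hΓ => ?_
    have := (qf_iff (TrCongr.qC_pr hgC hp) _).1 h i Γ.shiftC fun j => by rw [← hΓ, ← eC]; rfl
    refine TrCongr.exC (φ := φ.comap i) ?_
    exact this

section
variable {α : Type} {c : α → ℕ}

theorem trCongr (a b k x y l X Y : PN c) (Γ : PL c) (φ : PF c) : TrCongr a b k x y l X Y Γ φ := by
  obtain ⟨g, hg, e⟩ := exists_shiftCode
  obtain ⟨gC, hgC, eC⟩ := exists_shiftCCode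
  have hp : PR c fun i => (((a.f i, b.f i), (k.f i, x.f i, y.f i), (l.f i, X.f i, Y.f i),
      codeList (Γ.f i)) : TrCongr.Param) :=
    .mk (.mk a.pr b.pr) (.mk (.mk k.pr (.mk x.pr y.pr)) (.mk (.mk l.pr (.mk X.pr Y.pr)) Γ.pr))
  refine (TrCongr.qf_iff hp φ).1 ((TrCongr.rules hg hgC e eC).family ?_ ?_ c _ φ hp) id Γ fun j => rfl
  · exact PR.primrec (TrCongr.q_pr hg (FRules.param .self))
  · exact PR.primrec (TrCongr.qC_pr hgC (FRules.param .self))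

theorem Pv.tr_inst_iff {Γ : PL c} {a b x y : PN c} {φ : PF c} (h : Pv IKM Γ (.sim a b x y)) :
    Pv IKM Γ (((φ.tr a.succ b.succ).inst x).iff ((φ.tr a.succ b.succ).inst y)) := by
  have k := impE (impE (impI (impI (trCongr a b (.const 0) x y (.const 0) (.const 0) (.const 0) Γ φ.shiftC)))
    (simC_refl a b (.const 0))) h
  have e : ∀ x, (φ.shiftC.subst (.const 0) x (.const 0) (.const 0)) = φ.inst x := fun x => by
    ext i
    simp only [PF.subst, PN.const, substRen_zero, PF.shiftC, Fml.shiftC, rename_rename]; rfl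
  simpa only [e, PF.tr_inst] using k

theorem Pv.tr_instC_iff {Γ : PL c} {a b X Y : PN c} {φ : PF c} (h : Pv IKM Γ (.simC a b X Y)) :
    Pv IKM Γ (((φ.tr a b).instC X).iff ((φ.tr a b).instC Y)) := by
  have k := impE (impE (impI (impI (trCongr a b (.const 0) (.const 0) (.const 0) (.const 0) X Y Γ φ.shift)))
    h) (sim_refl a b (.const 0))
  have e : ∀ X, (φ.shift.subst (.const 0) (.const 0) (.const 0) X) = φ.instC X := fun x => by
    ext i
    simp only [PF.subst, PN.const, substRen_zero, PF.shift, Fml.shift, rename_rename]; rfl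
  simpa only [e, PF.tr_instC] using k

end

end SetClass


/-! ## The translations of the axioms -/

namespace SetClass

open Fml

namespace Prv
variable {Γ : List Fml} {φ ψ χ : Fml} {a b x y z u v p X Y Z : ℕ}

section
variable {T : Theory} [T.Renamable]
theorem jAllI (h : ∀ t, Prv T Γ (J a b (ψ.inst t))) : Prv T Γ (J a b (all (J (a + 1) (b + 1) ψ))) :=
  .jI (.allI h)
theorem jAllE (h : Prv T Γ (J a b (all (J (a + 1) (b + 1) ψ)))) (t : ℕ) : Prv T Γ (J a b (ψ.inst t)) :=
  .jBind h fun k => k.allE t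
theorem jAllCI (h : ∀ t, Prv T Γ (J a b (ψ.instC t))) : Prv T Γ (J a b (allC (J a b ψ))) :=
  .jI (.allCI h)
theorem jImpI (h : Prv T (φ :: Γ) φ → Prv T (φ :: Γ) ψ) : Prv T Γ (J a b (imp φ ψ)) := .jI (.impI h)
theorem jImpE (h : Prv T Γ (J a b (imp φ (J a b ψ)))) (h' : Prv T Γ φ) : Prv T Γ (J a b ψ) :=
  .jBind h fun k => .impE k h'.w
theorem jAndI (h : Prv T Γ φ) (h' : Prv T Γ ψ) : Prv T Γ (J a b (conj φ ψ)) := .jI (.andI h h')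
theorem jAndL (h : Prv T Γ (J a b (conj (J a b φ) ψ))) : Prv T Γ (J a b φ) := .jBind h fun k => k.andL
theorem jAndR (h : Prv T Γ (J a b (conj φ (J a b ψ)))) : Prv T Γ (J a b ψ) := .jBind h fun k => k.andR
theorem jExI (t : ℕ) (h : Prv T Γ (J a b (ψ.inst t))) : Prv T Γ (J a b (ex (J (a + 1) (b + 1) ψ))) :=
  .jI (.exI t h)
theorem jExE (h : Prv T Γ (J a b (ex φ)))
    (h₁ : ∀ t, Prv T (φ.inst t :: ex φ :: Γ) (φ.inst t) → Prv T (φ.inst t :: ex φ :: Γ) (J a b χ)) :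
    Prv T Γ (J a b χ) := .jBind h fun k => .exE k h₁
/-- The translation of an equivalence. -/
theorem jIffI (h : Prv T (φ :: Γ) φ → Prv T (φ :: Γ) ψ) (h' : Prv T (ψ :: Γ) ψ → Prv T (ψ :: Γ) φ) :
    Prv T Γ (J a b (conj (J a b (imp φ ψ)) (J a b (imp ψ φ)))) := .jAndI (.jImpI h) (.jImpI h')
end

theorem igb (h : IGBAxiom φ) : Prv IKM Γ φ := .ax (.igb h)

theorem tr_mem (h : Prv IKM Γ (mem x y)) : Prv IKM Γ (tr a b (mem x y)) :=
  .jI (.exI x (.andI h (.sim_refl x)))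

theorem simExt_intro (h : ∀ z, Prv IKM (tr a b (mem z x) :: Γ) (tr a b (mem z x)) →
      Prv IKM (tr a b (mem z x) :: Γ) (tr a b (mem z y)))
    (h' : ∀ z, Prv IKM (tr a b (mem z y) :: Γ) (tr a b (mem z y)) →
      Prv IKM (tr a b (mem z y) :: Γ) (tr a b (mem z x))) : Prv IKM Γ (sim a b x y) := by
  refine .sim_fold (.andI (.allI fun z => .impI fun hz => ?_) (.allI fun z => .impI fun hz => ?_))
  · refine .jMap (.impE (Prv.w (.impI (h z))) (tr_mem hz)) fun k => .exE k fun w hw => ?_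
    have h₁ : Prv IKM _ (sim a b w z) := hw.andR
    exact .exI w (.andI hw.andL h₁.sim_symm)
  · refine .jMap (.impE (Prv.w (.impI (h' z))) (tr_mem hz)) fun k => .exE k fun w hw => ?_
    have h₁ : Prv IKM _ (sim a b w z) := hw.andR
    exact .exI w (.andI hw.andL h₁)

/-- Elimination of translated membership. -/
theorem tr_mem_elim (h : Prv IKM Γ (tr a b (mem x y)))
    (h' : ∀ z, Prv IKM (conj (mem z y) (sim a b z x) :: Γ) (mem z y) →
      Prv IKM (conj (mem z y) (sim a b z x) :: Γ) (sim a b z x) →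
      Prv IKM (conj (mem z y) (sim a b z x) :: Γ) (J a b χ)) : Prv IKM Γ (J a b χ) :=
  .jExE h fun z hz => .impE (Prv.w (.impI fun k => h' z k.andL k.andR)) hz

theorem separation (φ : Fml) (x : ℕ)
    (h : ∀ y, Prv IKM (all (iff (mem 0 (y + 1)) (conj φ (mem 0 (x + 1)))) :: Γ)
      (all (iff (mem 0 (y + 1)) (conj φ (mem 0 (x + 1))))) →
      Prv IKM (all (iff (mem 0 (y + 1)) (conj φ (mem 0 (x + 1)))) :: Γ) χ) : Prv IKM Γ χ := by
  refine .comprehension φ fun A hA => ?_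
  have h₁ : ∀ z, Prv IKM _ (iff (memC z A) (φ.inst z)) := fun z => hA.allE z
  refine .exE ((Prv.allCE (igb .classSeparation) A).allE x) fun y hy =>
    .impE (Prv.w (.impI (h y))) (.allI fun z => ?_)
  have h₂ : Prv IKM _ (iff (mem z y) (conj (memC z A) (mem z x))) := hy.allE z
  exact h₂.iff_trans (.iffI (fun k => .andI ((h₁ z).w.mp k.andL) k.andR)
    fun k => .andI ((h₁ z).w.mpr k.andL) k.andR)

theorem tr_extensionality : Prv IKM [] (tr a b extensionality) := by
  refine .jAllI fun x => .jAllI fun y => .jImpI fun h => .jI (.simExt_intro (fun z hz => ?_) fun z hz => ?_)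
  · exact .jImpE (.jAndL (.jAllE h.w z)) hz
  · exact .jImpE (.jAndR (.jAllE h.w z)) hz

theorem tr_pairing : Prv IKM [] (tr a b (all (all (ex (conj (mem 2 0) (mem 1 0)))))) :=
  .jAllI fun x => .jAllI fun y => .exE (.exists_upair x y) fun p hp => .jExI p (.jAndI
    (.tr_mem (hp.upair_left)) (.tr_mem hp.upair_right))

theorem tr_union : Prv IKM []
    (tr a b (all (ex (all (all (imp (mem 0 3) (imp (mem 1 0) (mem 1 2)))))))) := by
  refine .jAllI fun x => .exE ((izf .union).allE x) fun u hu => ?_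
  have h₅ : ∀ y, Prv IKM _ (iff (mem y u) (bexIn x (mem (y + 1) 0))) := fun y => hu.allE y
  refine .jExI u <| .jAllI fun y => .jAllI fun z => .jImpI fun hz => .jImpI fun hy => .tr_mem_elim hz.w fun z' h₁ h₂ => ?_
  refine .tr_mem_elim (simMem_congr (.sim_refl y) h₂.sim_symm hy.w) fun y' h₃ h₄ => ?_
  exact simMem_congr h₄ (.sim_refl u) (.tr_mem ((h₅ y').w.mpr (.exI z' (.andI h₁.w h₃))))

theorem tr_powerset : Prv IKM [] (tr a b (all (ex (all (imp (isSubset 0 2) (mem 0 1)))))) := by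
  refine .jAllI fun x => .exE ((izf .powerset).allE x) fun p hp => ?_
  have h₁ : ∀ z, Prv IKM _ (iff (mem z p) (isSubset z x)) := fun z => hp.allE z
  refine .jExI p <| .jAllI fun y => .jImpI fun hy => .separation (tr (a + 1) (b + 1) (mem 0 (y + 1))) x fun z hz => ?_
  have h : ∀ u, Prv IKM _ (iff (mem u z) (conj (tr a b (mem u y)) (mem u x))) := fun u => hz.allE u
  refine simMem_congr ?_ (.sim_refl p) (.tr_mem ((h₁ z).w.mpr (.allI fun u => .impI fun hu => ((h u).w.mp hu).andR)))
  refine .simExt_intro (fun u hu => ?_) fun u hu => ?_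
  · exact .tr_mem_elim hu fun v h₂ h₃ => simMem_congr h₃ (.sim_refl y) ((h v).w.mp h₂).andL
  · refine .tr_mem_elim (.jImpE (.jAllE hy.w u) hu) fun v h₂ h₃ => ?_
    exact simMem_congr h₃ (.sim_refl z) (.tr_mem ((h v).w.mpr (.andI (simMem_congr h₃.sim_symm (.sim_refl y) hu.w) h₂)))

theorem tr_isEmpty (h : Prv IKM Γ (isEmpty x)) : Prv IKM Γ (tr a b (isEmpty x)) :=
  .jAllI fun u => .jImpI fun hu => .tr_mem_elim hu fun v h₁ _ => .efq (.impE (h.w.allE v) h₁)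

theorem tr_isSucc (h : Prv IKM Γ (isSucc x y)) (h' : Prv IKM Γ (sim a b x z)) :
    Prv IKM Γ (tr a b (isSucc z y)) := by
  have h₁ : ∀ u, Prv IKM _ (iff (mem u y) (disj (mem u x) (eq u x))) := fun u => h.allE u
  refine .jAllI fun u => .jIffI (fun hu => .tr_mem_elim hu fun v h₂ h₃ => .orE ((h₁ v).w.mp h₂)
    (fun k => .jI (.orL (simMem_congr h₃.w h'.w (.tr_mem k))))
    fun k => .jI (.orR (.jI ((h₃.w.sim_symm.sim_trans (.sim_of_eq k)).sim_trans h'.w))))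
    fun hu => .jBind hu fun k => .orE k (fun k => ?_) fun k => ?_
  · exact .tr_mem_elim k fun v h₂ h₃ => .tr_mem_elim (simMem_congr (.sim_refl v) h'.w.sim_symm (.tr_mem h₂))
      fun w h₄ h₅ => simMem_congr (h₅.sim_trans h₃.w) (.sim_refl y) (.tr_mem ((h₁ w).w.mpr (.orL h₄)))
  · exact .jBind k fun k => simMem_congr (h'.w.sim_trans k.sim_symm) (.sim_refl y)
      (.tr_mem ((h₁ x).w.mpr (.orR (.refl x))))

theorem tr_isInductive (h : Prv IKM Γ (isInductive x)) : Prv IKM Γ (tr a b (isInductive x)) := by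
  refine .jAndI ?_ (.jAllI fun u => .jImpI fun hu => .tr_mem_elim hu fun v h₁ h₂ => ?_)
  · exact .exE h.andL fun e he => .jExI e (.jAndI (.tr_mem he.andL) (.tr_isEmpty he.andR))
  · exact .exE (.impE (h.andR.w.allE v) h₁) fun w hw => .jExI w (.jAndI (.tr_mem hw.andL)
      (.tr_isSucc hw.andR h₂.w))

theorem tr_infinity : Prv IKM [] (tr a b infinity) :=
  .exE (izf .infinity) fun x hx => .jExI x (.tr_isInductive hx)

theorem tr_classExtensionality : Prv IKM [] (tr a b classExtensionality) := by
  refine .jAllCI fun X => .jAllCI fun Y => .jIffI (fun h => .jBind h fun k => .jAllI fun x =>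
    .jAndI (.jImpI fun k' => ((simC_iff k x).w.mp k')) (.jImpI fun k' => ((simC_iff k x).w.mpr k')))
    fun h => .jI (.allI fun x => .iffI (fun k => ?_) fun k => ?_)
  · exact .jImpE (.jAndL (.jAllE h.w x)) k
  · exact .jImpE (.jAndR (.jAllE h.w x)) k

theorem tr_classSeparation : Prv IKM [] (tr a b classSeparation) := by
  refine .jAllCI fun X => .jAllI fun x => .separation (simMemC (a + 1) (b + 1) 0 X) x fun y hy =>
    .jExI y <| .jAllI fun u => ?_
  have h : ∀ u, Prv IKM _ (iff (mem u y) (conj (simMemC a b u X) (mem u x))) := fun u => hy.allE u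
  refine .jIffI (fun hu => .tr_mem_elim hu fun v h₁ h₂ => .jAndI (simMemC_congr h₂ ((h v).w.mp h₁).andL)
    (simMem_congr h₂ (.sim_refl x) (.tr_mem ((h v).w.mp h₁).andR))) fun hu => ?_
  refine .tr_mem_elim (.jAndR hu) fun v h₁ h₂ => ?_
  exact simMem_congr h₂ (.sim_refl y) (.tr_mem ((h v).w.mpr (.andI (simMemC_congr h₂.sim_symm (.jAndL hu.w)) h₁)))

theorem tr_classSetInduction : Prv IKM [] (tr a b classSetInduction) := by
  refine .jAllCI fun X => .jImpI fun h => .comprehension (simMemC (a + 1) (b + 1) 0 X) fun A hA => .jAllI fun x => ?_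
  have hA : ∀ x, Prv IKM _ (iff (memC x A) (simMemC a b x X)) := fun x => hA.allE x
  refine (hA x).mp (Prv.allE (.impE (Prv.allCE (igb .classSetInduction) A) (.allI fun y => .impI fun hy =>
    (hA y).w.mpr ?_)) x)
  refine .jImpE (.jAllE h.w y) (.jAllI fun z => .jImpI fun hz => .tr_mem_elim hz fun v h₁ h₂ => ?_)
  exact simMemC_congr h₂ ((hA v).w.mp (.impE (hy.w.allE v) h₁))

/-- Translated formulas respect bisimilarity. -/
theorem tr_congr (φ : Fml) (h : Prv IKM Γ (sim a b x y))
    (k : Prv IKM Γ ((tr (a + 1) (b + 1) φ).inst x)) : Prv IKM Γ ((tr (a + 1) (b + 1) φ).inst y) := by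
  have h' : Pv IKM (c := fun _ : Unit => 0) ⟨fun _ => Γ, .const _⟩ (.sim (.const a) (.const b) (.const x) (.const y)) :=
    h.elim fun d => ⟨fun _ => d.code, .const _, fun _ => ⟨d, rfl⟩⟩
  exact ((Pv.tr_inst_iff (φ := .const φ) h').toPrv ()).mp k

theorem tr_classCollection : Prv IKM [] (tr a b classCollection) := by
  refine .jAllCI fun R => .jAllI fun x => .jImpI fun h => ?_
  let ψ := tr (a + 2) (b + 2) (pairMemC 1 0 R)
  refine .comprehension₂ ψ fun S hS => ?_
  have e : ∀ u v, ψ.at₂ u v = tr a b (pairMemC u v R) := fun u v => tr_rename _ _ _ _ _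
  have hS : ∀ u v, Prv IKM _ (iff (pairMemC u v S) (tr a b (pairMemC u v R))) := fun u v => e u v ▸ rel_iff hS u v
  refine .separation (ex (pairMemC 1 0 S)) x fun y hy => ?_
  have hy : ∀ u, Prv IKM _ (iff (mem u y) (conj (ex (pairMemC (u + 1) 0 S)) (mem u x))) := fun u => hy.allE u
  refine .exE (.impE ((Prv.allCE (igb .classCollection) S).allE y)
    (.allI fun u => .impI fun hu => ((hy u).w.mp hu).andL)) fun z hz => .jExI z <| .jAllI fun u => .jImpI fun hu =>
      .tr_mem_elim hu fun w h₁ h₂ => .jExE (.jImpE (.jAllE h.w w) (.tr_mem h₁)) fun v hv => ?_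
  refine .exE (.impE (hz.w.allE w) ((hy w).w.mpr (.andI (.exI v ((hS w v).w.mpr hv)) h₁.w))) fun v hv => ?_
  refine .jExI v (.jAndI (.tr_mem hv.andL) ?_)
  have h₃ : Prv IKM _ (tr a b (pairMemC w v R)) := (hS w v).w.mp hv.andR
  have e : ∀ u, (tr (a + 1) (b + 1) (pairMemC 0 (v + 1) R)).inst u = tr a b (pairMemC u v R) := fun u => tr_rename ..
  have h₄ : Prv IKM _ (tr a b (pairMemC u v R)) :=
    e u ▸ tr_congr (a := a) (b := b) (pairMemC 0 (v + 1) R) (x := w) h₂.w (by rw [e]; exact h₃)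
  exact h₄

end Prv

end SetClass


/-! ## Soundness of the translation -/

namespace SetClass

open Fml

theorem Prv.tr_comprehension_aux : Prv IKM []
    (imp (all (all (imp (sim 2 3 1 0) (imp (memC 1 0) (memC 0 0)))))
      (imp (all (imp (J 1 2 (memC 0 0)) (memC 0 0)))
      (J 0 1 (exC (J 0 1 (all (J 1 2 (conj (J 1 2 (imp (simMemC 1 2 0 0) (memC 0 1)))
        (J 1 2 (imp (memC 0 1) (simMemC 1 2 0 0))))))))))) := by
  refine .impI fun h₁ => ?_
  have h₁' : ∀ z x, Prv IKM _ (imp (sim 0 1 z x) (imp (memC z 0) (memC x 0))) := fun z x => (h₁.allE z).allE x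
  refine .impI fun h₂ => .jI (.exCI 0 (.jI (.allI fun x => .jIffI (fun k => ?_) fun k => ?_)))
  · have h₂' : Prv IKM _ (imp (J 0 1 (memC x 0)) (memC x 0)) := h₂.allE x
    refine .impE h₂'.w (.jMap k fun k => .exE k fun z hz => ?_)
    exact .impE (.impE (h₁' z x).w hz.andR) hz.andL
  · exact .jI (.exI x (.andI k (.sim_refl x)))

section
variable {α : Type} {c : α → ℕ} {Γ : PL c} {a b : PN c}

namespace Pv

/-- Instances of closed derivable formulas. -/
theorem _root_.SetClass.Prv.fillPv {T : Theory} [T.Renamable] [T.Comprehension] {Φ : Fml} (h : Prv T [] Φ)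
    (hΦ : Φ.NoEqC) {Γ : PL c} {φ : PF c} (ρ : ℕ → PN c) (L : List (PF c))
    (e : ∀ i, (Φ.fill ρ (holes L)).f i = φ.f i) : Pv T Γ φ := by
  rw [← show Φ.fill ρ (holes L) = φ from PF.ext e]
  exact h.fill hΦ Γ ρ L

theorem tr_comprehension (φ : PF c) :
    Pv IKM Γ (.tr a b (.exC (.all (.iff (.memC (.const 0) (.const 0)) φ.shiftC)))) := by
  have h : Pv IKM Γ (.imp (.all (.all (.imp (.sim a.succ.succ b.succ.succ (.const 1) (.const 0))
       (.imp ((φ.tr a.succ b.succ).under.under.inst (.const 1)) ((φ.tr a.succ b.succ).under.under.inst (.const 0))))))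
      (.imp (.all (.imp (.J a.succ b.succ ((φ.tr a.succ b.succ).under.inst (.const 0)))
          ((φ.tr a.succ b.succ).under.inst (.const 0))))
      (.J a b (.exC (.J a b (.all (.J a.succ b.succ (.conj (.J a.succ b.succ (.imp (.simMemC a.succ b.succ (.const 0) (.const 0)) ((φ.tr a.succ b.succ).shiftC.under.inst (.const 0))))
        (.J a.succ b.succ (.imp ((φ.tr a.succ b.succ).shiftC.under.inst (.const 0)) (.simMemC a.succ b.succ (.const 0) (.const 0))))))))))) ) :=
    Prv.tr_comprehension_aux.fillPv (by simp [NoEqC, J, sim, simMemC, isBisim, forthBack, pairMemC, ballIn, bexIn, isOPair, isUPair, iff])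
      (fun | 0 => a | _ => b) [φ.tr a.succ b.succ] fun _ => rfl
  simp only [PF.under_inst] at h
  rw [← PF.tr_shiftC] at h
  refine impE (impE h (.allI (.allI (.impI ?_)))) (.allI (.impI ?_))
  · have k := tr_inst_iff (φ := φ.under.under) (Γ := .cons (.sim a.succ.succ b.succ.succ (.const 1) (.const 0)) Γ.shift.shift) hyp0
    simp only [PF.tr_under, PF.under_inst] at k
    exact andL k
  · exact trBind hyp0 hyp0

theorem tr_lem (φ : PF c) : Pv IKM Γ (.tr a b (φ.disj (φ.imp .fls))) := by
  have h : Prv IKM [] (imp (imp fls (mem 0 1)) (J 0 1 (disj (memC 0 0) (J 0 1 (imp (memC 0 0) (J 0 1 fls)))))) :=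
    .impI fun _ => .impI fun k => .impE k (.orR (.jI (.impI fun k' => .impI fun _ => .impE k.w (.orL k'.w))))
  have : Pv IKM Γ (.imp (.imp .fls (.mem a b)) (.J a b (.disj ((φ.tr a b).shift.inst a) (.J a b (.imp ((φ.tr a b).shift.inst a) (.J a b .fls)))))) :=
    h.fillPv (by simp [NoEqC, J]) (fun | 0 => a | _ => b) [(φ.tr a b).shift] fun _ => rfl
  rw [PF.shift_inst] at this
  exact impE this (impI (efq hyp0))

theorem tr_of_mem (L : List Fml) (hL : ∀ χ ∈ L, Prv IKM [] (Fml.tr 0 1 χ) ∧ ∀ ρ σ, χ.rename ρ σ = χ) :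
    ∀ {α : Type} {c : α → ℕ} (Γ : PL c) (a b : PN c) (φ : PF c), (∀ i, φ.f i ∈ L) → Pv IKM Γ (φ.tr a b) := by
  induction L with
  | nil => exact fun Γ a b φ h => ⟨fun _ => 0, .const 0, fun i => by simpa using h i⟩
  | cons χ L ih =>
    intro α c Γ a b φ h
    refine .ite (p := fun i => decide ((φ.f i).code = χ.code))
      (PR.comp (Primrec.eq.decide.comp .id (.const χ.code)) φ.pr) ?_ ?_
    · refine (hL χ (by simp)).1.pv (fun | 0 => a.comap _ | _ => b.comap _) (fun _ => a.comap _) fun i => ?_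
      rw [Fml.tr_rename, (hL χ (by simp)).2]
      exact congrArg (Fml.tr _ _) (code_injective (of_decide_eq_true i.2)).symm
    · exact ih (fun χ hχ => hL χ (by simp [hχ])) (Γ.comap Subtype.val) (a.comap _) (b.comap _) (φ.comap Subtype.val)
        fun i => (List.mem_cons.1 (h i.1)).resolve_left fun e => of_decide_eq_false i.2 (congrArg code e)

theorem tr_ax (φ : PF c) (h : ∀ i, KMCAxiom (φ.f i)) : Pv IKM Γ (.tr a b φ) := by
  refine .ite (p := fun i => decide ((φ.f i).code.unpair.1 = 11))
    (PR.comp (Primrec.eq.decide.comp .id (.const 11)) φ.pr.left) ?_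
    (tr_of_mem [extensionality, all (all (ex (conj (mem 2 0) (mem 1 0)))),
      all (ex (all (all (imp (mem 0 3) (imp (mem 1 0) (mem 1 2)))))), all (ex (all (imp (isSubset 0 2) (mem 0 1)))),
      infinity, classExtensionality, classSeparation, classSetInduction, classCollection] ?_ _ (a.comap _) (b.comap _)
      (φ.comap _) fun ⟨i, hi⟩ => ?_)
  · have h' : ∀ i : {i // decide ((φ.f i).code.unpair.1 = 11) = true}, ∃ χ : Fml, φ.f i = SetClass.comprehension χ := by
      rintro ⟨i, hi⟩
      have k := h i
      replace hi : (φ.f i).code.unpair.1 = 11 := of_decide_eq_true hi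
      show ∃ χ, φ.f i = _
      generalize φ.f i = ψ at *
      cases k with
      | comprehension χ => exact ⟨χ, rfl⟩
      | _ => simp [code, extensionality, infinity, classExtensionality, classSeparation, classSetInduction,
          classCollection] at hi
    obtain ⟨n, hn, h'⟩ : ∃ n : {i // decide ((φ.f i).code.unpair.1 = 11) = true} → ℕ, PR (fun i => c i.1) n ∧
        ∀ i, ∃ χ : Fml, χ.shiftC.code = n i ∧ φ.f i = SetClass.comprehension χ :=
      ⟨_, φ.pr.right.right.right.left.right.right.comap _,
        fun i => (h' i).imp fun χ hχ => ⟨by rw [hχ]; simp [SetClass.comprehension, iff, code], hχ⟩⟩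
    have := Pv.tr_comprehension (Γ := Γ.comap Subtype.val) (a := a.comap _) (b := b.comap _)
      ((PF.ofCode hn fun i => (h' i).elim fun _ k => ⟨_, k.1⟩).ren id (· - 1) .id (Primrec.nat_sub.comp .id (.const 1)))
    rwa [show PF.exC _ = φ.comap Subtype.val from PF.ext fun i => ?_] at this
    obtain ⟨χ, hχ, e⟩ := h' i
    have e' : ((PF.ofCode hn fun i => (h' i).elim fun _ k => ⟨_, k.1⟩).ren id (· - 1) .id (Primrec.nat_sub.comp .id (.const 1))).f i = χ := by
      simp only [PF.ren, PF.ofCode_f _ _ i hχ, Fml.shiftC, rename_rename]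
      exact rename_eq_self _ (fun _ => rfl) fun n => by simp
    exact (congrArg SetClass.comprehension e').trans e.symm
  · simp only [List.mem_cons, List.not_mem_nil, or_false]
    rintro χ (rfl | rfl | rfl | rfl | rfl | rfl | rfl | rfl | rfl)
    exacts [⟨.tr_extensionality, fun _ _ => rfl⟩, ⟨.tr_pairing, fun _ _ => rfl⟩, ⟨.tr_union, fun _ _ => rfl⟩,
      ⟨.tr_powerset, fun _ _ => rfl⟩, ⟨.tr_infinity, fun _ _ => rfl⟩, ⟨.tr_classExtensionality, fun _ _ => rfl⟩,
      ⟨.tr_classSeparation, fun _ _ => rfl⟩, ⟨.tr_classSetInduction, fun _ _ => rfl⟩,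
      ⟨.tr_classCollection, fun _ _ => rfl⟩]
  · have k := h i
    have hi : ¬ (φ.f i).code.unpair.1 = 11 := of_decide_eq_false hi
    show φ.f i ∈ _
    generalize φ.f i = ψ at *
    cases k with
    | comprehension χ => simp [code, SetClass.comprehension] at hi
    | _ => simp

theorem tr_orE {φ ψ χ : PF c} (h : Pv IKM Γ ((φ.disj ψ).tr a b)) (h₁ : Pv IKM (.cons (φ.tr a b) Γ) (χ.tr a b))
    (h₂ : Pv IKM (.cons (ψ.tr a b) Γ) (χ.tr a b)) : Pv IKM Γ (χ.tr a b) := by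
  have : Pv IKM Γ (.imp ((φ.disj ψ).tr a b) (.imp (.imp (φ.tr a b) (χ.tr a b)) (.imp (.imp (ψ.tr a b) (χ.tr a b)) (χ.tr a b)))) :=
    impI (impI (impI (trBind (φ := (φ.tr a b).disj (ψ.tr a b)) hyp2 (orE hyp0 (impE hyp3 hyp0) (impE hyp2 hyp0)))))
  exact impE (impE (impE this h) (impI h₁)) (impI h₂)

theorem tr_exE {φ χ : PF c} (h : Pv IKM Γ (φ.ex.tr a b))
    (h' : Pv IKM (.cons (φ.tr a.succ b.succ) Γ.shift) (χ.shift.tr a.succ b.succ)) : Pv IKM Γ (χ.tr a b) := by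
  rw [PF.tr_shift] at h'
  have : Pv IKM Γ (.imp (φ.ex.tr a b) (.imp (.all (.imp (φ.tr a.succ b.succ) (χ.tr a b).shift)) (χ.tr a b))) :=
    impI (impI (trBind (φ := (φ.tr a.succ b.succ).ex) hyp1 (exE hyp0 (impE ((PF.under_inst _).subst (motive := fun X => Pv IKM _ X) (allE (φ := ((φ.tr a.succ b.succ).imp (χ.tr a b).shift).under) (.const 0) (hyp fun _ => .tail _ (.tail _ (.head _))))) hyp0))))
  exact impE (impE this h) (.allI (impI h'))

theorem tr_exCE {φ χ : PF c} (h : Pv IKM Γ (φ.exC.tr a b))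
    (h' : Pv IKM (.cons (φ.tr a b) Γ.shiftC) (χ.shiftC.tr a b)) : Pv IKM Γ (χ.tr a b) := by
  rw [PF.tr_shiftC] at h'
  have : Pv IKM Γ (.imp (φ.exC.tr a b) (.imp (.allC (.imp (φ.tr a b) (χ.tr a b).shiftC)) (χ.tr a b))) :=
    impI (impI (trBind (φ := (φ.tr a b).exC) hyp1 (exCE hyp0 (impE ((PF.underC_instC _).subst (motive := fun X => Pv IKM _ X) (allCE (φ := ((φ.tr a b).imp (χ.tr a b).shiftC).underC) (.const 0) (hyp fun _ => .tail _ (.tail _ (.head _))))) hyp0))))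
  exact impE (impE this h) (.allCI (impI h'))

end Pv
end

/-- Derivations in `KMC` can be translated into derivations in `IKM`. -/
theorem exists_primrec_tr : ∃ G : ℕ → ℕ, Primrec G ∧ ∀ (p : ℕ × ℕ) Γ φ (d : Deriv KMC Γ φ),
    IsProof IKM (Γ.map (tr p.1 p.2)) (φ.tr p.1 p.2) (G (Nat.pair (Encodable.encode p) d.code)) := by
  have R : DRules KMC (π := ℕ × ℕ) (fun p => (p.1 + 1, p.2 + 1))
      (fun p Γ φ n => IsProof IKM (Γ.map (tr p.1 p.2)) (φ.tr p.1 p.2) n) := by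
    refine
    { ax := fun c p Γ φ hp h => Pv.tr_ax (Γ := Γ.tr ⟨_, hp.fst⟩ ⟨_, hp.snd⟩) (a := ⟨_, hp.fst⟩) (b := ⟨_, hp.snd⟩) φ h
      lem := fun c p Γ φ hp h => Pv.tr_lem (Γ := Γ.tr ⟨_, hp.fst⟩ ⟨_, hp.snd⟩) (a := ⟨_, hp.fst⟩) (b := ⟨_, hp.snd⟩) φ
      hyp := fun c p Γ φ hp h => Pv.hyp (Γ := Γ.tr ⟨_, hp.fst⟩ ⟨_, hp.snd⟩) (φ := φ.tr ⟨_, hp.fst⟩ ⟨_, hp.snd⟩) fun i => List.mem_map_of_mem (h i)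
      efq := fun c p Γ φ hp h => ?_
      andI := fun c p Γ φ ψ hp h h' => ?_
      andL := fun c p Γ φ ψ hp h => ?_
      andR := fun c p Γ φ ψ hp h => ?_
      orL := fun c p Γ φ ψ hp h => ?_
      orR := fun c p Γ φ ψ hp h => ?_
      orE := fun c p Γ φ ψ χ hp h h' h'' => ?_
      impI := fun c p Γ φ ψ hp h => ?_
      impE := fun c p Γ φ ψ hp h h' => ?_
      allI := fun c p Γ φ hp h => ?_
      allE := fun c p Γ t φ hp h => ?_
      exI := fun c p Γ t φ hp h => ?_
      exE := fun c p Γ φ χ hp h h' => ?_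
      allCI := fun c p Γ φ hp h => ?_
      allCE := fun c p Γ t φ hp h => ?_
      exCI := fun c p Γ t φ hp h => ?_
      exCE := fun c p Γ φ χ hp h h' => ?_
      eqRefl := fun c p Γ x hp => ?_
      eqSubst := fun c p Γ x y φ hp h h' => ?_
      eqCRefl := fun c p Γ x hp => ?_
      eqCSubst := fun c p Γ x y φ hp h h' => ?_ }
    all_goals
      let a : PN c := ⟨_, hp.fst⟩
      let b : PN c := ⟨_, hp.snd⟩
      have H : ∀ {Γ φ}, QD (fun p Γ φ n => IsProof IKM (Γ.map (tr p.1 p.2)) (φ.tr p.1 p.2) n) c p Γ φ =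
        Pv IKM (Γ.tr a b) (φ.tr a b) := rfl
      have H' : ∀ {Γ φ}, QD (fun p Γ φ n => IsProof IKM (Γ.map (tr p.1 p.2)) (φ.tr p.1 p.2) n) c (fun i => ((p i).1 + 1, (p i).2 + 1)) Γ φ =
        Pv IKM (Γ.tr a.succ b.succ) (φ.tr a.succ b.succ) := rfl
      simp only [H, H'] at *
    · exact .trBind (φ := .J a b .fls) (.jI h) (.trBind (φ := .fls) .hyp0 (.efq .hyp0))
    · exact .jI (.andI h h')
    · exact .trBind (φ := (φ.tr a b).conj (ψ.tr a b)) h (.andL .hyp0)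
    · exact .trBind (φ := (φ.tr a b).conj (ψ.tr a b)) h (.andR .hyp0)
    · exact .jI (.orL (ψ := ψ.tr a b) h)
    · exact .jI (.orR (φ := φ.tr a b) h)
    · exact .tr_orE h h' h''
    · exact .jI (.impI (Γ := Γ.tr a b) (φ := φ.tr a b) h)
    · have : Pv IKM (Γ.tr a b) (.imp ((φ.imp ψ).tr a b) (.imp (φ.tr a b) (ψ.tr a b))) :=
        .impI (.impI (.trBind (φ := (φ.tr a b).imp (ψ.tr a b)) .hyp1 (.impE .hyp0 .hyp1)))
      exact .impE (.impE this h) h'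
    · rw [PL.tr_shift] at h
      exact .jI (.allI h)
    · refine .trBind (φ := (φ.tr a.succ b.succ).all) h ?_
      rw [PF.tr_inst]
      exact .allE t .hyp0
    · rw [PF.tr_inst] at h
      exact .jI (.exI t h)
    · rw [PL.tr] at h'
      exact .tr_exE h (by rw [← PL.tr_shift]; exact h')
    · rw [PL.tr_shiftC] at h
      exact .jI (.allCI h)
    · refine .trBind (φ := (φ.tr a b).allC) h ?_
      rw [PF.tr_instC]
      exact .allCE t .hyp0
    · rw [PF.tr_instC] at h
      exact .jI (.exCI t h)
    · exact .tr_exCE h (by rw [← PL.tr_shiftC]; exact h')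
    · exact .jI (.sim_refl a b x)
    · have k : Pv IKM (Γ.tr a b) (.imp ((φ.inst x).tr a b) ((φ.inst y).tr a b)) := by
        have : Pv IKM (Γ.tr a b) (.imp ((PF.eq x y).tr a b) (.imp ((φ.inst x).tr a b) ((φ.inst y).tr a b))) := by
          refine .impI (.impI (.trBind (φ := .sim a b x y) .hyp1 ?_))
          rw [PF.tr_inst, PF.tr_inst]
          exact .impE (.andL (.tr_inst_iff .hyp0)) .hyp1
        exact .impE this h
      exact .impE k h'
    · exact .jI (.simC_refl a b x)
    · have k : Pv IKM (Γ.tr a b) (.imp ((φ.instC x).tr a b) ((φ.instC y).tr a b)) := by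
        have : Pv IKM (Γ.tr a b) (.imp ((PF.eqC x y).tr a b) (.imp ((φ.instC x).tr a b) ((φ.instC y).tr a b))) := by
          refine .impI (.impI (.trBind (φ := .simC a b x y) .hyp1 ?_))
          rw [PF.tr_instC, PF.tr_instC]
          exact .impE (.andL (.tr_instC_iff .hyp0)) .hyp1
        exact .impE this h
      exact .impE k h'
  obtain ⟨G, hG, e⟩ := R.exists_primrec (Primrec.pair (Primrec.succ.comp Primrec.fst) (Primrec.succ.comp Primrec.snd))
  exact ⟨G, hG, e⟩

end SetClass


/-! ## Natural numbers in `IKM` -/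

namespace SetClass

open Fml

namespace Prv

/-- Theorems of `IKM` can be translated. -/
theorem translate {φ : Fml} (h : Prv IKM [] φ) (a b : ℕ) : Prv IKM [] (Fml.tr a b φ) := by
  obtain ⟨d⟩ := h
  obtain ⟨G, -, e⟩ := exists_primrec_IKM KMC
  obtain ⟨d', -⟩ := e [] φ d
  obtain ⟨G', -, e'⟩ := exists_primrec_tr
  obtain ⟨d'', -⟩ := e' (a, b) [] φ d'
  exact ⟨d''⟩

section
variable {T : Theory} [T.Renamable] {Γ : List Fml} {φ ψ : Fml} {a b : ℕ}

theorem trBind (h : Prv T Γ (J a b φ)) (h' : Prv T (φ :: Γ) φ → Prv T (φ :: Γ) (tr a b ψ)) :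
    Prv T Γ (tr a b ψ) := by
  rw [tr_eq] at h' ⊢
  exact jBind h h'
theorem trAllE (h : Prv T Γ (tr a b (all φ))) (t : ℕ) : Prv T Γ (tr a b (φ.inst t)) :=
  .trBind (φ := all (tr (a + 1) (b + 1) φ)) h fun k =>
    (show (tr (a + 1) (b + 1) φ).inst t = _ from tr_rename ..) ▸ k.allE t
theorem trImpE (h : Prv T Γ (tr a b (imp φ ψ))) (h' : Prv T Γ (tr a b φ)) : Prv T Γ (tr a b ψ) :=
  .trBind (φ := imp (tr a b φ) (tr a b ψ)) h fun k => .impE k h'.w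
theorem imp_all (h : Prv T Γ (imp φ (all ψ))) (t : ℕ) : Prv T Γ (imp φ (ψ.inst t)) :=
  .impI fun k => (Prv.impE h.w k).allE t
theorem jFls (h : Prv T Γ (J a b fls)) : Prv T Γ (mem a b) := .impE h (.impI fun k => .efq k)
end

variable {Γ : List Fml} {φ ψ χ : Fml} {a b x y z e i n m s : ℕ}

theorem memL (h : Prv IKM Γ (eq x y)) (k : Prv IKM Γ (mem x z)) : Prv IKM Γ (mem y z) :=
  .subst (mem 0 (z + 1)) h k
theorem memR (h : Prv IKM Γ (eq x y)) (k : Prv IKM Γ (mem z x)) : Prv IKM Γ (mem z y) :=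
  .subst (mem (z + 1) 0) h k

theorem empty_uniq (h : Prv IKM Γ (isEmpty x)) (h' : Prv IKM Γ (isEmpty y)) : Prv IKM Γ (eq x y) :=
  .ext fun z => .iffI (fun k => .efq (.impE (h.w.allE z) k)) fun k => .efq (.impE (h'.w.allE z) k)

theorem exists_empty : Prv IKM Γ (ex (isEmpty 0)) :=
  .exE (izf .infinity) fun _ hx => .exE hx.andL fun e he => .exI e he.andR

theorem succ_iff (h : Prv IKM Γ (isSucc x y)) (z : ℕ) :
    Prv IKM Γ (iff (mem z y) (disj (mem z x) (eq z x))) := h.allE z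

theorem succ_uniq (h : Prv IKM Γ (isSucc x y)) (h' : Prv IKM Γ (isSucc x z)) : Prv IKM Γ (eq y z) :=
  .ext fun u => (succ_iff h u).iff_trans (succ_iff h' u).iff_symm

theorem self_mem_succ (h : Prv IKM Γ (isSucc x y)) : Prv IKM Γ (mem x y) :=
  (succ_iff h x).mpr (.orR (.refl x))

theorem exists_succ (x : ℕ) : Prv IKM Γ (ex (isSucc (x + 1) 0)) := by
  refine .exE (exists_upair x x) fun p hp => .exE (exists_upair x p) fun q hq =>
    .exE ((izf .union).allE q) fun u hu => .exI u (.allI fun z => ?_)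
  have hu : Prv IKM _ (iff (mem z u) (bexIn q (mem (z + 1) 0))) := hu.allE z
  refine hu.iff_trans (.iffI (fun k => .exE k fun y hy => .orE ((upair_iff hq.w y).mp hy.andL)
    (fun k => .orL (memR k hy.w.andR)) fun k => .orR (upair_self hp.w (memR k hy.w.andR)))
    fun k => .orE k (fun k => .exI x (.andI (upair_left hq.w) k)) fun k =>
      .exI p (.andI (upair_right hq.w) (memL k.symm (upair_left hp.w))))

theorem inductive_empty (h : Prv IKM Γ (isInductive i)) (he : Prv IKM Γ (isEmpty e)) : Prv IKM Γ (mem e i) :=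
  .exE h.andL fun _ he' => memL (empty_uniq he'.andR he.w) he'.andL

theorem inductive_succ (h : Prv IKM Γ (isInductive i)) (hs : Prv IKM Γ (isSucc x y))
    (hx : Prv IKM Γ (mem x i)) : Prv IKM Γ (mem y i) :=
  .exE (.impE (h.andR.allE x) hx) fun _ hy => memL (succ_uniq hy.andR hs.w) hy.andL

theorem nat_empty (h : Prv IKM Γ (isEmpty e)) : Prv IKM Γ (isNat e) :=
  .allI fun _ => .impI fun k => inductive_empty k h.w

theorem nat_succ (h : Prv IKM Γ (isNat x)) (hs : Prv IKM Γ (isSucc x y)) : Prv IKM Γ (isNat y) :=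
  .allI fun i => .impI fun k => inductive_succ k hs.w (.impE (h.w.allE i) k)

/-- Induction on natural numbers. -/
theorem nat_ind (φ : Fml)
    (h₀ : ∀ e, Prv IKM (isEmpty e :: Γ) (isEmpty e) → Prv IKM (isEmpty e :: Γ) (φ.inst e))
    (hs : ∀ y z, Prv IKM (φ.inst y :: isSucc y z :: isNat y :: Γ) (isNat y) →
      Prv IKM (φ.inst y :: isSucc y z :: isNat y :: Γ) (isSucc y z) →
      Prv IKM (φ.inst y :: isSucc y z :: isNat y :: Γ) (φ.inst y) →
      Prv IKM (φ.inst y :: isSucc y z :: isNat y :: Γ) (φ.inst z))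
    (h : Prv IKM Γ (isNat x)) : Prv IKM Γ (φ.inst x) := by
  refine .exE (izf .infinity) fun i hi => .separation (conj (isNat 0) φ) i fun s hs' => ?_
  have hs' : ∀ z, Prv IKM _ (iff (mem z s) (conj (conj (isNat z) (φ.inst z)) (mem z i))) := fun z => hs'.allE z
  have hi : Prv IKM _ (isInductive i) := hi
  refine ((hs' x).mp (.impE (h.w.allE s) (.andI (.exE exists_empty fun e he => .exI e (.andI ((hs' e).w.mpr
    (.andI (.andI (nat_empty he) (.impE (Prv.w (.impI (h₀ e))) he)) (inductive_empty hi.w he))) he))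
    (.allI fun y => .impI fun hy => .exE (exists_succ y) fun z hz => .exI z (.andI ((hs' z).w.mpr ?_) hz))))).andL.andR
  have hy := (hs' y).w.mp hy
  refine .andI (.andI (nat_succ hy.andL.andL.w hz) (.impE (.impE (.impE (Prv.w (.impI fun k₁ => .impI fun k₂ => .impI fun k₃ =>
    hs y z k₁.w k₂.w k₃)) hy.andL.andL.w) hz) hy.andL.andR.w)) (inductive_succ hi.w hz hy.andR.w)

theorem no_cycle (h : Prv IKM Γ (mem x y)) (h' : Prv IKM Γ (mem y x)) : Prv IKM Γ fls := by
  have k : Prv IKM Γ (all (all (imp (mem 0 1) (neg (mem 1 0))))) := by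
    refine .impE (izf (.setInduction (all (imp (mem 0 1) (neg (mem 1 0)))) ⟨trivial, trivial, trivial⟩))
      (.allI fun x => .impI fun k => ?_)
    have k : ∀ z y, Prv IKM _ (imp (mem z x) (imp (mem y z) (imp (mem z y) fls))) :=
      fun z y => imp_all (k.allE z) y
    exact .allI fun y => .impI fun h => .impI fun h' => .impE (.impE (.impE (k y x).w h.w) h') h.w
  exact .impE (.impE ((k.allE x).allE y) h') h

theorem empty_or_mem (he : Prv IKM Γ (isEmpty e)) (h : Prv IKM Γ (isNat n)) :
    Prv IKM Γ (disj (eq n e) (mem e n)) :=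
  nat_ind (disj (eq 0 (e + 1)) (mem (e + 1) 0)) (fun e' he' => .orL (empty_uniq he' he.w))
    (fun y z _ hz k => .orR (.orE k (fun k => memL k (self_mem_succ hz.w))
      fun k => (succ_iff hz.w e).mpr (.orL k))) h

theorem succ_mem (h : Prv IKM Γ (isNat m)) (hn : Prv IKM Γ (mem n m)) (hs : Prv IKM Γ (isSucc n s)) :
    Prv IKM Γ (disj (eq s m) (mem s m)) := by
  have key := nat_ind (all (imp (mem 0 1) (all (imp (isSucc 1 0) (disj (eq 0 2) (mem 0 2))))))
    (fun e he => .allI fun u => .impI fun k => .efq (.impE (he.w.allE u) k)) (fun y z hy hz k => ?_) h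
  · exact .impE ((Prv.impE (key.allE n) hn).allE s) hs
  · have k : ∀ u v, Prv IKM _ (imp (mem u y) (imp (isSucc u v) (disj (eq v y) (mem v y)))) :=
      fun u v => imp_all (k.allE u) v
    refine .allI fun u => .impI fun hu => .allI fun v => .impI fun hv => ?_
    refine .orE ((succ_iff hz.w u).mp hu.w) (fun k' => .orR ?_) fun k' => .orL ?_
    · exact .orE (.impE (.impE (k u v).w k') hv.w) (fun k => memL k.symm (self_mem_succ hz.w))
        fun k => (succ_iff hz.w v).mpr (.orL k)
    · exact succ_uniq hv.w (.subst (isSucc 0 (z + 1)) k'.symm hz.w)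

theorem trichotomy (hn : Prv IKM Γ (isNat n)) (hm : Prv IKM Γ (isNat m)) :
    Prv IKM Γ (disj (mem n m) (disj (eq n m) (mem m n))) :=
  nat_ind (disj (mem (n + 1) 0) (disj (eq (n + 1) 0) (mem 0 (n + 1))))
    (fun e he => .orR (empty_or_mem he hn.w))
    (fun y z _ hz k => .orE k (fun k => .orL ((succ_iff hz.w n).mpr (.orL k))) fun k => .orE k
      (fun k => .orL ((succ_iff hz.w n).mpr (.orR k)))
      fun k => .orE (succ_mem hn.w k hz.w) (fun k => .orR (.orL k.symm)) fun k => .orR (.orR k)) hm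

theorem mem_sim (h : Prv IKM Γ (mem x y)) (h' : Prv IKM Γ (sim a b x y)) : Prv IKM Γ (mem a b) := by
  have k : Prv IKM [] (tr a b (all (neg (mem 0 0)))) :=
    Prv.translate (.allI fun x => .impI fun k => no_cycle k k) a b
  exact .jFls (.jImpE (.jAllE k.w y) (simMem_congr h' (.sim_refl y) (.tr_mem h)))

theorem ne_of_mem (h : Prv IKM Γ (mem x y)) : Prv IKM Γ (neg (eq x y)) :=
  .impI fun k => no_cycle (memR k.symm h.w) (memR k.symm h.w)

/-- Equality of natural numbers is decidable, and inequality entails inequality for the translation. -/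
theorem nat_dec (a b : ℕ) (hn : Prv IKM Γ (isNat n)) (hm : Prv IKM Γ (isNat m)) :
    Prv IKM Γ (disj (eq n m) (conj (neg (eq n m)) (imp (sim a b n m) (mem a b)))) :=
  .orE (trichotomy hn hm) (fun k => .orR (.andI (ne_of_mem k) (.impI fun k' => mem_sim k.w k'))) fun k =>
    .orE k (fun k => .orL k) fun k => .orR (.andI (.impI fun k' => .impE (ne_of_mem k.w) k'.symm)
      (.impI fun k' => mem_sim k.w k'.sim_symm))

theorem nat_tr (h : Prv IKM Γ (isNat x)) : Prv IKM Γ (tr a b (isNat x)) := by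
  have e : ∀ x, (tr (a + 1) (b + 1) (isNat 0)).inst x = tr a b (isNat x) := fun x => tr_rename ..
  have h₀ : Prv IKM [] (tr a b (all (imp (isEmpty 0) (isNat 0)))) :=
    Prv.translate (.allI fun x => .impI fun k => nat_empty k) a b
  have hs : Prv IKM [] (tr a b (all (all (imp (isNat 1) (imp (isSucc 1 0) (isNat 0)))))) :=
    Prv.translate (.allI fun x => .allI fun y => .impI fun k => .impI fun k' => nat_succ k.w k') a b
  rw [← e]
  refine nat_ind _ (fun y hy => ?_) (fun y z _ hz k => ?_) h
  · rw [e]; exact .trImpE (.trAllE h₀.w y) (.tr_isEmpty hy)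
  · rw [e] at k ⊢
    exact .trImpE (.trImpE (.trAllE (.trAllE hs.w y) z) k) (.tr_isSucc hz (.sim_refl y))

theorem tr_nat_elim (h : Prv IKM Γ (tr a b (isNat m))) :
    Prv IKM Γ (J a b (ex (conj (isNat 0) (sim (a + 1) (b + 1) 0 (m + 1))))) := by
  refine .exE (izf .infinity) fun i hi => .separation (isNat 0) i fun s hs => ?_
  have hs : ∀ z, Prv IKM _ (iff (mem z s) (conj (isNat z) (mem z i))) := fun z => hs.allE z
  have hi : Prv IKM _ (isInductive i) := hi
  refine .cut (φ := isInductive s) (.andI (.exE exists_empty fun e he => .exI e (.andI ((hs e).w.mpr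
    (.andI (nat_empty he) (inductive_empty hi.w he))) he)) (.allI fun y => .impI fun hy => .exE (exists_succ y) fun z hz =>
      .exI z (.andI ((hs z).w.mpr (.andI (nat_succ ((hs y).w.mp hy.w).andL hz)
        (inductive_succ hi.w hz ((hs y).w.mp hy.w).andR))) hz))) fun hs' => ?_
  refine .jMap (.trImpE (.trAllE h.w s) (tr_isInductive hs')) fun k => .exE k fun u hu => .exI u
    (.andI ((hs u).w.mp hu.andL).andL hu.andR)

end Prv

end SetClass


/-! ## Addition and multiplication in `IKM` -/

namespace SetClass

open Fml

/-- `∀ x y, ⟨x, y⟩ ∈ f ↔ x ∈ ω ∧ y ∈ ω ∧ φ(x, y)` for a set `f` -/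
def isNatRel (f : ℕ) (φ : Fml) : Fml :=
  all (all (iff (pairMem 1 0 (f + 2)) (conj (isNat 1) (conj (isNat 0) φ))))

/-- The set `f` contains `⟨0, b⟩` and is closed under `⟨u, v⟩ ↦ ⟨u + 1, S v⟩` for a class `S`. -/
def recClosed (S b f : ℕ) : Fml :=
  conj (all (imp (isEmpty 0) (pairMem 0 (b + 1) (f + 1))))
    (all (all (all (all (imp (conj (pairMem 3 2 (f + 4)) (conj (isSucc 3 1) (pairMemC 2 0 S)))
      (pairMem 1 0 (f + 4)))))))

/-- `∃ z ∈ ω, z ∈ X ∧ ∀ w ∈ X, w = z`, where `X` is given by a formula and `ψ` is `φ` seen from below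
one more quantifier. -/
def existsUniqueNat (φ ψ : Fml) : Fml := ex (conj (isNat 0) (conj φ (all (imp ψ (eq 0 1)))))

namespace Prv
variable {Γ : List Fml} {φ ψ χ : Fml} {a b x y z e n m s u v w f S G x' y' z' : ℕ}

theorem natRel_iff (h : Prv IKM Γ (isNatRel f φ)) (x y : ℕ) :
    Prv IKM Γ (iff (pairMem x y f) (conj (isNat x) (conj (isNat y) (φ.at₂ x y)))) := by
  have := (h.allE x).allE y
  have e : (φ.rename (up (instRen x)) id).inst y = φ.at₂ x y := by
    simp only [Fml.at₂, inst, rename_rename]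
    exact rename_congr _ (fun n => by rcases n with _ | _ | n <;> rfl) fun _ => rfl
  rw [← e]; exact this

theorem exists_natPairs : Prv IKM Γ (ex (all (all (all (imp (isNat 2) (imp (isNat 1)
    (imp (isOPair 0 2 1) (mem 0 3)))))))) := by
  refine .exE (izf .infinity) fun i hi => .exE ((izf .powerset).allE i) fun p hp =>
    .exE ((izf .powerset).allE p) fun q hq => .exI q ?_
  have hi : Prv IKM _ (isInductive i) := hi
  have hp : ∀ z, Prv IKM _ (iff (mem z p) (isSubset z i)) := fun z => hp.allE z
  have hq : ∀ z, Prv IKM _ (iff (mem z q) (isSubset z p)) := fun z => hq.allE z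
  refine .allI fun x => .allI fun y => .allI fun z => .impI fun hx => .impI fun hy => .impI fun hz => ?_
  have hx : Prv IKM _ (isNat x) := hx
  have hy : Prv IKM _ (isNat y) := hy
  have mem_i : ∀ {Δ x u}, Prv IKM Δ (isInductive i) → Prv IKM Δ (isNat x) → Prv IKM Δ (eq u x) → Prv IKM Δ (mem u i) :=
    fun hi hx hu => memL hu.symm (.impE (hx.allE i) hi)
  refine (hq z).w.mpr (.allI fun t => .impI fun ht => (hp t).w.mpr (.allI fun u => .impI fun hu => ?_))
  refine .orE ((opair_iff hz.w t).mp ht.w) (fun k => mem_i hi.w hx.w (upair_self k hu.w)) fun k =>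
    .orE ((upair_iff k u).mp hu.w) (fun k => mem_i hi.w hx.w k) fun k => mem_i hi.w hy.w k

theorem exists_natRel (φ : Fml) (h : ∀ f, Prv IKM (isNatRel f φ :: Γ) (isNatRel f φ) →
    Prv IKM (isNatRel f φ :: Γ) χ) : Prv IKM Γ χ := by
  refine .comprehension₂ (conj (isNat 1) (conj (isNat 0) φ)) fun R hR => .exE exists_natPairs fun d hd =>
    .exE ((Prv.allCE (igb .classSeparation) R).allE d) fun f hf => .impE (Prv.w (.impI (h f))) (.allI fun x => .allI fun y => ?_)
  have hR : ∀ x y, Prv IKM _ (iff (pairMemC x y R) (conj (isNat x) (conj (isNat y) (φ.at₂ x y)))) := fun x y => rel_iff hR x y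
  have hd : ∀ x y p, Prv IKM _ (imp (isNat x) (imp (isNat y) (imp (isOPair p x y) (mem p d)))) := fun x y p =>
    ((hd.allE x).allE y).allE p
  have hf : ∀ p, Prv IKM _ (iff (mem p f) (conj (memC p R) (mem p d))) := fun p => hf.allE p
  have e : (φ.rename (up (instRen x)) id).inst y = φ.at₂ x y := by
    simp only [Fml.at₂, inst, rename_rename]
    exact rename_congr _ (fun n => by rcases n with _ | _ | n <;> rfl) fun _ => rfl
  show Prv IKM _ (iff (pairMem x y f) (conj (isNat x) (conj (isNat y) ((φ.rename (up (instRen x)) id).inst y))))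
  rw [e]
  refine .iffI (fun k => .exE k fun p hp => ?_) fun k => .exE ((hR x y).w.mpr k) fun p hp => .exI p ?_
  · exact (hR x y).w.mp (.exI p (.andI hp.andL ((hf p).w.mp hp.andR).andL))
  · exact .andI hp.andL ((hf p).w.mpr (.andI hp.andR
        (.impE (.impE (.impE (hd x y p).w k.andL.w) k.andR.andL.w) hp.andL)))

theorem succ_inj (h : Prv IKM Γ (isSucc x z)) (h' : Prv IKM Γ (isSucc y z)) : Prv IKM Γ (eq x y) :=
  .orE ((succ_iff h' x).mp (self_mem_succ h)) (fun k => .orE ((succ_iff h.w y).mp (self_mem_succ h'.w))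
    (fun k' => .efq (no_cycle k.w k')) fun k' => k'.symm) id

/-- Induction on the pairs in a recursively defined class `G`. -/
theorem rec_ind (θ : Fml) (hb : Prv IKM Γ (isNat b))
    (hS : Prv IKM Γ (all (imp (isNat 0) (existsUniqueNat (pairMemC 1 0 S) (pairMemC 2 0 S)))))
    (hG : ∀ y z f, Prv IKM Γ (imp (pairMemC y z G) (imp (recClosed S b f) (pairMem y z f))))
    (hG₀ : ∀ e, Prv IKM Γ (imp (isEmpty e) (pairMemC e b G)))
    (hG₁ : ∀ u v u' v', Prv IKM Γ (imp (pairMemC u v G) (imp (isSucc u u') (imp (pairMemC v v' S) (pairMemC u' v' G)))))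
    (h₀ : ∀ e, Prv IKM Γ (imp (isEmpty e) (θ.at₂ e b)))
    (h₁ : ∀ u v u' v', Prv IKM Γ (imp (conj (conj (isNat u) (isNat v)) (conj (conj (pairMemC u v G) (θ.at₂ u v))
      (conj (isSucc u u') (pairMemC v v' S)))) (θ.at₂ u' v')))
    (h : Prv IKM Γ (pairMemC y z G)) : Prv IKM Γ (θ.at₂ y z) := by
  refine .exists_natRel (conj (pairMemC 1 0 G) θ) fun f hf => ?_
  have hf : ∀ u v, Prv IKM _ (iff (pairMem u v f) (conj (isNat u) (conj (isNat v) (conj (pairMemC u v G) (θ.at₂ u v))))) :=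
    fun u v => natRel_iff hf u v
  refine ((hf y z).mp (.impE (.impE (hG y z f).w h.w) (.andI (.allI fun e => .impI fun he => ?_)
    (.allI fun u => .allI fun v => .allI fun u' => .allI fun v' => .impI fun k => ?_)))).andR.andR.andR
  · exact (hf e b).w.mpr (.andI (nat_empty he) (.andI hb.w (.andI (.impE (hG₀ e).w he) (.impE (h₀ e).w he))))
  · have k₁ : Prv IKM _ (pairMem u v f) := k.andL
    have k₂ : Prv IKM _ (isSucc u u') := k.andR.andL
    have k₃ : Prv IKM _ (pairMemC v v' S) := k.andR.andR
    have k := (hf u v).w.mp k₁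
    refine (hf u' v').w.mpr (.andI (nat_succ k.andL k₂) (.andI ?_ (.andI (.impE (.impE (.impE (hG₁ u v u' v').w
      k.andR.andR.andL) k₂) k₃) (.impE (h₁ u v u' v').w (.andI (.andI k.andL k.andR.andL) (.andI k.andR.andR
        (.andI k₂ k₃)))))))
    exact .exE (.impE (hS.w.allE v) k.andR.andL) fun s hs => .subst (isNat 0) (Prv.impE (hs.andR.andR.allE v') k₃.w).symm hs.andL

/-- A recursively defined class is a function on the natural numbers. -/
theorem rec_unique (hb : Prv IKM Γ (isNat b))
    (hS : Prv IKM Γ (all (imp (isNat 0) (existsUniqueNat (pairMemC 1 0 S) (pairMemC 2 0 S)))))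
    (hG : ∀ y z f, Prv IKM Γ (imp (pairMemC y z G) (imp (recClosed S b f) (pairMem y z f))))
    (hG₀ : ∀ e, Prv IKM Γ (imp (isEmpty e) (pairMemC e b G)))
    (hG₁ : ∀ u v u' v', Prv IKM Γ (imp (pairMemC u v G) (imp (isSucc u u') (imp (pairMemC v v' S) (pairMemC u' v' G)))))
    (hy : Prv IKM Γ (isNat y)) : Prv IKM Γ (existsUniqueNat (pairMemC (y + 1) 0 G) (pairMemC (y + 2) 0 G)) := by
  refine nat_ind (existsUniqueNat (pairMemC 1 0 G) (pairMemC 2 0 G)) (fun e he => .exI b (.andI hb.w (.andI (.impE (hG₀ e).w he)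
    (.allI fun w => .impI fun hw => ?_)))) (fun y y' hy hy' k => .exE k fun z hz => .exE (.impE (hS.w.allE z) hz.andL) fun z' hz' =>
      .exI z' (.andI hz'.andL (.andI ?_ (.allI fun w => .impI fun hw => ?_)))) hy
  · refine .impE (rec_ind (imp (isEmpty 1) (eq 0 (b + 2))) hb.w hS.w (fun y z f => (hG y z f).w) (fun e => (hG₀ e).w)
      (fun u v u' v' => (hG₁ u v u' v').w) (fun e => .impI fun _ => .impI fun _ => .refl b)
      (fun u v u' v' => .impI fun k => .impI fun k' => .efq (.impE (k'.allE u) (self_mem_succ k.w.andR.andR.andL))) (y := e) (z := w) hw) he.w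
  · exact .impE (.impE (.impE (hG₁ y z y' z').w hz.andR.andL.w) hy'.w) hz'.andR.andL
  · have k₁ : ∀ v, Prv IKM _ (imp (pairMemC y v G) (eq v z)) := fun v => hz.andR.andR.allE v
    have k₂ : ∀ v, Prv IKM _ (imp (pairMemC z v S) (eq v z')) := fun v => hz'.andR.andR.allE v
    refine .impE (rec_ind (imp (eq 1 (y' + 2)) (eq 0 (z' + 2))) hb.w hS.w (fun y z f => (hG y z f).w) (fun e => (hG₀ e).w)
      (fun u v u' v' => (hG₁ u v u' v').w) (fun e => .impI fun k => .impI fun k' => .efq (.impE (k.w.allE y) (memR k'.symm (self_mem_succ hy'.w))))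
      (fun u v u' v' => .impI fun k => ?_) (y := y') (z := w) hw) (.refl y')
    have k₃ : Prv IKM _ (isSucc u u') := k.andR.andR.andL
    have k₄ : Prv IKM _ (pairMemC v v' S) := k.andR.andR.andR
    have k₅ : Prv IKM _ (pairMemC u v G) := k.andR.andL.andL
    refine .impI fun k' => .cut (φ := isSucc u y') (.subst (isSucc (u + 1) 0) k' k₃.w) fun k₆ =>
      .cut (φ := eq v z) (.impE (k₁ v).w (.subst (pairMemC 0 (v + 1) G) (succ_inj k₆ hy'.w) k₅.w)) fun k₇ => ?_
    exact .impE (k₂ v').w (Prv.subst (pairMemC 0 (v' + 1) S) k₇ k₄.w)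

theorem add_zero (h : Prv IKM Γ (isEmpty e)) : Prv IKM Γ (isAdd x e x) :=
  .allI fun _ => .impI fun k => .impE (k.andL.allE e) h.w

theorem add_succ (h : Prv IKM Γ (isAdd x y z)) (h' : Prv IKM Γ (isSucc y y')) (h'' : Prv IKM Γ (isSucc z z')) :
    Prv IKM Γ (isAdd x y' z') :=
  .allI fun f => .impI fun k => .impE ((((k.andR.allE y).allE z).allE y').allE z')
    (.andI (.impE (h.w.allE f) k) (.andI h'.w h''.w))

theorem mul_zero (h : Prv IKM Γ (isEmpty e)) : Prv IKM Γ (isMul x e e) :=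
  .allI fun _ => .impI fun k => .impE (k.andL.allE e) h.w

theorem mul_succ (h : Prv IKM Γ (isMul x y z)) (h' : Prv IKM Γ (isSucc y y')) (h'' : Prv IKM Γ (isAdd z x z')) :
    Prv IKM Γ (isMul x y' z') :=
  .allI fun f => .impI fun k => .impE ((((k.andR.allE y).allE z).allE y').allE z')
    (.andI (.impE (h.w.allE f) k) (.andI h'.w h''.w))

theorem add_unique (hx : Prv IKM Γ (isNat x)) (hy : Prv IKM Γ (isNat y)) :
    Prv IKM Γ (existsUniqueNat (isAdd (x + 1) (y + 1) 0) (isAdd (x + 2) (y + 2) 0)) := by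
  refine .comprehension₂ (isSucc 1 0) fun S hS => .comprehension₂ (isAdd (x + 2) 1 0) fun G hG => ?_
  have hS : ∀ u v, Prv IKM _ (iff (pairMemC u v S) (isSucc u v)) := fun u v => (rel_iff hS u v)
  have hG : ∀ u v, Prv IKM _ (iff (pairMemC u v G) (isAdd x u v)) := fun u v => rel_iff hG u v
  refine .exE (rec_unique (b := x) (S := S) (G := G) hx.w (.allI fun z => .impI fun hz => .exE (exists_succ z) fun s hs =>
    .exI s (.andI (nat_succ hz.w hs) (.andI ((hS z s).w.mpr hs) (.allI fun t => .impI fun ht => succ_uniq ((hS z t).w.mp ht) hs.w))))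
    (fun u v f => .impI fun k => .impI fun k' => .impE (((hG u v).w.mp k.w).allE f) (.andI k'.andL
      (.allI fun u => .allI fun v => .allI fun u' => .allI fun v' => .impI fun k => ?_)))
    (fun e => .impI fun he => (hG e x).w.mpr (add_zero he))
    (fun u v u' v' => .impI fun k => .impI fun k' => .impI fun k'' => (hG u' v').w.mpr (add_succ ((hG u v).w.mp k.w)
      k'.w ((hS v v').w.mp k''))) (y := y) hy.w) fun z hz => ?_
  · exact .impE ((((k'.w.andR.allE u).allE v).allE u').allE v') (.andI k.andL (.andI k.andR.andL ((hS v v').w.mpr k.andR.andR)))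
  · exact .exI z (.andI hz.andL (.andI ((hG y z).w.mp hz.andR.andL) (.allI fun w => .impI fun hw =>
      .impE (hz.w.andR.andR.allE w) ((hG y w).w.mpr hw))))

theorem mul_unique (hx : Prv IKM Γ (isNat x)) (hy : Prv IKM Γ (isNat y)) :
    Prv IKM Γ (existsUniqueNat (isMul (x + 1) (y + 1) 0) (isMul (x + 2) (y + 2) 0)) := by
  refine .exE exists_empty fun b hb => .comprehension₂ (isAdd 1 (x + 2) 0) fun S hS => .comprehension₂ (isMul (x + 2) 1 0) fun G hG => ?_
  have hb : Prv IKM _ (isEmpty b) := hb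
  have hS : ∀ u v, Prv IKM _ (iff (pairMemC u v S) (isAdd u x v)) := fun u v => (rel_iff hS u v)
  have hG : ∀ u v, Prv IKM _ (iff (pairMemC u v G) (isMul x u v)) := fun u v => rel_iff hG u v
  refine .exE (rec_unique (b := b) (S := S) (G := G) (nat_empty hb.w) (.allI fun z => .impI fun hz => .exE (add_unique hz hx.w) fun s hs =>
    .exI s (.andI hs.andL (.andI ((hS z s).w.mpr hs.andR.andL) (.allI fun t => .impI fun ht =>
      .impE (hs.w.andR.andR.allE t) ((hS z t).w.mp ht)))))
    (fun u v f => .impI fun k => .impI fun k' => .impE (((hG u v).w.mp k.w).allE f) (.andI (.allI fun e => .impI fun he => ?_)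
      (.allI fun u => .allI fun v => .allI fun u' => .allI fun v' => .impI fun k => ?_)))
    (fun e => .impI fun he => (hG e b).w.mpr (.subst (isMul (x + 1) (e + 1) 0) (empty_uniq he hb.w) (mul_zero he)))
    (fun u v u' v' => .impI fun k => .impI fun k' => .impI fun k'' => (hG u' v').w.mpr (mul_succ ((hG u v).w.mp k.w)
      k'.w ((hS v v').w.mp k''))) (y := y) hy.w) fun z hz => ?_
  · exact .subst (pairMem (e + 1) 0 (f + 1)) (empty_uniq hb.w he) (.impE (k'.w.andL.allE e) he)
  · exact .impE ((((k'.w.andR.allE u).allE v).allE u').allE v') (.andI k.andL (.andI k.andR.andL ((hS v v').w.mpr k.andR.andR)))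
  · exact .exI z (.andI hz.andL (.andI ((hG y z).w.mp hz.andR.andL) (.allI fun w => .impI fun hw =>
      .impE (hz.w.andR.andR.allE w) ((hG y w).w.mpr hw))))

end Prv

end SetClass


/-! ## Values of arithmetical operations and of their translations -/

namespace SetClass

open Fml

/-- `∃ v ∈ ω, (∀ w, φ(w) ↔ w = v) ∧ ∀ w, φ'(w) ↔ w ~ v` -/
def Fml.value (a b : ℕ) (φ φ' : Fml) : Fml :=
  ex (conj (isNat 0) (conj (all (iff φ (eq 0 1))) (all (iff φ' (sim (a + 2) (b + 2) 0 1)))))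

namespace Prv
variable {Γ : List Fml} {φ ψ χ : Fml} {a b x y z e n m s u v w y' z' : ℕ}

theorem value_tr_intro (z : ℕ) (φ : Fml) (hz : Prv IKM Γ (isNat z)) (h : Prv IKM Γ (φ.inst z))
    (hu : ∀ w, Prv IKM (φ.inst w :: Γ) (φ.inst w) → Prv IKM (φ.inst w :: Γ) (eq w z))
    (h' : Prv IKM Γ (tr a b (φ.inst z)))
    (hu' : ∀ w, Prv IKM (tr a b (φ.inst w) :: Γ) (tr a b (φ.inst w)) → Prv IKM (tr a b (φ.inst w) :: Γ) (tr a b (eq w z))) :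
    Prv IKM Γ (value a b (φ.rename (up Nat.succ) id) (tr (a + 2) (b + 2) (φ.rename (up Nat.succ) id))) := by
  have e : ∀ w, ((φ.rename (up Nat.succ) id).rename (up (instRen z)) id).inst w = φ.inst w := fun w => by
    simp only [inst, rename_rename]
    exact rename_congr _ (fun n => by cases n <;> rfl) fun _ => rfl
  have e₁ : ∀ w, (tr (a + 1) (b + 1) φ).inst w = tr a b (φ.inst w) := fun w => tr_rename ..
  have e' : ∀ w, ((tr (a + 2) (b + 2) (φ.rename (up Nat.succ) id)).rename (up (instRen z)) id).inst w = tr a b (φ.inst w) := fun w => by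
    rw [← e, inst, inst, tr_rename, tr_rename]; rfl
  refine .exI z (.andI hz (.andI (.allI fun w => ?_) (.allI fun w => ?_)))
  · show Prv IKM Γ (iff (((φ.rename (up Nat.succ) id).rename (up (instRen z)) id).inst w) (eq w z))
    rw [e]
    exact .iffI (hu w) fun k => .subst φ k.symm h.w
  · show Prv IKM Γ (iff (((tr (a + 2) (b + 2) (φ.rename (up Nat.succ) id)).rename (up (instRen z)) id).inst w) (sim a b w z))
    rw [e']
    refine .iffI (fun k => .sim_stable (hu' w k)) fun k => ?_
    rw [← e₁] at h' ⊢
    exact tr_congr φ k.sim_symm h'.w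

theorem add_tr (hx : Prv IKM Γ (isNat x)) (hy : Prv IKM Γ (isNat y)) (h : Prv IKM Γ (isAdd x y z)) :
    Prv IKM Γ (tr a b (isAdd x y z)) := by
  have h₀ : Prv IKM [] (tr a b (all (all (imp (isEmpty 0) (isAdd 1 0 1))))) :=
    Prv.translate (.allI fun x => .allI fun y => .impI fun k => add_zero k) a b
  have h₁ : Prv IKM [] (tr a b (all (all (all (all (all (imp (isAdd 4 3 2) (imp (isSucc 3 1) (imp (isSucc 2 0)
      (isAdd 4 1 0))))))))))  :=
    Prv.translate (.allI fun x => .allI fun y => .allI fun z => .allI fun y' => .allI fun z' => .impI fun k =>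
      .impI fun k' => .impI fun k'' => add_succ k.w k'.w k'') a b
  have e : ∀ y z, ((tr (a + 2) (b + 2) (isAdd (x + 2) 1 0)).rename (up (instRen y)) id).inst z = tr a b (isAdd x y z) := fun y z => by
    rw [inst, tr_rename, tr_rename]; rfl
  have key := nat_ind (all (imp (isAdd (x + 2) 1 0) (tr (a + 2) (b + 2) (isAdd (x + 2) 1 0))))
    (fun y hy => .allI fun z => .impI fun k => ?_) (fun y y' hy hy' k => .allI fun z' => .impI fun k' => ?_) hy
  · exact e y z ▸ Prv.impE (key.allE z) h
  · refine Eq.mpr (congrArg (Prv IKM _) (e y z)) (.exE (add_unique hx.w (nat_empty hy.w)) fun v hv => ?_)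
    have h₂ : ∀ w, Prv IKM _ (imp (isAdd x y w) (eq w v)) := fun w => hv.andR.andR.allE w
    have h₃ := Prv.trans (Prv.impE (h₂ z) k.w) (Prv.impE (h₂ x) (add_zero hy.w)).symm
    have e₁ : ∀ z, (tr (a + 1) (b + 1) (isAdd (x + 1) (y + 1) 0)).inst z = tr a b (isAdd x y z) := fun z => tr_rename ..
    rw [← e₁]
    refine .subst _ h₃.symm ?_
    rw [e₁]
    exact .trImpE (.trAllE (.trAllE h₀.w x) y) (tr_isEmpty hy.w)
  · have hk : ∀ z, Prv IKM _ (imp (isAdd x y z) (tr a b (isAdd x y z))) := fun z =>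
      Eq.mp (congrArg (fun X => Prv IKM _ (imp (isAdd x y z) X)) (e y z)) (k.allE z)
    refine Eq.mpr (congrArg (Prv IKM _) (e y' z')) (.exE (add_unique hx.w hy.w) fun z hz => .exE (exists_succ z) fun s hs => ?_)
    have h₂ : Prv IKM _ (isAdd x y z) := hz.andR.andL
    have hy' : Prv IKM _ (isSucc y y') := hy'
    refine .exE (add_unique hx.w (nat_succ hy.w hy'.w)) fun v hv => ?_
    have h₅ : ∀ w, Prv IKM _ (imp (isAdd x y' w) (eq w v)) := fun w => hv.andR.andR.allE w
    have h₃ := Prv.trans (Prv.impE (h₅ s) (add_succ h₂.w hy'.w hs.w)) (Prv.impE (h₅ z') k'.w).symm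
    have e₁ : ∀ z, (tr (a + 1) (b + 1) (isAdd (x + 1) (y' + 1) 0)).inst z = tr a b (isAdd x y' z) := fun z => tr_rename ..
    rw [← e₁]
    refine .subst _ h₃ ?_
    rw [e₁]
    exact .trImpE (.trImpE (.trImpE (.trAllE (.trAllE (.trAllE (.trAllE (.trAllE h₁.w x) y) z) y') s) (.impE (hk z).w h₂.w))
      (tr_isSucc hy'.w (.sim_refl y))) (tr_isSucc hs.w (.sim_refl z))

theorem mul_tr (hx : Prv IKM Γ (isNat x)) (hy : Prv IKM Γ (isNat y)) (h : Prv IKM Γ (isMul x y z)) :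
    Prv IKM Γ (tr a b (isMul x y z)) := by
  have h₀ : Prv IKM [] (tr a b (all (all (imp (isEmpty 0) (isMul 1 0 0))))) :=
    Prv.translate (.allI fun x => .allI fun y => .impI fun k => mul_zero k) a b
  have h₁ : Prv IKM [] (tr a b (all (all (all (all (all (imp (isMul 4 3 2) (imp (isSucc 3 1) (imp (isAdd 2 4 0)
      (isMul 4 1 0))))))))))  :=
    Prv.translate (.allI fun x => .allI fun y => .allI fun z => .allI fun y' => .allI fun z' => .impI fun k =>
      .impI fun k' => .impI fun k'' => mul_succ k.w k'.w k'') a b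
  have e : ∀ y z, ((tr (a + 2) (b + 2) (isMul (x + 2) 1 0)).rename (up (instRen y)) id).inst z = tr a b (isMul x y z) := fun y z => by
    rw [inst, tr_rename, tr_rename]; rfl
  have key := nat_ind (all (imp (isMul (x + 2) 1 0) (tr (a + 2) (b + 2) (isMul (x + 2) 1 0))))
    (fun y hy => .allI fun z => .impI fun k => ?_) (fun y y' hy hy' k => .allI fun z' => .impI fun k' => ?_) hy
  · exact e y z ▸ Prv.impE (key.allE z) h
  · refine Eq.mpr (congrArg (Prv IKM _) (e y z)) (.exE (mul_unique hx.w (nat_empty hy.w)) fun v hv => ?_)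
    have h₂ : ∀ w, Prv IKM _ (imp (isMul x y w) (eq w v)) := fun w => hv.andR.andR.allE w
    have h₃ := Prv.trans (Prv.impE (h₂ z) k.w) (Prv.impE (h₂ y) (mul_zero hy.w)).symm
    have e₁ : ∀ z, (tr (a + 1) (b + 1) (isMul (x + 1) (y + 1) 0)).inst z = tr a b (isMul x y z) := fun z => tr_rename ..
    rw [← e₁]
    refine .subst _ h₃.symm ?_
    rw [e₁]
    exact .trImpE (.trAllE (.trAllE h₀.w x) y) (tr_isEmpty hy.w)
  · have hk : ∀ z, Prv IKM _ (imp (isMul x y z) (tr a b (isMul x y z))) := fun z =>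
      Eq.mp (congrArg (fun X => Prv IKM _ (imp (isMul x y z) X)) (e y z)) (k.allE z)
    refine Eq.mpr (congrArg (Prv IKM _) (e y' z')) (.exE (mul_unique hx.w hy.w) fun z hz =>   .exE (add_unique hz.andL hx.w) fun s hs => ?_)
    have h₂ : Prv IKM _ (isMul x y z) := hz.andR.andL
    have hy' : Prv IKM _ (isSucc y y') := hy'
    refine .exE (mul_unique hx.w (nat_succ hy.w hy'.w)) fun v hv => ?_
    have h₅ : ∀ w, Prv IKM _ (imp (isMul x y' w) (eq w v)) := fun w => hv.andR.andR.allE w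
    have h₃ := Prv.trans (Prv.impE (h₅ s) (mul_succ h₂.w hy'.w hs.andR.andL.w)) (Prv.impE (h₅ z') k'.w).symm
    have e₁ : ∀ z, (tr (a + 1) (b + 1) (isMul (x + 1) (y' + 1) 0)).inst z = tr a b (isMul x y' z) := fun z => tr_rename ..
    rw [← e₁]
    refine .subst _ h₃ ?_
    rw [e₁]
    exact .trImpE (.trImpE (.trImpE (.trAllE (.trAllE (.trAllE (.trAllE (.trAllE h₁.w x) y) z) y') s) (.impE (hk z).w h₂.w))
      (tr_isSucc hy'.w (.sim_refl y))) (add_tr hz.andL.w hx.w hs.andR.andL.w)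

theorem add_value (hx : Prv IKM Γ (isNat x)) (hy : Prv IKM Γ (isNat y)) :
    Prv IKM Γ (value a b (isAdd (x + 2) (y + 2) 0) (tr (a + 2) (b + 2) (isAdd (x + 2) (y + 2) 0))) := by
  have h : Prv IKM [] (tr a b (all (all (imp (isNat 1) (imp (isNat 0) (all (all (imp (isAdd 3 2 1) (imp (isAdd 3 2 0) (eq 1 0))))))))) ) :=
    Prv.translate (.allI fun x => .allI fun y => .impI fun hx => .impI fun hy => .allI fun z => .allI fun w =>
      .impI fun hz => .impI fun hw => .exE (add_unique hx.w hy.w) fun v hv => by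
        have h₂ : ∀ w, Prv IKM _ (imp (isAdd x y w) (eq w v)) := fun w => hv.andR.andR.allE w
        exact (Prv.impE (h₂ z) hz.w).trans (Prv.impE (h₂ w) hw.w).symm) a b
  have k : Prv IKM Γ (tr a b (imp (isNat y) (all (all (imp (isAdd (x + 2) (y + 2) 1) (imp (isAdd (x + 2) (y + 2) 0) (eq 1 0))))))) :=
    .trImpE (.trAllE (.trAllE h.w x) y) (nat_tr hx)
  have k : Prv IKM Γ (tr a b (all (all (imp (isAdd (x + 2) (y + 2) 1) (imp (isAdd (x + 2) (y + 2) 0) (eq 1 0)))))) :=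
    .trImpE k (nat_tr hy)
  have k : ∀ w z, Prv IKM Γ (tr a b (imp (isAdd x y w) (imp (isAdd x y z) (eq w z)))) := fun w z => (k.trAllE w).trAllE z
  refine .exE (add_unique hx hy) fun z hz => ?_
  have h₂ : ∀ w, Prv IKM _ (imp (isAdd x y w) (eq w z)) := fun w => hz.andR.andR.allE w
  have h₃ : Prv IKM _ (isAdd x y z) := hz.andR.andL
  refine Eq.mp (congrArg (fun X => Prv IKM _ (value a b X (tr (a + 2) (b + 2) X)))
    (show (isAdd (x + 1) (y + 1) 0).rename (up Nat.succ) id = isAdd (x + 2) (y + 2) 0 from rfl)) ?_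
  refine value_tr_intro z (isAdd (x + 1) (y + 1) 0) hz.andL h₃ (fun w hw => .impE (h₂ w).w hw) (add_tr hx.w hy.w h₃)
    fun w hw => .impE (φ := tr a b (isAdd x y w)) (.impI fun hw => ?_) hw
  exact ((k w z).w.trImpE hw).trImpE (add_tr hx.w hy.w h₃.w)

theorem mul_value (hx : Prv IKM Γ (isNat x)) (hy : Prv IKM Γ (isNat y)) :
    Prv IKM Γ (value a b (isMul (x + 2) (y + 2) 0) (tr (a + 2) (b + 2) (isMul (x + 2) (y + 2) 0))) := by
  have h : Prv IKM [] (tr a b (all (all (imp (isNat 1) (imp (isNat 0) (all (all (imp (isMul 3 2 1) (imp (isMul 3 2 0) (eq 1 0))))))))) ) :=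
    Prv.translate (.allI fun x => .allI fun y => .impI fun hx => .impI fun hy => .allI fun z => .allI fun w =>
      .impI fun hz => .impI fun hw => .exE (mul_unique hx.w hy.w) fun v hv => by
        have h₂ : ∀ w, Prv IKM _ (imp (isMul x y w) (eq w v)) := fun w => hv.andR.andR.allE w
        exact (Prv.impE (h₂ z) hz.w).trans (Prv.impE (h₂ w) hw.w).symm) a b
  have k : Prv IKM Γ (tr a b (imp (isNat y) (all (all (imp (isMul (x + 2) (y + 2) 1) (imp (isMul (x + 2) (y + 2) 0) (eq 1 0))))))) :=
    .trImpE (.trAllE (.trAllE h.w x) y) (nat_tr hx)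
  have k : Prv IKM Γ (tr a b (all (all (imp (isMul (x + 2) (y + 2) 1) (imp (isMul (x + 2) (y + 2) 0) (eq 1 0)))))) :=
    .trImpE k (nat_tr hy)
  have k : ∀ w z, Prv IKM Γ (tr a b (imp (isMul x y w) (imp (isMul x y z) (eq w z)))) := fun w z => (k.trAllE w).trAllE z
  refine .exE (mul_unique hx hy) fun z hz => ?_
  have h₂ : ∀ w, Prv IKM _ (imp (isMul x y w) (eq w z)) := fun w => hz.andR.andR.allE w
  have h₃ : Prv IKM _ (isMul x y z) := hz.andR.andL
  refine Eq.mp (congrArg (fun X => Prv IKM _ (value a b X (tr (a + 2) (b + 2) X)))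
    (show (isMul (x + 1) (y + 1) 0).rename (up Nat.succ) id = isMul (x + 2) (y + 2) 0 from rfl)) ?_
  refine value_tr_intro z (isMul (x + 1) (y + 1) 0) hz.andL h₃ (fun w hw => .impE (h₂ w).w hw) (mul_tr hx.w hy.w h₃)
    fun w hw => .impE (φ := tr a b (isMul x y w)) (.impI fun hw => ?_) hw
  exact ((k w z).w.trImpE hw).trImpE (mul_tr hx.w hy.w h₃.w)

end Prv

end SetClass


/-! ## Evaluation of terms and decision of bounded formulas -/

namespace SetClass

open Fml

/-- `φ` is decidable, and `φ'` agrees with it up to double negation. -/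
def Fml.dec (a b : ℕ) (φ φ' : Fml) : Fml := disj (conj φ φ') (conj (neg φ) (imp φ' (mem a b)))

/-- `φ(x, y, z)` -/
def Fml.at₃ (φ : Fml) (x y z : ℕ) : Fml := φ.rename (fun | 0 => x | 1 => y | _ => z) id

theorem Fml.at₃_rename (φ : Fml) (x y z : ℕ) (ρ : ℕ → ℕ) : (φ.at₃ x y z).rename ρ id = φ.at₃ (ρ x) (ρ y) (ρ z) := by
  simp only [at₃, rename_rename]
  exact rename_congr _ (fun | 0 => rfl | 1 => rfl | _ + 2 => rfl) fun _ => rfl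

/-- The class `X` respects bisimilarity. -/
def respects (a b X : ℕ) : Fml := all (all (imp (sim (a + 2) (b + 2) 1 0) (imp (memC 1 X) (memC 0 X))))

/-- Membership in the class `X` is equivalent to its double negation. -/
def isStable (a b X : ℕ) : Fml := all (imp (J (a + 1) (b + 1) (memC 0 X)) (memC 0 X))

namespace Prv
variable {Γ : List Fml} {φ ψ χ : Fml} {a b x y z e n m s u v w U V X : ℕ}

theorem jMem (h : Prv IKM Γ (J a b (mem a b))) : Prv IKM Γ (mem a b) := .impE h (.impI id)

theorem respects_apply (h : Prv IKM Γ (respects a b X)) (h' : Prv IKM Γ (sim a b x y))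
    (k : Prv IKM Γ (memC x X)) : Prv IKM Γ (memC y X) := .impE (.impE ((h.allE x).allE y) h') k

theorem isStable_apply (h : Prv IKM Γ (isStable a b X)) (k : Prv IKM Γ (J a b (memC x X))) :
    Prv IKM Γ (memC x X) := .impE (h.allE x) k

theorem value_var : Prv IKM [] (imp (all (iff (memC 0 0) (eq 0 3))) (imp (all (iff (memC 0 1) (J 1 2 (sim 1 2 0 3))))
    (imp (isNat 2) (value 0 1 (memC 0 0) (memC 0 1))))) := by
  refine .impI fun hZ => ?_
  have hZ : ∀ w, Prv IKM _ (iff (memC w 0) (eq w 2)) := fun w => hZ.allE w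
  refine .impI fun hZ' => ?_
  have hZ' : ∀ w, Prv IKM _ (iff (memC w 1) (J 0 1 (sim 0 1 w 2))) := fun w => hZ'.allE w
  exact .impI fun h => .exI 2 (.andI h (.andI (.allI fun w => (hZ w).w) (.allI fun w =>
    .iffI (fun k => .sim_stable ((hZ' w).w.mp k)) fun k => (hZ' w).w.mpr (.jI k))))

theorem value_zero : Prv IKM [] (imp (all (iff (memC 0 0) (isEmpty 0))) (imp (all (iff (memC 0 1) (tr 1 2 (isEmpty 0))))
    (value 0 1 (memC 0 0) (memC 0 1)))) := by
  refine .impI fun hZ => ?_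
  have hZ : ∀ w, Prv IKM _ (iff (memC w 0) (isEmpty w)) := fun w => hZ.allE w
  refine .impI fun hZ' => ?_
  have hZ' : ∀ w, Prv IKM _ (iff (memC w 1) (tr 0 1 (isEmpty w))) := fun w => hZ'.allE w
  have h : Prv IKM [] (tr 0 1 (all (all (imp (isEmpty 1) (imp (isEmpty 0) (eq 1 0)))))) :=
    Prv.translate (.allI fun x => .allI fun y => .impI fun k => .impI fun k' => empty_uniq k.w k') 0 1
  refine .exE exists_empty fun e he => ?_
  have he : Prv IKM _ (isEmpty e) := he
  refine .exI e (.andI (nat_empty he) (.andI (.allI fun w => .iffI (fun k => empty_uniq ((hZ w).w.mp k) he.w) fun k => (hZ w).w.mpr ?_)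
    (.allI fun w => .iffI (fun k => .sim_stable (.trImpE (.trImpE (.trAllE (.trAllE h.w w) e) ((hZ' w).w.mp k)) (tr_isEmpty he.w))) fun k => (hZ' w).w.mpr ?_)))
  · exact .subst (isEmpty 0) k.symm he.w
  · exact tr_congr (isEmpty 0) k.sim_symm (tr_isEmpty he.w)

theorem value_succ : Prv IKM [] (imp (all (iff (memC 0 2) (ex (conj (memC 0 0) (isSucc 0 1)))))
    (imp (all (iff (memC 0 3) (J 1 2 (ex (J 2 3 (conj (memC 0 1) (tr 2 3 (isSucc 0 1))))))))
    (imp (value 0 1 (memC 0 0) (memC 0 1)) (value 0 1 (memC 0 2) (memC 0 3))))) := by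
  have h : Prv IKM [] (tr 0 1 (all (all (all (imp (isSucc 2 1) (imp (isSucc 2 0) (eq 1 0))))))) :=
    Prv.translate (.allI fun x => .allI fun y => .allI fun z => .impI fun k => .impI fun k' => succ_uniq k.w k') 0 1
  refine .impI fun hZ => ?_
  have hZ : ∀ w, Prv IKM _ (iff (memC w 2) (ex (conj (memC 0 0) (isSucc 0 (w + 1))))) := fun w => hZ.allE w
  refine .impI fun hZ' => ?_
  have hZ' : ∀ w, Prv IKM _ (iff (memC w 3) (J 0 1 (ex (J 1 2 (conj (memC 0 1) (tr 1 2 (isSucc 0 (w + 1)))))))) := fun w => hZ'.allE w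
  refine .impI fun hv => .exE hv fun v hv => ?_
  have hv₁ : ∀ w, Prv IKM _ (iff (memC w 0) (eq w v)) := fun w => hv.andR.andL.allE w
  have hv₂ : ∀ w, Prv IKM _ (iff (memC w 1) (sim 0 1 w v)) := fun w => hv.andR.andR.allE w
  refine .exE (exists_succ v) fun s hs => .exI s (.andI (nat_succ hv.andL.w hs)
    (.andI (.allI fun w => .iffI (fun k => .exE ((hZ w).w.mp k) fun u hu => ?_) fun k => (hZ w).w.mpr ?_)
      (.allI fun w => .iffI (fun k => .sim_stable (.jExE ((hZ' w).w.mp k) fun u hu => .jBind hu fun hu => ?_)) fun k => (hZ' w).w.mpr ?_)))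
  · have h₁ : Prv IKM _ (isSucc u w) := hu.andR
    exact succ_uniq (.subst (isSucc 0 (w + 1)) ((hv₁ u).w.mp hu.andL) h₁) hs.w
  · exact .exI v (.andI ((hv₁ v).w.mpr (.refl v)) (.subst (isSucc (v + 1) 0) k.symm hs.w))
  · have h₁ : Prv IKM _ (tr 0 1 (isSucc u w)) := hu.andR
    have h₃ : Prv IKM _ (tr 0 1 (isSucc v w)) := tr_congr (isSucc 0 (w + 1)) ((hv₂ u).w.mp hu.andL) h₁
    exact .trImpE (.trImpE (.trAllE (.trAllE (.trAllE h.w v) w) s) h₃) (tr_isSucc hs.w (.sim_refl v))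
  · have h₃ : Prv IKM _ (tr 0 1 (isSucc v w)) := tr_congr (isSucc (v + 1) 0) k.sim_symm (tr_isSucc hs.w (.sim_refl v))
    exact .jExI v (.jAndI ((hv₂ v).w.mpr (.sim_refl v)) h₃)

/-- The value of an operation applied to two values. -/
theorem value_op (Φ : Fml) (hΦ : ∀ (Γ : List Fml) (x y : ℕ), Prv IKM Γ (isNat x) → Prv IKM Γ (isNat y) →
      Prv IKM Γ (value 0 1 (Φ.at₃ (x + 2) (y + 2) 0) (tr 2 3 (Φ.at₃ (x + 2) (y + 2) 0)))) :
    Prv IKM [] (imp (all (iff (memC 0 4) (ex (ex (conj (memC 1 0) (conj (memC 0 2) (Φ.at₃ 1 0 2)))))))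
    (imp (all (iff (memC 0 5) (J 1 2 (ex (J 2 3 (ex (J 3 4 (conj (memC 1 1) (J 3 4 (conj (memC 0 3) (tr 3 4 (Φ.at₃ 1 0 2))))))))))))
    (imp (value 0 1 (memC 0 0) (memC 0 1)) (imp (value 0 1 (memC 0 2) (memC 0 3)) (value 0 1 (memC 0 4) (memC 0 5)))))) := by
  have e₃ : ∀ w x y, (((Φ.at₃ 1 0 2).rename (up (up (instRen w))) id).rename (up (instRen x)) id).rename
      (instRen y) id = Φ.at₃ x y w := fun w x y => by simp only [at₃_rename]; rfl
  have e₄ : ∀ w x y, (((tr 3 4 (Φ.at₃ 1 0 2)).rename (up (up (instRen w))) id).rename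
      (up (instRen x)) id).rename (instRen y) id = tr 0 1 (Φ.at₃ x y w) := fun w x y => by simp only [tr_rename, at₃_rename]; rfl
  refine .impI fun hZ => ?_
  have hZ : ∀ w, Prv IKM _ (iff (memC w 4) (ex (ex (conj (memC 1 0) (conj (memC 0 2) ((Φ.at₃ 1 0 2).rename (up (up (instRen w))) id)))))) :=
    fun w => hZ.allE w
  refine .impI fun hZ' => ?_
  have hZ' : ∀ w, Prv IKM _ (iff (memC w 5) (J 0 1 (ex (J 1 2 (ex (J 2 3 (conj (memC 1 1) (J 2 3 (conj (memC 0 3)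
      ((tr 3 4 (Φ.at₃ 1 0 2)).rename (up (up (instRen w))) id)))))))))) := fun w => hZ'.allE w
  refine .impI fun hv => .impI fun hu => .exE hv.w fun v hv => ?_
  have hv₁ : ∀ w, Prv IKM _ (iff (memC w 0) (eq w v)) := fun w => hv.andR.andL.allE w
  have hv₂ : ∀ w, Prv IKM _ (iff (memC w 1) (sim 0 1 w v)) := fun w => hv.andR.andR.allE w
  refine .exE hu.w fun u hu => ?_
  have hu₁ : ∀ w, Prv IKM _ (iff (memC w 2) (eq w u)) := fun w => hu.andR.andL.allE w
  have hu₂ : ∀ w, Prv IKM _ (iff (memC w 3) (sim 0 1 w u)) := fun w => hu.andR.andR.allE w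
  refine .exE (hΦ _ v u hv.andL.w hu.andL) fun s hs => ?_
  have e₁ : ∀ w, ((Φ.at₃ (v + 2) (u + 2) 0).rename (up (instRen s)) id).inst w = Φ.at₃ v u w := fun w => by
    simp only [inst, at₃_rename]; rfl
  have hs₁ : ∀ w, Prv IKM _ (iff (Φ.at₃ v u w) (eq w s)) := fun w =>
    Eq.mp (congrArg (fun X => Prv IKM _ (iff X (eq w s))) (e₁ w)) (hs.andR.andL.allE w)
  have e₂ : ∀ w, ((tr 2 3 (Φ.at₃ (v + 2) (u + 2) 0)).rename (up (instRen s)) id).inst w = tr 0 1 (Φ.at₃ v u w) := fun w => by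
    simp only [inst, tr_rename, at₃_rename]; rfl
  have hs₂ : ∀ w, Prv IKM _ (iff (tr 0 1 (Φ.at₃ v u w)) (sim 0 1 w s)) := fun w =>
    Eq.mp (congrArg (fun X => Prv IKM _ (iff X (sim 0 1 w s))) (e₂ w)) (hs.andR.andR.allE w)
  have s₁ : ∀ {Γ : List Fml} {x v y w : ℕ}, Prv IKM Γ (eq x v) → Prv IKM Γ (Φ.at₃ x y w) → Prv IKM Γ (Φ.at₃ v y w) := fun {Γ x v y w} h k => by
    have e : ∀ x, (Φ.at₃ 0 (y + 1) (w + 1)).inst x = Φ.at₃ x y w := fun x => by simp only [inst, at₃_rename]; rfl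
    rw [← e] at k ⊢; exact .subst _ h k
  have s₂ : ∀ {Γ : List Fml} {x u y w : ℕ}, Prv IKM Γ (eq y u) → Prv IKM Γ (Φ.at₃ x y w) → Prv IKM Γ (Φ.at₃ x u w) := fun {Γ x v y w} h k => by
    have e : ∀ y, (Φ.at₃ (x + 1) 0 (w + 1)).inst y = Φ.at₃ x y w := fun y => by simp only [inst, at₃_rename]; rfl
    rw [← e] at k ⊢; exact .subst _ h k
  have t₁ : ∀ {Γ : List Fml} {x v y w : ℕ}, Prv IKM Γ (sim 0 1 x v) → Prv IKM Γ (tr 0 1 (Φ.at₃ x y w)) → Prv IKM Γ (tr 0 1 (Φ.at₃ v y w)) :=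
    fun {Γ x v y w} h k => by
      have e : ∀ x, (tr 1 2 (Φ.at₃ 0 (y + 1) (w + 1))).inst x = tr 0 1 (Φ.at₃ x y w) := fun x => by simp only [inst, tr_rename, at₃_rename]; rfl
      rw [← e] at k ⊢; exact tr_congr _ h k
  have t₂ : ∀ {Γ : List Fml} {x u y w : ℕ}, Prv IKM Γ (sim 0 1 y u) → Prv IKM Γ (tr 0 1 (Φ.at₃ x y w)) → Prv IKM Γ (tr 0 1 (Φ.at₃ x u w)) :=
    fun {Γ x v y w} h k => by
      have e : ∀ y, (tr 1 2 (Φ.at₃ (x + 1) 0 (w + 1))).inst y = tr 0 1 (Φ.at₃ x y w) := fun y => by simp only [inst, tr_rename, at₃_rename]; rfl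
      rw [← e] at k ⊢; exact tr_congr _ h k
  refine .exI s (.andI hs.andL (.andI (.allI fun w => .iffI (fun k => .exE ((hZ w).w.mp k) fun x k => .exE k fun y k => ?_) fun k => (hZ w).w.mpr ?_)
      (.allI fun w => .iffI (fun k => .sim_stable (.jExE ((hZ' w).w.mp k) fun x k => .jExE k fun y k => .jBind k fun k => ?_)) fun k => (hZ' w).w.mpr ?_)))
  · have k₁ : Prv IKM _ (Φ.at₃ x y w) := Eq.mp (congrArg (Prv IKM _) (e₃ w x y)) k.andR.andR
    exact (hs₁ w).w.mp (s₂ ((hu₁ y).w.mp k.andR.andL) (s₁ ((hv₁ x).w.mp k.andL) k₁))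
  · exact .exI v (.exI u (.andI ((hv₁ v).w.mpr (.refl v)) (.andI ((hu₁ u).w.mpr (.refl u))
      (Eq.mpr (congrArg (Prv IKM _) (e₃ w v u)) ((hs₁ w).w.mpr k)))))
  · refine .jBind k.andR fun k' => .jI ((hs₂ w).w.mp ?_)
    have h₄ : Prv IKM _ (tr 0 1 (Φ.at₃ x y w)) := Eq.mp (congrArg (Prv IKM _) (e₄ w x y)) k'.andR
    exact t₂ ((hu₂ y).w.mp k'.andL) (t₁ ((hv₂ x).w.mp k.andL.w) h₄)
  · exact .jExI v (.jExI u (.jAndI ((hv₂ v).w.mpr (.sim_refl v)) (.jAndI ((hu₂ u).w.mpr (.sim_refl u))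
      (Eq.mpr (congrArg (Prv IKM _) (e₄ w v u)) ((hs₂ w).w.mpr k)))))

theorem dec_eq : Prv IKM [] (imp (value 0 1 (memC 0 0) (memC 0 1)) (imp (value 0 1 (memC 0 2) (memC 0 3))
    (dec 0 1 (ex (conj (memC 0 0) (memC 0 2))) (J 0 1 (ex (J 1 2 (conj (memC 0 1) (memC 0 3)))))))) := by
  refine .impI fun hv => .impI fun hu => .exE hv.w fun v hv => .exE hu.w fun u hu => ?_
  have hv₁ : ∀ w, Prv IKM _ (iff (memC w 0) (eq w v)) := fun w => hv.andR.andL.allE w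
  have hv₂ : ∀ w, Prv IKM _ (iff (memC w 1) (sim 0 1 w v)) := fun w => hv.andR.andR.allE w
  have hu₁ : ∀ w, Prv IKM _ (iff (memC w 2) (eq w u)) := fun w => hu.andR.andL.allE w
  have hu₂ : ∀ w, Prv IKM _ (iff (memC w 3) (sim 0 1 w u)) := fun w => hu.andR.andR.allE w
  refine .orE (nat_dec (n := v) (m := u) 0 1 hv.andL.w hu.andL) (fun k => .orL (.andI (.exI v (.andI ((hv₁ v).w.mpr (.refl v)) ((hu₁ v).w.mpr k)))
    (.jExI v (.jAndI ((hv₂ v).w.mpr (.sim_refl v)) ((hu₂ v).w.mpr (.sim_of_eq k)))))) fun k => .orR (.andI (.impI fun k' => .exE k' fun w hw =>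
      .impE k.andL.w (((hv₁ w).w.mp hw.andL).symm.trans ((hu₁ w).w.mp hw.andR))) (.impI fun k' => .jMem (.jExE k' fun w hw => .jBind hw fun hw =>
        .jI (.impE k.andR.w (((hv₂ w).w.mp hw.andL).sim_symm.sim_trans ((hu₂ w).w.mp hw.andR))))))

theorem dec_fls : Prv IKM [] (dec 0 1 fls (J 0 1 fls)) := .orR (.andI (.impI id) (.impI fun k => .jFls k))

theorem dec_conj : Prv IKM [] (imp (dec 0 1 (memC 0 0) (memC 0 1)) (imp (dec 0 1 (memC 0 2) (memC 0 3))
    (dec 0 1 (conj (memC 0 0) (memC 0 2)) (J 0 1 (conj (memC 0 1) (memC 0 3)))))) :=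
  .impI fun h => .impI fun h' => .orE h.w (fun k => .orE h'.w
    (fun k' => .orL (.andI (.andI k.andL.w k'.andL) (.jI (.andI k.andR.w k'.andR))))
    fun k' => .orR (.andI (.impI fun l => .impE k'.andL.w l.andR) (.impI fun l => .jMem (.jBind l fun l => .jI (.impE k'.andR.w l.andR)))))
    fun k => .orR (.andI (.impI fun l => .impE k.andL.w l.andL) (.impI fun l => .jMem (.jBind l fun l => .jI (.impE k.andR.w l.andL))))

theorem dec_disj : Prv IKM [] (imp (dec 0 1 (memC 0 0) (memC 0 1)) (imp (dec 0 1 (memC 0 2) (memC 0 3))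
    (dec 0 1 (disj (memC 0 0) (memC 0 2)) (J 0 1 (disj (memC 0 1) (memC 0 3)))))) :=
  .impI fun h => .impI fun h' => .orE h.w (fun k => .orL (.andI (.orL k.andL) (.jI (.orL k.andR)))) fun k => .orE h'.w
    (fun k' => .orL (.andI (.orR k'.andL) (.jI (.orR k'.andR))))
    fun k' => .orR (.andI (.impI fun l => .orE l (fun l => .impE k.andL.w l) fun l => .impE k'.andL.w l)
      (.impI fun l => .jMem (.jBind l fun l => .jI (.orE l (fun l => .impE k.andR.w l) fun l => .impE k'.andR.w l))))

theorem dec_imp : Prv IKM [] (imp (imp (J 0 1 (memC 0 3)) (memC 0 3)) (imp (dec 0 1 (memC 0 0) (memC 0 1)) (imp (dec 0 1 (memC 0 2) (memC 0 3))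
    (dec 0 1 (imp (memC 0 0) (memC 0 2)) (J 0 1 (imp (memC 0 1) (memC 0 3))))))) :=
  .impI fun st => .impI fun h => .impI fun h' => .orE h.w (fun k => .orE h'.w
    (fun k' => .orL (.andI (.impI fun _ => k'.andL.w) (.jI (.impI fun _ => k'.andR.w))))
    fun k' => .orR (.andI (.impI fun l => .impE k'.andL.w (.impE l k.andL.w)) (.impI fun l => .jMem (.jBind l fun l => .jI (.impE k'.andR.w
      (.impE l k.andR.w))))))
    fun k => .orL (.andI (.impI fun l => .efq (.impE k.andL.w l)) (.jI (.impI fun l => .impE st.w (.impI fun _ => .impE k.andR.w l.w))))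

/-- Bounded search. -/
theorem search (hn : Prv IKM Γ (isNat n)) (h : Prv IKM Γ (all (imp (isNat 0) (disj (memC 0 U) (memC 0 V))))) :
    Prv IKM Γ (disj (ballIn n (memC 0 U)) (bexIn n (memC 0 V))) := by
  refine nat_ind (disj (ballIn 0 (memC 0 U)) (bexIn 0 (memC 0 V))) (fun e he => .orL (.allI fun x => .impI fun hx => .efq (.impE (he.w.allE x) hx)))
    (fun y z hy hz k => ?_) hn
  have hz : Prv IKM _ (isSucc y z) := hz
  refine .orE k (fun k => ?_) fun k => .orR (.exE k fun x hx => .exI x (.andI ((succ_iff hz.w x).mpr (.orL hx.andL)) hx.andR))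
  have k : ∀ x, Prv IKM _ (imp (mem x y) (memC x U)) := fun x => k.allE x
  refine .orE (.impE (h.w.allE y) hy.w) (fun k' => .orL (.allI fun x => .impI fun hx => .orE ((succ_iff hz.w x).mp hx)
    (fun l => .impE (k x).w l) fun l => .subst (memC 0 U) l.symm k'.w)) fun k' => .orR (.exI y (.andI (self_mem_succ hz.w) k'))

theorem dec_ball : Prv IKM [] (imp (value 0 1 (memC 0 0) (memC 0 1)) (imp (all (imp (isNat 0) (dec 1 2 (memC 0 2) (memC 0 3))))
    (imp (respects 0 1 3) (imp (isStable 0 1 3) (dec 0 1 (all (imp (memC 0 0) (all (imp (mem 0 1) (memC 0 2)))))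
      (J 0 1 (all (J 1 2 (imp (memC 0 1) (J 1 2 (all (J 2 3 (imp (tr 2 3 (mem 0 1)) (memC 0 3)))))))))))))) := by
  refine .impI fun hv => .impI fun h => .impI fun hr => .impI fun hs => .exE hv.w fun v hv =>
    .comprehension (conj (memC 0 2) (memC 0 3)) fun U hU => .comprehension (conj (neg (memC 0 2)) (imp (memC 0 3) (mem 1 2))) fun V hV => ?_
  have hv₁ : ∀ w, Prv IKM _ (iff (memC w 0) (eq w v)) := fun w => hv.andR.andL.allE w
  have hv₂ : ∀ w, Prv IKM _ (iff (memC w 1) (sim 0 1 w v)) := fun w => hv.andR.andR.allE w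
  have hU : ∀ x, Prv IKM _ (iff (memC x U) (conj (memC x 2) (memC x 3))) := fun x => hU.allE x
  have hV : ∀ x, Prv IKM _ (iff (memC x V) (conj (neg (memC x 2)) (imp (memC x 3) (mem 0 1)))) := fun x => hV.allE x
  have h' : ∀ x, Prv IKM _ (imp (isNat x) (disj (conj (memC x 2) (memC x 3)) (conj (neg (memC x 2)) (imp (memC x 3) (mem 0 1))))) := fun x => h.allE x
  have hr : Prv IKM _ (respects 0 1 3) := hr
  have hs : Prv IKM _ (isStable 0 1 3) := hs
  refine .orE (search  (n := v) (U := U) (V := V) hv.andL.w (.allI fun x => .impI fun hx => .orE (.impE (h' x).w hx) (fun k => .orL ((hU x).w.mpr k))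
    fun k => .orR ((hV x).w.mpr k))) (fun k => ?_) fun k => .exE k fun x hx => .orR (.andI (.impI fun k' => ?_) (.impI fun k' => .jMem ?_))
  · have k : ∀ x, Prv IKM _ (imp (mem x v) (memC x U)) := fun x => k.allE x
    refine .orL (.andI (.allI fun w => .impI fun hw => .allI fun x => .impI fun hx => ?_)
      (.jAllI fun w => .jImpI fun hw => .jAllI fun x => .jI (.impI fun hx => ?_)))
    · have hx : Prv IKM _ (mem x w) := hx
      exact ((hU x).w.mp (.impE (k x).w (memR ((hv₁ w).w.mp hw.w) hx))).andL
    refine isStable_apply hs.w (.tr_mem_elim (simMem_congr (.sim_refl x) ((hv₂ w).w.mp hw.w) hx) fun y hy hy' => .jI ?_)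
    exact respects_apply hr.w hy' ((hU y).w.mp (.impE (k y).w hy)).andR
  · exact .impE ((hV x).w.mp hx.andR.w).andL (.impE ((Prv.impE (k'.allE v) ((hv₁ v).w.mpr (.refl v))).allE x) hx.andL.w)
  · refine .jBind k' fun k' => .jBind (k'.allE v) fun k' => .jBind (.impE k' ((hv₂ v).w.mpr (.sim_refl v))) fun k' => .jBind (k'.allE x) fun k' =>
      .jI (.impE ((hV x).w.mp hx.andR.w).andR (.impE k' (tr_mem hx.andL.w)))

theorem dec_bex : Prv IKM [] (imp (value 0 1 (memC 0 0) (memC 0 1)) (imp (all (imp (isNat 0) (dec 1 2 (memC 0 2) (memC 0 3))))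
    (imp (respects 0 1 3) (imp (isStable 0 1 3) (dec 0 1 (ex (conj (memC 0 0) (ex (conj (mem 0 1) (memC 0 2)))))
      (J 0 1 (ex (J 1 2 (conj (memC 0 1) (J 1 2 (ex (J 2 3 (conj (tr 2 3 (mem 0 1)) (memC 0 3)))))))))))))) := by
  refine .impI fun hv => .impI fun h => .impI fun hr => .impI fun hs => .exE hv.w fun v hv =>
    .comprehension (conj (memC 0 2) (memC 0 3)) fun V hV => .comprehension (conj (neg (memC 0 2)) (imp (memC 0 3) (mem 1 2))) fun U hU => ?_
  have hv₁ : ∀ w, Prv IKM _ (iff (memC w 0) (eq w v)) := fun w => hv.andR.andL.allE w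
  have hv₂ : ∀ w, Prv IKM _ (iff (memC w 1) (sim 0 1 w v)) := fun w => hv.andR.andR.allE w
  have hV : ∀ x, Prv IKM _ (iff (memC x V) (conj (memC x 2) (memC x 3))) := fun x => hV.allE x
  have hU : ∀ x, Prv IKM _ (iff (memC x U) (conj (neg (memC x 2)) (imp (memC x 3) (mem 0 1)))) := fun x => hU.allE x
  have h' : ∀ x, Prv IKM _ (imp (isNat x) (disj (conj (memC x 2) (memC x 3)) (conj (neg (memC x 2)) (imp (memC x 3) (mem 0 1))))) := fun x => h.allE x
  have hr : Prv IKM _ (respects 0 1 3) := hr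
  refine .orE (search  (n := v) (U := U) (V := V) hv.andL.w (.allI fun x => .impI fun hx => .orE (.impE (h' x).w hx) (fun k => .orR ((hV x).w.mpr k))
    fun k => .orL ((hU x).w.mpr k))) (fun k => ?_) fun k => .exE k fun x hx => .orL (.andI ?_ ?_)
  · have k : ∀ x, Prv IKM _ (imp (mem x v) (memC x U)) := fun x => k.allE x
    refine .orR (.andI (.impI fun k' => .exE k' fun w hw => .exE hw.andR fun x hx => ?_)
        (.impI fun k' => .jMem (.jExE k' fun w hw => .jBind hw fun hw => .jExE hw.andR fun x hx => .jBind hx fun hx => ?_)))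
    · have hx' : Prv IKM _ (mem x w) := hx.andL
      exact .impE ((hU x).w.mp (.impE (k x).w (memR ((hv₁ w).w.mp hw.andL.w) hx'))).andL hx.andR
    refine .tr_mem_elim (simMem_congr (.sim_refl x) ((hv₂ w).w.mp hw.andL.w) hx.andL) fun y hy hy' => .jI ?_
    exact .impE ((hU y).w.mp (.impE (k y).w hy)).andR (respects_apply hr.w hy'.sim_symm hx.andR.w)
  · exact .exI v (.andI ((hv₁ v).w.mpr (.refl v)) (.exI x (.andI hx.andL ((hV x).w.mp hx.andR).andL)))
  · exact .jExI v (.jAndI ((hv₂ v).w.mpr (.sim_refl v)) (.jExI x (.jAndI (tr_mem hx.andL) ((hV x).w.mp hx.andR).andR)))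

theorem sigma_ex : Prv IKM [] (imp (all (imp (isNat 0) (imp (memC 0 1) (J 1 2 (memC 0 0))))) (imp (respects 0 1 1)
    (imp (J 0 1 (ex (J 1 2 (conj (tr 1 2 (isNat 0)) (memC 0 1))))) (J 0 1 (ex (conj (isNat 0) (memC 0 0))))))) := by
  refine .impI fun h => ?_
  have h : ∀ u, Prv IKM _ (imp (isNat u) (imp (memC u 1) (J 0 1 (memC u 0)))) := fun u => h.allE u
  refine .impI fun hr => ?_
  have hr : Prv IKM _ (respects 0 1 1) := hr
  refine .impI fun k => .jExE k fun m hm => .jBind hm fun hm => .jBind (tr_nat_elim (m := m) hm.andL) fun k => .exE k fun u hu => ?_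
  have h₃ : Prv IKM _ (sim 0 1 u m) := hu.andR
  refine .jMap (.impE (.impE (h u).w hu.andL) (respects_apply hr.w h₃.sim_symm hm.andR.w)) fun k => .exI u (.andI hu.andL.w k)

/-- The double negations of a formula with respect to all propositions imply the formula. -/
theorem of_forall_J : Prv IKM [] (imp (all (all (J 1 0 (memC 2 0)))) (memC 0 0)) := by
  refine .impI fun h => ?_
  have h : ∀ e b, Prv IKM _ (J e b (memC 0 0)) := fun e b => (h.allE e).allE b
  refine .exE exists_empty fun e he => .exE (exists_upair e e) fun p hp => ?_
  have h₃ : Prv IKM _ (isUPair p e e) := hp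
  refine .separation (memC 1 0) p fun b hb => ?_
  have h₁ : Prv IKM _ (iff (mem e b) (conj (memC 0 0) (mem e p))) := hb.allE e
  exact (h₁.mp (.impE (h e b).w (.impI fun k => h₁.w.mpr (.andI k (upair_left h₃.w))))).andL

end Prv

end SetClass


/-! ## Families of values and of decisions -/

namespace SetClass

open Fml

section
variable {α : Type} {c : α → ℕ}

namespace PF

/-- `Fml.value` for families -/
def value (a b : PN c) (φ φ' : PF c) : PF c :=
  .ex (.conj (.const (isNat 0)) (.conj (.all (.iff (φ.under.under.inst (.const 0)) (.eq (.const 0) (.const 1))))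
    (.all (.iff (φ'.under.under.inst (.const 0)) (.sim a.succ.succ b.succ.succ (.const 0) (.const 1))))))

/-- `Fml.dec` for families -/
def dec (a b : PN c) (φ φ' : PF c) : PF c :=
  .disj (.conj φ φ') (.conj (.imp φ .fls) (.imp φ' (.mem a b)))

/-- The double negations of `φ` with respect to all propositions. -/
def box (φ : PF c) : PF c := (φ.shift.shift.tr (.const 1) (.const 0)).all.all

/-- The graph of the successor of a term with graph `g`. -/
def succG (g : PF c) : PF c := .ex (.conj g.under (.const (isSucc 0 1)))

/-- The graph of the operation `Φ` applied to terms with graphs `g` and `h`. -/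
def opG (Φ : Fml) (g h : PF c) : PF c :=
  .ex (.ex (.conj (g.under.under.under.inst (.const 1)) (.conj h.under.under (.const (Φ.at₃ 1 0 2)))))

/-- The derivable formula for the value of `opG Φ g h`. -/
def opStep (Φ : Fml) (a b : PN c) (g h : PF c) : PF c :=
  .imp (.all (.iff ((opG Φ g h).under.inst (.const 0)) (.ex (.ex (.conj (g.under.under.under.inst (.const 1))
      (.conj (h.under.under.under.inst (.const 0)) (.const (Φ.at₃ 1 0 2))))))))
    (.imp (.all (.iff (((opG Φ g h).tr a.succ b.succ).under.inst (.const 0)) (.J a.succ b.succ (.ex (.J a.succ.succ b.succ.succ (.ex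
      (.J a.succ.succ.succ b.succ.succ.succ (.conj ((g.tr a.succ b.succ).under.under.under.inst (.const 1)) (.J a.succ.succ.succ b.succ.succ.succ
        (.conj ((h.tr a.succ b.succ).under.under.under.inst (.const 0)) ((const (Φ.at₃ 1 0 2)).tr a.succ.succ.succ b.succ.succ.succ)))))))))))
    (.imp (.value a b g (g.tr a.succ b.succ)) (.imp (.value a b h (h.tr a.succ b.succ))
      (.value a b (.opG Φ g h) ((PF.opG Φ g h).tr a.succ b.succ)))))

/-- `∀ x ∈ y, φ(x)` for all `y` with `g(y)` -/
def ballG (g φ : PF c) : PF c := .all (.imp g (.all (.imp (.mem (.const 0) (.const 1)) φ.under)))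

/-- `∃ x ∈ y, φ(x)` for some `y` with `g(y)` -/
def bexG (g φ : PF c) : PF c := .ex (.conj g (.ex (.conj (.mem (.const 0) (.const 1)) φ.under)))

end PF

namespace Pv
variable {Γ : PL c} {a b : PN c} {g h φ ψ : PF c}

theorem value_var (i : PN c) (k : ∀ j, isNat (i.f j) ∈ Γ.f j) :
    Pv IKM Γ (.value a b (.eq (.const 0) i.succ) ((PF.eq (.const 0) i.succ).tr a.succ b.succ)) := by
  have h : Pv IKM Γ (.imp (.all (.iff ((PF.eq (.const 0) i.succ).under.inst (.const 0)) (.eq (.const 0) i.succ)))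
      (.imp (.all (.iff (((PF.eq (.const 0) i.succ).tr a.succ b.succ).under.inst (.const 0)) (.J a.succ b.succ (.sim a.succ b.succ (.const 0) i.succ))))
      (.imp (.all (.imp (.const (isInductive 0)) (.mem i.succ (.const 0))))
      (.value a b (.eq (.const 0) i.succ) ((PF.eq (.const 0) i.succ).tr a.succ b.succ))))) :=
    Prv.value_var.fillPv (by simp [NoEqC, J, sim, simMemC, isBisim, forthBack, pairMemC, ballIn, bexIn, isOPair, isUPair, iff, value, isNat, isInductive, isEmpty, isSucc, neg, Fml.tr])
      (fun | 0 => a | 1 => b | _ => i) [.eq (.const 0) i.succ, (PF.eq (.const 0) i.succ).tr a.succ b.succ] fun _ => rfl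
  simp only [PF.under_inst] at h
  exact impE (impE (impE h (allI iffRefl)) (allI iffRefl)) (.hyp k)

theorem value_zero : Pv IKM Γ (.value a b (.const (isEmpty 0)) ((PF.const (isEmpty 0)).tr a.succ b.succ)) := by
  have h : Pv IKM Γ (.imp (.all (.iff ((PF.const (isEmpty 0)).under.inst (.const 0)) (.const (isEmpty 0))))
      (.imp (.all (.iff (((PF.const (isEmpty 0)).tr a.succ b.succ).under.inst (.const 0)) ((PF.const (isEmpty 0)).tr a.succ b.succ)))
      (.value a b (.const (isEmpty 0)) ((PF.const (isEmpty 0)).tr a.succ b.succ)))) :=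
    Prv.value_zero.fillPv (by simp [NoEqC, J, sim, simMemC, isBisim, forthBack, pairMemC, ballIn, bexIn, isOPair, isUPair, iff, value, isNat, isInductive, isEmpty, isSucc, neg, Fml.tr])
      (fun | 0 => a | _ => b) [.const (isEmpty 0), (PF.const (isEmpty 0)).tr a.succ b.succ] fun _ => rfl
  simp only [PF.under_inst] at h
  exact impE (impE h (allI iffRefl)) (allI iffRefl)

theorem value_succ (h : Pv IKM Γ (.value a b g (g.tr a.succ b.succ))) :
    Pv IKM Γ (.value a b g.succG (g.succG.tr a.succ b.succ)) := by
  have k : Pv IKM Γ (.imp (.all (.iff (g.succG.under.inst (.const 0)) (.ex (.conj (g.under.under.inst (.const 0)) (.const (isSucc 0 1))))))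
      (.imp (.all (.iff ((g.succG.tr a.succ b.succ).under.inst (.const 0)) (.J a.succ b.succ (.ex (.J a.succ.succ b.succ.succ
        (.conj ((g.tr a.succ b.succ).under.under.inst (.const 0)) ((PF.const (isSucc 0 1)).tr a.succ.succ b.succ.succ)))))))
      (.imp (.value a b g (g.tr a.succ b.succ)) (.value a b g.succG (g.succG.tr a.succ b.succ))))) :=
    Prv.value_succ.fillPv (by simp [NoEqC, J, sim, simMemC, isBisim, forthBack, pairMemC, ballIn, bexIn, isOPair, isUPair, iff, value, isNat, isInductive, isEmpty, isSucc, neg, Fml.tr])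
      (fun | 0 => a | _ => b) [g, g.tr a.succ b.succ, g.succG, g.succG.tr a.succ b.succ] fun _ => rfl
  simp only [PF.under_inst] at k
  rw [← PF.tr_under] at k
  exact impE (impE (impE k (allI iffRefl)) (allI iffRefl)) h

theorem value_op {Φ : Fml} (k : Pv IKM Γ (.opStep Φ a b g h))
    (k₁ : Pv IKM Γ (.value a b g (g.tr a.succ b.succ))) (k₂ : Pv IKM Γ (.value a b h (h.tr a.succ b.succ))) :
    Pv IKM Γ (.value a b (.opG Φ g h) ((PF.opG Φ g h).tr a.succ b.succ)) := by
  simp only [PF.opStep, PF.under_inst] at k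
  refine impE (impE (impE (impE k (allI iffRefl)) (allI ?_)) k₁) k₂
  have := iffRefl (T := IKM) (Γ := Γ.shift) (φ := (PF.opG Φ g h).tr a.succ b.succ)
  simp only [← PF.tr_under, ← PF.tr_inst]
  exact this

theorem value_add (k₁ : Pv IKM Γ (.value a b g (g.tr a.succ b.succ))) (k₂ : Pv IKM Γ (.value a b h (h.tr a.succ b.succ))) :
    Pv IKM Γ (.value a b (.opG (isAdd 0 1 2) g h) ((PF.opG (isAdd 0 1 2) g h).tr a.succ b.succ)) :=
  value_op ((Prv.value_op (isAdd 0 1 2) fun _ _ _ k k' => Prv.add_value k k').fillPv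
    (by simp [NoEqC, J, sim, simMemC, isBisim, forthBack, pairMemC, pairMem, ballIn, bexIn, isOPair, isUPair, iff, value, isNat, isInductive, isEmpty,
      isSucc, neg, Fml.tr, at₃, isAdd, Fml.rename, up]) (fun | 0 => a | _ => b)
    [g, g.tr a.succ b.succ, h, h.tr a.succ b.succ, .opG (isAdd 0 1 2) g h, (PF.opG (isAdd 0 1 2) g h).tr a.succ b.succ] fun _ => rfl) k₁ k₂

theorem value_mul (k₁ : Pv IKM Γ (.value a b g (g.tr a.succ b.succ))) (k₂ : Pv IKM Γ (.value a b h (h.tr a.succ b.succ))) :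
    Pv IKM Γ (.value a b (.opG (isMul 0 1 2) g h) ((PF.opG (isMul 0 1 2) g h).tr a.succ b.succ)) :=
  value_op ((Prv.value_op (isMul 0 1 2) fun _ _ _ k k' => Prv.mul_value k k').fillPv
    (by simp [NoEqC, J, sim, simMemC, isBisim, forthBack, pairMemC, pairMem, ballIn, bexIn, isOPair, isUPair, iff, value, isNat, isInductive, isEmpty,
      isSucc, neg, Fml.tr, at₃, isMul, isAdd, Fml.rename, up]) (fun | 0 => a | _ => b)
    [g, g.tr a.succ b.succ, h, h.tr a.succ b.succ, .opG (isMul 0 1 2) g h, (PF.opG (isMul 0 1 2) g h).tr a.succ b.succ] fun _ => rfl) k₁ k₂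

end Pv
end
end SetClass


namespace SetClass

open Fml

section
variable {α : Type} {c : α → ℕ}

namespace Pv
variable {Γ : PL c} {a b : PN c} {g h φ ψ : PF c}

theorem dec_eq (k₁ : Pv IKM Γ (.value a b g (g.tr a.succ b.succ))) (k₂ : Pv IKM Γ (.value a b h (h.tr a.succ b.succ))) :
    Pv IKM Γ (.dec a b (.ex (.conj g h)) ((PF.ex (.conj g h)).tr a b)) := by
  have k : Pv IKM Γ (.imp (.value a b g (g.tr a.succ b.succ)) (.imp (.value a b h (h.tr a.succ b.succ))
      (.dec a b (.ex (.conj (g.under.inst (.const 0)) (h.under.inst (.const 0)))) (.J a b (.ex (.J a.succ b.succ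
        (.conj ((g.tr a.succ b.succ).under.inst (.const 0)) ((h.tr a.succ b.succ).under.inst (.const 0))))))))) :=
    Prv.dec_eq.fillPv (by simp [NoEqC, J, sim, isBisim, forthBack, pairMemC, ballIn, bexIn, isOPair, isUPair, iff, value, dec, isNat, isInductive,
      isEmpty, isSucc, neg]) (fun | 0 => a | _ => b) [g, g.tr a.succ b.succ, h, h.tr a.succ b.succ] fun _ => rfl
  simp only [PF.under_inst] at k
  exact impE (impE k k₁) k₂

theorem dec_fls : Pv IKM Γ (.dec a b .fls (PF.fls.tr a b)) :=
  Prv.dec_fls.pv (fun | 0 => a | _ => b) (fun _ => a) fun _ => rfl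

theorem dec_conj (k₁ : Pv IKM Γ (.dec a b φ (φ.tr a b))) (k₂ : Pv IKM Γ (.dec a b ψ (ψ.tr a b))) :
    Pv IKM Γ (.dec a b (.conj φ ψ) ((PF.conj φ ψ).tr a b)) := by
  have k : Pv IKM Γ (.imp (.dec a b (φ.shift.inst a) ((φ.tr a b).shift.inst a)) (.imp (.dec a b (ψ.shift.inst a) ((ψ.tr a b).shift.inst a))
      (.dec a b (.conj (φ.shift.inst a) (ψ.shift.inst a)) (.J a b (.conj ((φ.tr a b).shift.inst a) ((ψ.tr a b).shift.inst a)))))) :=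
    Prv.dec_conj.fillPv (by simp [NoEqC, J, dec, neg]) (fun | 0 => a | _ => b) [φ.shift, (φ.tr a b).shift, ψ.shift, (ψ.tr a b).shift] fun _ => rfl
  simp only [PF.shift_inst] at k
  exact impE (impE k k₁) k₂

theorem dec_disj (k₁ : Pv IKM Γ (.dec a b φ (φ.tr a b))) (k₂ : Pv IKM Γ (.dec a b ψ (ψ.tr a b))) :
    Pv IKM Γ (.dec a b (.disj φ ψ) ((PF.disj φ ψ).tr a b)) := by
  have k : Pv IKM Γ (.imp (.dec a b (φ.shift.inst a) ((φ.tr a b).shift.inst a)) (.imp (.dec a b (ψ.shift.inst a) ((ψ.tr a b).shift.inst a))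
      (.dec a b (.disj (φ.shift.inst a) (ψ.shift.inst a)) (.J a b (.disj ((φ.tr a b).shift.inst a) ((ψ.tr a b).shift.inst a)))))) :=
    Prv.dec_disj.fillPv (by simp [NoEqC, J, dec, neg]) (fun | 0 => a | _ => b) [φ.shift, (φ.tr a b).shift, ψ.shift, (ψ.tr a b).shift] fun _ => rfl
  simp only [PF.shift_inst] at k
  exact impE (impE k k₁) k₂

theorem dec_imp (k₁ : Pv IKM Γ (.dec a b φ (φ.tr a b))) (k₂ : Pv IKM Γ (.dec a b ψ (ψ.tr a b))) :
    Pv IKM Γ (.dec a b (.imp φ ψ) ((PF.imp φ ψ).tr a b)) := by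
  have k : Pv IKM Γ (.imp (.imp (.J a b ((ψ.tr a b).shift.inst a)) ((ψ.tr a b).shift.inst a))
      (.imp (.dec a b (φ.shift.inst a) ((φ.tr a b).shift.inst a)) (.imp (.dec a b (ψ.shift.inst a) ((ψ.tr a b).shift.inst a))
      (.dec a b (.imp (φ.shift.inst a) (ψ.shift.inst a)) (.J a b (.imp ((φ.tr a b).shift.inst a) ((ψ.tr a b).shift.inst a))))))) :=
    Prv.dec_imp.fillPv (by simp [NoEqC, J, dec, neg]) (fun | 0 => a | _ => b) [φ.shift, (φ.tr a b).shift, ψ.shift, (ψ.tr a b).shift] fun _ => rfl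
  simp only [PF.shift_inst] at k
  exact impE (impE (impE k (impI (trBind hyp0 hyp0))) k₁) k₂

theorem respects_tr : Pv IKM Γ (.all (.all (.imp (.sim a.succ.succ b.succ.succ (.const 1) (.const 0))
    (.imp ((φ.tr a.succ b.succ).under.under.inst (.const 1)) (φ.tr a.succ b.succ).under)))) := by
  refine .allI (.allI (.impI ?_))
  have k := tr_inst_iff (φ := φ.under.under) (Γ := .cons (.sim a.succ.succ b.succ.succ (.const 1) (.const 0)) Γ.shift.shift) hyp0
  simp only [PF.tr_under, PF.under_inst] at k
  exact andL k

theorem dec_ball (k₁ : Pv IKM Γ (.value a b g (g.tr a.succ b.succ)))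
    (k₂ : Pv IKM (.cons (.const (isNat 0)) Γ.shift) (.dec a.succ b.succ φ (φ.tr a.succ b.succ))) :
    Pv IKM Γ (.dec a b (.ballG g φ) ((PF.ballG g φ).tr a b)) := by
  have k : Pv IKM Γ (.imp (.value a b g (g.tr a.succ b.succ)) (.imp (.all (.imp (.const (isNat 0))
        (.dec a.succ b.succ (φ.under.inst (.const 0)) ((φ.tr a.succ b.succ).under.inst (.const 0)))))
      (.imp (.all (.all (.imp (.sim a.succ.succ b.succ.succ (.const 1) (.const 0)) (.imp ((φ.tr a.succ b.succ).under.under.inst (.const 1))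
        ((φ.tr a.succ b.succ).under.under.inst (.const 0))))))
      (.imp (.all (.imp (.J a.succ b.succ ((φ.tr a.succ b.succ).under.inst (.const 0))) ((φ.tr a.succ b.succ).under.inst (.const 0))))
      (.dec a b (.all (.imp (g.under.inst (.const 0)) (.all (.imp (.mem (.const 0) (.const 1)) (φ.under.under.inst (.const 0))))))
      (.J a b (.all (.J a.succ b.succ (.imp ((g.tr a.succ b.succ).under.inst (.const 0)) (.J a.succ b.succ (.all (.J a.succ.succ b.succ.succ
        (.imp ((PF.mem (.const 0) (.const 1)).tr a.succ.succ b.succ.succ) ((φ.tr a.succ b.succ).under.under.inst (.const 0))))))))))))))) :=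
    Prv.dec_ball.fillPv (by simp [NoEqC, J, sim, isBisim, forthBack, pairMemC, ballIn, bexIn, isOPair, isUPair, iff, value, dec, isNat, isInductive,
      isEmpty, isSucc, neg, respects, isStable, Fml.tr]) (fun | 0 => a | _ => b) [g, g.tr a.succ b.succ, φ, φ.tr a.succ b.succ] fun _ => rfl
  simp only [PF.under_inst] at k
  have k := impE (impE (impE (impE k k₁) (allI (impI k₂))) respects_tr) (allI (impI (trBind hyp0 hyp0)))
  rw [← PF.tr_under] at k
  exact k

theorem dec_bex (k₁ : Pv IKM Γ (.value a b g (g.tr a.succ b.succ)))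
    (k₂ : Pv IKM (.cons (.const (isNat 0)) Γ.shift) (.dec a.succ b.succ φ (φ.tr a.succ b.succ))) :
    Pv IKM Γ (.dec a b (.bexG g φ) ((PF.bexG g φ).tr a b)) := by
  have k : Pv IKM Γ (.imp (.value a b g (g.tr a.succ b.succ)) (.imp (.all (.imp (.const (isNat 0))
        (.dec a.succ b.succ (φ.under.inst (.const 0)) ((φ.tr a.succ b.succ).under.inst (.const 0)))))
      (.imp (.all (.all (.imp (.sim a.succ.succ b.succ.succ (.const 1) (.const 0)) (.imp ((φ.tr a.succ b.succ).under.under.inst (.const 1))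
        ((φ.tr a.succ b.succ).under.under.inst (.const 0))))))
      (.imp (.all (.imp (.J a.succ b.succ ((φ.tr a.succ b.succ).under.inst (.const 0))) ((φ.tr a.succ b.succ).under.inst (.const 0))))
      (.dec a b (.ex (.conj (g.under.inst (.const 0)) (.ex (.conj (.mem (.const 0) (.const 1)) (φ.under.under.inst (.const 0))))))
      (.J a b (.ex (.J a.succ b.succ (.conj ((g.tr a.succ b.succ).under.inst (.const 0)) (.J a.succ b.succ (.ex (.J a.succ.succ b.succ.succ
        (.conj ((PF.mem (.const 0) (.const 1)).tr a.succ.succ b.succ.succ) ((φ.tr a.succ b.succ).under.under.inst (.const 0))))))))))))))) :=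
    Prv.dec_bex.fillPv (by simp [NoEqC, J, sim, isBisim, forthBack, pairMemC, ballIn, bexIn, isOPair, isUPair, iff, value, dec, isNat, isInductive,
      isEmpty, isSucc, neg, respects, isStable, Fml.tr]) (fun | 0 => a | _ => b) [g, g.tr a.succ b.succ, φ, φ.tr a.succ b.succ] fun _ => rfl
  simp only [PF.under_inst] at k
  have k := impE (impE (impE (impE k k₁) (allI (impI k₂))) respects_tr) (allI (impI (trBind hyp0 hyp0)))
  rw [← PF.tr_under] at k
  exact k

theorem sigma_of_dec (k : Pv IKM Γ (.dec a b φ (φ.tr a b))) : Pv IKM Γ (.imp (φ.tr a b) (.J a b φ)) := by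
  have h : Pv IKM Γ (.imp (.dec a b φ (φ.tr a b)) (.imp (φ.tr a b) (.J a b φ))) :=
    impI (impI (orE hyp1 (impI (impE hyp0 (andL hyp1))) (impI (impE (andR hyp1) hyp2))))
  exact impE h k

theorem sigma_ex (k : Pv IKM (.cons (.const (isNat 0)) Γ.shift) (.imp (φ.tr a.succ b.succ) (.J a.succ b.succ φ))) :
    Pv IKM Γ (.imp ((PF.ex (.conj (.const (isNat 0)) φ)).tr a b) (.J a b (.ex (.conj (.const (isNat 0)) φ)))) := by
  have h : Pv IKM Γ (.imp (.all (.imp (.const (isNat 0)) (.imp ((φ.tr a.succ b.succ).under.inst (.const 0)) (.J a.succ b.succ (φ.under.inst (.const 0))))))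
      (.imp (.all (.all (.imp (.sim a.succ.succ b.succ.succ (.const 1) (.const 0)) (.imp ((φ.tr a.succ b.succ).under.under.inst (.const 1))
        ((φ.tr a.succ b.succ).under.under.inst (.const 0))))))
      (.imp (.J a b (.ex (.J a.succ b.succ (.conj ((PF.const (isNat 0)).tr a.succ b.succ) ((φ.tr a.succ b.succ).under.inst (.const 0))))))
      (.J a b (.ex (.conj (.const (isNat 0)) (φ.under.inst (.const 0)))))))) :=
    Prv.sigma_ex.fillPv (by simp [NoEqC, J, sim, isBisim, forthBack, pairMemC, ballIn, bexIn, isOPair, isUPair, iff, isNat, isInductive,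
      isEmpty, isSucc, neg, respects, Fml.tr]) (fun | 0 => a | _ => b) [φ, φ.tr a.succ b.succ] fun _ => rfl
  simp only [PF.under_inst] at h
  exact impE (impE h (allI (impI k))) respects_tr

theorem imp_trans {T : Theory} (k₁ : Pv T Γ (.imp φ ψ)) (k₂ : Pv T Γ (.imp ψ h)) : Pv T Γ (.imp φ h) := by
  have k : Pv T Γ (.imp (.imp φ ψ) (.imp (.imp ψ h) (.imp φ h))) := impI (impI (impI (impE hyp1 (impE hyp2 hyp0))))
  exact impE (impE k k₁) k₂

theorem all_mp {T : Theory} (k : Pv T Γ.shift (.imp φ ψ)) : Pv T Γ (.imp φ.all ψ.all) := by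
  have l : Pv T Γ (.imp (PF.imp φ ψ).all (.imp φ.all ψ.all)) := by
    refine impI (impI (allI (impE (φ := φ) ?_ ?_)))
    · exact (PF.under_inst _).subst (motive := fun X => Pv T _ X) (allE (φ := (PF.imp φ ψ).under) (.const 0) (hyp fun _ => .tail _ (.head _)))
    · exact (PF.under_inst _).subst (motive := fun X => Pv T _ X) (allE (φ := φ.under) (.const 0) (hyp fun _ => .head _))
  exact impE l (allI k)

theorem box_mp (k : Pv IKM Γ.shift.shift (.imp (φ.shift.shift.tr (.const 1) (.const 0)) (ψ.shift.shift.tr (.const 1) (.const 0)))) :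
    Pv IKM Γ (.imp φ.box ψ.box) := all_mp (all_mp k)

theorem imp_all {T : Theory} (k : Pv T Γ.shift (.imp φ.shift ψ)) : Pv T Γ (.imp φ ψ.all) := by
  have l : Pv T Γ (.imp (PF.imp φ.shift ψ).all (.imp φ ψ.all)) := by
    refine impI (impI (allI (impE (φ := φ.shift) ?_ (hyp fun _ => .head _))))
    exact (PF.under_inst _).subst (motive := fun X => Pv T _ X) (allE (φ := (PF.imp φ.shift ψ).under) (.const 0) (hyp fun _ => .tail _ (.head _)))
  exact impE l (allI k)

theorem tr_allE (t : PN c) (k : Pv IKM Γ (φ.all.tr a b)) : Pv IKM Γ ((φ.inst t).tr a b) := by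
  refine trBind (φ := (φ.tr a.succ b.succ).all) k ?_
  rw [PF.tr_inst]
  exact allE t hyp0

theorem tr_impE (k : Pv IKM Γ ((φ.imp ψ).tr a b)) (k' : Pv IKM Γ (φ.tr a b)) : Pv IKM Γ (ψ.tr a b) := by
  have : Pv IKM Γ (.imp ((φ.imp ψ).tr a b) (.imp (φ.tr a b) (ψ.tr a b))) :=
    impI (impI (trBind (φ := (φ.tr a b).imp (ψ.tr a b)) hyp1 (impE hyp0 hyp1)))
  exact impE (impE this k) k'

theorem pi_of_sigma (k : Pv IKM Γ.shift.shift (.imp (φ.shift.shift.tr (.const 1) (.const 0)) (.J (.const 1) (.const 0) φ.shift.shift))) :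
    Pv IKM Γ (.imp φ.box φ) := by
  have h : Pv IKM Γ (.imp (.all (.all (.J (.const 1) (.const 0) (φ.shift.under.under.inst (.const 2))))) (φ.shift.inst (.const 0))) :=
    Prv.of_forall_J.fillPv (by simp [NoEqC, J]) (fun _ => .const 0) [φ.shift] fun _ => rfl
  have e : φ.shift.under.under.inst (.const 2) = φ.shift.shift := PF.ext fun i => by
    simp only [PF.shift, PF.under, PF.ren, PF.inst, Fml.shift, Fml.inst, rename_rename]; rfl
  rw [e, PF.shift_inst] at h
  exact imp_trans (all_mp (all_mp k)) h

theorem tr_nat_imp (t : PN c) (n : Pv IKM Γ ((PF.inst (.const (isNat 0)) t).tr a b)) :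
    Pv IKM Γ (.imp ((PF.all (.imp (.const (isNat 0)) φ)).tr a b) ((φ.inst t).tr a b)) := by
  have : Pv IKM Γ (.imp ((PF.inst (.const (isNat 0)) t).tr a b) (.imp ((PF.all (.imp (.const (isNat 0)) φ)).tr a b) ((φ.inst t).tr a b))) :=
    impI (impI (tr_impE (φ := PF.inst (.const (isNat 0)) t) (tr_allE (φ := .imp (.const (isNat 0)) φ) t hyp0) hyp1))
  exact impE this n

theorem _root_.SetClass.PF.shift_box (φ : PF c) : φ.shift.box = φ.box.shift := PF.ext fun i => by
  refine congrArg Fml.all (congrArg Fml.all ?_)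
  show Fml.tr 1 0 (((φ.f i).shift).shift).shift = Fml.rename (up (up Nat.succ)) id (Fml.tr 1 0 (φ.f i).shift.shift)
  rw [tr_rename]
  simp only [Fml.shift, rename_rename]
  rfl

theorem pi_all (k : Pv IKM (.cons (.const (isNat 0)) Γ.shift) (.imp φ.box φ)) :
    Pv IKM Γ (.imp (PF.all (.imp (.const (isNat 0)) φ)).box (.all (.imp (.const (isNat 0)) φ))) := by
  have e : φ.under.under.under.inst (.const 2) = φ.shift.shift := PF.ext fun i => by
    simp only [PF.shift, PF.under, PF.ren, PF.inst, Fml.shift, Fml.inst, rename_rename]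
    exact rename_congr _ (fun n => by cases n <;> rfl) fun _ => rfl
  have l : Pv IKM (.cons (.const (isNat 0)) Γ.shift) (.imp (PF.all (.imp (.const (isNat 0)) φ)).shift.box φ.box) := by
    refine box_mp (e ▸ tr_nat_imp (φ := φ.under.under.under) (.const 2) ?_)
    exact impE (φ := .const (isNat 2)) ((Prv.impI fun k => Prv.nat_tr k : Prv IKM [] (imp (isNat 2) (Fml.tr 1 0 (isNat 2)))).const _) (hyp fun _ => .head _)
  refine imp_all ?_
  have m : Pv IKM Γ.shift (.imp (.imp (.const (isNat 0)) (.imp (PF.all (.imp (.const (isNat 0)) φ)).shift.box φ))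
    (.imp (PF.all (.imp (.const (isNat 0)) φ)).shift.box (.imp (.const (isNat 0)) φ))) := impI (impI (impI (impE (impE hyp2 hyp0) hyp1)))
  rw [← PF.shift_box]
  exact impE m (impI (imp_trans l k))

end Pv
end
end SetClass


/-! ## The recursion over arithmetical formulas -/

namespace SetClass

open Fml

/-- A task of the recursion: to derive, from `Γ`, the statement of kind `m` about `ψ`. -/
structure Task where
  Γ : List Fml
  a : ℕ
  b : ℕ
  m : ℕ
  ψ : Fml

/-- The number of a task. -/
def Task.code (t : Task) : ℕ := Nat.pair (Nat.pair t.a t.b) (Nat.pair (codeList t.Γ) (Nat.pair t.m t.ψ.code))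

/-- A trivial task. -/
def Task.none : Task := ⟨[], 0, 0, 4, .fls⟩

/-- Families of tasks of a fixed kind. -/
structure TaskF {α : Type} (c : α → ℕ) where
  Γ : PL c
  a : PN c
  b : PN c
  m : ℕ
  ψ : PF c

section
variable {α : Type} {c : α → ℕ}

/-- A family of trivial tasks. -/
def TaskF.none : TaskF c := ⟨.nil, .const 0, .const 0, 4, .fls⟩

/-- The members of a family of tasks. -/
def TaskF.f (t : TaskF c) (i : α) : Task := ⟨t.Γ.f i, t.a.f i, t.b.f i, t.m, t.ψ.f i⟩

theorem TaskF.pr (t : TaskF c) : PR c fun i => (t.f i).code :=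
  .natPair (.natPair t.a.pr t.b.pr) (.natPair t.Γ.pr (.natPair (.const _) t.ψ.pr))

/-- The formula to be derived for a family of tasks. -/
def PF.goal (a b : PN c) (φ : PF c) : ℕ → PF c
  | 0 => .value a b φ (φ.tr a.succ b.succ)
  | 1 => .dec a b φ (φ.tr a b)
  | 2 => .imp (φ.tr a b) (.J a b φ)
  | 3 => .imp φ.box φ
  | _ => .imp .fls .fls

/-- The tasks of the family have a solution. -/
def TaskF.Solvable (t : TaskF c) : Prop := Pv IKM t.Γ (.goal t.a t.b t.ψ t.m)

/-- A constant formula as a family of formulas. -/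
abbrev PF.unit (φ : Fml) : PF fun _ : Unit => 0 := .const φ

/-- The number `n` solves the task `t`. -/
def Task.IsSolution (t : Task) (n : ℕ) : Prop :=
  t.m = 4 ∨ IsProof IKM t.Γ ((PF.goal (.const t.a) (.const t.b) (.unit t.ψ) t.m).f ()) n

theorem TaskF.solvable_iff (t : TaskF c) : t.Solvable ↔ ∃ n, PR c n ∧ ∀ i, (t.f i).IsSolution (n i) := by
  obtain ⟨Γ, a, b, m, ψ⟩ := t
  match m with
  | 0 | 1 | 2 | 3 => simp only [Task.IsSolution, TaskF.f, Nat.reduceEqDiff, OfNat.zero_ne_ofNat, OfNat.one_ne_ofNat, false_or]; rfl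
  | m + 4 => exact ⟨fun ⟨n, hn, e⟩ => ⟨n, hn, fun i => .inr (e i)⟩, fun _ => .impI .hyp0⟩

end

/-- The data of a step of the recursion. -/
structure Arg where
  Γ : List Fml
  a : ℕ
  b : ℕ
  g : Fml
  h : Fml

/-- The code of the condition in `∃ y, g(y) ∧ ∃ x, x ∈ y ∧ φ(x)` -/
def memTag (n : ℕ) : ℕ := Nat.pair n.unpair.1 (Nat.pair n.unpair.2.unpair.1 n.unpair.2.unpair.2.unpair.1.unpair.1)

/-- The quantifier and the bound in `∀ x, x ∈ ω → φ(x)` and `∃ x, x ∈ ω ∧ φ(x)` -/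
def natTag (n : ℕ) : ℕ := Nat.pair n.unpair.1 n.unpair.2.unpair.2.unpair.1

/-- A kind of steps: the step reduces the task `x A` to `s A` and `t A`, for data with `V A`. -/
structure Kind where
  V : Arg → Prop
  x : Arg → Task
  s : Arg → Task
  t : Arg → Task

/-- The kinds of steps. -/
def kind : ℕ → Kind
  | 0 => ⟨fun A => (∃ i, A.g = .eq 0 (i + 1) ∧ isNat i ∈ A.Γ) ∧ A.h = A.g, fun A => ⟨A.Γ, A.a, A.b, 0, A.g⟩,
      fun _ => .none, fun _ => .none⟩
  | 1 => ⟨fun A => A.g = isEmpty 0 ∧ A.h = A.g, fun A => ⟨A.Γ, A.a, A.b, 0, A.g⟩,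
      fun _ => .none, fun _ => .none⟩
  | 2 => ⟨fun A => A.h = A.g, fun A => ⟨A.Γ, A.a, A.b, 0, .ex (.conj ((PF.unit A.g).under.f ()) (isSucc 0 1))⟩,
      fun A => ⟨A.Γ, A.a, A.b, 0, A.g⟩, fun _ => .none⟩
  | 3 => ⟨fun _ => True, fun A => ⟨A.Γ, A.a, A.b, 0, .ex (.ex (.conj (((PF.unit A.g).under.under.under.inst (.const 1)).f ())
      (.conj ((PF.unit A.h).under.under.f ()) (isAdd 1 0 2))))⟩,
      fun A => ⟨A.Γ, A.a, A.b, 0, A.g⟩, fun A => ⟨A.Γ, A.a, A.b, 0, A.h⟩⟩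
  | 4 => ⟨fun _ => True, fun A => ⟨A.Γ, A.a, A.b, 0, .ex (.ex (.conj (((PF.unit A.g).under.under.under.inst (.const 1)).f ())
      (.conj ((PF.unit A.h).under.under.f ()) (isMul 1 0 2))))⟩,
      fun A => ⟨A.Γ, A.a, A.b, 0, A.g⟩, fun A => ⟨A.Γ, A.a, A.b, 0, A.h⟩⟩
  | 5 => ⟨fun A => memTag A.h.code ≠ Nat.pair 9 (Nat.pair 5 0), fun A => ⟨A.Γ, A.a, A.b, 1, .ex (.conj A.g A.h)⟩,
      fun A => ⟨A.Γ, A.a, A.b, 0, A.g⟩, fun A => ⟨A.Γ, A.a, A.b, 0, A.h⟩⟩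
  | 6 => ⟨fun A => A.g = .fls ∧ A.h = A.g, fun A => ⟨A.Γ, A.a, A.b, 1, A.g⟩,
      fun _ => .none, fun _ => .none⟩
  | 7 => ⟨fun _ => True, fun A => ⟨A.Γ, A.a, A.b, 1, .conj A.g A.h⟩,
      fun A => ⟨A.Γ, A.a, A.b, 1, A.g⟩, fun A => ⟨A.Γ, A.a, A.b, 1, A.h⟩⟩
  | 8 => ⟨fun _ => True, fun A => ⟨A.Γ, A.a, A.b, 1, .disj A.g A.h⟩,
      fun A => ⟨A.Γ, A.a, A.b, 1, A.g⟩, fun A => ⟨A.Γ, A.a, A.b, 1, A.h⟩⟩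
  | 9 => ⟨fun _ => True, fun A => ⟨A.Γ, A.a, A.b, 1, .imp A.g A.h⟩,
      fun A => ⟨A.Γ, A.a, A.b, 1, A.g⟩, fun A => ⟨A.Γ, A.a, A.b, 1, A.h⟩⟩
  | 10 => ⟨fun _ => True, fun A => ⟨A.Γ, A.a, A.b, 1, .all (.imp A.g (.all (.imp (.mem 0 1) ((PF.unit A.h).under.f ()))))⟩,
      fun A => ⟨A.Γ, A.a, A.b, 0, A.g⟩, fun A => ⟨isNat 0 :: A.Γ.map shift, A.a + 1, A.b + 1, 1, A.h⟩⟩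
  | 11 => ⟨fun _ => True, fun A => ⟨A.Γ, A.a, A.b, 1, .ex (.conj A.g (.ex (.conj (.mem 0 1) ((PF.unit A.h).under.f ()))))⟩,
      fun A => ⟨A.Γ, A.a, A.b, 0, A.g⟩, fun A => ⟨isNat 0 :: A.Γ.map shift, A.a + 1, A.b + 1, 1, A.h⟩⟩
  | 12 => ⟨fun A => natTag A.g.code ≠ Nat.pair 9 (isNat 0).code ∧ A.h = A.g, fun A => ⟨A.Γ, A.a, A.b, 2, A.g⟩,
      fun A => ⟨A.Γ, A.a, A.b, 1, A.g⟩, fun _ => .none⟩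
  | 13 => ⟨fun A => A.h = A.g, fun A => ⟨A.Γ, A.a, A.b, 2, .ex (.conj (isNat 0) A.g)⟩,
      fun A => ⟨isNat 0 :: A.Γ.map shift, A.a + 1, A.b + 1, 2, A.g⟩, fun _ => .none⟩
  | 14 => ⟨fun A => natTag A.g.code ≠ Nat.pair 8 (isNat 0).code ∧ A.h = A.g, fun A => ⟨A.Γ, A.a, A.b, 3, A.g⟩,
      fun A => ⟨(A.Γ.map shift).map shift, 1, 0, 2, A.g.shift.shift⟩, fun _ => .none⟩
  | _ => ⟨fun A => A.h = A.g, fun A => ⟨A.Γ, A.a, A.b, 3, .all (.imp (isNat 0) A.g)⟩,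
      fun A => ⟨isNat 0 :: A.Γ.map shift, A.a, A.b, 3, A.g⟩, fun _ => .none⟩

/-- The kind of step for the task with number `n`; `N` and `M` are the codes of `isNat 0` and `isAdd 1 0 2`. -/
def tag (N M n : ℕ) : ℕ :=
  if n.unpair.2.unpair.2.unpair.1 = 0 then
    if n.unpair.2.unpair.2.unpair.2.unpair.1 = 2 then 0 else if n.unpair.2.unpair.2.unpair.2.unpair.1 = 8 then 1 else
    if n.unpair.2.unpair.2.unpair.2.unpair.2.unpair.1 = 5 then 2 else
    if n.unpair.2.unpair.2.unpair.2.unpair.2.unpair.2.unpair.2.unpair.2.unpair.2.unpair.2 = M then 3 else 4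
  else if n.unpair.2.unpair.2.unpair.1 = 1 then
    if n.unpair.2.unpair.2.unpair.2.unpair.1 = 4 then 6 else if n.unpair.2.unpair.2.unpair.2.unpair.1 = 5 then 7 else
    if n.unpair.2.unpair.2.unpair.2.unpair.1 = 6 then 8 else if n.unpair.2.unpair.2.unpair.2.unpair.1 = 7 then 9 else
    if n.unpair.2.unpair.2.unpair.2.unpair.1 = 8 then 10 else
    if memTag n.unpair.2.unpair.2.unpair.2.unpair.2.unpair.2.unpair.2 = Nat.pair 9 (Nat.pair 5 0) then 11 else 5
  else if n.unpair.2.unpair.2.unpair.1 = 2 then if natTag n.unpair.2.unpair.2.unpair.2 = Nat.pair 9 N then 13 else 12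
  else if natTag n.unpair.2.unpair.2.unpair.2 = Nat.pair 8 N then 15 else 14

theorem PR.ifEq {α : Type} {c f g h : α → ℕ} (k : ℕ) (hf : PR c f) (hg : PR c g) (hh : PR c h) :
    PR c fun a => if f a = k then g a else h a :=
  (PR.ite (PR.comp (Primrec.eq.decide.comp .id (.const k)) hf) hg hh).of_eq fun a => by
    by_cases e : f a = k <;> simp [e]

theorem tag_primrec (N M : ℕ) : Primrec (tag N M) := by
  have hm : PR (fun n : ℕ => Encodable.encode n) fun n => n.unpair.2.unpair.2.unpair.1 := (PR.self (c := fun n => n)).right.right.left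
  have hk : PR (fun n : ℕ => Encodable.encode n) fun n => n.unpair.2.unpair.2.unpair.2 := (PR.self (c := fun n => n)).right.right.right
  have hnat : PR (fun n : ℕ => Encodable.encode n) fun n => natTag n.unpair.2.unpair.2.unpair.2 := .natPair hk.left hk.right.right.left
  have hmem : PR (fun n : ℕ => Encodable.encode n) fun n => memTag n.unpair.2.unpair.2.unpair.2.unpair.2.unpair.2.unpair.2 :=
    .natPair hk.right.right.right.left (.natPair hk.right.right.right.right.left hk.right.right.right.right.right.left.left)
  exact PR.primrec (.ifEq _ hm (.ifEq _ hk.left (.const _) (.ifEq _ hk.left (.const _) (.ifEq _ hk.right.left (.const _)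
    (.ifEq _ hk.right.right.right.right.right.right (.const _) (.const _)))))
    (.ifEq _ hm (.ifEq _ hk.left (.const _) (.ifEq _ hk.left (.const _) (.ifEq _ hk.left (.const _) (.ifEq _ hk.left (.const _)
      (.ifEq _ hk.left (.const _) (.ifEq _ hmem (.const _) (.const _)))))))
    (.ifEq _ hm (.ifEq _ hnat (.const _) (.const _)) (.ifEq _ hnat (.const _) (.const _)))))

theorem tag_code {k : ℕ} (hk : k < 16) (A : Arg) (hA : (kind k).V A) :
    tag (isNat 0).code (isAdd 1 0 2).code ((kind k).x A).code = k := by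
  have e : (isMul 1 0 2).code ≠ (isAdd 1 0 2).code := fun e => by
    have := code_injective e
    simp [isMul, isAdd, pairMem, isOPair, isUPair, iff] at this
  obtain ⟨Γ, a, b, g, h⟩ := A
  interval_cases k
  · obtain ⟨⟨i, rfl, -⟩, -⟩ := hA
    simp [tag, kind, Task.code, Fml.code]
  · obtain ⟨rfl, -⟩ := hA
    simp [tag, kind, Task.code, isEmpty, Fml.code]
  · simp [tag, kind, Task.code, Fml.code]
  · simp [tag, kind, Task.code, Fml.code]
  · simp [tag, kind, Task.code, Fml.code, e]
  · have hA : memTag h.code ≠ _ := hA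
    simp [tag, kind, Task.code, Fml.code, hA]
  · obtain ⟨rfl, -⟩ := hA
    simp [tag, kind, Task.code, Fml.code]
  · simp [tag, kind, Task.code, Fml.code]
  · simp [tag, kind, Task.code, Fml.code]
  · simp [tag, kind, Task.code, Fml.code]
  · simp [tag, kind, Task.code, Fml.code]
  · simp [tag, kind, Task.code, Fml.code, memTag]
  · have hA : natTag g.code ≠ _ := hA.1
    simp [tag, kind, Task.code, Fml.code, hA]
  · simp [tag, kind, Task.code, Fml.code, natTag]
  · have hA : natTag g.code ≠ _ := hA.1
    simp [tag, kind, Task.code, Fml.code, hA]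
  · simp [tag, kind, Task.code, Fml.code, natTag]

end SetClass


namespace SetClass

open Fml

namespace Kind

/-- Families of data have families of steps. -/
def HasFamilies (K : Kind) : Prop := ∀ (α : Type) (c : α → ℕ) (A : α → Arg), (∀ i, K.V (A i)) → (PR c fun i => (K.x (A i)).code) →
  ∃ X S T : TaskF c, (∀ i, X.f i = K.x (A i)) ∧ (∀ i, S.f i = K.s (A i)) ∧ (∀ i, T.f i = K.t (A i)) ∧ (S.Solvable → T.Solvable → X.Solvable)

theorem HasFamilies.mk {K : Kind} (Hx : ∀ A, (K.x A).Γ = A.Γ ∧ (K.x A).a = A.a ∧ (K.x A).b = A.b)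
    (H : ∀ {α : Type} {c : α → ℕ} (A : α → Arg), (∀ i, K.V (A i)) → (PR c fun i => (K.x (A i)).ψ.code) →
      (PR c fun i => (A i).g.code) ∧ PR c fun i => (A i).h.code)
    (Hp : ∀ {α : Type} {c : α → ℕ} (Γ : PL c) (a b : PN c) (g h : PF c), (∀ i, K.V ⟨Γ.f i, a.f i, b.f i, g.f i, h.f i⟩) →
      ∃ X S T : TaskF c, (∀ i, X.f i = K.x ⟨Γ.f i, a.f i, b.f i, g.f i, h.f i⟩) ∧ (∀ i, S.f i = K.s ⟨Γ.f i, a.f i, b.f i, g.f i, h.f i⟩) ∧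
        (∀ i, T.f i = K.t ⟨Γ.f i, a.f i, b.f i, g.f i, h.f i⟩) ∧ (S.Solvable → T.Solvable → X.Solvable)) : K.HasFamilies := by
  intro α c A hA hc
  obtain ⟨hg, hh⟩ := H A hA (hc.right.right.right.of_eq fun i => by simp [Task.code])
  exact Hp ⟨fun i => (A i).Γ, hc.right.left.of_eq fun i => by simp [Task.code, Hx]⟩
    ⟨fun i => (A i).a, hc.left.left.of_eq fun i => by simp [Task.code, Hx]⟩
    ⟨fun i => (A i).b, hc.left.right.of_eq fun i => by simp [Task.code, Hx]⟩ ⟨fun i => (A i).g, hg⟩ ⟨fun i => (A i).h, hh⟩ hA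

theorem HasFamilies.rule {K : Kind} (hK : K.HasFamilies) : ∃ q r G : ℕ → ℕ, Primrec q ∧ Primrec r ∧ Primrec G ∧ ∀ A, K.V A →
    (K.s A).code = q (K.x A).code ∧ (K.t A).code = r (K.x A).code ∧ ∀ n m, (K.s A).IsSolution n → (K.t A).IsSolution m →
      (K.x A).IsSolution (G (Nat.pair (K.x A).code (Nat.pair n m))) := by
  obtain ⟨_, S, T, -, hS, hT, -⟩ := hK {A // K.V A} (fun A => (K.x A.1).code) (fun A => A.1) (fun A => A.2) .self
  obtain ⟨q, hq, eq⟩ := S.pr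
  obtain ⟨r, hr, er⟩ := T.pr
  obtain ⟨X', S', T', hX', hS', hT', h⟩ := hK {y : Arg × ℕ × ℕ // K.V y.1 ∧ (K.s y.1).IsSolution y.2.1 ∧ (K.t y.1).IsSolution y.2.2}
    (fun y => Nat.pair (K.x y.1.1).code (Nat.pair y.1.2.1 y.1.2.2)) (fun y => y.1.1) (fun y => y.2.1) (PR.self.left.of_eq fun _ => by simp)
  obtain ⟨_, ⟨G, hG, e⟩, k⟩ := X'.solvable_iff.1 (h (S'.solvable_iff.2 ⟨fun y => y.1.2.1, PR.self.right.left.of_eq fun _ => by simp,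
    fun y => hS' y ▸ y.2.2.1⟩) (T'.solvable_iff.2 ⟨fun y => y.1.2.2, PR.self.right.right.of_eq fun _ => by simp, fun y => hT' y ▸ y.2.2.2⟩))
  refine ⟨q, r, G, hq, hr, hG, fun A hA => ⟨?_, ?_, fun n m hn hm => ?_⟩⟩
  · exact congrArg Task.code (hS ⟨A, hA⟩).symm |>.trans (eq ⟨A, hA⟩)
  · exact congrArg Task.code (hT ⟨A, hA⟩).symm |>.trans (er ⟨A, hA⟩)
  · have := k ⟨(A, n, m), hA, hn, hm⟩
    rwa [e, hX'] at this

end Kind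

theorem PR.rename_sub {α : Type} {c : α → ℕ} (k : ℕ) {φ ψ : α → Fml} (h : PR c fun i => (ψ i).code)
    (e : ∀ i, (ψ i).rename (· - k) id = φ i) : PR c fun i => (φ i).code :=
  (PF.ren (· - k) id (Primrec.nat_sub.comp .id (.const k)) .id ⟨ψ, h⟩).pr.of_eq fun i => congrArg Fml.code (e i)

theorem PF.under_sub (φ : Fml) : ((PF.unit φ).under.f ()).rename (· - 1) id = φ := by
  simp only [PF.under, PF.ren, PF.const, rename_rename]
  exact rename_eq_self _ (fun n => by cases n <;> rfl) fun _ => rfl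

theorem PF.under_under_sub (φ : Fml) : ((PF.unit φ).under.under.f ()).rename (· - 2) id = φ := by
  simp only [PF.under, PF.ren, PF.const, rename_rename]
  exact rename_eq_self _ (fun n => by cases n <;> rfl) fun _ => rfl

theorem PF.under_inst_sub (φ : Fml) : ((((PF.unit φ).under.under.under).inst (.const 1)).f ()).rename (· - 2) id = φ := by
  simp only [PF.under, PF.ren, PF.inst, PF.const, Fml.inst, rename_rename]
  exact rename_eq_self _ (fun n => by cases n <;> rfl) fun _ => rfl

theorem kind_hasFamilies (k : ℕ) : (kind k).HasFamilies := by
  match k with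
  | 0 =>
    refine .mk (K := kind 0) (fun A => ⟨rfl, rfl, rfl⟩) (fun A hA h => ⟨h, h.of_eq fun i => by rw [(hA i).2]; rfl⟩) fun Γ a b g h hA => ?_
    have e : ∃ i : PN _, (∀ j, isNat (i.f j) ∈ Γ.f j) ∧ g = .eq (.const 0) i.succ := by
      refine ⟨⟨fun j => (g.f j).code.unpair.2.unpair.2 - 1, .comp (Primrec.nat_sub.comp .id (.const 1)) g.pr.right.right⟩, fun j => ?_, PF.ext fun j => ?_⟩
      all_goals
        obtain ⟨⟨i, e, hi⟩, -⟩ := hA j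
        have e : g.f j = _ := e
        simp only [e, PF.eq, PN.const, PN.succ, Fml.code, Nat.unpair_pair, Nat.add_sub_cancel]
        try exact hi
    obtain ⟨i, hi, rfl⟩ := e
    exact ⟨⟨Γ, a, b, 0, .eq (.const 0) i.succ⟩, .none, .none, fun _ => rfl, fun _ => rfl,
      fun _ => rfl, fun _ _ => Pv.value_var i hi⟩
  | 1 =>
    refine .mk (K := kind 1) (fun A => ⟨rfl, rfl, rfl⟩) (fun A hA h => ⟨h, h.of_eq fun i => by rw [(hA i).2]; rfl⟩) fun Γ a b g h hA => ?_
    obtain rfl : g = .const (isEmpty 0) := PF.ext fun i => (hA i).1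
    exact ⟨⟨Γ, a, b, 0, .const (isEmpty 0)⟩, .none, .none, fun _ => rfl, fun _ => rfl,
      fun _ => rfl, fun _ _ => Pv.value_zero⟩
  | 2 =>
    refine .mk (K := kind 2) (fun A => ⟨rfl, rfl, rfl⟩) (fun A hA h => ?_) fun Γ a b g h hA => ⟨⟨Γ, a, b, 0, g.succG⟩, ⟨Γ, a, b, 0, g⟩,
      .none, fun _ => rfl, fun _ => rfl, fun _ => rfl, fun k _ => Pv.value_succ k⟩
    have := PR.rename_sub 1 (h.right.right.left.of_eq fun i => by simp [kind, Fml.code]) fun i => PF.under_sub (A i).g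
    exact ⟨this, this.of_eq fun i => by rw [show (A i).h = _ from hA i]⟩
  | 3 =>
    exact .mk (K := kind 3) (fun A => ⟨rfl, rfl, rfl⟩) (fun A hA h =>
      ⟨PR.rename_sub 2 (h.right.right.right.left.of_eq fun i => by simp [kind, Fml.code]) fun i => PF.under_inst_sub (A i).g,
        PR.rename_sub 2 (h.right.right.right.right.right.left.of_eq fun i => by simp [kind, Fml.code]) fun i => PF.under_under_sub (A i).h⟩)
      fun Γ a b g h hA => ⟨⟨Γ, a, b, 0, .opG (isAdd 0 1 2) g h⟩, ⟨Γ, a, b, 0, g⟩, ⟨Γ, a, b, 0, h⟩, fun _ => rfl, fun _ => rfl, fun _ => rfl, Pv.value_add⟩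
  | 4 =>
    exact .mk (K := kind 4) (fun A => ⟨rfl, rfl, rfl⟩) (fun A hA h =>
      ⟨PR.rename_sub 2 (h.right.right.right.left.of_eq fun i => by simp [kind, Fml.code]) fun i => PF.under_inst_sub (A i).g,
        PR.rename_sub 2 (h.right.right.right.right.right.left.of_eq fun i => by simp [kind, Fml.code]) fun i => PF.under_under_sub (A i).h⟩)
      fun Γ a b g h hA => ⟨⟨Γ, a, b, 0, .opG (isMul 0 1 2) g h⟩, ⟨Γ, a, b, 0, g⟩, ⟨Γ, a, b, 0, h⟩, fun _ => rfl, fun _ => rfl, fun _ => rfl, Pv.value_mul⟩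
  | 5 =>
    exact .mk (K := kind 5) (fun A => ⟨rfl, rfl, rfl⟩) (fun A hA h => ⟨h.right.right.left.of_eq fun i => by simp [kind, Fml.code],
        h.right.right.right.of_eq fun i => by simp [kind, Fml.code]⟩)
      fun Γ a b g h hA => ⟨⟨Γ, a, b, 1, .ex (.conj g h)⟩, ⟨Γ, a, b, 0, g⟩, ⟨Γ, a, b, 0, h⟩, fun _ => rfl, fun _ => rfl, fun _ => rfl, Pv.dec_eq⟩
  | 6 =>
    refine .mk (K := kind 6) (fun A => ⟨rfl, rfl, rfl⟩) (fun A hA h => ⟨h, h.of_eq fun i => by rw [(hA i).2]; rfl⟩) fun Γ a b g h hA => ?_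
    obtain rfl : g = .fls := PF.ext fun i => (hA i).1
    exact ⟨⟨Γ, a, b, 1, .fls⟩, .none, .none, fun _ => rfl, fun _ => rfl,
      fun _ => rfl, fun _ _ => Pv.dec_fls⟩
  | 7 =>
    exact .mk (K := kind 7) (fun A => ⟨rfl, rfl, rfl⟩) (fun A hA h => ⟨h.right.left.of_eq fun i => by simp [kind, Fml.code],
        h.right.right.of_eq fun i => by simp [kind, Fml.code]⟩)
      fun Γ a b g h hA => ⟨⟨Γ, a, b, 1, .conj g h⟩, ⟨Γ, a, b, 1, g⟩, ⟨Γ, a, b, 1, h⟩, fun _ => rfl, fun _ => rfl, fun _ => rfl, Pv.dec_conj⟩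
  | 8 =>
    exact .mk (K := kind 8) (fun A => ⟨rfl, rfl, rfl⟩) (fun A hA h => ⟨h.right.left.of_eq fun i => by simp [kind, Fml.code],
        h.right.right.of_eq fun i => by simp [kind, Fml.code]⟩)
      fun Γ a b g h hA => ⟨⟨Γ, a, b, 1, .disj g h⟩, ⟨Γ, a, b, 1, g⟩, ⟨Γ, a, b, 1, h⟩, fun _ => rfl, fun _ => rfl, fun _ => rfl, Pv.dec_disj⟩
  | 9 =>
    exact .mk (K := kind 9) (fun A => ⟨rfl, rfl, rfl⟩) (fun A hA h => ⟨h.right.left.of_eq fun i => by simp [kind, Fml.code],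
        h.right.right.of_eq fun i => by simp [kind, Fml.code]⟩)
      fun Γ a b g h hA => ⟨⟨Γ, a, b, 1, .imp g h⟩, ⟨Γ, a, b, 1, g⟩, ⟨Γ, a, b, 1, h⟩, fun _ => rfl, fun _ => rfl, fun _ => rfl, Pv.dec_imp⟩
  | 10 =>
    exact .mk (K := kind 10) (fun A => ⟨rfl, rfl, rfl⟩) (fun A hA h => ⟨h.right.right.left.of_eq fun i => by simp [kind, Fml.code],
        PR.rename_sub 1 (h.right.right.right.right.right.right.of_eq fun i => by simp [kind, Fml.code]) fun i => PF.under_sub (A i).h⟩)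
      fun Γ a b g h hA => ⟨⟨Γ, a, b, 1, .ballG g h⟩, ⟨Γ, a, b, 0, g⟩, ⟨.cons (.const (isNat 0)) Γ.shift, a.succ, b.succ, 1, h⟩, fun _ => rfl,
        fun _ => rfl, fun _ => rfl, Pv.dec_ball⟩
  | 11 =>
    exact .mk (K := kind 11) (fun A => ⟨rfl, rfl, rfl⟩) (fun A hA h => ⟨h.right.right.left.of_eq fun i => by simp [kind, Fml.code],
        PR.rename_sub 1 (h.right.right.right.right.right.right.of_eq fun i => by simp [kind, Fml.code]) fun i => PF.under_sub (A i).h⟩)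
      fun Γ a b g h hA => ⟨⟨Γ, a, b, 1, .bexG g h⟩, ⟨Γ, a, b, 0, g⟩, ⟨.cons (.const (isNat 0)) Γ.shift, a.succ, b.succ, 1, h⟩, fun _ => rfl,
        fun _ => rfl, fun _ => rfl, Pv.dec_bex⟩
  | 12 =>
    exact .mk (K := kind 12) (fun A => ⟨rfl, rfl, rfl⟩) (fun A hA h => ⟨h, h.of_eq fun i => by rw [(hA i).2]; rfl⟩)
      fun Γ a b g h hA => ⟨⟨Γ, a, b, 2, g⟩, ⟨Γ, a, b, 1, g⟩, .none, fun _ => rfl, fun _ => rfl, fun _ => rfl,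
        fun k _ => Pv.sigma_of_dec k⟩
  | 13 =>
    refine .mk (K := kind 13) (fun A => ⟨rfl, rfl, rfl⟩) (fun A hA h => ?_)
      fun Γ a b g h hA => ⟨⟨Γ, a, b, 2, .ex (.conj (.const (isNat 0)) g)⟩, ⟨.cons (.const (isNat 0)) Γ.shift, a.succ, b.succ, 2, g⟩,
        .none, fun _ => rfl, fun _ => rfl, fun _ => rfl, fun k _ => Pv.sigma_ex k⟩
    have := h.right.right.right.of_eq (k := fun i => (A i).g.code) fun i => by simp [kind, Fml.code]
    exact ⟨this, this.of_eq fun i => by rw [show (A i).h = _ from hA i]⟩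
  | 14 =>
    exact .mk (K := kind 14) (fun A => ⟨rfl, rfl, rfl⟩) (fun A hA h => ⟨h, h.of_eq fun i => by rw [(hA i).2]; rfl⟩)
      fun Γ a b g h hA => ⟨⟨Γ, a, b, 3, g⟩, ⟨Γ.shift.shift, .const 1, .const 0, 2, g.shift.shift⟩, .none,
        fun _ => rfl, fun _ => rfl, fun _ => rfl, fun k _ => Pv.pi_of_sigma k⟩
  | n + 15 =>
    refine .mk (K := kind (n + 15)) (fun A => ⟨rfl, rfl, rfl⟩) (fun A hA h => ?_)
      fun Γ a b g h hA => ⟨⟨Γ, a, b, 3, .all (.imp (.const (isNat 0)) g)⟩, ⟨.cons (.const (isNat 0)) Γ.shift, a, b, 3, g⟩,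
        .none, fun _ => rfl, fun _ => rfl, fun _ => rfl, fun k _ => Pv.pi_all k⟩
    have := h.right.right.right.of_eq (k := fun i => (A i).g.code) fun i => by simp [kind, Fml.code]
    exact ⟨this, this.of_eq fun i => by rw [show (A i).h = _ from hA i]⟩

end SetClass


namespace SetClass

open Fml

/-- A task that is reduced to trivial ones in at most `n` steps. -/
inductive Valid : ℕ → Task → Prop
  | none (n : ℕ) : Valid n .none
  | node {n k : ℕ} {A : Arg} (hk : k < 16) (hV : (kind k).V A) (hs : Valid n ((kind k).s A)) (ht : Valid n ((kind k).t A)) :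
      Valid (n + 1) ((kind k).x A)

theorem exists_primrec_valid : ∃ F : ℕ → ℕ → ℕ, Primrec₂ F ∧ ∀ n t, Valid n t → t.IsSolution (F n t.code) := by
  choose q r G hq hr hG H using fun k => (kind_hasFamilies k).rule
  obtain ⟨q', hq', eq⟩ := FRules.pick' q hq 16
  obtain ⟨r', hr', er⟩ := FRules.pick' r hr 16
  obtain ⟨G', hG', eG⟩ := FRules.pick' G hG 16
  have ht := tag_primrec (isNat 0).code (isAdd 1 0 2).code
  let T := tag (isNat 0).code (isAdd 1 0 2).code
  have nth : ∀ i, Primrec₂ fun (_ : ℕ) (l : List ℕ) => l.getD i 0 := fun i =>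
    (Primrec.list_getD 0).comp Primrec.snd (.const i)
  refine ⟨fuelRec 2 (fun i x => if i = 0 then q' (T x) x else r' (T x) x)
    fun x l => G' (T x) (Nat.pair x (Nat.pair (l.getD 0 0) (l.getD 1 0))), fuelRec_primrec 2 ?_ ?_, ?_⟩
  · exact .ite (Primrec.eq.comp .fst (.const 0)) (hq'.comp (ht.comp .snd) .snd) (hr'.comp (ht.comp .snd) .snd)
  · exact hG'.comp (ht.comp .fst) (Primrec₂.natPair.comp .fst (Primrec₂.natPair.comp (nth 0) (nth 1)))
  · intro n t h
    induction h with
    | none n => exact .inl rfl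
    | @node n k A hk hV _ _ is it =>
      obtain ⟨es, et, e⟩ := H k A hV
      have hT : T ((kind k).x A).code = k := tag_code hk A hV
      rw [fuelRec]
      simp only [hT, List.range_succ, List.range_zero, List.nil_append, List.map_append, List.map_cons, List.map_nil,
        List.cons_append, if_true, one_ne_zero, if_false, List.getD_cons_zero, List.getD_cons_succ]
      rw [eq _ _ hk, er _ _ hk, eG _ _ hk, ← es, ← et]
      exact e _ _ is it

theorem Fml.height_rename (φ : Fml) (ρ σ : ℕ → ℕ) : FRules.height (φ.rename ρ σ) = FRules.height φ := by
  induction φ generalizing ρ σ <;> simp_all [rename, FRules.height]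

theorem Valid.step {n : ℕ} {t : Task} (k : ℕ) (A : Arg) (e : (kind k).x A = t) (hk : k < 16) (hn : 0 < n) (hV : (kind k).V A)
    (hs : Valid (n - 1) ((kind k).s A)) (ht : Valid (n - 1) ((kind k).t A)) : Valid n t := by
  obtain ⟨n, rfl⟩ := Nat.exists_eq_succ_of_ne_zero hn.ne'
  exact e ▸ .node hk hV hs ht

namespace ATerm
variable {m : ℕ}

theorem graph_ne_isNat (t : ATerm m) (ρ : ℕ → ℕ) : t.graph.rename ρ id ≠ isNat 0 := by
  cases t <;> simp [graph, rename, isNat, isEmpty, neg, isInductive]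

theorem memTag_graph (t : ATerm m) (ρ : ℕ → ℕ) : memTag (t.graph.rename ρ id).code ≠ Nat.pair 9 (Nat.pair 5 0) := by
  rcases t with _ | _ | t | _ | _
  · simp [graph, rename, memTag, code]
  · simp [graph, rename, memTag, code, isEmpty]
  · cases t <;> simp [graph, rename, memTag, code, isEmpty]
  · simp [graph, rename, memTag, code]
  · simp [graph, rename, memTag, code]

theorem valid (t : ATerm m) {Γ : List Fml} {a b n : ℕ} {ρ : ℕ → ℕ} (hΓ : ∀ i < m, isNat (ρ i) ∈ Γ)
    (hn : FRules.height t.graph ≤ n) : Valid n ⟨Γ, a, b, 0, t.graph.rename (up ρ) id⟩ := by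
  induction t generalizing n with
  | var i =>
    simp only [graph, FRules.height] at hn
    exact .step 0 ⟨Γ, a, b, .eq 0 (ρ i + 1), .eq 0 (ρ i + 1)⟩ rfl (by decide) (by omega) ⟨⟨_, rfl, hΓ i i.2⟩, rfl⟩ (.none _) (.none _)
  | zero =>
    simp only [graph, isEmpty, FRules.height] at hn
    exact .step 1 ⟨Γ, a, b, isEmpty 0, isEmpty 0⟩ rfl (by decide) (by omega) ⟨rfl, rfl⟩ (.none _) (.none _)
  | succ t ih =>
    simp only [graph, FRules.height, height_rename] at hn
    refine .step 2 ⟨Γ, a, b, t.graph.rename (up ρ) id, t.graph.rename (up ρ) id⟩ ?_ (by decide) (by omega) rfl (ih (by omega)) (.none _)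
    simp only [kind, graph, PF.under, PF.ren, PF.const, rename, rename_rename]
    congr 3
    exact rename_congr _ (fun n => by cases n <;> rfl) fun _ => rfl
  | add t s iht ihs =>
    simp only [graph, FRules.height, height_rename] at hn
    refine .step 3 ⟨Γ, a, b, t.graph.rename (up ρ) id, s.graph.rename (up ρ) id⟩ ?_ (by decide) (by omega) trivial (iht (by omega)) (ihs (by omega))
    simp only [kind, graph, PF.under, PF.ren, PF.const, PF.inst, Fml.inst, rename, rename_rename]
    congr 4
    · exact rename_congr _ (fun n => by cases n <;> rfl) fun _ => rfl
    · congr 1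
      exact rename_congr _ (fun n => by cases n <;> rfl) fun _ => rfl
  | mul t s iht ihs =>
    simp only [graph, FRules.height, height_rename] at hn
    refine .step 4 ⟨Γ, a, b, t.graph.rename (up ρ) id, s.graph.rename (up ρ) id⟩ ?_ (by decide) (by omega) trivial (iht (by omega)) (ihs (by omega))
    simp only [kind, graph, PF.under, PF.ren, PF.const, PF.inst, Fml.inst, rename, rename_rename]
    congr 4
    · exact rename_congr _ (fun n => by cases n <;> rfl) fun _ => rfl
    · congr 1
      exact rename_congr _ (fun n => by cases n <;> rfl) fun _ => rfl

end ATerm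

theorem isNat_up {Γ : List Fml} {ρ : ℕ → ℕ} {m : ℕ} (hΓ : ∀ i < m, isNat (ρ i) ∈ Γ) :
    ∀ i < m + 1, isNat (up ρ i) ∈ isNat 0 :: Γ.map shift
  | 0, _ => List.mem_cons_self
  | i + 1, h => List.mem_cons_of_mem _ (List.mem_map_of_mem (f := shift) (hΓ i (by omega)))

namespace AFml

theorem valid_delta {m : ℕ} (φ : AFml m) (h : φ.IsDelta0) {Γ : List Fml} {a b n : ℕ} {ρ : ℕ → ℕ} (hΓ : ∀ i < m, isNat (ρ i) ∈ Γ)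
    (hn : FRules.height φ.toSet ≤ n) : Valid n ⟨Γ, a, b, 1, φ.toSet.rename ρ id⟩ := by
  induction φ generalizing n ρ Γ a b with
  | eq t s =>
    simp only [toSet, FRules.height] at hn
    exact .step 5 ⟨Γ, a, b, t.graph.rename (up ρ) id, s.graph.rename (up ρ) id⟩ rfl (by decide) (by omega) (s.memTag_graph _)
      (t.valid hΓ (by omega)) (s.valid hΓ (by omega))
  | fls =>
    simp only [toSet, FRules.height] at hn
    exact .step 6 ⟨Γ, a, b, .fls, .fls⟩ rfl (by decide) (by omega) ⟨rfl, rfl⟩ (.none _) (.none _)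
  | conj φ ψ ih jh =>
    simp only [toSet, FRules.height] at hn
    exact .step 7 ⟨Γ, a, b, φ.toSet.rename ρ id, ψ.toSet.rename ρ id⟩ rfl (by decide) (by omega) trivial (ih h.1 hΓ (by omega)) (jh h.2 hΓ (by omega))
  | disj φ ψ ih jh =>
    simp only [toSet, FRules.height] at hn
    exact .step 8 ⟨Γ, a, b, φ.toSet.rename ρ id, ψ.toSet.rename ρ id⟩ rfl (by decide) (by omega) trivial (ih h.1 hΓ (by omega)) (jh h.2 hΓ (by omega))
  | imp φ ψ ih jh =>
    simp only [toSet, FRules.height] at hn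
    exact .step 9 ⟨Γ, a, b, φ.toSet.rename ρ id, ψ.toSet.rename ρ id⟩ rfl (by decide) (by omega) trivial (ih h.1 hΓ (by omega)) (jh h.2 hΓ (by omega))
  | ball t φ ih =>
    simp only [toSet, ballIn, FRules.height, height_rename] at hn
    refine .step 10 ⟨Γ, a, b, t.graph.rename (up ρ) id, φ.toSet.rename (up ρ) id⟩ ?_ (by decide) (by omega) trivial
      (t.valid hΓ (by omega)) (ih h (isNat_up hΓ) (by omega))
    simp only [kind, toSet, ballIn, PF.under, PF.ren, PF.const, rename, rename_rename]
    congr 5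
    exact rename_congr _ (fun n => by cases n <;> rfl) fun _ => rfl
  | bex t φ ih =>
    simp only [toSet, bexIn, FRules.height, height_rename] at hn
    refine .step 11 ⟨Γ, a, b, t.graph.rename (up ρ) id, φ.toSet.rename (up ρ) id⟩ ?_ (by decide) (by omega) trivial
      (t.valid hΓ (by omega)) (ih h (isNat_up hΓ) (by omega))
    simp only [kind, toSet, bexIn, PF.under, PF.ren, PF.const, rename, rename_rename]
    congr 5
    exact rename_congr _ (fun n => by cases n <;> rfl) fun _ => rfl
  | all | ex => exact h.elim

theorem IsDelta0.natTag {m : ℕ} {φ : AFml m} (h : φ.IsDelta0) (ρ : ℕ → ℕ) {k : ℕ} (hk : k = 8 ∨ k = 9) :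
    natTag (φ.toSet.rename ρ id).code ≠ Nat.pair k (isNat 0).code := by
  cases φ with
  | eq t s | ball t φ | bex t φ =>
    refine fun e => t.graph_ne_isNat (up ρ) (code_injective ?_)
    simp only [SetClass.natTag, toSet, rename, code, Nat.unpair_pair, Nat.pair_eq_pair] at e
    exact e.2
  | all | ex => exact h.elim
  | _ => rcases hk with rfl | rfl <;> simp [SetClass.natTag, toSet, rename, code]

theorem IsSigma1.valid {m : ℕ} {φ : AFml m} (h : φ.IsSigma1) {Γ : List Fml} {a b n : ℕ} {ρ : ℕ → ℕ} (hΓ : ∀ i < m, isNat (ρ i) ∈ Γ)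
    (hn : FRules.height φ.toSet + 1 ≤ n) : Valid n ⟨Γ, a, b, 2, φ.toSet.rename ρ id⟩ := by
  induction h generalizing n ρ Γ a b with
  | @delta _ φ h =>
    exact .step 12 ⟨Γ, a, b, φ.toSet.rename ρ id, φ.toSet.rename ρ id⟩ rfl (by decide) (by omega) ⟨h.natTag ρ (.inr rfl), rfl⟩
      (φ.valid_delta h hΓ (by omega)) (.none _)
  | @ex _ φ _ ih =>
    simp only [toSet, FRules.height] at hn
    exact .step 13 ⟨Γ, a, b, φ.toSet.rename (up ρ) id, φ.toSet.rename (up ρ) id⟩ rfl (by decide) (by omega) rfl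
      (ih (isNat_up hΓ) (by omega)) (.none _)

theorem IsPi2.valid {m : ℕ} {φ : AFml m} (h : φ.IsPi2) {Γ : List Fml} {a b n : ℕ} {ρ : ℕ → ℕ} (hΓ : ∀ i < m, isNat (ρ i) ∈ Γ)
    (hn : FRules.height φ.toSet + 2 ≤ n) : Valid n ⟨Γ, a, b, 3, φ.toSet.rename ρ id⟩ := by
  induction h generalizing n ρ Γ with
  | @sigma _ φ h =>
    refine .step 14 ⟨Γ, a, b, φ.toSet.rename ρ id, φ.toSet.rename ρ id⟩ rfl (by decide) (by omega) ⟨?_, rfl⟩ ?_ (.none _)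
    · cases h with
      | delta h => exact h.natTag ρ (.inl rfl)
      | ex => simp [natTag, toSet, rename, code]
    · have := h.valid (Γ := (Γ.map shift).map shift) (a := 1) (b := 0) (n := n - 1) (ρ := fun i => ρ i + 2)
        (fun i hi => List.mem_map_of_mem (f := shift) (List.mem_map_of_mem (f := shift) (hΓ i hi))) (by omega)
      simp only [kind, Fml.shift, rename_rename]
      exact this
  | @all _ φ _ ih =>
    simp only [toSet, FRules.height] at hn
    exact .step 15 ⟨Γ, a, b, φ.toSet.rename (up ρ) id, φ.toSet.rename (up ρ) id⟩ rfl (by decide) (by omega) rfl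
      (ih (isNat_up hΓ) (by omega)) (.none _)

end AFml

end SetClass


/-! ## The strength of `IKM` -/

namespace SetClass

open Fml

theorem ATerm.graph_rename_congr {m : ℕ} (t : ATerm m) {ρ ρ' : ℕ → ℕ} (h : ∀ i < m + 1, ρ i = ρ' i) :
    t.graph.rename ρ id = t.graph.rename ρ' id := by
  have h0 := h 0 (by omega)
  induction t generalizing ρ ρ' with
  | var i => simp [graph, rename, h0, h (i + 1) (by omega)]
  | zero => simp [graph, rename, isEmpty, neg, up, h0]
  | succ t ih =>
    have e := ih (ρ := up ρ ∘ up (· + 1)) (ρ' := up ρ' ∘ up (· + 1))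
      (fun | 0, _ => rfl | i + 1, hi => congrArg (· + 1) (h (i + 1) hi)) rfl
    simp only [graph, rename, rename_rename, isSucc, iff, up, h0, Function.id_comp, e]
  | add t s it is | mul t s it is =>
    have e := it (ρ := up (up ρ) ∘ fun | 0 => 1 | k + 1 => k + 3) (ρ' := up (up ρ') ∘ fun | 0 => 1 | k + 1 => k + 3)
      (fun | 0, _ => rfl | i + 1, hi => congrArg (· + 2) (h (i + 1) hi)) rfl
    have e' := is (ρ := up (up ρ) ∘ fun | 0 => 0 | k + 1 => k + 3) (ρ' := up (up ρ') ∘ fun | 0 => 0 | k + 1 => k + 3)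
      (fun | 0, _ => rfl | i + 1, hi => congrArg (· + 2) (h (i + 1) hi)) rfl
    have ha : ∀ ρ, (isAdd 1 0 2).rename (up (up ρ)) id = isAdd 1 0 (ρ 0 + 2) := fun _ => rfl
    have hm : ∀ ρ, (isMul 1 0 2).rename (up (up ρ)) id = isMul 1 0 (ρ 0 + 2) := fun _ => rfl
    simp only [graph, rename, rename_rename, Function.id_comp, ha, hm, h0]
    exact congrArg (fun g => Fml.ex (.ex g)) (congrArg₂ Fml.conj e (congrArg (Fml.conj · _) e'))

theorem AFml.toSet_rename_congr {m : ℕ} (φ : AFml m) {ρ ρ' : ℕ → ℕ} (h : ∀ i < m, ρ i = ρ' i) :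
    φ.toSet.rename ρ id = φ.toSet.rename ρ' id := by
  have up_congr : ∀ {m : ℕ} {ρ ρ' : ℕ → ℕ}, (∀ i < m, ρ i = ρ' i) → ∀ i < m + 1, up ρ i = up ρ' i := fun h i hi => by
    cases i with
    | zero => rfl
    | succ i => exact congrArg (· + 1) (h i (by omega))
  have comp : ∀ ρ : ℕ → ℕ, up (up ρ) ∘ up (· + 1) = up (· + 1) ∘ up ρ := fun ρ => by
    funext i
    cases i <;> rfl
  induction φ generalizing ρ ρ' with
  | eq t s => simp only [toSet, rename, t.graph_rename_congr (up_congr h), s.graph_rename_congr (up_congr h)]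
  | fls => rfl
  | conj φ ψ ih jh | disj φ ψ ih jh | imp φ ψ ih jh => simp only [toSet, rename, ih h, jh h]
  | ball t φ ih | bex t φ ih =>
    simp only [toSet, ballIn, bexIn, rename, t.graph_rename_congr (up_congr h), rename_rename, comp, up]
    rw [← rename_rename, ← rename_rename, ih (up_congr h)]
  | all φ ih | ex φ ih =>
    simp only [toSet, rename, ih (up_congr h)]
    rfl

theorem AFml.toSet_shift (φ : AFml 0) : φ.toSet.shift = φ.toSet :=
  (φ.toSet_rename_congr fun _ h => by omega).trans (rename_id _)

theorem Theory.Reducible.of_pv {S T : Theory} (h : ∀ {α : Type} {c : α → ℕ} (φ : PF c), (∀ i, ∃ χ : AFml 0, χ.IsPi2 ∧ φ.f i = χ.toSet) →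
    Pv S .nil φ → Pv T .nil φ) : S.Reducible T := by
  let α := Σ φ : {φ : AFml 0 // φ.IsPi2}, S.Proof φ.1.toSet
  have k : PR (fun i : α => i.2.code) fun i => i.1.1.toSet.code :=
    PR.self.left.right.of_eq fun i => by rw [i.2.code_fst, Nat.unpair_pair]
  obtain ⟨_, ⟨f, hf, e⟩, hn⟩ := h (c := fun i : α => i.2.code) ⟨_, k⟩ (fun i => ⟨i.1.1, i.1.2, rfl⟩) ⟨_, .self, fun i => ⟨i.2, rfl⟩⟩
  refine ⟨f, Primrec.nat_iff.1 hf, fun φ hφ d => ?_⟩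
  obtain ⟨d', h'⟩ := hn ⟨⟨φ, hφ⟩, d⟩
  exact ⟨d', h'.trans (e _)⟩

theorem Pv.of_KM {α : Type} {c : α → ℕ} (φ : PF c) (h : ∀ i, ∃ χ : AFml 0, χ.IsPi2 ∧ φ.f i = χ.toSet) (k : Pv KM .nil φ) :
    Pv IKM .nil φ := by
  obtain ⟨n, hn, k⟩ := k
  obtain ⟨G, hG, e⟩ := exists_primrec_KM
  obtain ⟨G', hG', e'⟩ := exists_primrec_tr
  have k : Pv IKM .nil (φ.tr (.const 1) (.const 0)) := by
    refine ⟨_, .comp hG' (.natPair (.const (Encodable.encode (1, 0))) (.comp hG hn)), fun i => ?_⟩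
    obtain ⟨d, hd⟩ := k i
    obtain ⟨d', hd'⟩ := e _ _ d
    have := e' (1, 0) _ _ d'
    rwa [hd', hd] at this
  have es : φ.shift = φ := PF.ext fun i => by
    obtain ⟨χ, -, hχ⟩ := h i
    exact (congrArg Fml.shift hχ).trans (χ.toSet_shift.trans hχ.symm)
  have k' : Pv IKM .nil φ.box := .allI (.allI (by rw [es, es]; exact k))
  obtain ⟨F, hF, eF⟩ := exists_primrec_valid
  let t : TaskF c := ⟨.nil, .const 0, .const 0, 3, φ⟩
  have ht : t.Solvable := t.solvable_iff.2 ⟨_, PR.comp₂ hF φ.pr.succ.succ.succ t.pr, fun i => eF _ _ ?_⟩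
  · exact impE ht k'
  · obtain ⟨χ, hχ, e⟩ := h i
    have := FRules.height_le_code (φ.f i)
    rw [show t.f i = ⟨[], 0, 0, 3, χ.toSet.rename id id⟩ by simp [t, TaskF.f, PL.nil, PN.const, e]]
    exact hχ.valid (fun _ h => by omega) (by rw [← e]; omega)

end SetClass

theorem mainTheorem3 : SetClass.Theory.SameStrength SetClass.IKM SetClass.KM := by
  refine ⟨.of_pv fun φ _ ⟨n, hn, h⟩ => ?_, .of_pv .of_KM⟩
  obtain ⟨G, hG, e⟩ := SetClass.exists_primrec_IKM SetClass.KM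
  exact ⟨_, .comp hG hn, fun i => (h i).elim fun d hd => hd ▸ e _ _ d⟩
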